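/- **Setting.** All functions of $t\in[0,T]$, $y=(y',y_3)$, $y'\in\mathbb T^2$, $Y_3$, $\theta\in\mathbb T$ are real valued, $\mathbb T=\mathbb R/2\pi\mathbb Z$, the Fourier coefficients in $\theta$ are $\widehat f(k)=\frac1{2\pi}\int_0^{2\pi}f(\theta)e^{-ik\theta}\,d\theta$, indices $j\in\{1,2\}$ that are repeated are summed, and $X\cdot Y=\sum_\alpha\overline{X_\alpha}Y_\alpha$ for complex vectors. *Parameters.* Let $\mathbf u^0=(u_1^0,u_2^0,0)$, $\mathbf B^0=(B^0_1,B^0_2,0)$, $\mathbf H^0=(H_1^0,H_2^0,0)$, $\mathbf E^0=(0,0,E_3^0)$ be constant real vectors with (H1) $|\mathbf E^0|^2<\frac12\big(|\mathbf B^0|^2+|\mathbf H^0|^2-\sqrt{(|\mathbf B^0|^2+|\mathbf H^0|^2)^2-4|\mathbf B^0\times\mathbf H^0|^2}\big)$, and let (H2) $\xi=(m,n)/\sqrt{m^2+n^2}$ with $(m,n)\in\mathbb Z^2\setminus\{0\}$. For $\nu>0$ and $\tau\in\mathbb R$ with $\nu^2\tau^2<1$ put $a^+=\xi_ju_j^0$,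 $b^+=\xi_jB_j^0$, $c^+=\tau+a^+$, $a_1^-=\nu\tau H_1^0+\xi_2E_3^0$, $a_2^-=\nu\tau H_2^0-\xi_1E_3^0$, $b^-=\xi_jH_j^0$, $\rho=\sqrt{1-\nu^2\tau^2}$, and consider the conditions (H3) $\rho\,((c^+)^2-(b^+)^2)+(a_1^-)^2+(a_2^-)^2-(b^-)^2=0$, and (H4) $a^+\ne0$, $\tau\neq0$. *Spaces.* $H^\infty$ is the space of functions all of whose derivatives are in $L^2$ (represented by their smooth representative). Write $\mathbb R^+=(0,\infty)$, $\mathbb R^-=(-\infty,0)$. A scalar residual function is an element of $H^\infty([0,T]\times\mathbb T^2\times\mathbb R^\pm_{y_3}\times\mathbb T_\theta)$. A scalar surface wave function is an $f\in H^\infty([0,T]\times\mathbb T^2\times\mathbb R^\pm_{y_3}\times\mathbb R^\pm_{Y_3}\times\mathbb T_\theta)$ for which there is $\delta>0$ such that for each multi-index $\alpha$ there is $C_\alpha$ with $\|\partial^\alpha f(\cdot,Y_3,\cdot)\|_{L^\infty_{t,y,\theta}}+\|\partial^\alpha f(\cdot,Y_3,\cdot)\|_{L^2_{t,y,\theta}}\le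 C_\alpha e^{-\delta|Y_3|}$ for all $Y_3$. The space $\underline S^-$ (resp. $S^-_\star$) consists of the $V=(\mathbf H,\mathbf E)$ all of whose components are residual (resp. surface wave) functions. The space $\underline S^+$ consists of the $U=(\mathbf u,\mathbf B,q)$ such that the components of $\mathbf u,\mathbf B$ and of $\nabla_yq$ are residual functions and $q$ is smooth; $S^+_\star$ is defined in the same way with surface wave functions, with $|q|\le Ce^{-\delta Y_3}$ for some $C$ and $\delta>0$. Put $S^\pm=\underline S^\pm\oplus S^\pm_\star$ and write $W=\underline W+W_\star$ accordingly. A scalar profile on the side $\pm$ is a residual function plus a surface wave function. Let $\Pi U=(u_1,u_2,0,B_1,B_2,0,0)$. *The fast problem.* Given source terms $F^+=(F^+_1,\dots,F^+_7)$, $F_8^+$ for $y_3,Y_3>0$, $F^-=(F_1^-,\dots,F_6^-)$, $F_7^-,F_8^-$ for $y_3,Y_3<0$, and $G=(G_1,\dots,G_6)(t,y',\theta)$, the unknowns are $U=(u_1,u_2,u_3,B_1,B_2,B_3,q)\in S^+$, $V=(H_1,H_2,H_3,E_1,E_2,E_3)\in S^-$ and $\varphi\in H^\infty([0,T]\times\mathbb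 T^2\times\mathbb T)$, and the equations are $$(\mathrm f)\quad\begin{cases}A_3^+\partial_{Y_3}U+\mathscr A^+\partial_\theta U=F^+,\quad \partial_{Y_3}B_3+\xi_j\partial_\theta B_j=F_8^+,& y_3,Y_3>0,\\ A_3^-\partial_{Y_3}V+\mathscr A^-\partial_\theta V=F^-,\quad \partial_{Y_3}H_3+\xi_j\partial_\theta H_j=F_7^-,\quad \partial_{Y_3}E_3+\xi_j\partial_\theta E_j=F_8^-,& y_3,Y_3<0,\\ \big(u_3,\ B_3,\ H_3,\ E_2,\ -E_1,\ q-H_j^0H_j+E_3^0E_3\big)+\partial_\theta\varphi\,\big({-c^+},-b^+,-b^-,a_1^-,a_2^-,0\big)=G,& y_3=Y_3=0,\end{cases}$$ where, for $j=1,2$, * the components of $A_3^+\partial_{Y_3}U+\mathscr A^+\partial_\theta U$ are: the $j$-th, $u_j^0\partial_{Y_3}u_3-B_j^0\partial_{Y_3}B_3+c^+\partial_\theta u_j-b^+\partial_\theta B_j+u_j^0\,\xi_i\partial_\theta u_i-B_j^0\,\xi_i\partial_\theta B_i+\xi_j\partial_\theta q$; the third, $\partial_{Y_3}q+c^+\partial_\theta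 u_3-b^+\partial_\theta B_3$; the $(3+j)$-th, $B_j^0\partial_{Y_3}u_3-u_j^0\partial_{Y_3}B_3+c^+\partial_\theta B_j-b^+\partial_\theta u_j+B_j^0\,\xi_i\partial_\theta u_i-u_j^0\,\xi_i\partial_\theta B_i$; the sixth, $c^+\partial_\theta B_3-b^+\partial_\theta u_3$; the seventh, $\partial_{Y_3}u_3+\xi_i\partial_\theta u_i$ (with $i$ summed over $1,2$); * $A_3^-\partial_{Y_3}V+\mathscr A^-\partial_\theta V=\big(\nu\tau\partial_\theta\mathbf H+(\xi_1\partial_\theta,\xi_2\partial_\theta,\partial_{Y_3})\times\mathbf E,\ \nu\tau\partial_\theta\mathbf E-(\xi_1\partial_\theta,\xi_2\partial_\theta,\partial_{Y_3})\times\mathbf H\big)$. *Vectors.* For $k\in\mathbb Z\setminus\{0\}$ put $\sigma=i\,\mathrm{sgn}(k)$ and $$\begin{aligned}\mathscr R^+(k)&=(\xi_1c^+,\xi_2c^+,\sigma c^+,\xi_1b^+,\xi_2b^+,\sigma b^+,(b^+)^2-(c^+)^2),\\ \mathscr R_1^-(k)&=(\rho\nu\tau,0,-\sigma\nu\tau\xi_1,-\sigma\xi_1\xi_2,\sigma(\nu^2\tau^2-\xi_2^2),-\rho\xi_2),\\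 \mathscr R_2^-(k)&=(0,\rho\nu\tau,-\sigma\nu\tau\xi_2,-\sigma(\nu^2\tau^2-\xi_1^2),\sigma\xi_1\xi_2,\rho\xi_1),\\ \mathscr L^+(k)&=(\xi_1\tau,\xi_2\tau,\sigma\tau,2\xi_1b^+,2\xi_2b^+,2\sigma b^+,-\tau(a^++c^+)),\\ \mathscr L^-(k)&=-\tfrac1\nu\Big(\tfrac{\nu\tau a_1^--\xi_1b^-}{\rho},\tfrac{\nu\tau a_2^--\xi_2b^-}{\rho},\sigma b^-,\sigma a_2^-,-\sigma a_1^-,\tfrac{\xi_1a_2^--\xi_2a_1^-}{\rho}\Big),\end{aligned}$$ and $l_1^+=2(b^+)^2-\tau c^+$, $l_2^+=-(a^++c^+)b^+$. *Compatibility conditions.* (a) $F_6^+=-b^+\partial_\theta G_1+c^+\partial_\theta G_2$ and $F_3^-=\nu\tau\partial_\theta G_3+\xi_j\partial_\theta G_{3+j}$ at $y_3=Y_3=0$. (b) $\underline{\widehat F}^\pm(0)=0$, $\underline{\widehat F}{}_7^-(0)=0$, $\underline{\widehat F}{}_8^\pm(0)=0$. (c) $u_j^0\widehat F^+_{7,\star}(0)-B_j^0\widehat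 F^+_{8,\star}(0)=\widehat F^+_{j,\star}(0)$ and $B_j^0\widehat F^+_{7,\star}(0)-u_j^0\widehat F^+_{8,\star}(0)=\widehat F^+_{3+j,\star}(0)$ for $j=1,2$ (no summation). (d) $\partial_{Y_3}F_6^++\xi_j\partial_\theta F_{3+j}^+-\tau\partial_\theta F_8^+=0$, $\partial_{Y_3}F_3^-+\xi_j\partial_\theta F_j^--\nu\tau\partial_\theta F_7^-=0$, $\partial_{Y_3}F_6^-+\xi_j\partial_\theta F_{3+j}^--\nu\tau\partial_\theta F_8^-=0$. (e) For all $(t,y')$ and all $k\in\mathbb Z\setminus\{0\}$, with the source terms $F^\pm$ taken at $y_3=0$, $$\int_0^\infty e^{-|k|Y_3}\mathscr L^+(k)\cdot\widehat F^+(Y_3,k)\,dY_3+l_j^+\widehat G_j(k)-\int_{-\infty}^0e^{|k|\rho Y_3}\mathscr L^-(k)\cdot\widehat F^-(Y_3,k)\,dY_3-\frac{-\nu\tau a_j^-+\xi_jb^-}{\nu\rho}\widehat G_{3+j}(k)-i\,\mathrm{sgn}(k)\,\tau\,\widehat G_6(k)+\frac{E_3^0}{|k|\nu}\widehat F_6^-(Y_3=0,k)=0.$$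 **Theorem.** Let $\mathbf u^0,\mathbf B^0,\mathbf H^0,\mathbf E^0,\xi$ satisfy (H1) and (H2). There is $\nu_*>0$ such that for all $0<\nu<\nu_*$ and all $\tau\in\mathbb R$ with $\nu^2\tau^2<1$ that satisfy (H3) and (H4), there are real constants $\widetilde\gamma_1,\widetilde\gamma_2$ with $$a_j^-\widetilde\gamma_j=\frac{(a_1^-)^2+(a_2^-)^2-(b^-)^2}{1-\nu^2\tau^2}$$ such that the following holds for all $T>0$, all source terms $F^\pm,F_7^-,F_8^\pm$ whose components are scalar profiles, and all $G\in H^\infty([0,T]\times\mathbb T^2\times\mathbb T)$. (i) (f) has a solution $(U,V,\varphi)\in S^+\times S^-\times H^\infty([0,T]\times\mathbb T^2\times\mathbb T)$ if and only if (a)–(e) hold. (ii) If (a)–(e) hold, then (f) has a solution of the form $(\mathbb U,\mathbb V,0)$ with $\Pi\,\widehat{\mathbb U}(0)=0$. (iii) Let $(\mathbb U,\mathbb V,0)$ be any solution as in (ii). Every solution $(U,V,\varphi)$ of (f) has the form $$\begin{aligned}U&=\mathbb U+\underline U_h(t,y)+\big(\widehat u_{1,\star}(0),\widehat u_{2,\star}(0),0,\widehat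 B_{1,\star}(0),\widehat B_{2,\star}(0),0,0\big)(t,y,Y_3)+\sum_{k\ne0}\gamma^+(t,y,k)e^{-|k|Y_3+ik\theta}\mathscr R^+(k),\\ V&=\mathbb V+\underline V_h(t,y)+\sum_{k\neq0}\gamma_j^-(t,y,k)e^{|k|\rho Y_3+ik\theta}\mathscr R_j^-(k),\end{aligned}$$ where $\underline U_h\in\underline S^+$ and $\underline V_h\in\underline S^-$ do not depend on $\theta$ and satisfy, at $y_3=0$, $\underline u_{h,3}=\underline B_{h,3}=\underline H_{h,3}=\underline E_{h,1}=\underline E_{h,2}=0$ and $\underline q_h-H_j^0\underline H_{h,j}+E_3^0\underline E_{h,3}=0$; the fast means $\widehat u_{j,\star}(0),\widehat B_{j,\star}(0)$ of $U$ are surface wave functions; and for all $(t,y')$ and $k\neq0$ $$\gamma^+(t,y',0,k)=|k|\,\widehat\varphi(t,y',k),\qquad\gamma_j^-(t,y',0,k)=\widetilde\gamma_j\,|k|\,\widehat\varphi(t,y',k)\quad(j=1,2,\text{ no summation}).$$ Moreover $(U-\mathbb U,V-\mathbb V,\varphi)$ is a solution of (f) with zero source terms. -/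

import Mathlib

open scoped ContDiff

namespace FastProblem

open MeasureTheory

noncomputable section

/-! ### Domains, partial derivatives, Fourier modes

A point of the boundary is `w = ![t, y₁, y₂, θ]`, a point of the slow domain is
`z = ![y₃, t, y₁, y₂, θ]`, a point of the full domain is `x = ![Y₃, y₃, t, y₁, y₂, θ]`.
So the variable `θ` is always the last one.

A domain is a product of factors: `some J` is the set `J` of real numbers, `none` is the
circle of length `2π`. Functions on a circle are `2π`-periodic functions of a real variable. -/

/-- The domain, with each circle unrolled to the real line. -/
def dom {n : ℕ} (s : Fin n → Option (Set ℝ)) : Set (Fin n → ℝ) :=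
  {x | ∀ i, x i ∈ (s i).getD Set.univ}

/-- One period cell of the domain. -/
def cell {n : ℕ} (s : Fin n → Option (Set ℝ)) : Set (Fin n → ℝ) :=
  {x | ∀ i, x i ∈ (s i).getD (Set.Ico 0 (2 * Real.pi))}

/-- `[0,T] × 𝕋² × 𝕋`, variables `(t, y₁, y₂, θ)`. -/
def bdryBox (T : ℝ) : Fin 4 → Option (Set ℝ) := ![some (Set.Icc 0 T), none, none, none]

/-- `J × [0,T] × 𝕋² × 𝕋`, variables `(y₃, t, y₁, y₂, θ)`. -/
def slowBox (T : ℝ) (J : Set ℝ) : Fin 5 → Option (Set ℝ) :=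
  Matrix.vecCons (some J) (bdryBox T)

/-- `J × J × [0,T] × 𝕋² × 𝕋`, variables `(Y₃, y₃, t, y₁, y₂, θ)`. -/
def fastBox (T : ℝ) (J : Set ℝ) : Fin 6 → Option (Set ℝ) :=
  Matrix.vecCons (some J) (slowBox T J)

/-- The half line of the plasma side. -/
def Jp : Set ℝ := Set.Ici 0

/-- The half line of the vacuum side. -/
def Jm : Set ℝ := Set.Iic 0

/-- Partial derivative in the `i`-th variable (one-sided on the boundary of the domain). -/
def pd {n : ℕ} (s : Fin n → Option (Set ℝ)) (i : Fin n) (f : (Fin n → ℝ) → ℝ) :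
    (Fin n → ℝ) → ℝ :=
  fun x => fderivWithin ℝ f (dom s) x (Pi.single i 1)

/-- Iterated partial derivative along a list of variables. -/
def iterPd {n : ℕ} (s : Fin n → Option (Set ℝ)) (l : List (Fin n)) (f : (Fin n → ℝ) → ℝ) :
    (Fin n → ℝ) → ℝ :=
  l.foldr (fun i g => pd s i g) f

/-- Smooth up to the boundary, and periodic in each variable that lives on a circle. -/
structure IsSmoothPer {n : ℕ} (s : Fin n → Option (Set ℝ)) (f : (Fin n → ℝ) → ℝ) : Prop where
  smooth : ContDiffOn ℝ ∞ f (dom s)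
  periodic : ∀ i, s i = none → ∀ x ∈ dom s,
    f (Function.update x i (x i + 2 * Real.pi)) = f x

/-- The space `H^∞`: all partial derivatives of all orders are square integrable. By the Sobolev
embedding each class has exactly one representative that is smooth up to the boundary; this
representative is used, so that traces are values. -/
structure IsHInf {n : ℕ} (s : Fin n → Option (Set ℝ)) (f : (Fin n → ℝ) → ℝ) : Prop where
  smoothPer : IsSmoothPer s f
  memLp : ∀ l : List (Fin n), MemLp (iterPd s l f) 2 (volume.restrict (cell s))

/-- `k`-th Fourier coefficient in `θ` (the last variable); the value of `θ` in `x` is irrelevant. -/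
def mode {n : ℕ} (f : (Fin (n + 1) → ℝ) → ℝ) (k : ℤ) (x : Fin (n + 1) → ℝ) : ℂ :=
  ((2 * Real.pi)⁻¹ : ℝ) * ∫ θ in (0 : ℝ)..(2 * Real.pi),
    (f (Function.update x (Fin.last n) θ) : ℂ) * Complex.exp (-(Complex.I * k * θ))

/-- Mean in `θ` (the zeroth Fourier coefficient), as a real-valued function. -/
def mean {n : ℕ} (f : (Fin (n + 1) → ℝ) → ℝ) (x : Fin (n + 1) → ℝ) : ℝ :=
  (2 * Real.pi)⁻¹ * ∫ θ in (0 : ℝ)..(2 * Real.pi), f (Function.update x (Fin.last n) θ)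

/-! ### Spaces of profiles -/

/-- Scalar surface wave components: `H^∞` in all variables, and every derivative decays
exponentially in `Y₃`, in the `L^∞` and `L²` norms with respect to `(t, y, θ)`. -/
structure InStar (T : ℝ) (J : Set ℝ) (f : (Fin 6 → ℝ) → ℝ) : Prop where
  hInf : IsHInf (fastBox T J) f
  decay : ∃ δ > 0, ∀ l : List (Fin 6), ∃ C : ℝ,
    (∀ x ∈ dom (fastBox T J),
      |iterPd (fastBox T J) l f x| ≤ C * Real.exp (-δ * |x 0|)) ∧
    (∀ Y ∈ J,
      eLpNorm (fun z : Fin 5 → ℝ => iterPd (fastBox T J) l f (Matrix.vecCons Y z)) 2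
        (volume.restrict (cell (slowBox T J))) ≤ ENNReal.ofReal (C * Real.exp (-δ * |Y|)))

/-- Residual total pressure: only its gradient in `(y₁, y₂, y₃)` is required to be in `H^∞`. -/
structure InResPressure (T : ℝ) (J : Set ℝ) (q : (Fin 5 → ℝ) → ℝ) : Prop where
  smoothPer : IsSmoothPer (slowBox T J) q
  grad : ∀ i ∈ ({0, 2, 3} : Set (Fin 5)), IsHInf (slowBox T J) (pd (slowBox T J) i q)

/-- Surface wave component of the total pressure: it decays exponentially in `Y₃`, and its gradient
in `(y₁, y₂, y₃)` is a surface wave component. -/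
structure InStarPressure (T : ℝ) (J : Set ℝ) (q : (Fin 6 → ℝ) → ℝ) : Prop where
  smoothPer : IsSmoothPer (fastBox T J) q
  decay : ∃ δ > 0, ∃ C : ℝ, ∀ x ∈ dom (fastBox T J), |q x| ≤ C * Real.exp (-δ * |x 0|)
  grad : ∀ i ∈ ({1, 3, 4} : Set (Fin 6)), InStar T J (pd (fastBox T J) i q)

/-- A scalar profile: the pair of its residual component, a function of `(y₃, t, y₁, y₂, θ)`, and
of its surface wave component, a function of `(Y₃, y₃, t, y₁, y₂, θ)`. The sum of the two kinds of
functions is direct, so a profile may be given as this pair. -/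
abbrev Profile := ((Fin 5 → ℝ) → ℝ) × ((Fin 6 → ℝ) → ℝ)

/-- The profile as a function of all variables. -/
def val (P : Profile) : (Fin 6 → ℝ) → ℝ := fun x => P.1 (Matrix.vecTail x) + P.2 x

/-- Scalar profiles: residual component in `H^∞`, plus surface wave component. -/
def InS (T : ℝ) (J : Set ℝ) (P : Profile) : Prop :=
  IsHInf (slowBox T J) P.1 ∧ InStar T J P.2

/-- The residual plasma space, for `(u₁, u₂, u₃, B₁, B₂, B₃, q)`. -/
def InResPlus (T : ℝ) (U : Fin 7 → (Fin 5 → ℝ) → ℝ) : Prop :=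
  (∀ i, i ≠ 6 → IsHInf (slowBox T Jp) (U i)) ∧ InResPressure T Jp (U 6)

/-- The surface wave plasma space. -/
def InStarPlus (T : ℝ) (U : Fin 7 → (Fin 6 → ℝ) → ℝ) : Prop :=
  (∀ i, i ≠ 6 → InStar T Jp (U i)) ∧ InStarPressure T Jp (U 6)

/-- The plasma space `S⁺`, for `U = (u₁, u₂, u₃, B₁, B₂, B₃, q)`. -/
def InSPlus (T : ℝ) (U : Fin 7 → Profile) : Prop :=
  InResPlus T (fun i => (U i).1) ∧ InStarPlus T (fun i => (U i).2)

/-- The residual vacuum space, for `(H₁, H₂, H₃, E₁, E₂, E₃)`. -/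
def InResMinus (T : ℝ) (V : Fin 6 → (Fin 5 → ℝ) → ℝ) : Prop :=
  ∀ i, IsHInf (slowBox T Jm) (V i)

/-- The vacuum space `S⁻`, for `V = (H₁, H₂, H₃, E₁, E₂, E₃)`. -/
def InSMinus (T : ℝ) (V : Fin 6 → Profile) : Prop := ∀ i, InS T Jm (V i)

/-! ### Reference state, frequencies, matrices -/

/-- The reference state `u⁰ = (u₁, u₂, 0)`, `B⁰ = (B₁, B₂, 0)`, `H⁰ = (H₁, H₂, 0)`,
`E⁰ = (0, 0, E₃)`, and the tangential frequency `(ξ₁, ξ₂)`. -/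
structure RefState where
  u₁ : ℝ
  u₂ : ℝ
  B₁ : ℝ
  B₂ : ℝ
  H₁ : ℝ
  H₂ : ℝ
  E₃ : ℝ
  ξ₁ : ℝ
  ξ₂ : ℝ

/-- Stability condition on the reference state:
`|E⁰|² < (|B⁰|² + |H⁰|² - √((|B⁰|² + |H⁰|²)² - 4 |B⁰ × H⁰|²)) / 2`. -/
def RefState.Stability (p : RefState) : Prop :=
  p.E₃ ^ 2 <
    ((p.B₁ ^ 2 + p.B₂ ^ 2) + (p.H₁ ^ 2 + p.H₂ ^ 2)
      - Real.sqrt (((p.B₁ ^ 2 + p.B₂ ^ 2) + (p.H₁ ^ 2 + p.H₂ ^ 2)) ^ 2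
          - 4 * (p.B₁ * p.H₂ - p.B₂ * p.H₁) ^ 2)) / 2

/-- The tangential frequency is a unit vector with rational direction. -/
def RefState.RationalDirection (p : RefState) : Prop :=
  ∃ m n : ℤ, (m, n) ≠ (0, 0) ∧
    p.ξ₁ = m / Real.sqrt ((m : ℝ) ^ 2 + (n : ℝ) ^ 2) ∧
    p.ξ₂ = n / Real.sqrt ((m : ℝ) ^ 2 + (n : ℝ) ^ 2)

/-- All parameters: the reference state, the tangential frequency, `ν` and the time
frequency `τ`. -/
structure Params extends RefState where
  ν : ℝ
  τ : ℝ

namespace Params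

variable (p : Params)

def ap : ℝ := p.ξ₁ * p.u₁ + p.ξ₂ * p.u₂
def bp : ℝ := p.ξ₁ * p.B₁ + p.ξ₂ * p.B₂
def cp : ℝ := p.τ + p.ap
def am₁ : ℝ := p.ν * p.τ * p.H₁ + p.ξ₂ * p.E₃
def am₂ : ℝ := p.ν * p.τ * p.H₂ - p.ξ₁ * p.E₃
def bm : ℝ := p.ξ₁ * p.H₁ + p.ξ₂ * p.H₂

/-- `√(1 - ν²τ²)`. -/
def rt : ℝ := Real.sqrt (1 - p.ν ^ 2 * p.τ ^ 2)

/-- The frequencies are a root of the Lopatinskii determinant. -/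
def Lopatinskii : Prop :=
  p.rt * (p.cp ^ 2 - p.bp ^ 2) + (p.am₁ ^ 2 + p.am₂ ^ 2 - p.bm ^ 2) = 0

/-- Nondegeneracy of the frequencies. -/
def Nondegenerate : Prop := p.ap ≠ 0 ∧ p.τ ≠ 0

/-- `A₃⁺` -/
def A3p : Matrix (Fin 7) (Fin 7) ℝ :=
  !![0, 0, p.u₁, 0, 0, -p.B₁, 0;
     0, 0, p.u₂, 0, 0, -p.B₂, 0;
     0, 0, 0, 0, 0, 0, 1;
     0, 0, p.B₁, 0, 0, -p.u₁, 0;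
     0, 0, p.B₂, 0, 0, -p.u₂, 0;
     0, 0, 0, 0, 0, 0, 0;
     0, 0, 1, 0, 0, 0, 0]

/-- `𝒜⁺ = τ A₀⁺ + ξ₁ A₁⁺ + ξ₂ A₂⁺` -/
def Ap : Matrix (Fin 7) (Fin 7) ℝ :=
  !![p.cp + p.ξ₁ * p.u₁, p.ξ₂ * p.u₁, 0, -(p.bp + p.ξ₁ * p.B₁), -(p.ξ₂ * p.B₁), 0, p.ξ₁;
     p.ξ₁ * p.u₂, p.cp + p.ξ₂ * p.u₂, 0, -(p.ξ₁ * p.B₂), -(p.bp + p.ξ₂ * p.B₂), 0, p.ξ₂;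
     0, 0, p.cp, 0, 0, -p.bp, 0;
     -(p.ξ₂ * p.B₂), p.ξ₂ * p.B₁, 0, p.cp - p.ξ₁ * p.u₁, -(p.ξ₂ * p.u₁), 0, 0;
     p.ξ₁ * p.B₂, -(p.ξ₁ * p.B₁), 0, -(p.ξ₁ * p.u₂), p.cp - p.ξ₂ * p.u₂, 0, 0;
     0, 0, -p.bp, 0, 0, p.cp, 0;
     p.ξ₁, p.ξ₂, 0, 0, 0, 0, 0]

/-- `A₃⁻` -/
def A3m : Matrix (Fin 6) (Fin 6) ℝ :=
  !![0, 0, 0, 0, -1, 0;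
     0, 0, 0, 1, 0, 0;
     0, 0, 0, 0, 0, 0;
     0, 1, 0, 0, 0, 0;
     -1, 0, 0, 0, 0, 0;
     0, 0, 0, 0, 0, 0]

/-- `𝒜⁻ = τ A₀⁻ + ξ₁ A₁⁻ + ξ₂ A₂⁻` -/
def Am : Matrix (Fin 6) (Fin 6) ℝ :=
  !![p.ν * p.τ, 0, 0, 0, 0, p.ξ₂;
     0, p.ν * p.τ, 0, 0, 0, -p.ξ₁;
     0, 0, p.ν * p.τ, -p.ξ₂, p.ξ₁, 0;
     0, 0, -p.ξ₂, p.ν * p.τ, 0, 0;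
     0, 0, p.ξ₁, 0, p.ν * p.τ, 0;
     p.ξ₂, -p.ξ₁, 0, 0, 0, p.ν * p.τ]

/-- Boundary matrix of the plasma. -/
def BBp : Matrix (Fin 6) (Fin 7) ℝ :=
  !![0, 0, 1, 0, 0, 0, 0;
     0, 0, 0, 0, 0, 1, 0;
     0, 0, 0, 0, 0, 0, 0;
     0, 0, 0, 0, 0, 0, 0;
     0, 0, 0, 0, 0, 0, 0;
     0, 0, 0, 0, 0, 0, 1]

/-- Boundary matrix of the vacuum. -/
def BBm : Matrix (Fin 6) (Fin 6) ℝ :=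
  !![0, 0, 0, 0, 0, 0;
     0, 0, 0, 0, 0, 0;
     0, 0, 1, 0, 0, 0;
     0, 0, 0, 0, 1, 0;
     0, 0, 0, -1, 0, 0;
     -p.H₁, -p.H₂, 0, 0, 0, p.E₃]

/-- The vector that multiplies `∂_θ φ` in the boundary condition. -/
def bvec : Fin 6 → ℝ := ![-p.cp, -p.bp, -p.bm, p.am₁, p.am₂, 0]

/-- `i sgn(k)` -/
def isgn (k : ℤ) : ℂ := Complex.I * (k.sign : ℂ)

/-- `𝓡⁺(k)` -/
def Rp (k : ℤ) : Fin 7 → ℂ :=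
  ![p.ξ₁ * p.cp, p.ξ₂ * p.cp, isgn k * p.cp, p.ξ₁ * p.bp, p.ξ₂ * p.bp, isgn k * p.bp,
    p.bp ^ 2 - p.cp ^ 2]

/-- `𝓡₁⁻(k)` -/
def Rm₁ (k : ℤ) : Fin 6 → ℂ :=
  ![p.rt * p.ν * p.τ, 0, -isgn k * p.ν * p.τ * p.ξ₁, -isgn k * p.ξ₁ * p.ξ₂,
    isgn k * (p.ν ^ 2 * p.τ ^ 2 - p.ξ₂ ^ 2), -p.rt * p.ξ₂]

/-- `𝓡₂⁻(k)` -/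
def Rm₂ (k : ℤ) : Fin 6 → ℂ :=
  ![0, p.rt * p.ν * p.τ, -isgn k * p.ν * p.τ * p.ξ₂,
    -isgn k * (p.ν ^ 2 * p.τ ^ 2 - p.ξ₁ ^ 2), isgn k * p.ξ₁ * p.ξ₂, p.rt * p.ξ₁]

/-- `𝓛⁺(k)` -/
def Lp (k : ℤ) : Fin 7 → ℂ :=
  ![p.ξ₁ * p.τ, p.ξ₂ * p.τ, isgn k * p.τ, 2 * p.ξ₁ * p.bp, 2 * p.ξ₂ * p.bp,
    2 * isgn k * p.bp, -p.τ * (p.ap + p.cp)]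

/-- `𝓛⁻(k)` -/
def Lm (k : ℤ) : Fin 6 → ℂ := fun i =>
  -(1 / (p.ν : ℂ)) *
    (![(p.ν * p.τ * p.am₁ - p.ξ₁ * p.bm) / p.rt, (p.ν * p.τ * p.am₂ - p.ξ₂ * p.bm) / p.rt,
      isgn k * p.bm, isgn k * p.am₂, -isgn k * p.am₁,
      (p.ξ₁ * p.am₂ - p.ξ₂ * p.am₁) / p.rt] : Fin 6 → ℂ) i

def lp₁ : ℝ := 2 * p.bp ^ 2 - p.τ * p.cp
def lp₂ : ℝ := -(p.ap + p.cp) * p.bp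

end Params

/-! ### The fast problem -/

/-- Source terms: `Fp = (F₁⁺, …, F₇⁺)`, `F8p = F₈⁺`, `Fm = (F₁⁻, …, F₆⁻)`, `F7m = F₇⁻`,
`F8m = F₈⁻`, and the boundary source `G = (G₁, …, G₆)`. -/
structure Sources where
  Fp : Fin 7 → Profile
  F8p : Profile
  Fm : Fin 6 → Profile
  F7m : Profile
  F8m : Profile
  G : Fin 6 → (Fin 4 → ℝ) → ℝ

/-- The zero source terms. -/
def Sources.zero : Sources := ⟨0, 0, 0, 0, 0, 0⟩

/-- Regularity of the source terms: each component is a scalar profile on its side, and the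
boundary source is in `H^∞`. -/
structure Sources.Regular (T : ℝ) (S : Sources) : Prop where
  Fp : ∀ i, InS T Jp (S.Fp i)
  F8p : InS T Jp S.F8p
  Fm : ∀ i, InS T Jm (S.Fm i)
  F7m : InS T Jm S.F7m
  F8m : InS T Jm S.F8m
  G : ∀ i, IsHInf (bdryBox T) (S.G i)

/-- `∂_{Y₃}` on the full domain of the side `J`. -/
def dY (T : ℝ) (J : Set ℝ) (P : Profile) : (Fin 6 → ℝ) → ℝ := pd (fastBox T J) 0 (val P)

/-- `∂_θ` on the full domain of the side `J`. -/
def dθ (T : ℝ) (J : Set ℝ) (P : Profile) : (Fin 6 → ℝ) → ℝ := pd (fastBox T J) 5 (val P)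

/-- `∂_θ` on the boundary. -/
def dθb (T : ℝ) (g : (Fin 4 → ℝ) → ℝ) : (Fin 4 → ℝ) → ℝ := pd (bdryBox T) 3 g

/-- The point `y₃ = Y₃ = 0` over the boundary point `w = (t, y₁, y₂, θ)`. -/
def onΓ (w : Fin 4 → ℝ) : Fin 6 → ℝ := Matrix.vecCons 0 (Matrix.vecCons 0 w)

/-- `(U, V, φ)` is a solution of the fast problem in `S⁺ × S⁻ × H^∞([0,T] × 𝕋² × 𝕋)`. By
continuity it does not matter that the equations are written on the closed half lines. -/
structure IsSolution (p : Params) (T : ℝ) (S : Sources)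
    (U : Fin 7 → Profile) (V : Fin 6 → Profile) (φ : (Fin 4 → ℝ) → ℝ) : Prop where
  memU : InSPlus T U
  memV : InSMinus T V
  memφ : IsHInf (bdryBox T) φ
  plasma : ∀ x ∈ dom (fastBox T Jp),
    p.A3p.mulVec (fun i => dY T Jp (U i) x) + p.Ap.mulVec (fun i => dθ T Jp (U i) x)
      = fun i => val (S.Fp i) x
  divB : ∀ x ∈ dom (fastBox T Jp),
    dY T Jp (U 5) x + (p.ξ₁ * dθ T Jp (U 3) x + p.ξ₂ * dθ T Jp (U 4) x) = val S.F8p x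
  vacuum : ∀ x ∈ dom (fastBox T Jm),
    Params.A3m.mulVec (fun i => dY T Jm (V i) x) + p.Am.mulVec (fun i => dθ T Jm (V i) x)
      = fun i => val (S.Fm i) x
  divH : ∀ x ∈ dom (fastBox T Jm),
    dY T Jm (V 2) x + (p.ξ₁ * dθ T Jm (V 0) x + p.ξ₂ * dθ T Jm (V 1) x) = val S.F7m x
  divE : ∀ x ∈ dom (fastBox T Jm),
    dY T Jm (V 5) x + (p.ξ₁ * dθ T Jm (V 3) x + p.ξ₂ * dθ T Jm (V 4) x) = val S.F8m x
  jump : ∀ w ∈ dom (bdryBox T),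
    Params.BBp.mulVec (fun i => val (U i) (onΓ w)) + p.BBm.mulVec (fun i => val (V i) (onΓ w))
      + dθb T φ w • p.bvec = fun i => S.G i w

/-- The compatibility conditions on the source terms. -/
structure Compatible (p : Params) (T : ℝ) (S : Sources) : Prop where
  a₁ : ∀ w ∈ dom (bdryBox T),
    val (S.Fp 5) (onΓ w) = -p.bp * dθb T (S.G 0) w + p.cp * dθb T (S.G 1) w
  a₂ : ∀ w ∈ dom (bdryBox T),
    val (S.Fm 2) (onΓ w) = p.ν * p.τ * dθb T (S.G 2) w
      + (p.ξ₁ * dθb T (S.G 3) w + p.ξ₂ * dθb T (S.G 4) w)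
  b_plus : ∀ z ∈ dom (slowBox T Jp), (∀ i, mean (S.Fp i).1 z = 0) ∧ mean S.F8p.1 z = 0
  b_minus : ∀ z ∈ dom (slowBox T Jm),
    (∀ i, mean (S.Fm i).1 z = 0) ∧ mean S.F7m.1 z = 0 ∧ mean S.F8m.1 z = 0
  c : ∀ x ∈ dom (fastBox T Jp),
    p.u₁ * mean (S.Fp 6).2 x - p.B₁ * mean S.F8p.2 x = mean (S.Fp 0).2 x ∧
    p.u₂ * mean (S.Fp 6).2 x - p.B₂ * mean S.F8p.2 x = mean (S.Fp 1).2 x ∧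
    p.B₁ * mean (S.Fp 6).2 x - p.u₁ * mean S.F8p.2 x = mean (S.Fp 3).2 x ∧
    p.B₂ * mean (S.Fp 6).2 x - p.u₂ * mean S.F8p.2 x = mean (S.Fp 4).2 x
  d_plus : ∀ x ∈ dom (fastBox T Jp),
    dY T Jp (S.Fp 5) x + (p.ξ₁ * dθ T Jp (S.Fp 3) x + p.ξ₂ * dθ T Jp (S.Fp 4) x)
      - p.τ * dθ T Jp S.F8p x = 0
  d_minus : ∀ x ∈ dom (fastBox T Jm),
    dY T Jm (S.Fm 2) x + (p.ξ₁ * dθ T Jm (S.Fm 0) x + p.ξ₂ * dθ T Jm (S.Fm 1) x)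
      - p.ν * p.τ * dθ T Jm S.F7m x = 0 ∧
    dY T Jm (S.Fm 5) x + (p.ξ₁ * dθ T Jm (S.Fm 3) x + p.ξ₂ * dθ T Jm (S.Fm 4) x)
      - p.ν * p.τ * dθ T Jm S.F8m x = 0
  e : ∀ w ∈ dom (bdryBox T), ∀ k : ℤ, k ≠ 0 →
    (∫ Y in Set.Ioi (0 : ℝ), (Real.exp (-|(k : ℝ)| * Y) : ℂ) *
        ∑ i, (starRingEnd ℂ) (p.Lp k i) *
          mode (val (S.Fp i)) k (Matrix.vecCons Y (Matrix.vecCons 0 w)))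
      + (p.lp₁ * mode (S.G 0) k w + p.lp₂ * mode (S.G 1) k w)
      - (∫ Y in Set.Iio (0 : ℝ), (Real.exp (|(k : ℝ)| * p.rt * Y) : ℂ) *
        ∑ i, (starRingEnd ℂ) (p.Lm k i) *
          mode (val (S.Fm i)) k (Matrix.vecCons Y (Matrix.vecCons 0 w)))
      - (((-(p.ν * p.τ * p.am₁) + p.ξ₁ * p.bm) / (p.ν * p.rt) : ℝ) * mode (S.G 3) k w
        + ((-(p.ν * p.τ * p.am₂) + p.ξ₂ * p.bm) / (p.ν * p.rt) : ℝ) * mode (S.G 4) k w)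
      - Params.isgn k * p.τ * mode (S.G 5) k w
      + ((p.E₃ / (|(k : ℝ)| * p.ν) : ℝ) : ℂ) * mode (val (S.Fm 5)) k (onΓ w) = 0

/-- `(𝕌, 𝕍, 0)` is a solution whose tangential velocity and magnetic field in the plasma have
zero mean in `θ`, that is `Π 𝕌̂(0) = 0`. -/
def IsParticular (p : Params) (T : ℝ) (S : Sources)
    (U : Fin 7 → Profile) (V : Fin 6 → Profile) : Prop :=
  IsSolution p T S U V 0 ∧
    ∀ i ∈ ({0, 1, 3, 4} : Set (Fin 7)), ∀ x ∈ dom (fastBox T Jp), mean (val (U i)) x = 0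

/-- The vector `(û₁⋆(0), û₂⋆(0), 0, B̂₁⋆(0), B̂₂⋆(0), 0, 0)` of fast means of `U`. -/
def fastMean (U : Fin 7 → Profile) : Fin 7 → (Fin 6 → ℝ) → ℝ :=
  ![mean (U 0).2, mean (U 1).2, 0, mean (U 3).2, mean (U 4).2, 0, 0]

/-- The general form of a solution `(U, V, φ)`, relative to `(U₀, V₀)`. The coefficients
`γp k`, `γm₁ k`, `γm₂ k` are functions of `(y₃, t, y₁, y₂)`. -/
structure Decomposition (p : Params) (T c₁ c₂ : ℝ)
    (U₀ : Fin 7 → Profile) (V₀ : Fin 6 → Profile)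
    (U : Fin 7 → Profile) (V : Fin 6 → Profile) (φ : (Fin 4 → ℝ) → ℝ)
    (Uh : Fin 7 → (Fin 5 → ℝ) → ℝ) (Vh : Fin 6 → (Fin 5 → ℝ) → ℝ)
    (γp γm₁ γm₂ : ℤ → ℝ → ℝ → ℝ → ℝ → ℂ) : Prop where
  memUh : InResPlus T Uh
  memVh : InResMinus T Vh
  indepU : ∀ i, ∀ z ∈ dom (slowBox T Jp), ∀ θ : ℝ, Uh i (Function.update z 4 θ) = Uh i z
  indepV : ∀ i, ∀ z ∈ dom (slowBox T Jm), ∀ θ : ℝ, Vh i (Function.update z 4 θ) = Vh i z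
  bdry : ∀ w ∈ dom (bdryBox T),
    Uh 2 (Matrix.vecCons 0 w) = 0 ∧ Uh 5 (Matrix.vecCons 0 w) = 0 ∧
    Vh 2 (Matrix.vecCons 0 w) = 0 ∧ Vh 3 (Matrix.vecCons 0 w) = 0 ∧
    Vh 4 (Matrix.vecCons 0 w) = 0 ∧
    Uh 6 (Matrix.vecCons 0 w)
      - (p.H₁ * Vh 0 (Matrix.vecCons 0 w) + p.H₂ * Vh 1 (Matrix.vecCons 0 w))
      + p.E₃ * Vh 5 (Matrix.vecCons 0 w) = 0
  memMean : InStarPlus T (fastMean U)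
  coeff : ∀ w ∈ dom (bdryBox T), ∀ k : ℤ, k ≠ 0 →
    γp k 0 (w 0) (w 1) (w 2) = |(k : ℝ)| * mode φ k w ∧
    γm₁ k 0 (w 0) (w 1) (w 2) = c₁ * |(k : ℝ)| * mode φ k w ∧
    γm₂ k 0 (w 0) (w 1) (w 2) = c₂ * |(k : ℝ)| * mode φ k w
  sumU : ∀ i, ∀ x ∈ dom (fastBox T Jp),
    HasSum (fun k : {k : ℤ // k ≠ 0} =>
      γp k (x 1) (x 2) (x 3) (x 4)
        * Complex.exp (-|((k : ℤ) : ℝ)| * x 0 + Complex.I * (k : ℤ) * x 5) * p.Rp k i)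
      ((val (U i) x - val (U₀ i) x - Uh i (Matrix.vecTail x) - fastMean U i x : ℝ) : ℂ)
  sumV : ∀ i, ∀ x ∈ dom (fastBox T Jm),
    HasSum (fun k : {k : ℤ // k ≠ 0} =>
      (γm₁ k (x 1) (x 2) (x 3) (x 4) * p.Rm₁ k i + γm₂ k (x 1) (x 2) (x 3) (x 4) * p.Rm₂ k i)
        * Complex.exp (|((k : ℤ) : ℝ)| * p.rt * x 0 + Complex.I * (k : ℤ) * x 5))
      ((val (V i) x - val (V₀ i) x - Vh i (Matrix.vecTail x) : ℝ) : ℂ)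

end

end FastProblem

open FastProblem

/-!
In the Fourier modes `k ≠ 0` in `θ` the fast problem is a system of linear ODEs in `Y₃` on two half
lines, with `t` and `y` as parameters, coupled by the boundary conditions. The divergence rows
allow it to be reduced to 2×2 systems `∂a = ikρ²b + r`, `∂b = -ika + s`: on the plasma side for
`c⁺u₃ - b⁺B₃` and `q` (with `1` for `ρ`), on the vacuum side for `ξ·H` and `H₃`, and likewise for
`ξ·E` and `E₃`. The other components follow algebraically
(`Params.plasma_rows`, `Params.vacuum_rows`). On the plasma side this divides by
`(c⁺)² - (b⁺)²`. That this is nonzero is the only use of a small `ν` (`Params.exists_disc_ne_zero`):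
where it vanishes, `τ` is bounded, and the Lopatinskii condition becomes a quadratic equation in
`ντ` that has no small nonzero root by the stability condition.

A 2×2 system has one growing and one decaying homogeneous solution. Hence it has a decaying solution
with one prescribed boundary value (`exists_halfspace`), and its decaying homogeneous solutions form
a line for each `k` (`halfspace_homogeneous`). To sum the modes back to profiles, surface wave
functions are identified with families of Fourier components that decay rapidly in `k` and
exponentially in `Y₃` with all derivatives (`InStar.niceAt_comp`, `NiceAt.inStar_syn`). The
necessary pointwise bounds by `L²` functions of the remaining variables come from one-dimensional
Sobolev inequalities. The residual part of a solution does not depend on `Y₃`, so that its equations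
are purely algebraic in the `θ`-derivatives (`exists_residual`).

The two sides are coupled by one scalar relation per mode. Pairing the equations with the decaying
solutions `𝓛^±` of the dual problem and integrating by parts in `Y₃` leaves boundary terms only,
and the front drops out of them by the Lopatinskii condition (`Params.solvability_identity`). For a
solution this is the last compatibility condition; the others are read off from the traces, the
limits `Y₃ → ±∞` and the redundancy of the divergence rows. Conversely, after solving on each side
with five prescribed components of the boundary data and no front, the identity says that the
pressure condition can only fail by a term independent of `θ`, which residual functions correct
(`Params.exists_particular`).

The difference of two solutions solves the homogeneous problem. Its modes `k ≠ 0` are decaying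
exponentials in the directions `𝓡^±` (`Params.plasma_modes`, `Params.vacuum_modes`), whose
amplitudes at the boundary are given by the front (`Params.boundary_amplitudes`). In the mode
`k = 0` the residual part is free up to the boundary conditions, and only the tangential components
of the plasma have a decaying part. This is the decomposition `Params.decomposition`.
-/

namespace FastProblem
open MeasureTheory

noncomputable section

/-! ### Calculus on boxes by partial derivatives -/

/-- The range of the `i`-th coordinate of `dom s`. -/
def fac {n : ℕ} (s : Fin n → Option (Set ℝ)) (i : Fin n) : Set ℝ := (s i).getD Set.univ

/-- A box whose factors are closed intervals with nonempty interior (possibly unbounded). -/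
structure GoodBox {n : ℕ} (s : Fin n → Option (Set ℝ)) : Prop where
  closed : ∀ i, IsClosed (fac s i)
  convex : ∀ i, Convex ℝ (fac s i)
  unique : ∀ i, UniqueDiffOn ℝ (fac s i)

/-- On `dom s`, the one-variable derivative of `f` in its `i`-th variable is `g`. -/
def HasPd {n : ℕ} {E : Type*} [NormedAddCommGroup E] [NormedSpace ℝ E]
    (s : Fin n → Option (Set ℝ)) (i : Fin n) (f g : (Fin n → ℝ) → E) : Prop :=
  ∀ x ∈ dom s, HasDerivWithinAt (fun t => f (Function.update x i t)) (g x) (fac s i) (x i)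

section
variable {n : ℕ} {s : Fin n → Option (Set ℝ)}
  {E : Type*} [NormedAddCommGroup E] [NormedSpace ℝ E]

lemma dom_eq_pi : dom s = Set.univ.pi (fac s) := by
  ext x; simp [dom, fac]

lemma mem_dom {x : Fin n → ℝ} : x ∈ dom s ↔ ∀ i, x i ∈ fac s i := Iff.rfl

lemma update_mem_dom {x : Fin n → ℝ} (hx : x ∈ dom s) {i : Fin n} {t : ℝ} (ht : t ∈ fac s i) :
    Function.update x i t ∈ dom s := by
  intro j
  change _ ∈ fac s j
  by_cases h : j = i
  · subst h; simpa using ht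
  · simpa [h] using mem_dom.1 hx j

lemma GoodBox.isClosed_dom (hs : GoodBox s) : IsClosed (dom s) := by
  rw [dom_eq_pi]; exact isClosed_set_pi fun i _ => hs.closed i

lemma GoodBox.uniqueDiffOn (hs : GoodBox s) : UniqueDiffOn ℝ (dom s) := by
  rw [dom_eq_pi]; exact UniqueDiffOn.univ_pi hs.unique

lemma HasPd.congr {i : Fin n} {f f' g g' : (Fin n → ℝ) → E} (h : HasPd s i f g)
    (hf : Set.EqOn f' f (dom s)) (hg : Set.EqOn g' g (dom s)) : HasPd s i f' g' := by
  intro x hx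
  rw [hg hx]
  refine (h x hx).congr (fun t ht => hf (update_mem_dom hx ht)) ?_
  simpa using hf hx

lemma HasPd.unique {i : Fin n} {f g g' : (Fin n → ℝ) → E} (hs : GoodBox s)
    (h : HasPd s i f g) (h' : HasPd s i f g') : Set.EqOn g g' (dom s) := fun x hx =>
  (hs.unique i _ (hx i)).eq_deriv _ (h x hx) (h' x hx)

lemma HasPd.add {i : Fin n} {f g f' g' : (Fin n → ℝ) → E}
    (h : HasPd s i f f') (h' : HasPd s i g g') : HasPd s i (f + g) (f' + g') :=
  fun x hx => (h x hx).add (h' x hx)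

lemma HasPd.sub {i : Fin n} {f g f' g' : (Fin n → ℝ) → E}
    (h : HasPd s i f f') (h' : HasPd s i g g') : HasPd s i (f - g) (f' - g') :=
  fun x hx => (h x hx).sub (h' x hx)

lemma HasPd.const_smul {i : Fin n} {f f' : (Fin n → ℝ) → E}
    (h : HasPd s i f f') (c : ℝ) : HasPd s i (c • f) (c • f') :=
  fun x hx => (h x hx).const_smul c

lemma HasPd.const_mul {i : Fin n} {f f' : (Fin n → ℝ) → ℂ}
    (h : HasPd s i f f') (c : ℂ) : HasPd s i (fun x => c * f x) (fun x => c * f' x) :=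
  fun x hx => (h x hx).const_mul c

/-- Mean value inequality on a box, obtained by changing one coordinate at a time. -/
lemma norm_sub_le_of_hasPd (hs : GoodBox s) {f : (Fin n → ℝ) → E} {g : Fin n → (Fin n → ℝ) → E}
    (hf : ∀ i, HasPd s i f (g i)) {x y : Fin n → ℝ} (hx : x ∈ dom s) (hy : y ∈ dom s)
    (v : Fin n → E) {c : ℝ}
    (hc : ∀ z ∈ dom s, (∀ i, z i ∈ Set.uIcc (x i) (y i)) → ∀ i, ‖g i z - v i‖ ≤ c) :
    ‖f y - f x - ∑ i, (y i - x i) • v i‖ ≤ ∑ i, c * |y i - x i| := by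
  classical
  have key : ∀ A : Finset (Fin n),
      ‖f (A.piecewise y x) - f x - ∑ i ∈ A, (y i - x i) • v i‖ ≤ ∑ i ∈ A, c * |y i - x i| := by
    intro A
    induction A using Finset.induction_on with
    | empty => simp
    | insert j A hj ih =>
      rw [Finset.sum_insert hj, Finset.sum_insert hj]
      set z := A.piecewise y x with hz
      have hzj : z j = x j := by simp [hz, hj]
      have hzd : z ∈ dom s := by
        intro i; by_cases hi : i ∈ A
        · simpa [hz, hi] using hy i
        · simpa [hz, hi] using hx i
      have hzu : ∀ i, z i ∈ Set.uIcc (x i) (y i) := by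
        intro i; by_cases hi : i ∈ A <;> simp [hz, hi]
      have hseg : Set.uIcc (x j) (y j) ⊆ fac s j := by
        rw [← segment_eq_uIcc]; exact (hs.convex j).segment_subset (hx j) (hy j)
      have step : ‖(f (Function.update z j (y j)) - y j • v j)
          - (f (Function.update z j (x j)) - x j • v j)‖ ≤ c * ‖y j - x j‖ := by
        refine (convex_uIcc (x j) (y j)).norm_image_sub_le_of_norm_hasDerivWithin_le
          (f := fun t => f (Function.update z j t) - t • v j)
          (f' := fun t => g j (Function.update z j t) - v j) ?_ ?_ Set.left_mem_uIcc
          Set.right_mem_uIcc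
        · intro t ht
          have h1 := hf j (Function.update z j t) (update_mem_dom hzd (hseg ht))
          simp only [Function.update_idem, Function.update_self] at h1
          have h2 := (hasDerivWithinAt_id t (Set.uIcc (x j) (y j))).smul_const (v j)
          have h3 := (h1.mono hseg).sub h2
          simp only [one_smul] at h3
          exact h3
        · intro t ht
          refine hc _ (update_mem_dom hzd (hseg ht)) (fun i => ?_) j
          by_cases hi : i = j
          · subst hi; simpa using ht
          · simpa [hi] using hzu i
      have e1 : (insert j A).piecewise y x = Function.update z j (y j) :=
        Finset.piecewise_insert _ _ _ _
      have e2 : Function.update z j (x j) = z := by rw [← hzj]; simp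
      rw [e1]
      rw [e2] at step
      calc _ = ‖((f (Function.update z j (y j)) - y j • v j) - (f z - x j • v j))
              + (f z - f x - ∑ i ∈ A, (y i - x i) • v i)‖ := by
            congr 1; rw [sub_smul]; abel
        _ ≤ _ := (norm_add_le _ _).trans (add_le_add (by simpa using step) ih)
  simpa using key Finset.univ

lemma continuousOn_of_bounded_hasPd (hs : GoodBox s) {f : (Fin n → ℝ) → E}
    {g : Fin n → (Fin n → ℝ) → E} (hf : ∀ i, HasPd s i f (g i))
    (hb : ∀ i, ∃ C, ∀ x ∈ dom s, ‖g i x‖ ≤ C) : ContinuousOn f (dom s) := by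
  choose C hC using hb
  set K := ∑ i, |C i|
  have hK : ∀ i, ∀ x ∈ dom s, ‖g i x‖ ≤ K := fun i x hx =>
    ((hC i x hx).trans (le_abs_self _)).trans
      (Finset.single_le_sum (f := fun i => |C i|) (fun _ _ => abs_nonneg _) (Finset.mem_univ i))
  have hK0 : 0 ≤ K := Finset.sum_nonneg fun _ _ => abs_nonneg _
  have : LipschitzOnWith (Real.toNNReal (n * K)) f (dom s) := by
    refine LipschitzOnWith.of_dist_le_mul fun y hy x hx => ?_
    rw [dist_eq_norm, Real.coe_toNNReal _ (by positivity)]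
    have h := norm_sub_le_of_hasPd hs hf hx hy 0 (c := K)
      (fun z hz _ i => by simpa using hK i z hz)
    simp only [Pi.zero_apply, smul_zero, Finset.sum_const_zero, sub_zero] at h
    refine h.trans ?_
    calc ∑ i, K * |y i - x i| ≤ ∑ _i : Fin n, K * dist y x :=
          Finset.sum_le_sum fun i _ => mul_le_mul_of_nonneg_left (by
            rw [← Real.dist_eq]; exact dist_le_pi_dist y x i) hK0
      _ = n * K * dist y x := by simp; ring
  exact this.continuousOn

/-- Continuous partial derivatives give a Fréchet derivative on a box. -/
lemma hasFDerivWithinAt_of_hasPd (hs : GoodBox s) {f : (Fin n → ℝ) → E}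
    {g : Fin n → (Fin n → ℝ) → E} (hf : ∀ i, HasPd s i f (g i))
    (hg : ∀ i, ContinuousOn (g i) (dom s)) {x : Fin n → ℝ} (hx : x ∈ dom s) :
    HasFDerivWithinAt f
      (∑ i, (ContinuousLinearMap.proj (R := ℝ) (φ := fun _ : Fin n => ℝ) i).smulRight (g i x))
      (dom s) x := by
  rw [hasFDerivWithinAt_iff_isLittleO, Asymptotics.isLittleO_iff]
  intro c hc
  have hc' : 0 < c / (n + 1) := by positivity
  have hev : ∀ᶠ z in nhdsWithin x (dom s), ∀ i, ‖g i z - g i x‖ ≤ c / (n + 1) := by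
    rw [Filter.eventually_all]
    intro i
    have := (hg i x hx).tendsto
    filter_upwards [this (Metric.closedBall_mem_nhds _ hc')] with z hz
    simpa [dist_eq_norm] using hz
  rw [eventually_nhdsWithin_iff, Metric.eventually_nhds_iff] at hev
  obtain ⟨r, hr, hev⟩ := hev
  rw [eventually_nhdsWithin_iff, Metric.eventually_nhds_iff]
  refine ⟨r, hr, fun y hy hyd => ?_⟩
  have h := norm_sub_le_of_hasPd hs hf hx hyd (fun i => g i x) (c := c / (n + 1)) (fun z hz hzi => by
    refine hev ?_ hz
    refine lt_of_le_of_lt ?_ hy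
    refine (dist_pi_le_iff dist_nonneg).2 fun i => ?_
    refine le_trans ?_ (dist_le_pi_dist y x i)
    rw [Real.dist_eq, Real.dist_eq]
    exact Set.abs_sub_left_of_mem_uIcc (hzi i))
  have e : (∑ i, (ContinuousLinearMap.proj (R := ℝ) (φ := fun _ : Fin n => ℝ) i).smulRight (g i x))
      (y - x) = ∑ i, (y i - x i) • g i x := by
    simp
  rw [e]
  refine h.trans ?_
  calc ∑ i, c / (n + 1) * |y i - x i| ≤ ∑ _i : Fin n, c / (n + 1) * ‖y - x‖ :=
        Finset.sum_le_sum fun i _ => mul_le_mul_of_nonneg_left (norm_le_pi_norm (y - x) i) hc'.le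
    _ = (n / (n + 1)) * (c * ‖y - x‖) := by simp; ring
    _ ≤ c * ‖y - x‖ := by
      refine mul_le_of_le_one_left (by positivity) ?_
      rw [div_le_one (by positivity)]; linarith

/-- A class of continuous functions that is closed under partial derivatives consists of smooth
functions. -/
lemma contDiffOn_of_class (hs : GoodBox s) {C : Set ((Fin n → ℝ) → E)}
    (hc : ∀ f ∈ C, ContinuousOn f (dom s))
    (hp : ∀ f ∈ C, ∀ i, ∃ g ∈ C, HasPd s i f g) {f : (Fin n → ℝ) → E} (hf : f ∈ C) :
    ContDiffOn ℝ ∞ f (dom s) := by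
  have key : ∀ N : ℕ, ∀ f ∈ C, ContDiffOn ℝ N f (dom s) := by
    intro N
    induction N with
    | zero => intro f hf; exact contDiffOn_zero.2 (hc f hf)
    | succ N ih =>
      intro f hf
      choose g hgC hg using hp f hf
      have hd := fun x (hx : x ∈ dom s) =>
        hasFDerivWithinAt_of_hasPd hs hg (fun i => hc _ (hgC i)) hx
      rw [show ((N + 1 : ℕ) : WithTop ℕ∞) = (N : WithTop ℕ∞) + 1 by push_cast; rfl,
        contDiffOn_succ_iff_hasFDerivWithinAt_of_uniqueDiffOn hs.uniqueDiffOn]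
      refine ⟨by simp, _, ?_, hd⟩
      refine ContDiffOn.sum fun i _ => ?_
      exact ContDiffOn.continuousLinearMap_comp
        (ContinuousLinearMap.smulRightL ℝ (Fin n → ℝ) E (ContinuousLinearMap.proj i)) (ih _ (hgC i))
  exact contDiffOn_infty.2 fun N => key N f hf

lemma hasPd_of_differentiableOn {f : (Fin n → ℝ) → E} (hf : DifferentiableOn ℝ f (dom s))
    (i : Fin n) : HasPd s i f (fun x => fderivWithin ℝ f (dom s) x (Pi.single i 1)) := by
  intro x hx
  have h1 := (hf x hx).hasFDerivWithinAt
  have h2 : HasDerivWithinAt (fun t => Function.update x i t) (Pi.single i 1) (fac s i) (x i) :=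
    (hasDerivAt_update x i (x i)).hasDerivWithinAt
  have h3 := HasFDerivWithinAt.comp_hasDerivWithinAt (x i) (t := dom s)
    (by simpa using h1) h2 (fun t ht => update_mem_dom hx ht)
  simpa [Function.comp_def] using h3

lemma hasPd_pd {f : (Fin n → ℝ) → ℝ} (hf : ContDiffOn ℝ ∞ f (dom s)) (i : Fin n) :
    HasPd s i f (pd s i f) :=
  hasPd_of_differentiableOn (hf.differentiableOn (by simp)) i

lemma contDiffOn_pd (hs : GoodBox s) {f : (Fin n → ℝ) → ℝ} (hf : ContDiffOn ℝ ∞ f (dom s))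
    (i : Fin n) : ContDiffOn ℝ ∞ (pd s i f) (dom s) :=
  (hf.fderivWithin hs.uniqueDiffOn (m := ∞) (by simp)).clm_apply contDiffOn_const

lemma HasPd.eqOn_pd {f g : (Fin n → ℝ) → ℝ} (hs : GoodBox s) (hf : ContDiffOn ℝ ∞ f (dom s))
    {i : Fin n} (h : HasPd s i f g) : Set.EqOn (pd s i f) g (dom s) :=
  (hasPd_pd hf i).unique hs h

lemma pd_congr {f g : (Fin n → ℝ) → ℝ} (h : Set.EqOn f g (dom s)) (i : Fin n) :
    Set.EqOn (pd s i f) (pd s i g) (dom s) := fun x hx => by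
  unfold pd; rw [fderivWithin_congr h (h hx)]

lemma iterPd_congr {f g : (Fin n → ℝ) → ℝ} (h : Set.EqOn f g (dom s)) (l : List (Fin n)) :
    Set.EqOn (iterPd s l f) (iterPd s l g) (dom s) := by
  induction l with
  | nil => exact h
  | cons i l ih => exact pd_congr ih i

lemma contDiffOn_iterPd (hs : GoodBox s) {f : (Fin n → ℝ) → ℝ} (hf : ContDiffOn ℝ ∞ f (dom s))
    (l : List (Fin n)) : ContDiffOn ℝ ∞ (iterPd s l f) (dom s) := by
  induction l with
  | nil => exact hf
  | cons i l ih => exact contDiffOn_pd hs ih i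

lemma iterPd_append (l l' : List (Fin n)) (f : (Fin n → ℝ) → ℝ) :
    iterPd s (l ++ l') f = iterPd s l (iterPd s l' f) := by
  simp [iterPd]

/-- In a class closed under partial derivatives, iterated derivatives stay in the class. -/
lemma iterPd_mem_class (hs : GoodBox s) {C : Set ((Fin n → ℝ) → ℝ)}
    (hc : ∀ f ∈ C, ContinuousOn f (dom s))
    (hp : ∀ f ∈ C, ∀ i, ∃ g ∈ C, HasPd s i f g) {f : (Fin n → ℝ) → ℝ} (hf : f ∈ C)
    (l : List (Fin n)) : ∃ g ∈ C, Set.EqOn (iterPd s l f) g (dom s) := by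
  induction l with
  | nil => exact ⟨f, hf, fun _ _ => rfl⟩
  | cons i l ih =>
    obtain ⟨g, hg, hgl⟩ := ih
    obtain ⟨g', hg', hgg'⟩ := hp g hg i
    exact ⟨g', hg', (pd_congr hgl i).trans (hgg'.eqOn_pd hs (contDiffOn_of_class hs hc hp hg))⟩

lemma pd_add (hs : GoodBox s) {f g : (Fin n → ℝ) → ℝ} (hf : ContDiffOn ℝ ∞ f (dom s))
    (hg : ContDiffOn ℝ ∞ g (dom s)) (i : Fin n) :
    Set.EqOn (pd s i (f + g)) (pd s i f + pd s i g) (dom s) :=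
  ((hasPd_pd hf i).add (hasPd_pd hg i)).eqOn_pd hs (hf.add hg)

lemma pd_smul (hs : GoodBox s) {f : (Fin n → ℝ) → ℝ} (hf : ContDiffOn ℝ ∞ f (dom s))
    (c : ℝ) (i : Fin n) : Set.EqOn (pd s i (c • f)) (c • pd s i f) (dom s) :=
  ((hasPd_pd hf i).const_smul c).eqOn_pd hs (contDiffOn_const.smul hf)

lemma iterPd_add (hs : GoodBox s) {f g : (Fin n → ℝ) → ℝ} (hf : ContDiffOn ℝ ∞ f (dom s))
    (hg : ContDiffOn ℝ ∞ g (dom s)) (l : List (Fin n)) :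
    Set.EqOn (iterPd s l (f + g)) (iterPd s l f + iterPd s l g) (dom s) := by
  induction l with
  | nil => exact fun _ _ => rfl
  | cons i l ih =>
    exact (pd_congr ih i).trans (pd_add hs (contDiffOn_iterPd hs hf l) (contDiffOn_iterPd hs hg l) i)

lemma iterPd_smul (hs : GoodBox s) {f : (Fin n → ℝ) → ℝ} (hf : ContDiffOn ℝ ∞ f (dom s))
    (c : ℝ) (l : List (Fin n)) :
    Set.EqOn (iterPd s l (c • f)) (c • iterPd s l f) (dom s) := by
  induction l with
  | nil => exact fun _ _ => rfl
  | cons i l ih => exact (pd_congr ih i).trans (pd_smul hs (contDiffOn_iterPd hs hf l) c i)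

/-- Partial derivatives of smooth functions commute on a box. -/
lemma pd_comm (hs : GoodBox s) (hi : dom s ⊆ closure (interior (dom s)))
    {f : (Fin n → ℝ) → ℝ} (hf : ContDiffOn ℝ ∞ f (dom s)) (i j : Fin n) :
    Set.EqOn (pd s i (pd s j f)) (pd s j (pd s i f)) (dom s) := by
  intro x hx
  have hsymm := (hf x hx).isSymmSndFDerivWithinAt (n := ∞)
    (by simp; exact WithTop.coe_le_coe.2 le_top) hs.uniqueDiffOn (hi hx) hx
  have key : ∀ i j : Fin n, pd s i (pd s j f) x
      = fderivWithin ℝ (fderivWithin ℝ f (dom s)) (dom s) x (Pi.single i 1) (Pi.single j 1) := by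
    intro i j
    have hd : DifferentiableWithinAt ℝ (fderivWithin ℝ f (dom s)) (dom s) x :=
      ((hf.fderivWithin hs.uniqueDiffOn (m := ∞) (by simp)).differentiableOn (by simp)) x hx
    have h := hd.hasFDerivWithinAt.clm_apply
      (hasFDerivWithinAt_const (Pi.single j (1 : ℝ) : Fin n → ℝ) x (dom s))
    have h' := h.fderivWithin (hs.uniqueDiffOn x hx)
    change fderivWithin ℝ (fun y => fderivWithin ℝ f (dom s) y (Pi.single j 1)) (dom s) x _ = _
    rw [h']; simp
  rw [key, key, hsymm]

end

/-! ### Periodicity -/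
section
variable {n : ℕ} {s : Fin n → Option (Set ℝ)}

lemma fac_none {i : Fin n} (hi : s i = none) : fac s i = Set.univ := by simp [fac, hi]

lemma IsSmoothPer.pd (hs : GoodBox s) {f : (Fin n → ℝ) → ℝ} (hf : IsSmoothPer s f) (j : Fin n) :
    IsSmoothPer s (pd s j f) := by
  refine ⟨contDiffOn_pd hs hf.smooth j, fun i hi x hx => ?_⟩
  have hx' : Function.update x i (x i + 2 * Real.pi) ∈ dom s :=
    update_mem_dom hx (by simp [fac_none hi])
  have h1 := hasPd_pd hf.smooth j _ hx'
  have h2 := hasPd_pd hf.smooth j _ hx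
  by_cases hij : j = i
  · subst hij
    simp only [Function.update_idem, Function.update_self] at h1
    rw [fac_none hi] at h1 h2
    have h3 : HasDerivWithinAt (fun t => f (Function.update x j t))
        (FastProblem.pd s j f (Function.update x j (x j + 2 * Real.pi))) Set.univ (x j) := by
      have := HasDerivWithinAt.scomp (x j) (t' := Set.univ) (h := fun t : ℝ => t + 2 * Real.pi)
        h1 ((hasDerivWithinAt_id (x j) Set.univ).add_const (2 * Real.pi)) (fun _ _ => Set.mem_univ _)
      refine (by simpa [Function.comp_def] using this : HasDerivWithinAt
        (fun t => f (Function.update x j (t + 2 * Real.pi))) _ _ _).congr (fun t _ => ?_) ?_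
      · have := hf.periodic j hi (Function.update x j t)
          (update_mem_dom hx (by simp [fac_none hi]))
        simpa using this.symm
      · have := hf.periodic j hi x hx
        simpa using this.symm
    exact uniqueDiffWithinAt_univ.eq_deriv _ h3 h2
  · refine (hs.unique j _ (hx j)).eq_deriv _ ?_ h2
    rw [Function.update_of_ne hij] at h1
    refine h1.congr (fun t ht => ?_) ?_
    · have := hf.periodic i hi _ (update_mem_dom hx ht)
      rw [Function.update_of_ne (Ne.symm hij)] at this
      rw [Function.update_comm (Ne.symm hij), this]
    · have := hf.periodic i hi _ hx
      rw [Function.update_eq_self]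
      rw [Function.update_comm (Ne.symm hij), Function.update_eq_self, this]

lemma IsSmoothPer.iterPd (hs : GoodBox s) {f : (Fin n → ℝ) → ℝ} (hf : IsSmoothPer s f)
    (l : List (Fin n)) : IsSmoothPer s (iterPd s l f) := by
  induction l with
  | nil => exact hf
  | cons i l ih => exact ih.pd hs i

lemma IsSmoothPer.congr {f g : (Fin n → ℝ) → ℝ} (hf : IsSmoothPer s f)
    (h : Set.EqOn g f (dom s)) : IsSmoothPer s g :=
  ⟨hf.smooth.congr h, fun i hi x hx => by
    rw [h hx, h (update_mem_dom hx (by simp [fac_none hi])), hf.periodic i hi x hx]⟩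

lemma IsSmoothPer.add {f g : (Fin n → ℝ) → ℝ} (hf : IsSmoothPer s f) (hg : IsSmoothPer s g) :
    IsSmoothPer s (f + g) :=
  ⟨hf.smooth.add hg.smooth, fun i hi x hx => by
    simp [hf.periodic i hi x hx, hg.periodic i hi x hx]⟩

lemma IsSmoothPer.smul {f : (Fin n → ℝ) → ℝ} (hf : IsSmoothPer s f) (c : ℝ) :
    IsSmoothPer s (c • f) :=
  ⟨contDiffOn_const.smul hf.smooth, fun i hi x hx => by simp [hf.periodic i hi x hx]⟩

lemma IsSmoothPer.sub {f g : (Fin n → ℝ) → ℝ} (hf : IsSmoothPer s f) (hg : IsSmoothPer s g) :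
    IsSmoothPer s (f - g) := by
  have := hf.add (hg.smul (-1)); simpa [sub_eq_add_neg] using this

end

/-! ### The boxes of the problem -/

/-- The half line `{y | 0 ≤ ε y}`; `ε = 1` is the plasma side and `ε = -1` the vacuum side. -/
def Jh (ε : ℝ) : Set ℝ := {y | 0 ≤ ε * y}

lemma Jp_eq : Jp = Jh 1 := by ext; simp [Jp, Jh]
lemma Jm_eq : Jm = Jh (-1) := by ext; simp [Jm, Jh]

lemma goodBox_cons {n : ℕ} {s : Fin n → Option (Set ℝ)} (hs : GoodBox s) {J : Set ℝ}
    (h1 : IsClosed J) (h2 : Convex ℝ J) (h3 : UniqueDiffOn ℝ J) :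
    GoodBox (Matrix.vecCons (some J) s) := by
  constructor <;> intro i <;> refine Fin.cases ?_ (fun i => ?_) i
  · exact h1
  · exact hs.closed i
  · exact h2
  · exact hs.convex i
  · exact h3
  · exact hs.unique i

lemma goodBox_bdry {T : ℝ} (hT : 0 < T) : GoodBox (bdryBox T) := by
  constructor <;> intro i <;> fin_cases i <;>
    simp [fac, bdryBox, isClosed_Icc, convex_Icc, uniqueDiffOn_Icc hT, convex_univ,
      uniqueDiffOn_univ]

/-- `ε = ±1`. -/
abbrev IsSide (ε : ℝ) : Prop := ε = 1 ∨ ε = -1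

lemma Jh_props {ε : ℝ} (hε : IsSide ε) :
    IsClosed (Jh ε) ∧ Convex ℝ (Jh ε) ∧ UniqueDiffOn ℝ (Jh ε) := by
  rcases hε with rfl | rfl
  · rw [← Jp_eq]; exact ⟨isClosed_Ici, convex_Ici _, uniqueDiffOn_Ici _⟩
  · rw [← Jm_eq]; exact ⟨isClosed_Iic, convex_Iic _, uniqueDiffOn_Iic _⟩

lemma goodBox_slow {T ε : ℝ} (hT : 0 < T) (hε : IsSide ε) : GoodBox (slowBox T (Jh ε)) :=
  goodBox_cons (goodBox_bdry hT) (Jh_props hε).1 (Jh_props hε).2.1 (Jh_props hε).2.2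

lemma goodBox_fast {T ε : ℝ} (hT : 0 < T) (hε : IsSide ε) : GoodBox (fastBox T (Jh ε)) :=
  goodBox_cons (goodBox_slow hT hε) (Jh_props hε).1 (Jh_props hε).2.1 (Jh_props hε).2.2

lemma mem_dom_cons {n : ℕ} {s : Fin n → Option (Set ℝ)} {J : Set ℝ} {Y : ℝ} {z : Fin n → ℝ} :
    Matrix.vecCons Y z ∈ dom (Matrix.vecCons (some J) s) ↔ Y ∈ J ∧ z ∈ dom s := by
  constructor
  · exact fun h => ⟨h 0, fun i => h i.succ⟩
  · exact fun h i => Fin.cases h.1 (fun j => h.2 j) i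

lemma mem_dom_vecTail {n : ℕ} {s : Fin n → Option (Set ℝ)} {J : Set ℝ} {x : Fin (n + 1) → ℝ}
    (hx : x ∈ dom (Matrix.vecCons (some J) s)) : Matrix.vecTail x ∈ dom s :=
  fun i => hx i.succ

/-! ### Differentiation under the integral sign, one-sided at the boundary -/

section
variable {E : Type*} [NormedAddCommGroup E] [NormedSpace ℝ E]

lemma hasDerivWithinAt_integral {α : Type*} [MeasurableSpace α] {μ : Measure α} {S : Set ℝ}
    (hS : Convex ℝ S) {t₀ : ℝ} (ht₀ : t₀ ∈ S) {F F' : ℝ → α → E} {bound : α → ℝ}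
    (hF : ∀ t ∈ S, Integrable (F t) μ) (hb : Integrable bound μ)
    (hd : ∀ᵐ a ∂μ, ∀ t ∈ S, HasDerivWithinAt (fun t => F t a) (F' t a) S t)
    (hF' : ∀ᵐ a ∂μ, ∀ t ∈ S, ‖F' t a‖ ≤ bound a) :
    HasDerivWithinAt (fun t => ∫ a, F t a ∂μ) (∫ a, F' t₀ a ∂μ) S t₀ := by
  rw [hasDerivWithinAt_iff_tendsto_slope]
  have hmem : ∀ᶠ t in nhdsWithin t₀ (S \ {t₀}), t ∈ S := by
    filter_upwards [self_mem_nhdsWithin] with t ht using ht.1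
  have h1 : Filter.Tendsto (fun t => ∫ a, (t - t₀)⁻¹ • (F t a - F t₀ a) ∂μ)
      (nhdsWithin t₀ (S \ {t₀})) (nhds (∫ a, F' t₀ a ∂μ)) := by
    refine tendsto_integral_filter_of_dominated_convergence bound ?_ ?_ hb ?_
    · filter_upwards [hmem] with t ht
      exact (((hF t ht).sub (hF t₀ ht₀)).smul ((t - t₀)⁻¹)).aestronglyMeasurable
    · filter_upwards [self_mem_nhdsWithin] with t ht
      filter_upwards [hd, hF'] with a ha hb
      have := hS.norm_image_sub_le_of_norm_hasDerivWithin_le ha hb ht₀ ht.1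
      have hne : 0 < ‖t - t₀‖ := norm_pos_iff.2 (sub_ne_zero.2 ht.2)
      rw [norm_smul, norm_inv, inv_mul_le_iff₀ hne, mul_comm]
      exact this
    · filter_upwards [hd] with a ha
      have := hasDerivWithinAt_iff_tendsto_slope.1 (ha t₀ ht₀)
      simpa [slope_fun_def] using this
  refine h1.congr' ?_
  filter_upwards [hmem] with t ht
  rw [slope_def_module, integral_smul, integral_sub (hF t ht) (hF t₀ ht₀)]

lemma hasDerivWithinAt_intervalIntegral {S : Set ℝ} (hS : Convex ℝ S) (hSc : IsClosed S)
    {t₀ : ℝ} (ht₀ : t₀ ∈ S) {F F' : ℝ → ℝ → E} {a b : ℝ} (hab : a ≤ b)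
    (hF : ∀ t ∈ S, ContinuousOn (F t) (Set.Icc a b))
    (hd : ∀ θ ∈ Set.Icc a b, ∀ t ∈ S, HasDerivWithinAt (fun t => F t θ) (F' t θ) S t)
    (hF' : ContinuousOn (fun q : ℝ × ℝ => F' q.1 q.2) (S ×ˢ Set.Icc a b)) :
    HasDerivWithinAt (fun t => ∫ θ in a..b, F t θ) (∫ θ in a..b, F' t₀ θ) S t₀ := by
  set S' := S ∩ Set.Icc (t₀ - 1) (t₀ + 1)
  have hcpt : IsCompact (S' ×ˢ Set.Icc a b) :=
    (isCompact_Icc.inter_left hSc).prod isCompact_Icc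
  obtain ⟨C, hC⟩ := hcpt.exists_bound_of_continuousOn
    (hF'.mono (Set.prod_mono Set.inter_subset_left le_rfl))
  have hmem : Set.Icc (t₀ - 1) (t₀ + 1) ∈ nhds t₀ :=
    Icc_mem_nhds (by linarith) (by linarith)
  have main : HasDerivWithinAt (fun t => ∫ θ in a..b, F t θ) (∫ θ in a..b, F' t₀ θ) S' t₀ := by
    simp only [intervalIntegral.integral_of_le hab]
    refine hasDerivWithinAt_integral (hS.inter (convex_Icc _ _)) (bound := fun _ => C)
      ⟨ht₀, mem_of_mem_nhds hmem⟩ ?_ (integrable_const C) ?_ ?_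
    · intro t ht
      exact (hF t ht.1).integrableOn_Icc.mono_set Set.Ioc_subset_Icc_self
    · refine (ae_restrict_iff' measurableSet_Ioc).2 (Filter.Eventually.of_forall fun θ hθ t ht => ?_)
      exact (hd θ (Set.Ioc_subset_Icc_self hθ) t ht.1).mono Set.inter_subset_left
    · refine (ae_restrict_iff' measurableSet_Ioc).2 (Filter.Eventually.of_forall fun θ hθ t ht => ?_)
      exact hC (t, θ) ⟨ht, Set.Ioc_subset_Icc_self hθ⟩
  exact (hasDerivWithinAt_inter hmem).1 main

end

/-! ### Fourier modes in the last variable -/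

section
variable {n : ℕ} {s : Fin (n + 1) → Option (Set ℝ)}

lemma update_last_mem (hθ : s (Fin.last n) = none) {x : Fin (n + 1) → ℝ} (hx : x ∈ dom s) (θ : ℝ) :
    Function.update x (Fin.last n) θ ∈ dom s :=
  update_mem_dom hx (by simp [fac_none hθ])

lemma continuous_line {E : Type*} [TopologicalSpace E] (hθ : s (Fin.last n) = none)
    {f : (Fin (n + 1) → ℝ) → E} (hf : ContinuousOn f (dom s)) {x : Fin (n + 1) → ℝ}
    (hx : x ∈ dom s) : Continuous fun θ => f (Function.update x (Fin.last n) θ) :=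
  hf.comp_continuous (continuous_const.update _ continuous_id) fun θ => update_last_mem hθ hx θ

lemma mode_update (f : (Fin (n + 1) → ℝ) → ℝ) (k : ℤ) (x : Fin (n + 1) → ℝ) (θ : ℝ) :
    mode f k (Function.update x (Fin.last n) θ) = mode f k x := by
  simp [mode]

lemma mode_congr (hθ : s (Fin.last n) = none) {f g : (Fin (n + 1) → ℝ) → ℝ}
    (h : Set.EqOn f g (dom s)) (k : ℤ) {x : Fin (n + 1) → ℝ} (hx : x ∈ dom s) :
    mode f k x = mode g k x := by
  unfold mode; simp only [h (update_last_mem hθ hx _)]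

lemma continuous_mode_integrand (hθ : s (Fin.last n) = none)
    {f : (Fin (n + 1) → ℝ) → ℝ} (hf : ContinuousOn f (dom s)) (k : ℤ) {x : Fin (n + 1) → ℝ}
    (hx : x ∈ dom s) : Continuous fun θ : ℝ => (f (Function.update x (Fin.last n) θ) : ℂ)
      * Complex.exp (-(Complex.I * k * θ)) :=
  (Complex.continuous_ofReal.comp (continuous_line hθ hf hx)).mul (by fun_prop)

lemma mode_add (hθ : s (Fin.last n) = none) {f g : (Fin (n + 1) → ℝ) → ℝ}
    (hf : ContinuousOn f (dom s)) (hg : ContinuousOn g (dom s)) (k : ℤ) {x : Fin (n + 1) → ℝ}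
    (hx : x ∈ dom s) : mode (f + g) k x = mode f k x + mode g k x := by
  unfold mode
  rw [← mul_add, ← intervalIntegral.integral_add
    ((continuous_mode_integrand hθ hf k hx).intervalIntegrable _ _)
    ((continuous_mode_integrand hθ hg k hx).intervalIntegrable _ _)]
  simp [add_mul]

lemma mode_smul (f : (Fin (n + 1) → ℝ) → ℝ) (c : ℝ) (k : ℤ) (x : Fin (n + 1) → ℝ) :
    mode (c • f) k x = c * mode f k x := by
  unfold mode
  rw [mul_left_comm, ← intervalIntegral.integral_const_mul]
  simp [mul_assoc]

lemma mode_zero_eq_mean (f : (Fin (n + 1) → ℝ) → ℝ) (x : Fin (n + 1) → ℝ) :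
    mode f 0 x = (mean f x : ℂ) := by
  unfold mode mean
  simp [intervalIntegral.integral_ofReal]

lemma norm_exp_I_mul (k : ℤ) (θ : ℝ) : ‖Complex.exp (-(Complex.I * k * θ))‖ = 1 := by
  rw [show -(Complex.I * k * θ) = ((-(k * θ) : ℝ) : ℂ) * Complex.I by push_cast; ring]
  exact Complex.norm_exp_ofReal_mul_I _

lemma norm_exp_I_mul' (k : ℤ) (θ : ℝ) : ‖Complex.exp (Complex.I * k * θ)‖ = 1 := by
  rw [show Complex.I * k * θ = ((k * θ : ℝ) : ℂ) * Complex.I by push_cast; ring]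
  exact Complex.norm_exp_ofReal_mul_I _

lemma norm_mode_le {f : (Fin (n + 1) → ℝ) → ℝ} {C : ℝ} {x : Fin (n + 1) → ℝ}
    (h : ∀ θ, |f (Function.update x (Fin.last n) θ)| ≤ C) (k : ℤ) : ‖mode f k x‖ ≤ C := by
  unfold mode
  have h1 := intervalIntegral.norm_integral_le_of_norm_le_const (a := 0) (b := 2 * Real.pi) (C := C)
    (f := fun θ : ℝ => (f (Function.update x (Fin.last n) θ) : ℂ)
      * Complex.exp (-(Complex.I * k * θ))) (fun θ _ => by
        rw [norm_mul, norm_exp_I_mul, mul_one, Complex.norm_real]; exact h θ)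
  have hpi : 0 < 2 * Real.pi := by positivity
  rw [norm_mul, Complex.norm_real, Real.norm_of_nonneg (by positivity), inv_mul_le_iff₀ hpi]
  rwa [sub_zero, abs_of_pos hpi, mul_comm C] at h1

lemma HasPd.hasDerivAt_line {E : Type*} [NormedAddCommGroup E] [NormedSpace ℝ E]
    (hθ : s (Fin.last n) = none) {f g : (Fin (n + 1) → ℝ) → E}
    (h : HasPd s (Fin.last n) f g) {x : Fin (n + 1) → ℝ} (hx : x ∈ dom s) (θ : ℝ) :
    HasDerivAt (fun t => f (Function.update x (Fin.last n) t))
      (g (Function.update x (Fin.last n) θ)) θ := by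
  have := h _ (update_last_mem hθ hx θ)
  simpa [fac_none hθ] using this

lemma IsSmoothPer.periodic_last (hθ : s (Fin.last n) = none) {f : (Fin (n + 1) → ℝ) → ℝ}
    (hf : IsSmoothPer s f) {x : Fin (n + 1) → ℝ} (hx : x ∈ dom s) :
    Function.Periodic (fun θ => f (Function.update x (Fin.last n) θ)) (2 * Real.pi) := fun θ => by
  have := hf.periodic _ hθ _ (update_last_mem hθ hx θ)
  simpa using this

lemma _root_.Function.Periodic.exists_abs_le {h : ℝ → ℝ} (hp : Function.Periodic h (2 * Real.pi))
    (hc : Continuous h) : ∃ C, ∀ θ, |h θ| ≤ C := by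
  obtain ⟨C, hC⟩ := isCompact_Icc.exists_bound_of_continuousOn
    (hc.continuousOn (s := Set.Icc 0 (2 * Real.pi)))
  refine ⟨C, fun θ => ?_⟩
  obtain ⟨y, hy, e⟩ := hp.exists_mem_Ico₀ (by positivity) θ
  rw [e]
  exact hC y ⟨hy.1, hy.2.le⟩

lemma exp_two_pi_mul_int (k : ℤ) : Complex.exp (-(Complex.I * k * (2 * Real.pi : ℝ))) = 1 := by
  rw [Complex.exp_eq_one_iff]; exact ⟨-k, by push_cast; ring⟩

lemma mode_pd_last (hs : GoodBox s) (hθ : s (Fin.last n) = none) {f : (Fin (n + 1) → ℝ) → ℝ}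
    (hf : IsSmoothPer s f) (k : ℤ) {x : Fin (n + 1) → ℝ} (hx : x ∈ dom s) :
    mode (pd s (Fin.last n) f) k x = Complex.I * k * mode f k x := by
  have hc := continuous_mode_integrand hθ hf.smooth.continuousOn k hx
  have hc' := continuous_mode_integrand hθ (hf.pd hs (Fin.last n)).smooth.continuousOn k hx
  have hd : ∀ θ : ℝ, HasDerivAt (fun θ : ℝ => (f (Function.update x (Fin.last n) θ) : ℂ)
      * Complex.exp (-(Complex.I * k * θ)))
      ((pd s (Fin.last n) f (Function.update x (Fin.last n) θ) : ℂ)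
          * Complex.exp (-(Complex.I * k * θ))
        - Complex.I * k * ((f (Function.update x (Fin.last n) θ) : ℂ)
      * Complex.exp (-(Complex.I * k * θ)))) θ := by
    intro θ
    have h1 := ((hasPd_pd hf.smooth (Fin.last n)).hasDerivAt_line hθ hx θ).ofReal_comp
    have h2 : HasDerivAt (fun θ : ℝ => Complex.exp (-(Complex.I * k * θ)))
        (Complex.exp (-(Complex.I * k * θ)) * (-(Complex.I * k * 1))) θ :=
      ((((hasDerivAt_id (θ : ℝ)).ofReal_comp).const_mul (Complex.I * (k : ℂ))).neg).cexp
    refine (h1.mul h2).congr_deriv ?_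
    ring
  have h := intervalIntegral.integral_eq_sub_of_hasDerivAt (a := 0) (b := 2 * Real.pi)
    (fun θ _ => hd θ) ((hc'.sub (hc.const_mul _)).intervalIntegrable _ _)
  have hper := hf.periodic_last hθ hx 0
  simp only [zero_add] at hper
  rw [exp_two_pi_mul_int, hper] at h
  rw [intervalIntegral.integral_sub (hc'.intervalIntegrable _ _)
    ((hc.const_mul _).intervalIntegrable _ _), intervalIntegral.integral_const_mul] at h
  simp only [Complex.ofReal_zero, mul_zero, neg_zero, Complex.exp_zero, sub_self, sub_eq_zero] at h
  unfold mode
  rw [h]; ring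

lemma hasPd_mode (hs : GoodBox s) (hθ : s (Fin.last n) = none) {f g : (Fin (n + 1) → ℝ) → ℝ}
    {i : Fin (n + 1)} (hi : i ≠ Fin.last n) (h : HasPd s i f g) (hf : ContinuousOn f (dom s))
    (hg : ContinuousOn g (dom s)) (k : ℤ) : HasPd s i (mode f k) (mode g k) := by
  intro x hx
  unfold mode
  refine HasDerivWithinAt.const_mul _ ?_
  have hm : ∀ t ∈ fac s i, ∀ θ, Function.update (Function.update x i t) (Fin.last n) θ ∈ dom s :=
    fun t ht θ => update_last_mem hθ (update_mem_dom hx ht) θ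
  have := hasDerivWithinAt_intervalIntegral (a := 0) (b := 2 * Real.pi) (hs.convex i) (hs.closed i)
    (hx i) (F := fun t θ => (f (Function.update (Function.update x i t) (Fin.last n) θ) : ℂ)
      * Complex.exp (-(Complex.I * k * θ)))
    (F' := fun t θ => (g (Function.update (Function.update x i t) (Fin.last n) θ) : ℂ)
      * Complex.exp (-(Complex.I * k * θ))) (by positivity) ?_ ?_ ?_
  · simpa using this
  · intro t ht
    exact (continuous_mode_integrand hθ hf k (update_mem_dom hx ht)).continuousOn
  · intro θ _ t ht
    have h1 := h _ (hm t ht θ)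
    have e : ∀ r, Function.update (Function.update (Function.update x i t) (Fin.last n) θ) i r
        = Function.update (Function.update x i r) (Fin.last n) θ := fun r => by
      rw [Function.update_comm hi.symm, Function.update_idem]
    simp only [e, Function.update_of_ne hi, Function.update_self] at h1
    exact h1.ofReal_comp.mul_const _
  · have : ContinuousOn (fun q : ℝ × ℝ =>
        g (Function.update (Function.update x i q.1) (Fin.last n) q.2))
        (fac s i ×ˢ Set.Icc 0 (2 * Real.pi)) := by
      refine hg.comp (Continuous.continuousOn ?_) (fun q hq => hm _ hq.1 _)
      exact ((continuous_const (y := x)).update i continuous_fst).update _ continuous_snd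
    refine (Complex.continuous_ofReal.comp_continuousOn this).mul (Continuous.continuousOn ?_)
    fun_prop

/-- Fourier inversion at a point of the domain. -/
lemma hasSum_mode (hs : GoodBox s) (hθ : s (Fin.last n) = none) {f : (Fin (n + 1) → ℝ) → ℝ}
    (hf : IsSmoothPer s f) {x : Fin (n + 1) → ℝ} (hx : x ∈ dom s) :
    HasSum (fun k : ℤ => mode f k x * Complex.exp (Complex.I * k * x (Fin.last n)))
      (f x : ℂ) := by
  have : Fact (0 < 2 * Real.pi) := ⟨by positivity⟩
  have hp : Function.Periodic (fun θ => (f (Function.update x (Fin.last n) θ) : ℂ))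
      (2 * Real.pi) := fun θ => by
    simpa using congrArg (fun r : ℝ => (r : ℂ)) (hf.periodic_last hθ hx θ)
  have hcont : Continuous fun θ => (f (Function.update x (Fin.last n) θ) : ℂ) :=
    Complex.continuous_ofReal.comp (continuous_line hθ hf.smooth.continuousOn hx)
  let G : C(AddCircle (2 * Real.pi), ℂ) := ⟨hp.lift, continuous_coinduced_dom.2 hcont⟩
  have hG : ∀ θ : ℝ, G θ = (f (Function.update x (Fin.last n) θ) : ℂ) := fun θ => hp.lift_coe θ
  have hcoef : ∀ k : ℤ, fourierCoeff G k = mode f k x := by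
    intro k
    rw [fourierCoeff_eq_intervalIntegral G k 0]
    unfold mode
    simp only [hG, zero_add, one_div, smul_eq_mul, Complex.real_smul]
    congr 1
    refine intervalIntegral.integral_congr fun θ _ => ?_
    simp only [fourier_coe_apply]
    rw [mul_comm]
    congr 2
    have : (Real.pi : ℂ) ≠ 0 := by exact_mod_cast Real.pi_ne_zero
    push_cast
    field_simp
  have hsum : Summable (fourierCoeff G) := by
    set g := pd s (Fin.last n) (pd s (Fin.last n) f)
    have hg : IsSmoothPer s g := (hf.pd hs _).pd hs _
    have hgc : Continuous fun θ => g (Function.update x (Fin.last n) θ) :=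
      continuous_line hθ hg.smooth.continuousOn hx
    obtain ⟨C, hC⟩ : ∃ C, ∀ θ, |g (Function.update x (Fin.last n) θ)| ≤ C := by
      exact (hg.periodic_last hθ hx).exists_abs_le hgc
    have hb : ∀ k : ℤ, ‖fourierCoeff G k‖ ≤ (if k = 0 then ‖fourierCoeff G 0‖ else 0)
        + C * (1 / (k : ℝ) ^ 2) := by
      intro k
      by_cases hk : k = 0
      · subst hk; simp
      have hk' : (0 : ℝ) < (k : ℝ) ^ 2 := by positivity
      rw [if_neg hk, zero_add, hcoef, mul_one_div, le_div_iff₀ hk']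
      have e : mode g k x = (Complex.I * k) * ((Complex.I * k) * mode f k x) := by
        rw [mode_pd_last hs hθ (hf.pd hs _) k hx, mode_pd_last hs hθ hf k hx]
      have := norm_mode_le hC k
      rw [e] at this
      simp only [norm_mul, Complex.norm_I, one_mul,
        Complex.norm_intCast] at this
      calc ‖mode f k x‖ * (k : ℝ) ^ 2 = |(k : ℝ)| * (|(k : ℝ)| * ‖mode f k x‖) := by
            rw [← sq_abs]; ring
        _ ≤ C := this
    refine Summable.of_norm_bounded (Summable.add ?_ (Summable.mul_left C ?_)) hb
    · exact summable_of_ne_finset_zero (s := {0}) (fun k hk => by simp at hk; simp [hk])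
    · exact Real.summable_one_div_int_pow.2 (by norm_num)
  have h := has_pointwise_sum_fourier_series_of_summable hsum (x (Fin.last n) : AddCircle _)
  rw [hG, Function.update_eq_self] at h
  convert h using 2 with k
  rw [hcoef, fourier_coe_apply, smul_eq_mul]
  congr 2
  have : (Real.pi : ℂ) ≠ 0 := by exact_mod_cast Real.pi_ne_zero
  push_cast
  field_simp

end

/-! ### Square integrals over period cells -/

section
variable {α : Type*} [MeasurableSpace α] {μ : Measure α}

lemma eLpNorm_two_sq (f : α → ℝ) :
    eLpNorm f 2 μ ^ 2 = ∫⁻ x, ENNReal.ofReal (f x ^ 2) ∂μ := by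
  have h := eLpNorm_nnreal_pow_eq_lintegral (f := f) (p := 2) (μ := μ) (by norm_num)
  simp only [NNReal.coe_ofNat, ENNReal.rpow_ofNat, ENNReal.coe_ofNat] at h
  rw [h]
  refine lintegral_congr fun x => ?_
  rw [← ofReal_norm, ← ENNReal.ofReal_pow (norm_nonneg _), Real.norm_eq_abs, sq_abs]

lemma eLpNorm_two_lt_top_iff (f : α → ℝ) :
    eLpNorm f 2 μ < ⊤ ↔ ∫⁻ x, ENNReal.ofReal (f x ^ 2) ∂μ < ⊤ := by
  rw [← eLpNorm_two_sq]; simp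

lemma eLpNorm_two_le_iff (f : α → ℝ) {c : ℝ} (hc : 0 ≤ c) :
    eLpNorm f 2 μ ≤ ENNReal.ofReal c ↔
      ∫⁻ x, ENNReal.ofReal (f x ^ 2) ∂μ ≤ ENNReal.ofReal (c ^ 2) := by
  rw [← eLpNorm_two_sq, ENNReal.ofReal_pow hc]
  exact (ENNReal.pow_right_strictMono two_ne_zero).le_iff_le.symm

end

section
variable {n : ℕ} {s : Fin n → Option (Set ℝ)}

/-- One period of the `i`-th coordinate. -/
def per (s : Fin n → Option (Set ℝ)) (i : Fin n) : Set ℝ :=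
  (s i).getD (Set.Ico 0 (2 * Real.pi))

lemma cell_eq_pi : cell s = Set.univ.pi (per s) := by
  ext x; simp [cell, per]

lemma cell_subset_dom : cell s ⊆ dom s := by
  intro x hx i
  have := hx i
  cases h : s i <;> simp_all

lemma GoodBox.measurableSet_per (hs : GoodBox s) (i : Fin n) : MeasurableSet (per s i) := by
  have := (hs.closed i).measurableSet
  unfold per fac at *
  cases h : s i <;> simp_all

lemma GoodBox.measurableSet_cell (hs : GoodBox s) : MeasurableSet (cell s) := by
  rw [cell_eq_pi]; exact MeasurableSet.univ_pi hs.measurableSet_per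

lemma restrict_cell : (volume : Measure (Fin n → ℝ)).restrict (cell s)
    = Measure.pi fun i => volume.restrict (per s i) := by
  rw [cell_eq_pi, volume_pi, Measure.restrict_pi_pi]

lemma lintegral_cell_cons {J : Set ℝ} {F : (Fin (n + 1) → ℝ) → ENNReal} (hF : Measurable F) :
    ∫⁻ x in cell (Matrix.vecCons (some J) s), F x
      = ∫⁻ r in J, ∫⁻ z in cell s, F (Matrix.vecCons r z) := by
  rw [restrict_cell, restrict_cell]
  have mp := measurePreserving_piFinSuccAbove
    (fun i => volume.restrict (per (Matrix.vecCons (some J) s) i)) 0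
  rw [← mp.symm.lintegral_comp_emb (MeasurableEquiv.measurableEmbedding _), lintegral_prod]
  · have e : ∀ (r : ℝ) (z : Fin n → ℝ), (MeasurableEquiv.piFinSuccAbove (fun _ => ℝ) 0).symm (r, z)
        = Matrix.vecCons r z := fun r z => by
      change Fin.insertNth (α := fun _ => ℝ) 0 r z = _
      rw [Fin.insertNth_zero']; rfl
    have e1 : ∀ j : Fin n, per (Matrix.vecCons (some J) s) (Fin.succAbove 0 j) = per s j := fun j => rfl
    have e2 : per (Matrix.vecCons (some J) s) 0 = J := rfl
    simp only [e, e1, e2]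
  · exact (hF.comp (MeasurableEquiv.measurable _)).aemeasurable

lemma lintegral_cell_update {s : Fin (n + 1) → Option (Set ℝ)} (hθ : s (Fin.last n) = none)
    {W : (Fin (n + 1) → ℝ) → ENNReal} (hW : Measurable W) :
    ∫⁻ x in cell s, ∫⁻ θ in Set.Ico 0 (2 * Real.pi), W (Function.update x (Fin.last n) θ)
      = ENNReal.ofReal (2 * Real.pi) * ∫⁻ x in cell s, W x := by
  have hper : per s (Fin.last n) = Set.Ico 0 (2 * Real.pi) := by simp [per, hθ]
  set μ : Fin (n + 1) → Measure ℝ := fun i => volume.restrict (per s i) with hμ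
  set V : (Fin (n + 1) → ℝ) → ENNReal := lmarginal μ {Fin.last n} W with hV
  have hV' : ∀ x, V x = ∫⁻ θ in Set.Ico 0 (2 * Real.pi), W (Function.update x (Fin.last n) θ) := by
    intro x; simp only [hV, lmarginal_singleton, hμ, hper]
  have hVm : Measurable V := hW.lmarginal μ
  simp only [← hV']
  rw [restrict_cell, lintegral_eq_lmarginal_univ 0, lintegral_eq_lmarginal_univ 0,
    ← Finset.insert_erase (Finset.mem_univ (Fin.last n)),
    lmarginal_insert' _ hVm (Finset.notMem_erase _ _),
    lmarginal_insert' _ hW (Finset.notMem_erase _ _)]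
  have h1 : (fun x => ∫⁻ t, V (Function.update x (Fin.last n) t) ∂μ (Fin.last n))
      = fun x => ENNReal.ofReal (2 * Real.pi) * V x := by
    ext x
    have : ∀ t, V (Function.update x (Fin.last n) t) = V x := fun t => by
      simp [hV', Function.update_idem]
    simp only [this, lintegral_const]
    simp [hμ, hper, mul_comm]
  have h2 : (fun x => ∫⁻ t, W (Function.update x (Fin.last n) t) ∂μ (Fin.last n)) = V := by
    ext x; rw [hV']; simp only [hμ, hper]
  rw [h1, h2]
  simp only [lmarginal]
  rw [lintegral_const_mul' _ _ ENNReal.ofReal_ne_top]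

end

/-! ### One-dimensional Sobolev inequalities -/

/-- Sobolev inequality for periodic functions. The two sides are compared in `[0, ∞]`, so that the
right side can be integrated in further variables without integrability side conditions. -/
lemma ofReal_sq_le_lintegral_period {h h' : ℝ → ℝ} (hd : ∀ θ, HasDerivAt h (h' θ) θ)
    (hc : Continuous h') (hp : Function.Periodic h (2 * Real.pi)) (θ : ℝ) :
    ENNReal.ofReal (h θ ^ 2)
      ≤ 2 * ∫⁻ t in Set.Ico 0 (2 * Real.pi), ENNReal.ofReal (h t ^ 2 + h' t ^ 2) := by
  obtain ⟨y, hy, e⟩ := hp.exists_mem_Ico₀ (by positivity) θ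
  rw [e]
  have hh : Continuous h := continuous_iff_continuousAt.2 fun t => (hd t).continuousAt
  have hpi : 0 < 2 * Real.pi := by positivity
  set A := ∫ t in (0 : ℝ)..(2 * Real.pi), (h t ^ 2 + h' t ^ 2) with hA
  have hA0 : 0 ≤ A := intervalIntegral.integral_nonneg hpi.le fun t _ => by positivity
  have step : ∀ t ∈ Set.Icc 0 (2 * Real.pi), h y ^ 2 ≤ h t ^ 2 + A := by
    intro t ht
    -- The oscillation of `h²` is the integral of `2 h h'`, which is at most `h² + h'²`.
    have h1 : ∫ r in t..y, 2 * h r * h' r = h y ^ 2 - h t ^ 2 := by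
      refine intervalIntegral.integral_eq_sub_of_hasDerivAt (f := fun r => h r ^ 2)
        (fun r _ => ?_) (Continuous.intervalIntegrable (by fun_prop) _ _)
      have := (hd r).pow 2
      simp only [Nat.cast_ofNat, Nat.add_one_sub_one, pow_one] at this
      exact this
    have h2 : ‖∫ r in t..y, 2 * h r * h' r‖ ≤ A := by
      refine (intervalIntegral.norm_integral_le_integral_norm_uIoc).trans ?_
      rw [hA, intervalIntegral.integral_of_le hpi.le]
      have hsub : Set.uIoc t y ⊆ Set.Ioc 0 (2 * Real.pi) := by
        rw [Set.uIoc]; exact Set.Ioc_subset_Ioc (le_min ht.1 hy.1) (max_le ht.2 hy.2.le)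
      refine (setIntegral_mono_set ?_ ?_ hsub.eventuallyLE).trans ?_
      · exact (Continuous.integrableOn_Icc (by fun_prop)).mono_set Set.Ioc_subset_Icc_self
      · exact Filter.Eventually.of_forall fun r => norm_nonneg _
      · refine setIntegral_mono_on
          ((Continuous.integrableOn_Icc (by fun_prop)).mono_set Set.Ioc_subset_Icc_self)
          ((Continuous.integrableOn_Icc (by fun_prop)).mono_set Set.Ioc_subset_Icc_self)
          measurableSet_Ioc fun r _ => ?_
        rw [Real.norm_eq_abs, abs_le]
        constructor <;> nlinarith [sq_nonneg (h r + h' r), sq_nonneg (h r - h' r)]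
    rw [h1] at h2
    linarith [(abs_le.1 h2).2]
  have hint : h y ^ 2 * (2 * Real.pi) ≤ A + A * (2 * Real.pi) := by
    have e1 : ∫ _t in (0 : ℝ)..(2 * Real.pi), h y ^ 2 = h y ^ 2 * (2 * Real.pi) := by
      simp [mul_comm]
    have e2 : ∫ t in (0 : ℝ)..(2 * Real.pi), (h t ^ 2 + A)
        = (∫ t in (0 : ℝ)..(2 * Real.pi), h t ^ 2) + A * (2 * Real.pi) := by
      rw [intervalIntegral.integral_add (Continuous.intervalIntegrable (by fun_prop) _ _)
        intervalIntegrable_const]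
      simp [mul_comm]
    have e3 : ∫ t in (0 : ℝ)..(2 * Real.pi), h t ^ 2 ≤ A :=
      intervalIntegral.integral_mono_on hpi.le (Continuous.intervalIntegrable (by fun_prop) _ _)
        (Continuous.intervalIntegrable (by fun_prop) _ _) fun t _ => by
          nlinarith [sq_nonneg (h' t)]
    have := intervalIntegral.integral_mono_on hpi.le
      (μ := volume) (f := fun _ => h y ^ 2) (g := fun t => h t ^ 2 + A) intervalIntegrable_const
      (Continuous.intervalIntegrable (by fun_prop) _ _) step
    linarith
  -- Average over `t`; the constant `2` is generous because `1 / (2π) ≤ 1`.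
  have hfin : h y ^ 2 ≤ 2 * A := by
    have h3 := Real.pi_gt_three
    by_contra hcon
    push Not at hcon
    nlinarith
  have hAl : ENNReal.ofReal A
      = ∫⁻ t in Set.Ico 0 (2 * Real.pi), ENNReal.ofReal (h t ^ 2 + h' t ^ 2) := by
    rw [hA, intervalIntegral.integral_of_le hpi.le, ← integral_Ico_eq_integral_Ioc,
      ofReal_integral_eq_lintegral_ofReal]
    · exact (Continuous.integrableOn_Icc (by fun_prop)).mono_set Set.Ico_subset_Icc_self
    · exact Filter.Eventually.of_forall fun t => by positivity
  rw [← hAl, show (2 : ENNReal) = ENNReal.ofReal 2 by simp, ← ENNReal.ofReal_mul (by norm_num)]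
  exact ENNReal.ofReal_le_ofReal hfin

/-- Sobolev inequality with exponential weight on the half line: `e^{δY} h(Y)²` is minus the
integral of the derivative of `e^{δr} h(r)²` over `(Y, ∞)`. The a priori decay of `h` removes the
boundary term at infinity; its rate is such that `e^{δr} h(r)²` still tends to zero. -/
lemma ofReal_sq_le_lintegral_Ici {h h' : ℝ → ℝ} {δ C : ℝ} (hδ : 0 < δ)
    (hd : ∀ r ∈ Set.Ici (0 : ℝ), HasDerivWithinAt h (h' r) (Set.Ici 0) r)
    (hc : ContinuousOn h' (Set.Ici 0)) (hb : ∀ r ∈ Set.Ici (0 : ℝ), |h r| ≤ C * Real.exp (-δ * r))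
    {Y : ℝ} (hY : 0 ≤ Y) :
    ENNReal.ofReal (Real.exp (δ * Y) * h Y ^ 2)
      ≤ ∫⁻ r in Set.Ici (0 : ℝ), ENNReal.ofReal (Real.exp (δ * r) * (h r ^ 2 + h' r ^ 2)) := by
  have hh : ContinuousOn h (Set.Ici 0) := fun r hr => (hd r hr).continuousWithinAt
  have step : ∀ R, Y ≤ R → ENNReal.ofReal (Real.exp (δ * Y) * h Y ^ 2)
      ≤ ENNReal.ofReal (C ^ 2 * Real.exp (-δ * R)) +
        ∫⁻ r in Set.Ici (0 : ℝ), ENNReal.ofReal (Real.exp (δ * r) * (h r ^ 2 + h' r ^ 2)) := by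
    intro R hR
    have hsub : Set.Icc Y R ⊆ Set.Ici 0 := fun r hr => hY.trans hr.1
    have c1 : ContinuousOn (fun r => Real.exp (δ * r) * (2 * h r * h' r + δ * h r ^ 2))
        (Set.Icc Y R) := by
      have := hh.mono hsub; have := hc.mono hsub; fun_prop
    have c2 : ContinuousOn (fun r => Real.exp (δ * r) * (h r ^ 2 + h' r ^ 2)) (Set.Icc Y R) := by
      have := hh.mono hsub; have := hc.mono hsub; fun_prop
    have h1 : ∫ r in Y..R, Real.exp (δ * r) * (2 * h r * h' r + δ * h r ^ 2)
        = Real.exp (δ * R) * h R ^ 2 - Real.exp (δ * Y) * h Y ^ 2 := by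
      refine intervalIntegral.integral_eq_sub_of_hasDeriv_right_of_le hR
        (f := fun r => Real.exp (δ * r) * h r ^ 2) ?_ ?_ ?_
      · have := hh.mono hsub; fun_prop
      · intro r hr
        have hr0 : 0 ≤ r := hY.trans hr.1.le
        have d1 := (hd r hr0).mono (Set.Ioi_subset_Ici hr0)
        have d2 : HasDerivWithinAt (fun r => Real.exp (δ * r)) (Real.exp (δ * r) * (δ * 1))
            (Set.Ioi r) r := ((hasDerivAt_id r).const_mul δ).exp.hasDerivWithinAt
        refine (d2.mul (d1.pow 2)).congr_deriv ?_
        simp only [Pi.pow_apply, Nat.cast_ofNat, Nat.add_one_sub_one, pow_one]; ring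
      · exact (c1.intervalIntegrable_of_Icc hR)
    have h2 : -∫ r in Y..R, Real.exp (δ * r) * (2 * h r * h' r + δ * h r ^ 2)
        ≤ ∫ r in Y..R, Real.exp (δ * r) * (h r ^ 2 + h' r ^ 2) := by
      rw [← intervalIntegral.integral_neg]
      refine intervalIntegral.integral_mono_on hR (c1.neg.intervalIntegrable_of_Icc hR)
        (c2.intervalIntegrable_of_Icc hR) fun r _ => ?_
      have := Real.exp_pos (δ * r)
      rw [← mul_neg]
      refine mul_le_mul_of_nonneg_left ?_ this.le
      nlinarith [sq_nonneg (h r + h' r), mul_nonneg hδ.le (sq_nonneg (h r))]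
    have h3 : ENNReal.ofReal (∫ r in Y..R, Real.exp (δ * r) * (h r ^ 2 + h' r ^ 2))
        ≤ ∫⁻ r in Set.Ici (0 : ℝ), ENNReal.ofReal (Real.exp (δ * r) * (h r ^ 2 + h' r ^ 2)) := by
      rw [intervalIntegral.integral_of_le hR, ofReal_integral_eq_lintegral_ofReal]
      · exact lintegral_mono_set (Set.Ioc_subset_Icc_self.trans hsub)
      · exact c2.integrableOn_Icc.mono_set Set.Ioc_subset_Icc_self
      · exact Filter.Eventually.of_forall fun r => by positivity
    have h4 : Real.exp (δ * R) * h R ^ 2 ≤ C ^ 2 * Real.exp (-δ * R) := by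
      have := hb R (hY.trans hR)
      have h5 : h R ^ 2 ≤ (C * Real.exp (-δ * R)) ^ 2 := by
        rw [← sq_abs]; exact pow_le_pow_left₀ (abs_nonneg _) this 2
      calc Real.exp (δ * R) * h R ^ 2 ≤ Real.exp (δ * R) * (C * Real.exp (-δ * R)) ^ 2 :=
            mul_le_mul_of_nonneg_left h5 (Real.exp_pos _).le
        _ = C ^ 2 * (Real.exp (δ * R) * Real.exp (-δ * R)) * Real.exp (-δ * R) := by ring
        _ = _ := by rw [← Real.exp_add]; simp
    have h6 : Real.exp (δ * Y) * h Y ^ 2 ≤ C ^ 2 * Real.exp (-δ * R)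
        + ∫ r in Y..R, Real.exp (δ * r) * (h r ^ 2 + h' r ^ 2) := by linarith
    refine (ENNReal.ofReal_le_ofReal h6).trans (ENNReal.ofReal_add_le.trans ?_)
    gcongr
  have lim : Filter.Tendsto (fun R : ℝ => ENNReal.ofReal (C ^ 2 * Real.exp (-δ * R)) +
        ∫⁻ r in Set.Ici (0 : ℝ), ENNReal.ofReal (Real.exp (δ * r) * (h r ^ 2 + h' r ^ 2)))
      Filter.atTop (nhds (ENNReal.ofReal (C ^ 2 * 0) +
        ∫⁻ r in Set.Ici (0 : ℝ), ENNReal.ofReal (Real.exp (δ * r) * (h r ^ 2 + h' r ^ 2)))) := by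
    refine (ENNReal.tendsto_ofReal (Filter.Tendsto.const_mul _ ?_)).add tendsto_const_nhds
    refine Real.tendsto_exp_atBot.comp ?_
    exact Filter.tendsto_id.const_mul_atTop_of_neg (by linarith)
  have := ge_of_tendsto lim ((Filter.eventually_ge_atTop Y).mono step)
  simpa using this

lemma abs_eq_mul_of_mem_Jh {ε : ℝ} (hε : IsSide ε) {Y : ℝ} (hY : Y ∈ Jh ε) : |Y| = ε * Y := by
  have hY : 0 ≤ ε * Y := hY
  rcases hε with rfl | rfl
  · rw [one_mul] at *; exact abs_of_nonneg hY
  · rw [abs_of_nonpos (by linarith)]; ring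

lemma ofReal_sq_le_lintegral_Jh {ε : ℝ} (hε : IsSide ε) {h h' : ℝ → ℝ} {δ C : ℝ} (hδ : 0 < δ)
    (hd : ∀ r ∈ Jh ε, HasDerivWithinAt h (h' r) (Jh ε) r)
    (hc : ContinuousOn h' (Jh ε)) (hb : ∀ r ∈ Jh ε, |h r| ≤ C * Real.exp (-δ * |r|))
    {Y : ℝ} (hY : Y ∈ Jh ε) :
    ENNReal.ofReal (Real.exp (δ * |Y|) * h Y ^ 2)
      ≤ ∫⁻ r in Jh ε, ENNReal.ofReal (Real.exp (δ * |r|) * (h r ^ 2 + h' r ^ 2)) := by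
  rcases hε with rfl | rfl
  · have e : Jh 1 = Set.Ici 0 := by ext; simp [Jh]
    rw [e] at hd hc hb hY ⊢
    have e1 : ∀ r ∈ Set.Ici (0 : ℝ), |r| = r := fun r hr => abs_of_nonneg hr
    rw [e1 Y hY, setLIntegral_congr_fun measurableSet_Ici (fun r hr => by rw [e1 r hr])]
    exact ofReal_sq_le_lintegral_Ici hδ hd hc (fun r hr => by
      have := hb r hr; rwa [e1 r hr] at this) hY
  · have e : Jh (-1) = Set.Iic 0 := by ext; simp [Jh]
    rw [e] at hd hc hb hY ⊢
    have mp := (Measure.measurePreserving_neg (volume : Measure ℝ)).setLIntegral_comp_preimage_emb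
      (MeasurableEquiv.neg ℝ).measurableEmbedding
      (fun r => ENNReal.ofReal (Real.exp (δ * |r|) * (h r ^ 2 + h' r ^ 2))) (Set.Iic 0)
    have e2 : Neg.neg ⁻¹' Set.Iic (0 : ℝ) = Set.Ici 0 := by ext; simp
    have e1 : ∀ r ∈ Set.Ici (0 : ℝ), |-r| = r := fun r hr => by rw [abs_neg, abs_of_nonneg hr]
    rw [e2] at mp
    rw [← mp, setLIntegral_congr_fun measurableSet_Ici (fun r hr => by rw [e1 r hr])]
    have hY' : 0 ≤ -Y := by simpa using hY
    have := ofReal_sq_le_lintegral_Ici (h := fun r => h (-r)) (h' := fun r => -h' (-r)) (C := C)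
      hδ ?_ ?_ ?_ hY'
    · rw [show |Y| = -Y from abs_of_nonpos hY]
      simpa using this
    · intro r hr
      have hr' : -r ∈ Set.Iic (0 : ℝ) := by simpa using hr
      have := HasDerivWithinAt.scomp r (t' := Set.Iic 0) (hd (-r) hr')
        ((hasDerivWithinAt_id r (Set.Ici 0)).neg) (fun t ht => by simpa using ht)
      simpa [Function.comp_def] using this
    · exact (hc.comp continuous_neg.continuousOn (fun t ht => by simpa using ht)).neg
    · intro r hr
      have := hb (-r) (by simpa using hr)
      rwa [e1 r hr] at this

/-! ### Pointwise majorants of `H^∞` functions -/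

/-- A square integrable majorant on a period cell that does not depend on the last variable. -/
structure L2Maj {n : ℕ} (s : Fin (n + 1) → Option (Set ℝ)) (m : (Fin (n + 1) → ℝ) → ℝ) : Prop where
  nonneg : ∀ x, 0 ≤ m x
  indep : ∀ x θ, m (Function.update x (Fin.last n) θ) = m x
  memLp : MemLp m 2 (volume.restrict (cell s))

/-- A bounded square integrable majorant on the slow domain. -/
structure StarMaj (T ε : ℝ) (m : (Fin 5 → ℝ) → ℝ) : Prop extends
    L2Maj (slowBox T (Jh ε)) m where
  bdd : ∃ C, ∀ z, m z ≤ C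

section
variable {n : ℕ} {s : Fin (n + 1) → Option (Set ℝ)}

lemma L2Maj.of_lintegral {M : (Fin (n + 1) → ℝ) → ENNReal} (hm : Measurable M)
    (hfin : ∀ x, M x ≠ ⊤) (hi : ∀ x θ, M (Function.update x (Fin.last n) θ) = M x)
    (hM : ∫⁻ x in cell s, M x < ⊤) : L2Maj s fun x => Real.sqrt (M x).toReal := by
  refine ⟨fun x => Real.sqrt_nonneg _, fun x θ => by simp only [hi],
    hm.ennreal_toReal.sqrt.aestronglyMeasurable, ?_⟩
  rw [eLpNorm_two_lt_top_iff]
  refine lt_of_le_of_lt (lintegral_mono fun x => ?_) hM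
  rw [Real.sq_sqrt ENNReal.toReal_nonneg, ENNReal.ofReal_toReal (hfin x)]

lemma abs_le_sqrt_toReal {M : ENNReal} (hfin : M ≠ ⊤) {a : ℝ} (h : ENNReal.ofReal (a ^ 2) ≤ M) :
    |a| ≤ Real.sqrt M.toReal := by
  rw [← Real.sqrt_sq_eq_abs]
  exact Real.sqrt_le_sqrt ((ENNReal.ofReal_le_iff_le_toReal hfin).1 h)

lemma L2Maj.add {m m' : (Fin (n + 1) → ℝ) → ℝ} (hm : L2Maj s m) (hm' : L2Maj s m') :
    L2Maj s (m + m') :=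
  ⟨fun x => add_nonneg (hm.nonneg x) (hm'.nonneg x),
    fun x θ => by simp [hm.indep, hm'.indep], hm.memLp.add hm'.memLp⟩

lemma L2Maj.smul {m : (Fin (n + 1) → ℝ) → ℝ} (hm : L2Maj s m) {c : ℝ} (hc : 0 ≤ c) :
    L2Maj s (c • m) :=
  ⟨fun x => mul_nonneg hc (hm.nonneg x), fun x θ => by simp [hm.indep], hm.memLp.const_smul c⟩

lemma StarMaj.add {T ε : ℝ} {m m' : (Fin 5 → ℝ) → ℝ} (hm : StarMaj T ε m) (hm' : StarMaj T ε m') :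
    StarMaj T ε (m + m') := by
  obtain ⟨C, hC⟩ := hm.bdd
  obtain ⟨C', hC'⟩ := hm'.bdd
  exact ⟨hm.toL2Maj.add hm'.toL2Maj, C + C', fun z => add_le_add (hC z) (hC' z)⟩

lemma StarMaj.smul {T ε : ℝ} {m : (Fin 5 → ℝ) → ℝ} (hm : StarMaj T ε m) {c : ℝ} (hc : 0 ≤ c) :
    StarMaj T ε (c • m) := by
  obtain ⟨C, hC⟩ := hm.bdd
  exact ⟨hm.toL2Maj.smul hc, c * C, fun z => mul_le_mul_of_nonneg_left (hC z) hc⟩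

lemma measurable_lintegral_update {W : (Fin (n + 1) → ℝ) → ENNReal} (hW : Measurable W)
    (A : Set ℝ) :
    Measurable fun x => ∫⁻ θ in A, W (Function.update x (Fin.last n) θ) := by
  have : Measurable fun q : (Fin (n + 1) → ℝ) × ℝ => W (Function.update q.1 (Fin.last n) q.2) :=
    hW.comp (Continuous.measurable (continuous_fst.update _ continuous_snd))
  exact this.lintegral_prod_right'

/-- The square of `g`, with weight `w`, extended by zero outside the domain. -/
def sqInd {n : ℕ} (s : Fin n → Option (Set ℝ)) (w g : (Fin n → ℝ) → ℝ) (x : Fin n → ℝ) : ENNReal :=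
  (dom s).indicator (fun x => ENNReal.ofReal (w x * g x ^ 2)) x

lemma measurable_sqInd {n : ℕ} {s : Fin n → Option (Set ℝ)} (hs : GoodBox s)
    {w g : (Fin n → ℝ) → ℝ} (hw : Continuous w)
    (hg : ContinuousOn g (dom s)) : Measurable (sqInd s w g) := by
  have hm := hs.isClosed_dom.measurableSet
  have h1 : Measurable ((dom s).indicator g) := by
    classical
    have : (dom s).indicator g = (dom s).piecewise g 0 := (Set.piecewise_eq_indicator).symm
    rw [this]
    exact hg.measurable_piecewise continuousOn_const hm
  have h2 : sqInd s w g = (dom s).indicator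
      (fun x => ENNReal.ofReal (w x * (dom s).indicator g x ^ 2)) := by
    ext x
    by_cases hx : x ∈ dom s <;> simp [sqInd, hx]
  rw [h2]
  exact ((hw.measurable.mul (h1.pow_const 2)).ennreal_ofReal).indicator hm

/-- `H^∞` functions are bounded by a square integrable function of the variables other than
`θ`. -/
lemma IsHInf.exists_maj (hs : GoodBox s) (hθ : s (Fin.last n) = none) {f : (Fin (n + 1) → ℝ) → ℝ}
    (hf : IsHInf s f) (l : List (Fin (n + 1))) :
    ∃ m, L2Maj s m ∧ ∀ x ∈ dom s, |iterPd s l f x| ≤ m x := by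
  set g := iterPd s l f with hg
  have hgs : IsSmoothPer s g := hf.smoothPer.iterPd hs l
  set g' := pd s (Fin.last n) g with hg'
  have hgs' : IsSmoothPer s g' := hgs.pd hs _
  have hgm : MemLp g 2 (volume.restrict (cell s)) := hf.memLp l
  have hgm' : MemLp g' 2 (volume.restrict (cell s)) := hf.memLp (Fin.last n :: l)
  have hWg := measurable_sqInd hs (w := fun _ => 1) continuous_const hgs.smooth.continuousOn
  have hWg' := measurable_sqInd hs (w := fun _ => 1) continuous_const hgs'.smooth.continuousOn
  set W := fun x => sqInd s (fun _ => 1) g x + sqInd s (fun _ => 1) g' x with hW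
  have hWm : Measurable W := hWg.add hWg'
  -- `M` is the right side of the Sobolev inequality in `θ`, with values in `[0, ∞]`.
  set M := fun x => 2 * ∫⁻ θ in Set.Ico 0 (2 * Real.pi), W (Function.update x (Fin.last n) θ)
    with hM
  have hle : ∀ x ∈ dom s, ENNReal.ofReal (g x ^ 2) ≤ M x := by
    intro x hx
    have := ofReal_sq_le_lintegral_period (h := fun θ => g (Function.update x (Fin.last n) θ))
      (fun θ => (hasPd_pd hgs.smooth _).hasDerivAt_line hθ hx θ)
      (continuous_line hθ hgs'.smooth.continuousOn hx) (hgs.periodic_last hθ hx) (x (Fin.last n))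
    simp only [Function.update_eq_self] at this
    refine this.trans (le_of_eq ?_)
    simp only [hM]
    congr 1
    refine lintegral_congr fun θ => ?_
    have hd := update_last_mem hθ hx θ
    simp only [hW, sqInd, Set.indicator_of_mem hd, one_mul]
    exact ENNReal.ofReal_add (sq_nonneg _) (sq_nonneg _)
  have hfin : ∀ x, M x ≠ ⊤ := by
    intro x
    refine (ENNReal.mul_lt_top (by norm_num) ?_).ne
    by_cases hx : x ∈ dom s
    · obtain ⟨C, hC⟩ := (hgs.periodic_last hθ hx).exists_abs_le
        (continuous_line hθ hgs.smooth.continuousOn hx)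
      obtain ⟨C', hC'⟩ := (hgs'.periodic_last hθ hx).exists_abs_le
        (continuous_line hθ hgs'.smooth.continuousOn hx)
      have hb : ∀ θ, W (Function.update x (Fin.last n) θ)
          ≤ ENNReal.ofReal (C ^ 2) + ENNReal.ofReal (C' ^ 2) := by
        intro θ
        have hd := update_last_mem hθ hx θ
        simp only [hW, sqInd, Set.indicator_of_mem hd, one_mul]
        refine add_le_add (ENNReal.ofReal_le_ofReal ?_) (ENNReal.ofReal_le_ofReal ?_)
        · exact sq_le_sq.2 ((hC θ).trans (le_abs_self _))
        · exact sq_le_sq.2 ((hC' θ).trans (le_abs_self _))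
      refine (lintegral_mono fun θ => hb θ).trans_lt ?_
      rw [lintegral_const]
      refine ENNReal.mul_lt_top (by simp) ?_
      rw [Measure.restrict_apply_univ, Real.volume_Ico]
      exact ENNReal.ofReal_lt_top
    · have : ∀ θ, W (Function.update x (Fin.last n) θ) = 0 := by
        intro θ
        have hd : Function.update x (Fin.last n) θ ∉ dom s := fun h => hx <| by
          have := update_last_mem hθ h (x (Fin.last n))
          simpa using this
        simp [hW, sqInd, hd]
      simp [this]
  have hint : ∫⁻ x in cell s, M x < ⊤ := by
    simp only [hM]
    rw [lintegral_const_mul' _ _ (by norm_num), lintegral_cell_update hθ hWm]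
    refine ENNReal.mul_lt_top (by norm_num) (ENNReal.mul_lt_top ENNReal.ofReal_lt_top ?_)
    simp only [hW]
    rw [lintegral_add_left hWg]
    have key : ∀ g, MemLp g 2 (volume.restrict (cell s)) →
        ∫⁻ x in cell s, sqInd s (fun _ => 1) g x < ⊤ := by
      intro g hg
      refine lt_of_le_of_lt (lintegral_mono fun x => ?_) ((eLpNorm_two_lt_top_iff _).1 hg.2)
      refine (Set.indicator_le_self _ _ x).trans (by simp)
    exact ENNReal.add_lt_top.2 ⟨key g hgm, key g' hgm'⟩
  refine ⟨_, L2Maj.of_lintegral ((measurable_lintegral_update hWm _).const_mul 2) hfin ?_ hint,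
    fun x hx => abs_le_sqrt_toReal (hfin x) (hle x hx)⟩
  intro x θ
  simp only [Function.update_idem]

lemma memLp_of_maj (hs : GoodBox s) {f m : (Fin (n + 1) → ℝ) → ℝ} (hf : ContinuousOn f (dom s))
    (hm : L2Maj s m) (h : ∀ x ∈ dom s, |f x| ≤ m x) : MemLp f 2 (volume.restrict (cell s)) := by
  refine MemLp.of_le hm.memLp ?_ ?_
  · exact (hf.aestronglyMeasurable hs.isClosed_dom.measurableSet).mono_measure
      (Measure.restrict_mono cell_subset_dom le_rfl)
  · refine (ae_restrict_iff' hs.measurableSet_cell).2 (Filter.Eventually.of_forall fun x hx => ?_)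
    rw [Real.norm_eq_abs, Real.norm_of_nonneg (hm.nonneg x)]
    exact h x (cell_subset_dom hx)

lemma memLp_congr_cell (hs : GoodBox s) {f g : (Fin (n + 1) → ℝ) → ℝ} (h : Set.EqOn f g (dom s))
    (hg : MemLp g 2 (volume.restrict (cell s))) : MemLp f 2 (volume.restrict (cell s)) :=
  hg.ae_eq ((ae_restrict_iff' hs.measurableSet_cell).2
    (Filter.Eventually.of_forall fun _ hx => (h (cell_subset_dom hx)).symm))

lemma IsHInf.congr (hs : GoodBox s) {f g : (Fin (n + 1) → ℝ) → ℝ} (hf : IsHInf s f)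
    (h : Set.EqOn g f (dom s)) : IsHInf s g :=
  ⟨hf.smoothPer.congr h, fun l => memLp_congr_cell hs (iterPd_congr h l) (hf.memLp l)⟩

lemma IsHInf.add (hs : GoodBox s) {f g : (Fin (n + 1) → ℝ) → ℝ} (hf : IsHInf s f)
    (hg : IsHInf s g) : IsHInf s (f + g) :=
  ⟨hf.smoothPer.add hg.smoothPer, fun l => memLp_congr_cell hs
    (iterPd_add hs hf.smoothPer.smooth hg.smoothPer.smooth l) ((hf.memLp l).add (hg.memLp l))⟩

lemma IsHInf.smul (hs : GoodBox s) {f : (Fin (n + 1) → ℝ) → ℝ} (hf : IsHInf s f) (c : ℝ) :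
    IsHInf s (c • f) :=
  ⟨hf.smoothPer.smul c, fun l => memLp_congr_cell hs
    (iterPd_smul hs hf.smoothPer.smooth c l) ((hf.memLp l).const_smul c)⟩

lemma IsHInf.sub (hs : GoodBox s) {f g : (Fin (n + 1) → ℝ) → ℝ} (hf : IsHInf s f)
    (hg : IsHInf s g) : IsHInf s (f - g) := by
  have := hf.add hs (hg.smul hs (-1)); simpa [sub_eq_add_neg] using this

lemma IsHInf.pd (hs : GoodBox s) {f : (Fin (n + 1) → ℝ) → ℝ} (hf : IsHInf s f)
    (i : Fin (n + 1)) : IsHInf s (pd s i f) :=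
  ⟨hf.smoothPer.pd hs i, fun l => by
    have := hf.memLp (l ++ [i]); rwa [iterPd_append] at this⟩

/-- A class of square integrable functions closed under partial derivatives lies in `H^∞`. -/
lemma IsHInf.of_class (hs : GoodBox s) {C : Set ((Fin (n + 1) → ℝ) → ℝ)}
    (hc : ∀ f ∈ C, ContinuousOn f (dom s))
    (hp : ∀ f ∈ C, ∀ i, ∃ g ∈ C, HasPd s i f g)
    (hper : ∀ f ∈ C, ∀ i, s i = none → ∀ x ∈ dom s,
      f (Function.update x i (x i + 2 * Real.pi)) = f x)
    (hm : ∀ f ∈ C, ∃ m, L2Maj s m ∧ ∀ x ∈ dom s, |f x| ≤ m x)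
    {f : (Fin (n + 1) → ℝ) → ℝ} (hf : f ∈ C) : IsHInf s f := by
  refine ⟨⟨contDiffOn_of_class hs hc hp hf, hper f hf⟩, fun l => ?_⟩
  obtain ⟨g, hg, e⟩ := iterPd_mem_class hs hc hp hf l
  obtain ⟨m, hm, h⟩ := hm g hg
  exact memLp_congr_cell hs e (memLp_of_maj hs (hc g hg) hm h)

end

/-! ### Majorants of surface wave functions -/

section
variable {T ε : ℝ}

lemma fastBox_last (J : Set ℝ) : fastBox T J (Fin.last 5) = none := rfl
lemma slowBox_last (J : Set ℝ) : slowBox T J (Fin.last 4) = none := rfl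

lemma mem_dom_fast {J : Set ℝ} {Y : ℝ} {z : Fin 5 → ℝ} :
    Matrix.vecCons Y z ∈ dom (fastBox T J) ↔ Y ∈ J ∧ z ∈ dom (slowBox T J) := mem_dom_cons

lemma lintegral_exp_lt_top (hε : IsSide ε) {δ : ℝ} (hδ : 0 < δ) (C : ℝ) :
    ∫⁻ r in Jh ε, ENNReal.ofReal (C * Real.exp (-δ * |r|)) < ⊤ := by
  have : IntegrableOn (fun r => C * Real.exp (-δ * |r|)) (Jh ε) := by
    refine Integrable.const_mul ?_ C
    rcases hε with rfl | rfl
    · rw [← Jp_eq]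
      have : IntegrableOn (fun r => Real.exp (-δ * r)) (Set.Ici 0) := by
        rw [integrableOn_Ici_iff_integrableOn_Ioi]; exact exp_neg_integrableOn_Ioi 0 hδ
      exact this.congr_fun (fun r hr => by rw [abs_of_nonneg hr]) measurableSet_Ici
    · rw [← Jm_eq]
      have : IntegrableOn (fun r => Real.exp (δ * r)) (Set.Iic 0) := integrableOn_exp_mul_Iic hδ 0
      exact this.congr_fun (fun r hr => by rw [abs_of_nonpos hr]; simp) measurableSet_Iic
  exact this.lintegral_lt_top

lemma measurableSet_Jh (hε : IsSide ε) : MeasurableSet (Jh ε) := (Jh_props hε).1.measurableSet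

lemma continuous_vecCons {n : ℕ} : Continuous fun q : ℝ × (Fin n → ℝ) => Matrix.vecCons q.1 q.2 := by
  refine continuous_pi fun i => ?_
  refine Fin.cases ?_ (fun j => ?_) i
  · exact continuous_fst
  · exact (continuous_apply j).comp continuous_snd

lemma vecCons_update_last {n : ℕ} (Y : ℝ) (z : Fin (n + 1) → ℝ) (θ : ℝ) :
    Matrix.vecCons Y (Function.update z (Fin.last n) θ)
      = Function.update (Matrix.vecCons Y z) (Fin.last (n + 1)) θ := by
  ext i
  refine Fin.cases ?_ (fun j => ?_) i
  · simp [Function.update, Fin.ext_iff]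
  · by_cases hj : j = Fin.last n
    · subst hj; simp [← Fin.succ_last]
    · have : j.succ ≠ Fin.last (n + 1) := by rwa [← Fin.succ_last, Ne, Fin.succ_inj]
      simp [hj, this]

lemma vecCons_update_zero {n : ℕ} (Y Y' : ℝ) (z : Fin n → ℝ) :
    Function.update (Matrix.vecCons Y z) 0 Y' = Matrix.vecCons Y' z := by
  ext i
  refine Fin.cases ?_ (fun j => ?_) i <;> simp

/-- The weighted square integral in `(Y₃, θ)` of a function on the fast domain. -/
def fibreSq (T ε δ : ℝ) (g : (Fin 6 → ℝ) → ℝ) (z : Fin 5 → ℝ) : ENNReal :=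
  ∫⁻ θ in Set.Ico 0 (2 * Real.pi), ∫⁻ r in Jh ε,
    sqInd (fastBox T (Jh ε)) (fun x => Real.exp (δ * |x 0|)) g
      (Matrix.vecCons r (Function.update z 4 θ))

/-- With only half of the decay spent on the weight, the weighted square integral in `(Y₃, θ)` is
bounded, and integrable in the slow variables. -/
lemma fibreSq_props (hT : 0 < T) (hε : IsSide ε) {δ C : ℝ} (hδ : 0 < δ) (hC0 : 0 ≤ C)
    {g : (Fin 6 → ℝ) → ℝ} (hg : ContinuousOn g (dom (fastBox T (Jh ε))))
    (hb : ∀ x ∈ dom (fastBox T (Jh ε)), |g x| ≤ C * Real.exp (-δ * |x 0|))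
    (hL : ∀ Y ∈ Jh ε, eLpNorm (fun z : Fin 5 → ℝ => g (Matrix.vecCons Y z)) 2
        (volume.restrict (cell (slowBox T (Jh ε)))) ≤ ENNReal.ofReal (C * Real.exp (-δ * |Y|))) :
    Measurable (fibreSq T ε δ g) ∧ (∃ K : ℝ, ∀ z, fibreSq T ε δ g z ≤ ENNReal.ofReal K) ∧
      ∫⁻ z in cell (slowBox T (Jh ε)), fibreSq T ε δ g z < ⊤ := by
  set W := sqInd (fastBox T (Jh ε)) (fun x => Real.exp (δ * |x 0|)) g with hW
  have hWm : Measurable W := measurable_sqInd (goodBox_fast hT hε) (by fun_prop) hg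
  have hWb : ∀ x, W x ≤ ENNReal.ofReal (C ^ 2 * Real.exp (-δ * |x 0|)) := by
    intro x
    by_cases hx : x ∈ dom (fastBox T (Jh ε))
    · simp only [hW, sqInd, Set.indicator_of_mem hx]
      refine ENNReal.ofReal_le_ofReal ?_
      have h5 : g x ^ 2 ≤ (C * Real.exp (-δ * |x 0|)) ^ 2 := by
        rw [← sq_abs]; exact pow_le_pow_left₀ (abs_nonneg _) (hb x hx) 2
      calc Real.exp (δ * |x 0|) * g x ^ 2
          ≤ Real.exp (δ * |x 0|) * (C * Real.exp (-δ * |x 0|)) ^ 2 :=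
            mul_le_mul_of_nonneg_left h5 (Real.exp_pos _).le
        _ = C ^ 2 * (Real.exp (δ * |x 0|) * Real.exp (-δ * |x 0|)) * Real.exp (-δ * |x 0|) := by ring
        _ = _ := by rw [← Real.exp_add]; simp
    · simp [hW, sqInd, hx]
  set V := fun z : Fin 5 → ℝ => ∫⁻ r in Jh ε, W (Matrix.vecCons r z) with hV
  have hWc : Measurable fun q : ℝ × (Fin 5 → ℝ) => W (Matrix.vecCons q.1 q.2) :=
    hWm.comp continuous_vecCons.measurable
  have hVm : Measurable V := by
    have : Measurable fun q : (Fin 5 → ℝ) × ℝ => W (Matrix.vecCons q.2 q.1) :=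
      hWc.comp measurable_swap
    exact this.lintegral_prod_right'
  set I := ∫⁻ r in Jh ε, ENNReal.ofReal (C ^ 2 * Real.exp (-δ * |r|)) with hI
  have hItop : I < ⊤ := lintegral_exp_lt_top hε hδ _
  have hVb : ∀ z, V z ≤ I := fun z => lintegral_mono fun r => hWb _
  have hfib : fibreSq T ε δ g
      = fun z => ∫⁻ θ in Set.Ico 0 (2 * Real.pi), V (Function.update z (Fin.last 4) θ) := rfl
  rw [hfib]
  refine ⟨measurable_lintegral_update hVm _, ⟨(I * ENNReal.ofReal (2 * Real.pi)).toReal, ?_⟩, ?_⟩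
  · intro z
    rw [ENNReal.ofReal_toReal (ENNReal.mul_lt_top hItop ENNReal.ofReal_lt_top).ne]
    refine (lintegral_mono fun θ => hVb _).trans ?_
    rw [lintegral_const]; simp
  · rw [lintegral_cell_update rfl hVm]
    refine ENNReal.mul_lt_top ENNReal.ofReal_lt_top ?_
    simp only [hV]
    rw [lintegral_lintegral_swap]
    · refine lt_of_le_of_lt (setLIntegral_mono' (measurableSet_Jh hε) fun r hr => ?_)
        hItop
      have h1 := (eLpNorm_two_le_iff _ (by positivity)).1 (hL r hr)
      have h2 : ∀ z, W (Matrix.vecCons r z)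
          ≤ ENNReal.ofReal (Real.exp (δ * |r|)) * ENNReal.ofReal (g (Matrix.vecCons r z) ^ 2) := by
        intro z
        rw [← ENNReal.ofReal_mul (Real.exp_pos _).le]
        exact Set.indicator_le_self _ _ _
      refine (lintegral_mono h2).trans ?_
      rw [lintegral_const_mul' _ _ ENNReal.ofReal_ne_top]
      refine (mul_le_mul_right h1 _).trans ?_
      rw [← ENNReal.ofReal_mul (Real.exp_pos _).le]
      refine ENNReal.ofReal_le_ofReal (le_of_eq ?_)
      calc Real.exp (δ * |r|) * (C * Real.exp (-δ * |r|)) ^ 2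
          = C ^ 2 * (Real.exp (δ * |r|) * Real.exp (-δ * |r|)) * Real.exp (-δ * |r|) := by ring
        _ = _ := by rw [← Real.exp_add]; simp
    · exact (hWc.comp measurable_swap).aemeasurable

/-- All derivatives of a surface wave function are bounded by an exponential in `Y₃` times a square
integrable function of the slow variables. -/
lemma InStar.exists_maj (hT : 0 < T) (hε : IsSide ε) {f : (Fin 6 → ℝ) → ℝ}
    (hf : InStar T (Jh ε) f) : ∃ δ > 0, ∀ l : List (Fin 6), ∃ m, StarMaj T ε m ∧
      ∀ x ∈ dom (fastBox T (Jh ε)),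
        |iterPd (fastBox T (Jh ε)) l f x| ≤ m (Matrix.vecTail x) * Real.exp (-δ * |x 0|) := by
  obtain ⟨δ, hδ, hdec⟩ := hf.decay
  refine ⟨δ / 2, by positivity, fun l => ?_⟩
  set s := fastBox T (Jh ε) with hsdef
  have hs : GoodBox s := goodBox_fast hT hε
  have hcont : ∀ l, ContinuousOn (iterPd s l f) (dom s) := fun l =>
    (contDiffOn_iterPd hs hf.hInf.smoothPer.smooth l).continuousOn
  have key : ∀ l, Measurable (fibreSq T ε δ (iterPd s l f)) ∧
      (∃ K : ℝ, ∀ z, fibreSq T ε δ (iterPd s l f) z ≤ ENNReal.ofReal K) ∧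
      ∫⁻ z in cell (slowBox T (Jh ε)), fibreSq T ε δ (iterPd s l f) z < ⊤ := by
    intro l
    obtain ⟨C, h1, h2⟩ := hdec l
    refine fibreSq_props hT hε hδ (C := |C|) (abs_nonneg _) (hcont l) (fun x hx => ?_)
      (fun Y hY => ?_)
    · exact (h1 x hx).trans (mul_le_mul_of_nonneg_right (le_abs_self _) (Real.exp_pos _).le)
    · exact (h2 Y hY).trans (ENNReal.ofReal_le_ofReal
        (mul_le_mul_of_nonneg_right (le_abs_self _) (Real.exp_pos _).le))
  -- Two one-dimensional Sobolev inequalities cost one derivative in `Y₃` and one in `θ`.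
  set L : Fin 4 → List (Fin 6) := ![l, 0 :: l, 5 :: l, 0 :: 5 :: l] with hLdef
  set M : (Fin 5 → ℝ) → ENNReal := fun z => 2 * ∑ i, fibreSq T ε δ (iterPd s (L i) f) z with hM
  have hMm : Measurable M :=
    (Finset.measurable_sum _ fun i _ => (key (L i)).1).const_mul 2
  choose K hK using fun i => (key (L i)).2.1
  have hMb : ∀ z, M z ≤ 2 * ∑ i, ENNReal.ofReal (K i) := fun z =>
    mul_le_mul_right (Finset.sum_le_sum fun i _ => hK i z) _
  have hMt : (2 * ∑ i, ENNReal.ofReal (K i) : ENNReal) ≠ ⊤ :=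
    (ENNReal.mul_lt_top (by norm_num) (ENNReal.sum_lt_top.2 fun i _ => by simp)).ne
  have hMfin : ∀ z, M z ≠ ⊤ := fun z => ((hMb z).trans_lt hMt.lt_top).ne
  have hMi : ∫⁻ z in cell (slowBox T (Jh ε)), M z < ⊤ := by
    simp only [hM]
    rw [lintegral_const_mul' _ _ (by norm_num), lintegral_finsetSum _ (fun i _ => (key (L i)).1)]
    exact ENNReal.mul_lt_top (by norm_num) (ENNReal.sum_lt_top.2 fun i _ => (key (L i)).2.2)
  refine ⟨fun z => Real.sqrt (M z).toReal,
    ⟨L2Maj.of_lintegral hMm hMfin (fun x θ => ?_) hMi, ?_⟩, fun x hx => ?_⟩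
  · simp only [hM, fibreSq, show (Fin.last 4 : Fin 5) = 4 from rfl, Function.update_idem]
  · exact ⟨Real.sqrt (2 * ∑ i, ENNReal.ofReal (K i) : ENNReal).toReal, fun z =>
      Real.sqrt_le_sqrt (ENNReal.toReal_mono hMt (hMb z))⟩
  · obtain ⟨Y, z, rfl⟩ : ∃ Y z, x = Matrix.vecCons Y z :=
      ⟨x 0, Matrix.vecTail x, (Matrix.cons_head_tail x).symm⟩
    simp only [Matrix.cons_val_zero, Matrix.tail_cons]
    obtain ⟨hY, hz⟩ := mem_dom_fast.1 hx
    have hzθ : ∀ θ, Function.update z 4 θ ∈ dom (slowBox T (Jh ε)) := fun θ =>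
      update_last_mem (n := 4) rfl hz θ
    set g := iterPd s l f with hg
    have hgs : IsSmoothPer s g := hf.hInf.smoothPer.iterPd hs l
    -- Sobolev in `Y₃`, at fixed slow variables
    have hSob : ∀ l, ∀ z ∈ dom (slowBox T (Jh ε)),
        ENNReal.ofReal (Real.exp (δ * |Y|) * iterPd s l f (Matrix.vecCons Y z) ^ 2)
        ≤ ∫⁻ r in Jh ε, (sqInd s (fun x => Real.exp (δ * |x 0|)) (iterPd s l f) (Matrix.vecCons r z)
          + sqInd s (fun x => Real.exp (δ * |x 0|)) (iterPd s (0 :: l) f) (Matrix.vecCons r z)) := by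
      intro l z hz
      obtain ⟨C, h1, -⟩ := hdec l
      have hmem : ∀ r ∈ Jh ε, Matrix.vecCons r z ∈ dom s := fun r hr => mem_dom_fast.2 ⟨hr, hz⟩
      have := ofReal_sq_le_lintegral_Jh hε (h := fun r => iterPd s l f (Matrix.vecCons r z))
        (h' := fun r => iterPd s (0 :: l) f (Matrix.vecCons r z)) (C := C) hδ ?_ ?_ ?_ hY
      · refine this.trans (le_of_eq (setLIntegral_congr_fun (measurableSet_Jh hε) fun r hr => ?_))
        simp only [sqInd, Set.indicator_of_mem (hmem r hr), Matrix.cons_val_zero]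
        rw [mul_add, ENNReal.ofReal_add (by positivity) (by positivity)]
      · intro r hr
        have := hasPd_pd (contDiffOn_iterPd hs hf.hInf.smoothPer.smooth l) 0 _ (hmem r hr)
        simp only [vecCons_update_zero, Matrix.cons_val_zero] at this
        exact this
      · exact (hcont (0 :: l)).comp
          (continuous_vecCons.comp (Continuous.prodMk_left z)).continuousOn hmem
      · intro r hr; simpa using h1 _ (hmem r hr)
    have h1 := ofReal_sq_le_lintegral_period
      (h := fun θ => g (Function.update (Matrix.vecCons Y z) (Fin.last 5) θ))
      (fun θ => (hasPd_pd hgs.smooth _).hasDerivAt_line rfl hx θ)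
      (continuous_line rfl (hgs.pd hs _).smooth.continuousOn hx) (hgs.periodic_last rfl hx) (z 4)
    have h2 : ENNReal.ofReal ((Real.exp (δ / 2 * |Y|) * g (Matrix.vecCons Y z)) ^ 2) ≤ M z := by
      have e0 : (Real.exp (δ / 2 * |Y|)) ^ 2 = Real.exp (δ * |Y|) := by
        rw [← Real.exp_nat_mul]; congr 1; push_cast; ring
      rw [mul_pow, e0, ENNReal.ofReal_mul (Real.exp_pos _).le]
      have e1 : Function.update (Matrix.vecCons Y z) (Fin.last 5) (z 4) = Matrix.vecCons Y z := by
        exact Function.update_eq_self (Fin.last 5) (Matrix.vecCons Y z)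
      rw [e1] at h1
      refine (mul_le_mul_right h1 _).trans ?_
      rw [mul_left_comm]
      refine mul_le_mul_right ?_ _
      rw [← lintegral_const_mul' _ _ ENNReal.ofReal_ne_top]
      have e2 : ∑ i, fibreSq T ε δ (iterPd s (L i) f) z
          = ∫⁻ θ in Set.Ico 0 (2 * Real.pi), ∫⁻ r in Jh ε, ∑ i, sqInd s
            (fun x => Real.exp (δ * |x 0|)) (iterPd s (L i) f)
            (Matrix.vecCons r (Function.update z 4 θ)) := by
        have hWm : ∀ l, Measurable (sqInd s (fun x => Real.exp (δ * |x 0|)) (iterPd s l f)) :=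
          fun l => measurable_sqInd hs (by fun_prop) (hcont l)
        have hm1 : ∀ l, Measurable fun q : ℝ × ℝ => sqInd s (fun x => Real.exp (δ * |x 0|))
            (iterPd s l f) (Matrix.vecCons q.2 (Function.update z 4 q.1)) := fun l =>
          (hWm l).comp (continuous_vecCons.comp (continuous_snd.prodMk
            (continuous_const.update _ continuous_fst))).measurable
        simp only [fibreSq]
        rw [← lintegral_finsetSum _ (fun i _ => (hm1 (L i)).lintegral_prod_right')]
        refine lintegral_congr fun θ => ?_
        refine (lintegral_finsetSum _ fun i _ => ?_).symm
        exact (hWm (L i)).comp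
          (continuous_vecCons.comp (Continuous.prodMk_left (Function.update z 4 θ))).measurable
      rw [e2]
      refine lintegral_mono fun θ => ?_
      have ha := hSob l _ (hzθ θ)
      have hb := hSob (5 :: l) _ (hzθ θ)
      have e3 : Function.update (Matrix.vecCons Y z) (Fin.last 5) θ
          = Matrix.vecCons Y (Function.update z 4 θ) := (vecCons_update_last Y z θ).symm
      rw [← ENNReal.ofReal_mul (Real.exp_pos _).le, mul_add,
        ENNReal.ofReal_add (by positivity) (by positivity), e3]
      refine (add_le_add ha hb).trans ((le_lintegral_add _ _).trans (le_of_eq ?_))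
      refine lintegral_congr fun r => ?_
      simp only [hLdef, Fin.sum_univ_four]
      simp only [Matrix.cons_val]
      ring
    have h3 := abs_le_sqrt_toReal (hMfin z) h2
    rw [abs_mul, abs_of_pos (Real.exp_pos _)] at h3
    rw [neg_mul, Real.exp_neg, ← div_eq_mul_inv, le_div_iff₀ (Real.exp_pos _), mul_comm]
    exact h3

/-- A class of functions with exponentially decaying majorants, closed under partial derivatives,
consists of surface wave functions. -/
lemma InStar.of_class (hT : 0 < T) (hε : IsSide ε) {C : Set ((Fin 6 → ℝ) → ℝ)} {δ : ℝ} (hδ : 0 < δ)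
    (hp : ∀ f ∈ C, ∀ i, ∃ g ∈ C, HasPd (fastBox T (Jh ε)) i f g)
    (hper : ∀ f ∈ C, ∀ i, fastBox T (Jh ε) i = none → ∀ x ∈ dom (fastBox T (Jh ε)),
      f (Function.update x i (x i + 2 * Real.pi)) = f x)
    (hm : ∀ f ∈ C, ∃ m, StarMaj T ε m ∧ ∀ x ∈ dom (fastBox T (Jh ε)),
      |f x| ≤ m (Matrix.vecTail x) * Real.exp (-δ * |x 0|))
    {f : (Fin 6 → ℝ) → ℝ} (hf : f ∈ C) : InStar T (Jh ε) f := by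
  set s := fastBox T (Jh ε) with hsdef
  have hs : GoodBox s := goodBox_fast hT hε
  have hbd : ∀ f ∈ C, ∃ K, ∀ x ∈ dom s, ‖f x‖ ≤ K := by
    intro f hf
    obtain ⟨m, hm, h⟩ := hm f hf
    obtain ⟨K, hK⟩ := hm.bdd
    refine ⟨K, fun x hx => (h x hx).trans ?_⟩
    refine (mul_le_of_le_one_right (hm.nonneg _) ?_).trans (hK _)
    rw [Real.exp_le_one_iff]; nlinarith [abs_nonneg (x 0)]
  have hc : ∀ f ∈ C, ContinuousOn f (dom s) := by
    intro f hf
    choose g hgC hg using hp f hf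
    exact continuousOn_of_bounded_hasPd hs hg fun i => hbd _ (hgC i)
  -- One constant controls the supremum and the square integral of a majorant.
  have hslice : ∀ m, StarMaj T ε m → ∃ c, 0 ≤ c ∧ (∀ z, m z ≤ c) ∧
      ∫⁻ z in cell (slowBox T (Jh ε)), ENNReal.ofReal (m z ^ 2) ≤ ENNReal.ofReal (c ^ 2) := by
    intro m hm
    obtain ⟨K, hK⟩ := hm.bdd
    have h1 := hm.memLp.2
    refine ⟨max K (eLpNorm m 2 (volume.restrict (cell (slowBox T (Jh ε))))).toReal,
      le_max_of_le_right ENNReal.toReal_nonneg, fun z => (hK z).trans (le_max_left _ _), ?_⟩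
    rw [← eLpNorm_two_le_iff _ (le_max_of_le_right ENNReal.toReal_nonneg)]
    rw [← ENNReal.ofReal_toReal h1.ne]
    exact ENNReal.ofReal_le_ofReal (by simp)
  have hsq : ∀ g ∈ C, ∃ c, 0 ≤ c ∧ (∀ x ∈ dom s, |g x| ≤ c * Real.exp (-δ * |x 0|)) ∧
      ∀ Y ∈ Jh ε, ∫⁻ z in cell (slowBox T (Jh ε)), ENNReal.ofReal (g (Matrix.vecCons Y z) ^ 2)
        ≤ ENNReal.ofReal ((c * Real.exp (-δ * |Y|)) ^ 2) := by
    intro g hg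
    obtain ⟨m, hm, h⟩ := hm g hg
    obtain ⟨c, hc0, hc1, hc2⟩ := hslice m hm
    refine ⟨c, hc0, fun x hx => (h x hx).trans
      (mul_le_mul_of_nonneg_right (hc1 _) (Real.exp_pos _).le), fun Y hY => ?_⟩
    rw [mul_pow, ENNReal.ofReal_mul (by positivity)]
    refine le_trans ?_ (mul_le_mul_left hc2 _)
    rw [mul_comm, ← lintegral_const_mul' _ _ ENNReal.ofReal_ne_top]
    refine setLIntegral_mono' (goodBox_slow hT hε).measurableSet_cell fun z hz => ?_
    rw [← ENNReal.ofReal_mul (by positivity)]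
    refine ENNReal.ofReal_le_ofReal ?_
    have := h (Matrix.vecCons Y z) (mem_dom_fast.2 ⟨hY, cell_subset_dom hz⟩)
    simp only [Matrix.tail_cons, Matrix.cons_val_zero] at this
    calc g (Matrix.vecCons Y z) ^ 2 = |g (Matrix.vecCons Y z)| ^ 2 := (sq_abs _).symm
      _ ≤ (m z * Real.exp (-δ * |Y|)) ^ 2 := pow_le_pow_left₀ (abs_nonneg _) this 2
      _ = _ := by ring
  have hsmooth : IsSmoothPer s f := ⟨contDiffOn_of_class hs hc hp hf, hper f hf⟩
  refine ⟨⟨hsmooth, fun l => ?_⟩, δ, hδ, fun l => ?_⟩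
  · obtain ⟨g, hg, e⟩ := iterPd_mem_class hs hc hp hf l
    refine memLp_congr_cell hs e ?_
    obtain ⟨c, hc0, -, hc2⟩ := hsq g hg
    refine ⟨((hc g hg).aestronglyMeasurable hs.isClosed_dom.measurableSet).mono_measure
      (Measure.restrict_mono cell_subset_dom le_rfl), ?_⟩
    rw [eLpNorm_two_lt_top_iff]
    have hW := measurable_sqInd hs (w := fun _ => 1) continuous_const (hc g hg)
    have h1 : ∫⁻ x in cell s, ENNReal.ofReal (g x ^ 2) = ∫⁻ x in cell s, sqInd s (fun _ => 1) g x :=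
      setLIntegral_congr_fun hs.measurableSet_cell fun x hx => by
        simp [sqInd, Set.indicator_of_mem (cell_subset_dom hx)]
    have h3 : ∫⁻ x in cell s, sqInd s (fun _ => 1) g x = ∫⁻ r in Jh ε,
        ∫⁻ z in cell (slowBox T (Jh ε)), sqInd s (fun _ => 1) g (Matrix.vecCons r z) :=
      lintegral_cell_cons hW
    rw [h1, h3]
    refine lt_of_le_of_lt (setLIntegral_mono' (measurableSet_Jh hε) fun r hr => ?_)
      (lintegral_exp_lt_top hε (δ := 2 * δ) (by positivity) (c ^ 2))
    refine (lintegral_mono fun z => ?_).trans ((hc2 r hr).trans (le_of_eq ?_))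
    · exact (Set.indicator_le_self _ _ _).trans (by simp)
    · rw [mul_pow, ← Real.exp_nat_mul]; congr 3; push_cast; ring
  · obtain ⟨g, hg, e⟩ := iterPd_mem_class hs hc hp hf l
    obtain ⟨c, hc0, hc1, hc2⟩ := hsq g hg
    refine ⟨c, fun x hx => by rw [e hx]; exact hc1 x hx, fun Y hY => ?_⟩
    rw [eLpNorm_two_le_iff _ (by positivity)]
    refine le_trans (le_of_eq ?_) (hc2 Y hY)
    refine setLIntegral_congr_fun (goodBox_slow hT hε).measurableSet_cell fun z hz => ?_
    change ENNReal.ofReal (iterPd s l f (Matrix.vecCons Y z) ^ 2) = _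
    rw [e (mem_dom_fast.2 ⟨hY, cell_subset_dom hz⟩ : Matrix.vecCons Y z ∈ dom s)]

end

/-! ### Rapidly decaying families of Fourier components -/

lemma hasDerivWithinAt_tsum {ι : Type*} {S : Set ℝ} (hS : Convex ℝ S) {t₀ : ℝ} (ht₀ : t₀ ∈ S)
    {F F' : ℝ → ι → ℂ} {bound : ι → ℝ} (hF : ∀ t ∈ S, Summable (F t)) (hb : Summable bound)
    (hd : ∀ a, ∀ t ∈ S, HasDerivWithinAt (fun t => F t a) (F' t a) S t)
    (hF' : ∀ a, ∀ t ∈ S, ‖F' t a‖ ≤ bound a) :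
    HasDerivWithinAt (fun t => ∑' a, F t a) (∑' a, F' t₀ a) S t₀ := by
  rw [hasDerivWithinAt_iff_tendsto_slope]
  have h1 : Filter.Tendsto (fun t => ∑' a, (t - t₀)⁻¹ • (F t a - F t₀ a))
      (nhdsWithin t₀ (S \ {t₀})) (nhds (∑' a, F' t₀ a)) := by
    refine tendsto_tsum_of_dominated_convergence hb (fun a => ?_) ?_
    · have := hasDerivWithinAt_iff_tendsto_slope.1 (hd a t₀ ht₀)
      simpa [slope_fun_def] using this
    · filter_upwards [self_mem_nhdsWithin] with t ht a
      have := hS.norm_image_sub_le_of_norm_hasDerivWithin_le (hd a) (hF' a) ht₀ ht.1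
      have hne : 0 < ‖t - t₀‖ := norm_pos_iff.2 (sub_ne_zero.2 ht.2)
      rw [norm_smul, norm_inv, inv_mul_le_iff₀ hne, mul_comm]
      exact this
  refine h1.congr' ?_
  filter_upwards [self_mem_nhdsWithin] with t ht
  rw [slope_def_module, ← (hF t ht.1).tsum_sub (hF t₀ ht₀), tsum_const_smul'']

/-- The `k`-th Fourier component `f̂(k) e^{ikθ}` of `f`. -/
def comp {n : ℕ} (f : (Fin (n + 1) → ℝ) → ℝ) (k : ℤ) (x : Fin (n + 1) → ℝ) : ℂ :=
  mode f k x * Complex.exp (Complex.I * k * x (Fin.last n))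

/-- Families of Fourier components on the fast domain, closed under partial derivatives, with
rapid decay in `k` and decay at rate `δ` in `Y₃`. -/
structure NiceClass (T ε δ : ℝ) (D : Set (ℤ → (Fin 6 → ℝ) → ℂ)) : Prop where
  mode : ∀ a ∈ D, ∀ k x θ,
    a k (Function.update x 5 θ) = a k x * Complex.exp (Complex.I * k * (θ - x 5))
  per : ∀ a ∈ D, ∀ k, ∀ i, fastBox T (Jh ε) i = none → ∀ x ∈ dom (fastBox T (Jh ε)),
    a k (Function.update x i (x i + 2 * Real.pi)) = a k x
  bound : ∀ a ∈ D, ∀ N : ℕ, ∃ m, StarMaj T ε m ∧ ∀ k : ℤ, ∀ x ∈ dom (fastBox T (Jh ε)),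
    ‖a k x‖ * (1 + |(k : ℝ)|) ^ N ≤ m (Matrix.vecTail x) * Real.exp (-δ * |x 0|)
  pd : ∀ a ∈ D, ∀ i, ∃ a' ∈ D, ∀ k, HasPd (fastBox T (Jh ε)) i (a k) (a' k)

/-- Membership in some class of rapidly decaying families. -/
def NiceAt (T ε δ : ℝ) (a : ℤ → (Fin 6 → ℝ) → ℂ) : Prop := ∃ D, NiceClass T ε δ D ∧ a ∈ D

/-- At most polynomial growth of a symbol. -/
def PolyGrowth (c : ℤ → ℂ) : Prop := ∃ C : ℝ, ∃ N : ℕ, ∀ k : ℤ, ‖c k‖ ≤ C * (1 + |(k : ℝ)|) ^ N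

lemma one_le_one_add_abs (k : ℤ) : 1 ≤ 1 + |(k : ℝ)| := by linarith [abs_nonneg (k : ℝ)]

lemma PolyGrowth.nonneg {c : ℤ → ℂ} (h : PolyGrowth c) :
    ∃ C : ℝ, ∃ N : ℕ, 0 ≤ C ∧ ∀ k : ℤ, ‖c k‖ ≤ C * (1 + |(k : ℝ)|) ^ N := by
  obtain ⟨C, N, h⟩ := h
  refine ⟨|C|, N, abs_nonneg _, fun k => (h k).trans ?_⟩
  have := one_le_one_add_abs k
  exact mul_le_mul_of_nonneg_right (le_abs_self _) (by positivity)

lemma PolyGrowth.mul {c d : ℤ → ℂ} (hc : PolyGrowth c) (hd : PolyGrowth d) :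
    PolyGrowth fun k => c k * d k := by
  obtain ⟨C, N, hC, h⟩ := hc.nonneg
  obtain ⟨C', N', hC', h'⟩ := hd.nonneg
  refine ⟨C * C', N + N', fun k => ?_⟩
  have := one_le_one_add_abs k
  rw [norm_mul]
  calc _ ≤ (C * (1 + |(k : ℝ)|) ^ N) * (C' * (1 + |(k : ℝ)|) ^ N') :=
        mul_le_mul (h k) (h' k) (norm_nonneg _) (by positivity)
    _ = _ := by ring

lemma PolyGrowth.of_bdd {c : ℤ → ℂ} {C : ℝ} (h : ∀ k, ‖c k‖ ≤ C) : PolyGrowth c :=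
  ⟨C, 0, fun k => by simpa using h k⟩

lemma PolyGrowth.const (c : ℂ) : PolyGrowth fun _ => c := .of_bdd fun _ => le_rfl

lemma polyGrowth_abs : PolyGrowth fun k : ℤ => ((|(k : ℝ)| : ℝ) : ℂ) :=
  ⟨1, 1, fun k => by rw [Complex.norm_real, Real.norm_eq_abs, abs_abs]; simp⟩

section
variable {T ε δ : ℝ}

lemma side_mul_self (hε : IsSide ε) : ε * ε = 1 := by rcases hε with rfl | rfl <;> norm_num

lemma mul_mem_Jh (hε : IsSide ε) {r : ℝ} (hr : 0 ≤ r) : ε * r ∈ Jh ε := by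
  change 0 ≤ ε * (ε * r); rw [← mul_assoc, side_mul_self hε, one_mul]; exact hr

lemma abs_side_mul (hε : IsSide ε) {r : ℝ} (hr : 0 ≤ r) : |ε * r| = r := by
  rw [abs_eq_mul_of_mem_Jh hε (mul_mem_Jh hε hr), ← mul_assoc, side_mul_self hε, one_mul]

lemma update_zero_mem {x : Fin 6 → ℝ} (hx : x ∈ dom (fastBox T (Jh ε))) {Y : ℝ} (hY : Y ∈ Jh ε) :
    Function.update x 0 Y ∈ dom (fastBox T (Jh ε)) :=
  update_mem_dom hx hY

lemma vecTail_update_zero (x : Fin 6 → ℝ) (Y : ℝ) :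
    Matrix.vecTail (Function.update x 0 Y) = Matrix.vecTail x := by
  ext i; simp [Matrix.vecTail]

lemma niceClass_niceAt : NiceClass T ε δ {a | NiceAt T ε δ a} where
  mode := fun _ ⟨_, hD, ha⟩ => hD.mode _ ha
  per := fun _ ⟨_, hD, ha⟩ => hD.per _ ha
  bound := fun _ ⟨_, hD, ha⟩ => hD.bound _ ha
  pd := fun _ ⟨D, hD, ha⟩ i => by
    obtain ⟨a', ha', h⟩ := hD.pd _ ha i
    exact ⟨a', ⟨D, hD, ha'⟩, h⟩

lemma NiceAt.pd {a : ℤ → (Fin 6 → ℝ) → ℂ} (ha : NiceAt T ε δ a) (i : Fin 6) :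
    ∃ a', NiceAt T ε δ a' ∧ ∀ k, HasPd (fastBox T (Jh ε)) i (a k) (a' k) :=
  niceClass_niceAt.pd _ ha i

lemma NiceAt.bound {a : ℤ → (Fin 6 → ℝ) → ℂ} (ha : NiceAt T ε δ a) (N : ℕ) :
    ∃ m, StarMaj T ε m ∧ ∀ k : ℤ, ∀ x ∈ dom (fastBox T (Jh ε)),
      ‖a k x‖ * (1 + |(k : ℝ)|) ^ N ≤ m (Matrix.vecTail x) * Real.exp (-δ * |x 0|) :=
  niceClass_niceAt.bound _ ha N

lemma NiceAt.norm_le {a : ℤ → (Fin 6 → ℝ) → ℂ} (ha : NiceAt T ε δ a) :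
    ∃ C : ℝ, 0 ≤ C ∧ ∀ k : ℤ, ∀ x ∈ dom (fastBox T (Jh ε)), ‖a k x‖ ≤ C * Real.exp (-δ * |x 0|) := by
  obtain ⟨m, hm, h⟩ := ha.bound 0
  obtain ⟨C, hC⟩ := hm.bdd
  refine ⟨C, (hm.nonneg 0).trans (hC 0), fun k x hx => ?_⟩
  have := h k x hx
  rw [pow_zero, mul_one] at this
  exact this.trans (mul_le_mul_of_nonneg_right (hC _) (Real.exp_pos _).le)

lemma NiceAt.mode {a : ℤ → (Fin 6 → ℝ) → ℂ} (ha : NiceAt T ε δ a) (k : ℤ) (x : Fin 6 → ℝ) (θ : ℝ) :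
    a k (Function.update x 5 θ) = a k x * Complex.exp (Complex.I * k * (θ - x 5)) :=
  niceClass_niceAt.mode _ ha k x θ

lemma NiceAt.hasPd_theta {a : ℤ → (Fin 6 → ℝ) → ℂ} (ha : NiceAt T ε δ a) (k : ℤ) :
    HasPd (fastBox T (Jh ε)) 5 (a k) (fun x => Complex.I * k * a k x) := by
  intro x _
  simp only [ha.mode k x]
  have h : HasDerivAt (fun t : ℝ => a k x * Complex.exp (Complex.I * k * (t - x 5)))
      (a k x * (Complex.exp (Complex.I * k * ((x 5 : ℝ) - x 5)) * (Complex.I * k * 1))) (x 5) :=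
    ((((hasDerivAt_id (x 5)).ofReal_comp.sub_const _).const_mul _).cexp).const_mul _
  refine (h.hasDerivWithinAt).congr_deriv ?_
  simp; ring

lemma NiceAt.mono {δ' : ℝ} (h : δ' ≤ δ) {a : ℤ → (Fin 6 → ℝ) → ℂ} (ha : NiceAt T ε δ a) :
    NiceAt T ε δ' a := by
  obtain ⟨D, hD, ha⟩ := ha
  refine ⟨D, ⟨hD.mode, hD.per, fun a ha N => ?_, hD.pd⟩, ha⟩
  obtain ⟨m, hm, hb⟩ := hD.bound a ha N
  refine ⟨m, hm, fun k x hx => (hb k x hx).trans (mul_le_mul_of_nonneg_left ?_ (hm.nonneg _))⟩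
  exact Real.exp_le_exp.2 (by nlinarith [abs_nonneg (x 0)])

lemma NiceAt.add {a b : ℤ → (Fin 6 → ℝ) → ℂ} (ha : NiceAt T ε δ a) (hb : NiceAt T ε δ b) :
    NiceAt T ε δ (a + b) := by
  refine ⟨{c | ∃ a b, NiceAt T ε δ a ∧ NiceAt T ε δ b ∧ c = a + b}, ⟨?_, ?_, ?_, ?_⟩,
    a, b, ha, hb, rfl⟩
  · rintro _ ⟨a, b, ha, hb, rfl⟩ k x θ
    simp [ha.mode, hb.mode, add_mul]
  · rintro _ ⟨a, b, ha, hb, rfl⟩ k i hi x hx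
    simp [niceClass_niceAt.per a ha k i hi x hx, niceClass_niceAt.per b hb k i hi x hx]
  · rintro _ ⟨a, b, ha, hb, rfl⟩ N
    obtain ⟨m, hm, h⟩ := ha.bound N
    obtain ⟨m', hm', h'⟩ := hb.bound N
    refine ⟨m + m', hm.add hm', fun k x hx => ?_⟩
    have := one_le_one_add_abs k
    rw [Pi.add_apply, Pi.add_apply, Pi.add_apply, add_mul]
    refine le_trans ?_ (add_le_add (h k x hx) (h' k x hx))
    rw [← add_mul]
    exact mul_le_mul_of_nonneg_right (norm_add_le _ _) (by positivity)
  · rintro _ ⟨a, b, ha, hb, rfl⟩ i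
    obtain ⟨a', ha', h⟩ := ha.pd i
    obtain ⟨b', hb', h'⟩ := hb.pd i
    exact ⟨a' + b', ⟨a', b', ha', hb', rfl⟩, fun k => (h k).add (h' k)⟩

lemma NiceAt.symbol {c : ℤ → ℂ} (hc : PolyGrowth c) {a : ℤ → (Fin 6 → ℝ) → ℂ}
    (ha : NiceAt T ε δ a) : NiceAt T ε δ (fun k x => c k * a k x) := by
  refine ⟨{b | ∃ a, NiceAt T ε δ a ∧ b = fun k x => c k * a k x}, ⟨?_, ?_, ?_, ?_⟩, a, ha, rfl⟩
  · rintro _ ⟨a, ha, rfl⟩ k x θ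
    simp [ha.mode, mul_assoc]
  · rintro _ ⟨a, ha, rfl⟩ k i hi x hx
    simp [niceClass_niceAt.per a ha k i hi x hx]
  · rintro _ ⟨a, ha, rfl⟩ N
    obtain ⟨C, M, hC, hcb⟩ := hc.nonneg
    obtain ⟨m, hm, h⟩ := ha.bound (M + N)
    refine ⟨C • m, hm.smul hC, fun k x hx => ?_⟩
    have h1 := one_le_one_add_abs k
    calc ‖c k * a k x‖ * (1 + |(k : ℝ)|) ^ N
        = ‖c k‖ * (‖a k x‖ * (1 + |(k : ℝ)|) ^ N) := by rw [norm_mul]; ring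
      _ ≤ (C * (1 + |(k : ℝ)|) ^ M) * (‖a k x‖ * (1 + |(k : ℝ)|) ^ N) :=
          mul_le_mul_of_nonneg_right (hcb k) (by positivity)
      _ = C * (‖a k x‖ * (1 + |(k : ℝ)|) ^ (M + N)) := by ring
      _ ≤ C * (m (Matrix.vecTail x) * Real.exp (-δ * |x 0|)) :=
          mul_le_mul_of_nonneg_left (h k x hx) hC
      _ = _ := by simp [mul_assoc]
  · rintro _ ⟨a, ha, rfl⟩ i
    obtain ⟨a', ha', h⟩ := ha.pd i
    exact ⟨_, ⟨a', ha', rfl⟩, fun k => (h k).const_mul (c k)⟩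

/-! ### Summation of families -/

/-- The real function with the given Fourier components (real part of the series). -/
def syn (a : ℤ → (Fin 6 → ℝ) → ℂ) (x : Fin 6 → ℝ) : ℝ := (∑' k, a k x).re

lemma summable_weight : Summable fun k : ℤ => ((1 + |(k : ℝ)|) ^ 2)⁻¹ := by
  have h1 : Summable fun k : ℤ => (if k = 0 then (1 : ℝ) else 0) + 1 / (k : ℝ) ^ 2 :=
    (summable_of_ne_finset_zero (s := {0}) (fun k hk => by simp at hk; simp [hk])).add
      (Real.summable_one_div_int_pow.2 (by norm_num))
  refine Summable.of_nonneg_of_le (fun k => by positivity) (fun k => ?_) h1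
  by_cases hk : k = 0
  · subst hk; simp
  · rw [if_neg hk, zero_add, one_div]
    have : (0 : ℝ) < (k : ℝ) ^ 2 := by positivity
    refine inv_anti₀ this ?_
    rw [← sq_abs (k : ℝ)]
    exact pow_le_pow_left₀ (abs_nonneg _) (by linarith) 2

lemma NiceAt.summable_bound {a : ℤ → (Fin 6 → ℝ) → ℂ} (ha : NiceAt T ε δ a) :
    ∃ m, StarMaj T ε m ∧ ∀ k : ℤ, ∀ x ∈ dom (fastBox T (Jh ε)),
      ‖a k x‖ ≤ m (Matrix.vecTail x) * Real.exp (-δ * |x 0|) * ((1 + |(k : ℝ)|) ^ 2)⁻¹ := by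
  obtain ⟨m, hm, h⟩ := ha.bound 2
  refine ⟨m, hm, fun k x hx => ?_⟩
  have := one_le_one_add_abs k
  rw [← div_eq_mul_inv, le_div_iff₀ (by positivity)]
  exact h k x hx

lemma NiceAt.summable {a : ℤ → (Fin 6 → ℝ) → ℂ} (ha : NiceAt T ε δ a) {x : Fin 6 → ℝ}
    (hx : x ∈ dom (fastBox T (Jh ε))) : Summable fun k => a k x := by
  obtain ⟨m, -, h⟩ := ha.summable_bound
  exact Summable.of_norm_bounded (summable_weight.mul_left _) fun k => h k x hx

lemma NiceAt.hasPd_syn (hT : 0 < T) (hε : IsSide ε) (hδ : 0 ≤ δ)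
    {a a' : ℤ → (Fin 6 → ℝ) → ℂ} (ha : NiceAt T ε δ a) (ha' : NiceAt T ε δ a') {i : Fin 6}
    (h : ∀ k, HasPd (fastBox T (Jh ε)) i (a k) (a' k)) :
    HasPd (fastBox T (Jh ε)) i (syn a) (syn a') := by
  intro x hx
  obtain ⟨m, hm, hb⟩ := ha'.summable_bound
  obtain ⟨C, hC⟩ := hm.bdd
  have hs := goodBox_fast hT hε
  have := hasDerivWithinAt_tsum (hs.convex i) (hx i)
    (F := fun t k => a k (Function.update x i t)) (F' := fun t k => a' k (Function.update x i t))
    (bound := fun k => C * ((1 + |(k : ℝ)|) ^ 2)⁻¹)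
    (fun t ht => ha.summable (update_mem_dom hx ht)) (summable_weight.mul_left _) ?_ ?_
  · have h2 := Complex.reCLM.hasFDerivAt.comp_hasDerivWithinAt _ this
    simpa [syn, Function.comp_def] using h2
  · intro k t ht
    have := h k _ (update_mem_dom hx ht)
    simpa using this
  · intro k t ht
    refine (hb k _ (update_mem_dom hx ht)).trans ?_
    have h1 := one_le_one_add_abs k
    refine mul_le_mul_of_nonneg_right ?_ (by positivity)
    refine (mul_le_of_le_one_right (hm.nonneg _) ?_).trans (hC _)
    rw [Real.exp_le_one_iff]; nlinarith [abs_nonneg (Function.update x i t 0)]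

lemma NiceAt.inStar_syn (hT : 0 < T) (hε : IsSide ε) (hδ : 0 < δ) {a : ℤ → (Fin 6 → ℝ) → ℂ}
    (ha : NiceAt T ε δ a) : InStar T (Jh ε) (syn a) := by
  refine InStar.of_class hT hε (C := {f | ∃ a, NiceAt T ε δ a ∧ f = syn a}) hδ ?_ ?_ ?_ ⟨a, ha, rfl⟩
  · rintro _ ⟨a, ha, rfl⟩ i
    obtain ⟨a', ha', h⟩ := ha.pd i
    exact ⟨_, ⟨a', ha', rfl⟩, ha.hasPd_syn hT hε hδ.le ha' h⟩
  · rintro _ ⟨a, ha, rfl⟩ i hi x hx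
    simp only [syn, niceClass_niceAt.per a ha _ i hi x hx]
  · rintro _ ⟨a, ha, rfl⟩
    obtain ⟨m, hm, hb⟩ := ha.summable_bound
    set K := ∑' k : ℤ, ((1 + |(k : ℝ)|) ^ 2)⁻¹ with hK
    have hK0 : 0 ≤ K := tsum_nonneg fun k => by positivity
    refine ⟨K • m, hm.smul hK0, fun x hx => ?_⟩
    calc |syn a x| ≤ ‖∑' k, a k x‖ := Complex.abs_re_le_norm _
      _ ≤ ∑' k : ℤ, m (Matrix.vecTail x) * Real.exp (-δ * |x 0|) * ((1 + |(k : ℝ)|) ^ 2)⁻¹ :=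
          tsum_of_norm_bounded (summable_weight.mul_left _).hasSum fun k => hb k x hx
      _ = _ := by rw [tsum_mul_left]; simp; ring

/-- Linear relations between families give linear relations between their sums. -/
lemma syn_linear {ι : Type*} [Fintype ι] {a : ι → ℤ → (Fin 6 → ℝ) → ℂ} {x : Fin 6 → ℝ}
    (ha : ∀ j, Summable fun k => a j k x) (c : ι → ℝ) {b : ℤ → (Fin 6 → ℝ) → ℂ}
    (h : ∀ k, ∑ j, (c j : ℂ) * a j k x = b k x) :
    ∑ j, c j * syn (a j) x = syn b x := by
  have h1 : HasSum (fun k => ∑ j, (c j : ℂ) * a j k x) (∑ j, (c j : ℂ) * ∑' k, a j k x) :=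
    hasSum_sum fun j _ => (ha j).hasSum.mul_left _
  simp only [h] at h1
  simp only [syn, h1.tsum_eq, Complex.re_sum, Complex.re_ofReal_mul]

/-! ### Components of a surface wave function -/

lemma hasSum_comp {n : ℕ} {s : Fin (n + 1) → Option (Set ℝ)} (hs : GoodBox s)
    (hθ : s (Fin.last n) = none) {f : (Fin (n + 1) → ℝ) → ℝ}
    (hf : IsSmoothPer s f) {x : Fin (n + 1) → ℝ} (hx : x ∈ dom s) :
    HasSum (fun k : ℤ => comp f k x) (f x : ℂ) := hasSum_mode hs hθ hf hx

lemma syn_comp (hT : 0 < T) (hε : IsSide ε) {f : (Fin 6 → ℝ) → ℝ}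
    (hf : IsSmoothPer (fastBox T (Jh ε)) f) {x : Fin 6 → ℝ} (hx : x ∈ dom (fastBox T (Jh ε))) :
    syn (comp f) x = f x := by
  rw [syn, (hasSum_comp (n := 5) (goodBox_fast hT hε) rfl hf hx).tsum_eq]; simp

lemma hasPd_comp {n : ℕ} {s : Fin (n + 1) → Option (Set ℝ)} (hs : GoodBox s)
    (hθ : s (Fin.last n) = none) {f : (Fin (n + 1) → ℝ) → ℝ} (hf : IsSmoothPer s f)
    (i : Fin (n + 1)) (k : ℤ) : HasPd s i (comp f k) (comp (pd s i f) k) := by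
  intro x hx
  by_cases hi : i = Fin.last n
  · subst hi
    simp only [comp, mode_update, Function.update_self, mode_pd_last hs hθ hf k hx]
    have h : HasDerivAt (fun t : ℝ => mode f k x * Complex.exp (Complex.I * k * t))
        (mode f k x * (Complex.exp (Complex.I * k * (x (Fin.last n) : ℝ)) * (Complex.I * k * 1)))
        (x (Fin.last n)) :=
      (((hasDerivAt_id _).ofReal_comp.const_mul _).cexp).const_mul _
    refine (h.hasDerivWithinAt).congr_deriv ?_
    ring
  · have h := hasPd_mode hs hθ hi (hasPd_pd hf.smooth i) hf.smooth.continuousOn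
      (hf.pd hs i).smooth.continuousOn k x hx
    have e : ∀ t, Function.update x i t (Fin.last n) = x (Fin.last n) := fun t => by
      rw [Function.update_of_ne (Ne.symm hi)]
    simp only [comp, e]
    exact h.mul_const _

lemma mode_iterPd_last {n : ℕ} {s : Fin (n + 1) → Option (Set ℝ)} (hs : GoodBox s)
    (hθ : s (Fin.last n) = none) {f : (Fin (n + 1) → ℝ) → ℝ} (hf : IsSmoothPer s f) (k : ℤ)
    {x : Fin (n + 1) → ℝ} (hx : x ∈ dom s) (N : ℕ) :
    mode (iterPd s (List.replicate N (Fin.last n)) f) k x = (Complex.I * k) ^ N * mode f k x := by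
  induction N with
  | zero => simp [iterPd]
  | succ N ih =>
    rw [List.replicate_succ]
    change mode (FastProblem.pd s (Fin.last n)
      (iterPd s (List.replicate N (Fin.last n)) f)) k x = _
    rw [mode_pd_last hs hθ (hf.iterPd hs _) k hx, ih]; ring

lemma norm_comp {n : ℕ} (f : (Fin (n + 1) → ℝ) → ℝ) (k : ℤ) (x : Fin (n + 1) → ℝ) :
    ‖comp f k x‖ = ‖mode f k x‖ := by
  rw [comp, norm_mul, norm_exp_I_mul', mul_one]

/-- The Fourier components of a surface wave function decay rapidly in `k`, because its
derivatives in `θ` of all orders have majorants of the same kind. -/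
lemma InStar.niceAt_comp (hT : 0 < T) (hε : IsSide ε) {f : (Fin 6 → ℝ) → ℝ}
    (hf : InStar T (Jh ε) f) : ∃ δ > 0, NiceAt T ε δ (comp f) := by
  obtain ⟨δ, hδ, hmaj⟩ := hf.exists_maj hT hε
  have hs := goodBox_fast hT hε
  set s := fastBox T (Jh ε) with hsdef
  have hsm : ∀ l, IsSmoothPer s (iterPd s l f) := fun l => hf.hInf.smoothPer.iterPd hs l
  refine ⟨δ, hδ, {a | ∃ l, a = comp (iterPd s l f)}, ⟨?_, ?_, ?_, ?_⟩, [], rfl⟩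
  · rintro _ ⟨l, rfl⟩ k x θ
    have h1 : mode (iterPd s l f) k (Function.update x 5 θ) = mode (iterPd s l f) k x :=
      mode_update _ k x θ
    have h2 : Function.update x 5 θ (Fin.last 5) = θ := Function.update_self (5 : Fin 6) θ x
    rw [comp, comp, h1, h2, mul_assoc (mode _ _ _), ← Complex.exp_add]
    congr 2
    rw [show x (Fin.last 5) = x 5 from rfl]; ring
  · rintro _ ⟨l, rfl⟩ k i hi x hx
    by_cases h5 : i = Fin.last 5
    · subst h5
      simp only [comp, mode_update, Function.update_self]
      congr 1
      rw [show Complex.I * k * ((x (Fin.last 5) + 2 * Real.pi : ℝ) : ℂ)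
        = Complex.I * k * x (Fin.last 5) + (k : ℂ) * (2 * Real.pi * Complex.I) by push_cast; ring,
        Complex.exp_add, Complex.exp_int_mul_two_pi_mul_I, mul_one]
    · simp only [comp, Function.update_of_ne (Ne.symm h5)]
      congr 1
      unfold FastProblem.mode
      congr 1
      refine intervalIntegral.integral_congr fun θ _ => ?_
      have := (hsm l).periodic i hi _ (update_last_mem (n := 5) rfl hx θ)
      rw [Function.update_of_ne h5] at this
      change ((iterPd s l f (Function.update (Function.update x i _) (Fin.last 5) θ) : ℝ) : ℂ) * _ = _
      rw [Function.update_comm h5, this]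
  · rintro _ ⟨l, rfl⟩ N
    obtain ⟨m₀, hm₀, h₀⟩ := hmaj l
    -- `N` derivatives in `θ` gain the factor `|k|^N`.
    obtain ⟨m₁, hm₁, h₁⟩ := hmaj (List.replicate N 5 ++ l)
    refine ⟨(2 ^ N : ℝ) • (m₀ + m₁), (hm₀.add hm₁).smul (by positivity), fun k x hx => ?_⟩
    have hline : ∀ θ, Function.update x (Fin.last 5) θ ∈ dom s := fun θ =>
      update_last_mem (n := 5) rfl hx θ
    have ht : ∀ m : (Fin 5 → ℝ) → ℝ, StarMaj T ε m → ∀ θ,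
        m (Matrix.vecTail (Function.update x (Fin.last 5) θ)) = m (Matrix.vecTail x) := by
      intro m hm θ
      have e : Matrix.vecTail (Function.update x (Fin.last 5) θ)
          = Function.update (Matrix.vecTail x) (Fin.last 4) θ := by
        have := vecCons_update_last (x 0) (Matrix.vecTail x) θ
        have e2 : Matrix.vecCons (x 0) (Matrix.vecTail x) = x := Matrix.cons_head_tail x
        rw [e2] at this
        rw [← this]; rfl
      rw [e, hm.indep]
    have e0 : ∀ θ, Function.update x (Fin.last 5) θ 0 = x 0 := fun θ =>
      Function.update_of_ne (by decide) _ _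
    have b0 : ‖mode (iterPd s l f) k x‖ ≤ m₀ (Matrix.vecTail x) * Real.exp (-δ * |x 0|) := by
      refine norm_mode_le (fun θ => ?_) k
      have := h₀ _ (hline θ)
      rwa [ht _ hm₀, e0] at this
    have b1 : |(k : ℝ)| ^ N * ‖mode (iterPd s l f) k x‖
        ≤ m₁ (Matrix.vecTail x) * Real.exp (-δ * |x 0|) := by
      have h := norm_mode_le (f := iterPd s (List.replicate N 5 ++ l) f) (x := x)
        (C := m₁ (Matrix.vecTail x) * Real.exp (-δ * |x 0|)) (fun θ => by
          have := h₁ _ (hline θ)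
          rwa [ht _ hm₁, e0] at this) k
      rw [iterPd_append] at h
      have e := mode_iterPd_last hs rfl (hsm l) k hx N
      rw [show (Fin.last 5 : Fin 6) = 5 from rfl] at e
      rwa [e, norm_mul, norm_pow, norm_mul, Complex.norm_I, one_mul, Complex.norm_intCast] at h
    rw [norm_comp]
    have hk : (1 + |(k : ℝ)|) ^ N ≤ 2 ^ N * (1 + |(k : ℝ)| ^ N) := by
      have h0 := abs_nonneg (k : ℝ)
      calc (1 + |(k : ℝ)|) ^ N ≤ (2 * max 1 |(k : ℝ)|) ^ N := by
            refine pow_le_pow_left₀ (by positivity) ?_ N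
            have := le_max_left 1 |(k : ℝ)|
            have := le_max_right 1 |(k : ℝ)|
            linarith
        _ = 2 ^ N * (max 1 |(k : ℝ)|) ^ N := mul_pow _ _ _
        _ ≤ _ := by
            refine mul_le_mul_of_nonneg_left ?_ (by positivity)
            rcases max_choice 1 |(k : ℝ)| with h | h <;> rw [h]
            · rw [one_pow]; linarith [pow_nonneg h0 N]
            · linarith
    calc ‖mode (iterPd s l f) k x‖ * (1 + |(k : ℝ)|) ^ N
        ≤ ‖mode (iterPd s l f) k x‖ * (2 ^ N * (1 + |(k : ℝ)| ^ N)) :=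
          mul_le_mul_of_nonneg_left hk (norm_nonneg _)
      _ = 2 ^ N * (‖mode (iterPd s l f) k x‖ + |(k : ℝ)| ^ N * ‖mode (iterPd s l f) k x‖) := by ring
      _ ≤ 2 ^ N * (m₀ (Matrix.vecTail x) * Real.exp (-δ * |x 0|)
          + m₁ (Matrix.vecTail x) * Real.exp (-δ * |x 0|)) :=
          mul_le_mul_of_nonneg_left (add_le_add b0 b1) (by positivity)
      _ = _ := by simp; ring
  · rintro _ ⟨l, rfl⟩ i
    exact ⟨_, ⟨i :: l, rfl⟩, fun k => hasPd_comp hs rfl (hsm l) i k⟩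

end

/-! ### Solution operators of the first order equations in `Y₃` -/

section
variable {T ε δ κ : ℝ}

/-- `∫₀^∞ e^{-κ|k|r} a(Y₃ + εr) dr`, the bounded solution `g` of `ε ∂_{Y₃} g = κ|k| g - a`. -/
def Tm (ε κ : ℝ) (a : ℤ → (Fin 6 → ℝ) → ℂ) (k : ℤ) (x : Fin 6 → ℝ) : ℂ :=
  ∫ r in Set.Ioi (0 : ℝ), ((Real.exp (-(κ * |(k : ℝ)| * r)) : ℝ) : ℂ)
    * a k (Function.update x 0 (x 0 + ε * r))

/-- `e^{-κ|k||Y₃|} a(Y₃ = 0)` for `k ≠ 0`. -/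
def Pe (ε κ : ℝ) (a : ℤ → (Fin 6 → ℝ) → ℂ) (k : ℤ) (x : Fin 6 → ℝ) : ℂ :=
  if k = 0 then 0 else ((Real.exp (-(κ * |(k : ℝ)| * (ε * x 0))) : ℝ) : ℂ)
    * a k (Function.update x 0 0)

/-- `∫₀^{|Y₃|} e^{-κ|k|(|Y₃| - r)} a(εr) dr` for `k ≠ 0`, the solution `g` of
`ε ∂_{Y₃} g = -κ|k| g + a` that vanishes at `Y₃ = 0`. The maximum only serves to extend the
integrand continuously to negative `r`. -/
def Tp (ε κ : ℝ) (a : ℤ → (Fin 6 → ℝ) → ℂ) (k : ℤ) (x : Fin 6 → ℝ) : ℂ :=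
  if k = 0 then 0 else ((Real.exp (-(κ * |(k : ℝ)| * (ε * x 0))) : ℝ) : ℂ)
    * ∫ r in (0 : ℝ)..(ε * x 0), ((Real.exp (κ * |(k : ℝ)| * r) : ℝ) : ℂ)
      * a k (Function.update x 0 (ε * max r 0))

lemma shift_mem_Jh (hε : IsSide ε) {Y r : ℝ} (hY : Y ∈ Jh ε) (hr : 0 ≤ r) : Y + ε * r ∈ Jh ε := by
  have hY : 0 ≤ ε * Y := hY
  change 0 ≤ ε * (Y + ε * r)
  rw [mul_add, ← mul_assoc, side_mul_self hε]; linarith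

lemma abs_shift (hε : IsSide ε) {Y r : ℝ} (hY : Y ∈ Jh ε) (hr : 0 ≤ r) : |Y + ε * r| = |Y| + r := by
  rw [abs_eq_mul_of_mem_Jh hε (shift_mem_Jh hε hY hr), abs_eq_mul_of_mem_Jh hε hY, mul_add,
    ← mul_assoc, side_mul_self hε, one_mul]

lemma mem_Jh_of_mem_dom {x : Fin 6 → ℝ} (hx : x ∈ dom (fastBox T (Jh ε))) : x 0 ∈ Jh ε := hx 0

/-- Derivative along `r ↦ Y₃ + εr`. -/
lemma HasPd.shift (hε : IsSide ε) {f g : (Fin 6 → ℝ) → ℂ} (h : HasPd (fastBox T (Jh ε)) 0 f g)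
    {x : Fin 6 → ℝ} (hx : x ∈ dom (fastBox T (Jh ε))) {r : ℝ} (hr : 0 ≤ r) :
    HasDerivWithinAt (fun r => f (Function.update x 0 (x 0 + ε * r)))
      (ε * g (Function.update x 0 (x 0 + ε * r))) (Set.Ici 0) r := by
  have hm := shift_mem_Jh hε (mem_Jh_of_mem_dom hx) hr
  have h1 := h _ (update_zero_mem hx hm)
  simp only [Function.update_idem, Function.update_self] at h1
  have h2 : HasDerivWithinAt (fun r => x 0 + ε * r) (ε * 1) (Set.Ici 0) r :=
    ((hasDerivAt_id r).const_mul ε).const_add (x 0) |>.hasDerivWithinAt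
  have := HasDerivWithinAt.scomp r (t' := Jh ε) h1 h2
    (fun t ht => shift_mem_Jh hε (mem_Jh_of_mem_dom hx) ht)
  simpa [Function.comp_def] using this

lemma NiceAt.continuousOn_shift (hε : IsSide ε) {a : ℤ → (Fin 6 → ℝ) → ℂ} (ha : NiceAt T ε δ a)
    (k : ℤ) {x : Fin 6 → ℝ} (hx : x ∈ dom (fastBox T (Jh ε))) :
    ContinuousOn (fun r => a k (Function.update x 0 (x 0 + ε * r))) (Set.Ici 0) := by
  obtain ⟨a', -, h⟩ := ha.pd 0
  exact fun r hr => ((h k).shift hε hx hr).continuousWithinAt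

lemma integrableOn_exp_Ioi (hδ : 0 < δ) : IntegrableOn (fun r : ℝ => Real.exp (-δ * r)) (Set.Ioi 0) :=
  exp_neg_integrableOn_Ioi 0 hδ

lemma Tm_integrand_bound (hε : IsSide ε) (hκ : 0 ≤ κ) {a : ℤ → (Fin 6 → ℝ) → ℂ} {k : ℤ}
    {x : Fin 6 → ℝ} (hx : x ∈ dom (fastBox T (Jh ε))) {B : ℝ}
    (hB : ∀ Y ∈ Jh ε, ‖a k (Function.update x 0 Y)‖ ≤ B * Real.exp (-δ * |Y|)) {r : ℝ}
    (hr : 0 ≤ r) :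
    ‖((Real.exp (-(κ * |(k : ℝ)| * r)) : ℝ) : ℂ) * a k (Function.update x 0 (x 0 + ε * r))‖
      ≤ B * Real.exp (-δ * |x 0|) * Real.exp (-δ * r) := by
  have hm := shift_mem_Jh hε (mem_Jh_of_mem_dom hx) hr
  have h1 := hB _ hm
  rw [abs_shift hε (mem_Jh_of_mem_dom hx) hr] at h1
  rw [norm_mul, Complex.norm_real, Real.norm_eq_abs, abs_of_pos (Real.exp_pos _)]
  have h2 : Real.exp (-(κ * |(k : ℝ)| * r)) ≤ 1 := by
    rw [Real.exp_le_one_iff]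
    have : 0 ≤ κ * |(k : ℝ)| * r := by positivity
    linarith
  refine (mul_le_of_le_one_left (norm_nonneg _) h2).trans (h1.trans (le_of_eq ?_))
  rw [mul_assoc, ← Real.exp_add]; congr 2; ring

lemma NiceAt.integrableOn_Tm (hε : IsSide ε) (hδ : 0 < δ) (hκ : 0 ≤ κ) {a : ℤ → (Fin 6 → ℝ) → ℂ}
    (ha : NiceAt T ε δ a) (k : ℤ) {x : Fin 6 → ℝ} (hx : x ∈ dom (fastBox T (Jh ε))) :
    IntegrableOn (fun r => ((Real.exp (-(κ * |(k : ℝ)| * r)) : ℝ) : ℂ)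
      * a k (Function.update x 0 (x 0 + ε * r))) (Set.Ioi 0) := by
  obtain ⟨C, hC0, hC⟩ := ha.norm_le
  refine Integrable.mono' ((integrableOn_exp_Ioi hδ).const_mul (C * Real.exp (-δ * |x 0|))) ?_ ?_
  · refine ContinuousOn.aestronglyMeasurable ?_ measurableSet_Ioi
    refine ContinuousOn.mul (Continuous.continuousOn (by fun_prop)) ?_
    exact (ha.continuousOn_shift hε k hx).mono Set.Ioi_subset_Ici_self
  · refine (ae_restrict_iff' measurableSet_Ioi).2 (Filter.Eventually.of_forall fun r hr => ?_)
    exact Tm_integrand_bound hε hκ hx (fun Y hY => by simpa using hC k _ (update_zero_mem hx hY))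
      (le_of_lt hr)

/-- `Tm` commutes with partial derivatives. -/
lemma NiceAt.hasPd_Tm' (hT : 0 < T) (hε : IsSide ε) (hδ : 0 < δ) (hκ : 0 ≤ κ)
    {a a' : ℤ → (Fin 6 → ℝ) → ℂ} (ha : NiceAt T ε δ a) (ha' : NiceAt T ε δ a') {i : Fin 6} {k : ℤ}
    (h : HasPd (fastBox T (Jh ε)) i (a k) (a' k)) :
    HasPd (fastBox T (Jh ε)) i (Tm ε κ a k) (Tm ε κ a' k) := by
  intro x hx
  obtain ⟨C, hC0, hC⟩ := ha'.norm_le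
  have hs := goodBox_fast hT hε
  have key := hasDerivWithinAt_integral (hs.convex i) (hx i) (μ := volume.restrict (Set.Ioi 0))
    (F := fun t r => ((Real.exp (-(κ * |(k : ℝ)| * r)) : ℝ) : ℂ)
      * a k (Function.update (Function.update x i t) 0 (Function.update x i t 0 + ε * r)))
    (F' := fun t r => ((Real.exp (-(κ * |(k : ℝ)| * r)) : ℝ) : ℂ)
      * a' k (Function.update (Function.update x i t) 0 (Function.update x i t 0 + ε * r)))
    (bound := fun r => C * Real.exp (-δ * r))
    (fun t ht => ha.integrableOn_Tm hε hδ hκ k (update_mem_dom hx ht))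
    ((integrableOn_exp_Ioi hδ).const_mul C) ?_ ?_
  · simpa [Tm] using key
  · refine (ae_restrict_iff' measurableSet_Ioi).2 (Filter.Eventually.of_forall fun r hr t ht => ?_)
    have hr : 0 ≤ r := le_of_lt hr
    refine HasDerivWithinAt.const_mul _ ?_
    have hxt := update_mem_dom hx ht
    have hm := update_zero_mem hxt (shift_mem_Jh hε (mem_Jh_of_mem_dom hxt) hr)
    have h1 := h _ hm
    by_cases hi : i = 0
    · subst hi
      simp only [Function.update_idem, Function.update_self] at h1 ⊢
      have h2 : HasDerivWithinAt (fun t : ℝ => t + ε * r) 1 (Jh ε) t :=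
        ((hasDerivAt_id t).add_const _).hasDerivWithinAt
      have := HasDerivWithinAt.scomp t (t' := Jh ε) h1 h2 (fun y hy => shift_mem_Jh hε hy hr)
      simp only [Function.comp_def, one_smul] at this
      exact this
    · have e : ∀ y, Function.update x i y 0 = x 0 := fun y => Function.update_of_ne (Ne.symm hi) _ _
      have e2 : ∀ y, Function.update (Function.update (Function.update x i t) 0 (x 0 + ε * r)) i y
          = Function.update (Function.update x i y) 0 (x 0 + ε * r) := fun y => by
        rw [Function.update_comm (Ne.symm hi), Function.update_idem]
      simp only [e, e2, Function.update_of_ne hi, Function.update_self] at h1 ⊢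
      exact h1
  · refine (ae_restrict_iff' measurableSet_Ioi).2 (Filter.Eventually.of_forall fun r hr t ht => ?_)
    have hr : 0 ≤ r := le_of_lt hr
    have hxt := update_mem_dom hx ht
    refine (Tm_integrand_bound hε hκ hxt (fun Y hY => by
      simpa using hC k _ (update_zero_mem hxt hY)) hr).trans ?_
    refine mul_le_mul_of_nonneg_right (mul_le_of_le_one_right hC0 ?_) (Real.exp_pos _).le
    rw [Real.exp_le_one_iff]; nlinarith [abs_nonneg (Function.update x i t 0)]

lemma NiceAt.Tm (hT : 0 < T) (hε : IsSide ε) (hδ : 0 < δ) (hκ : 0 ≤ κ)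
    {a : ℤ → (Fin 6 → ℝ) → ℂ} (ha : NiceAt T ε δ a) : NiceAt T ε δ (Tm ε κ a) := by
  refine ⟨{b | ∃ a, NiceAt T ε δ a ∧ b = FastProblem.Tm ε κ a}, ⟨?_, ?_, ?_, ?_⟩, a, ha, rfl⟩
  · rintro _ ⟨a, ha, rfl⟩ k x θ
    simp only [FastProblem.Tm]
    rw [← integral_mul_const]
    congr 1; ext r
    rw [Function.update_of_ne (by decide), Function.update_comm (by decide : (5 : Fin 6) ≠ 0),
      ha.mode, Function.update_of_ne (by decide : (5 : Fin 6) ≠ 0)]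
    ring
  · rintro _ ⟨a, ha, rfl⟩ k i hi x hx
    have h0 : i ≠ 0 := by rintro rfl; simp [fastBox] at hi
    simp only [FastProblem.Tm]
    refine setIntegral_congr_fun measurableSet_Ioi fun r hr => ?_
    have hm := update_zero_mem hx (shift_mem_Jh hε (mem_Jh_of_mem_dom hx) (le_of_lt hr))
    have := niceClass_niceAt.per a ha k i hi _ hm
    rw [Function.update_of_ne h0] at this
    rw [Function.update_of_ne (Ne.symm h0), Function.update_comm h0, this]
  · rintro _ ⟨a, ha, rfl⟩ N
    obtain ⟨m, hm, h⟩ := ha.bound N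
    set K := ∫ r in Set.Ioi (0 : ℝ), Real.exp (-δ * r) with hK
    have hK0 : 0 ≤ K := integral_nonneg fun r => (Real.exp_pos _).le
    refine ⟨K • m, hm.smul hK0, fun k x hx => ?_⟩
    have h1 := one_le_one_add_abs k
    have hp : (0 : ℝ) < (1 + |(k : ℝ)|) ^ N := by positivity
    have hb : ∀ Y ∈ Jh ε, ‖a k (Function.update x 0 Y)‖
        ≤ m (Matrix.vecTail x) / (1 + |(k : ℝ)|) ^ N * Real.exp (-δ * |Y|) := by
      intro Y hY
      have := h k _ (update_zero_mem hx hY)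
      rw [vecTail_update_zero, Function.update_self] at this
      rwa [div_mul_eq_mul_div, le_div_iff₀ hp]
    rw [← le_div_iff₀ hp]
    refine (norm_integral_le_of_norm_le ((integrableOn_exp_Ioi hδ).const_mul
      (m (Matrix.vecTail x) / (1 + |(k : ℝ)|) ^ N * Real.exp (-δ * |x 0|))) ?_).trans
      (le_of_eq ?_)
    · refine (ae_restrict_iff' measurableSet_Ioi).2 (Filter.Eventually.of_forall fun r hr => ?_)
      exact Tm_integrand_bound hε hκ hx hb (le_of_lt hr)
    · rw [integral_const_mul, ← hK]
      simp only [Pi.smul_apply, smul_eq_mul]; ring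
  · rintro _ ⟨a, ha, rfl⟩ i
    obtain ⟨a', ha', h⟩ := ha.pd i
    exact ⟨_, ⟨a', ha', rfl⟩, fun k => ha.hasPd_Tm' hT hε hδ hκ ha' (h k)⟩

/-- The differential equation solved by `Tm`. -/
lemma NiceAt.hasPd_Tm (hT : 0 < T) (hε : IsSide ε) (hδ : 0 < δ) (hκ : 0 ≤ κ)
    {a : ℤ → (Fin 6 → ℝ) → ℂ} (ha : NiceAt T ε δ a) (k : ℤ) :
    HasPd (fastBox T (Jh ε)) 0 (FastProblem.Tm ε κ a k)
      (fun x => ε * ((κ * |(k : ℝ)| : ℝ) * FastProblem.Tm ε κ a k x - a k x)) := by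
  obtain ⟨a', ha', h⟩ := ha.pd 0
  refine (ha.hasPd_Tm' hT hε hδ hκ ha' (h k)).congr (fun _ _ => rfl) fun x hx => ?_
  set c : ℝ := κ * |(k : ℝ)| with hc
  have hI := ha.integrableOn_Tm hε hδ hκ k hx
  have hI' := ha'.integrableOn_Tm hε hδ hκ k hx
  have hcont := ha.continuousOn_shift hε k hx
  have hd : ∀ r ∈ Set.Ioi (0 : ℝ), HasDerivAt (fun r => ((Real.exp (-(c * r)) : ℝ) : ℂ)
      * a k (Function.update x 0 (x 0 + ε * r)))
      (-c * (((Real.exp (-(c * r)) : ℝ) : ℂ) * a k (Function.update x 0 (x 0 + ε * r)))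
        + ε * (((Real.exp (-(c * r)) : ℝ) : ℂ) * a' k (Function.update x 0 (x 0 + ε * r)))) r := by
    intro r hr
    have h1 := ((h k).shift hε hx (le_of_lt hr)).hasDerivAt (Ici_mem_nhds hr)
    have h2 : HasDerivAt (fun r : ℝ => ((Real.exp (-(c * r)) : ℝ) : ℂ))
        ((Real.exp (-(c * r)) * -(c * 1) : ℝ) : ℂ) r :=
      (((hasDerivAt_id r).const_mul c).neg.exp).ofReal_comp
    refine (h2.mul h1).congr_deriv ?_
    push_cast; ring
  have hlim : Filter.Tendsto (fun r => ((Real.exp (-(c * r)) : ℝ) : ℂ)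
      * a k (Function.update x 0 (x 0 + ε * r))) Filter.atTop (nhds 0) := by
    obtain ⟨C, hC0, hC⟩ := ha.norm_le
    have h3 : Filter.Tendsto (fun r : ℝ => C * Real.exp (-δ * |x 0|) * Real.exp (-δ * r))
        Filter.atTop (nhds (C * Real.exp (-δ * |x 0|) * 0)) := by
      refine Filter.Tendsto.const_mul _ (Real.tendsto_exp_atBot.comp ?_)
      exact Filter.tendsto_id.const_mul_atTop_of_neg (by linarith)
    rw [mul_zero] at h3
    refine squeeze_zero_norm' ?_ h3
    filter_upwards [Filter.eventually_ge_atTop 0] with r hr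
    exact Tm_integrand_bound hε hκ hx (fun Y hY => by
      simpa using hC k _ (update_zero_mem hx hY)) hr
  have hFTC := integral_Ioi_of_hasDerivAt_of_tendsto (a := 0) ?_ hd
    ((hI.const_mul _).add (hI'.const_mul _)) hlim
  · rw [integral_add (hI.const_mul _) (hI'.const_mul _), integral_const_mul,
      integral_const_mul] at hFTC
    simp only [mul_zero, neg_zero, Real.exp_zero, Complex.ofReal_one, one_mul, add_zero,
      Function.update_eq_self] at hFTC
    change -(c : ℂ) * FastProblem.Tm ε κ a k x + ε * FastProblem.Tm ε κ a' k x = 0 - a k x at hFTC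
    have hε2 : (ε : ℂ) * ε = 1 := by exact_mod_cast side_mul_self hε
    linear_combination -(ε : ℂ) * hFTC + FastProblem.Tm ε κ a' k x * hε2
  · refine ContinuousWithinAt.mul (Continuous.continuousWithinAt (by fun_prop)) ?_
    exact hcont 0 (Set.mem_Ici.2 le_rfl)

lemma hasDerivAt_expY (c : ℝ) (y : ℝ) :
    HasDerivAt (fun t : ℝ => ((Real.exp (-(c * (ε * t))) : ℝ) : ℂ))
      (-(c * ε : ℝ) * ((Real.exp (-(c * (ε * y))) : ℝ) : ℂ)) y := by
  have := ((((hasDerivAt_id y).const_mul ε).const_mul c).neg.exp).ofReal_comp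
  refine this.congr_deriv ?_
  simp; ring

lemma hasPd_Pe (κ : ℝ) (a : ℤ → (Fin 6 → ℝ) → ℂ) (k : ℤ) :
    HasPd (fastBox T (Jh ε)) 0 (Pe ε κ a k)
      (fun x => -ε * (κ * |(k : ℝ)| : ℝ) * Pe ε κ a k x) := by
  intro x _
  by_cases hk : k = 0
  · simp only [Pe, hk, if_true, mul_zero]; exact hasDerivWithinAt_const _ _ _
  simp only [Pe, hk, if_false, Function.update_idem, Function.update_self]
  refine (((hasDerivAt_expY (ε := ε) (κ * |(k : ℝ)|) (x 0)).mul_const _).hasDerivWithinAt).congr_deriv ?_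
  push_cast; ring

lemma exp_decay_le (hκ : 0 < κ) {k : ℤ} (hk : k ≠ 0) {y : ℝ} (hy : 0 ≤ y) :
    Real.exp (-(κ * |(k : ℝ)| * y)) ≤ Real.exp (-κ * y) := by
  have h1 : (1 : ℝ) ≤ |(k : ℝ)| := by exact_mod_cast Int.one_le_abs hk
  refine Real.exp_le_exp.2 ?_
  nlinarith [mul_nonneg hκ.le hy]

/-- The homogeneous solution with given value at `Y₃ = 0` decays rapidly. -/
lemma NiceAt.Pe (hε : IsSide ε) (hκ : 0 < κ) {a : ℤ → (Fin 6 → ℝ) → ℂ}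
    (ha : NiceAt T ε δ a) : NiceAt T ε κ (Pe ε κ a) := by
  refine ⟨{b | ∃ c a, PolyGrowth c ∧ NiceAt T ε δ a ∧ b = fun k x => c k * FastProblem.Pe ε κ a k x},
    ⟨?_, ?_, ?_, ?_⟩, fun _ => 1, a, .const 1, ha, by simp⟩
  · rintro _ ⟨c, a, hc, ha, rfl⟩ k x θ
    by_cases hk : k = 0
    · simp [FastProblem.Pe, hk]
    simp only [FastProblem.Pe, hk, if_false]
    rw [Function.update_of_ne (by decide), Function.update_comm (by decide : (5 : Fin 6) ≠ 0),
      ha.mode, Function.update_of_ne (by decide : (5 : Fin 6) ≠ 0)]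
    ring
  · rintro _ ⟨c, a, hc, ha, rfl⟩ k i hi x hx
    have h0 : i ≠ 0 := by rintro rfl; simp [fastBox] at hi
    by_cases hk : k = 0
    · simp [FastProblem.Pe, hk]
    simp only [FastProblem.Pe, hk, if_false]
    have hm := update_zero_mem hx (Y := 0) (by simp [Jh])
    have := niceClass_niceAt.per a ha k i hi _ hm
    rw [Function.update_of_ne h0] at this
    rw [Function.update_of_ne (Ne.symm h0), Function.update_comm h0, this]
  · rintro _ ⟨c, a, hc, ha, rfl⟩ N
    obtain ⟨m, hm, h⟩ := (ha.symbol hc).bound N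
    refine ⟨m, hm, fun k x hx => ?_⟩
    have h1 := one_le_one_add_abs k
    by_cases hk : k = 0
    · simp only [FastProblem.Pe, hk, if_true, mul_zero, norm_zero, zero_mul]
      exact mul_nonneg (hm.nonneg _) (Real.exp_pos _).le
    simp only [FastProblem.Pe, hk, if_false]
    have h2 := h k _ (update_zero_mem hx (Y := 0) (by simp [Jh]))
    simp only [vecTail_update_zero, Function.update_self, abs_zero, mul_zero, Real.exp_zero,
      mul_one] at h2
    have hY := abs_eq_mul_of_mem_Jh hε (mem_Jh_of_mem_dom hx)
    calc _ = Real.exp (-(κ * |(k : ℝ)| * (ε * x 0)))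
          * (‖c k * a k (Function.update x 0 0)‖ * (1 + |(k : ℝ)|) ^ N) := by
            rw [mul_left_comm, norm_mul, Complex.norm_real, Real.norm_eq_abs,
              abs_of_pos (Real.exp_pos _)]; ring
      _ ≤ Real.exp (-κ * (ε * x 0)) * m (Matrix.vecTail x) :=
          mul_le_mul (exp_decay_le hκ hk (mem_Jh_of_mem_dom hx)) h2 (by positivity)
            (Real.exp_pos _).le
      _ = _ := by rw [hY, mul_comm]
  · rintro _ ⟨c, a, hc, ha, rfl⟩ i
    by_cases hi : i = 0
    · subst hi
      refine ⟨_, ⟨fun k => c k * (-ε * (κ * |(k : ℝ)| : ℝ)), a, ?_, ha, rfl⟩, fun k => ?_⟩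
      · refine hc.mul ((PolyGrowth.const (-ε)).mul ?_)
        have := (PolyGrowth.const κ).mul polyGrowth_abs
        simpa using this
      · refine ((hasPd_Pe κ a k).const_mul (c k)).congr (fun _ _ => rfl) fun x _ => ?_
        simp only; ring
    · obtain ⟨a', ha', h⟩ := ha.pd i
      refine ⟨_, ⟨c, a', hc, ha', rfl⟩, fun k => HasPd.const_mul (fun x hx => ?_) (c k)⟩
      by_cases hk : k = 0
      · simp only [FastProblem.Pe, hk, if_true]; exact hasDerivWithinAt_const _ _ _
      simp only [FastProblem.Pe, hk, if_false]
      have h1 := h k _ (update_zero_mem hx (Y := 0) (by simp [Jh]))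
      rw [Function.update_of_ne hi] at h1
      simp only [Function.update_of_ne (Ne.symm hi), Function.update_comm hi]
      exact h1.const_mul _

lemma NiceAt.continuous_Tp (hε : IsSide ε) {a : ℤ → (Fin 6 → ℝ) → ℂ} (ha : NiceAt T ε δ a)
    (k : ℤ) {x : Fin 6 → ℝ} (hx : x ∈ dom (fastBox T (Jh ε))) (c : ℝ) :
    Continuous fun r => ((Real.exp (c * r) : ℝ) : ℂ) * a k (Function.update x 0 (ε * max r 0)) := by
  refine Continuous.mul (by fun_prop) ?_
  have h0 := update_zero_mem hx (Y := 0) (by simp [Jh])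
  have h := ha.continuousOn_shift hε k h0
  simp only [Function.update_idem, Function.update_self, zero_add] at h
  exact h.comp_continuous (f := fun r : ℝ => max r 0) (by fun_prop) (fun r => le_max_right r 0)

lemma NiceAt.hasPd_Tp (hε : IsSide ε) {a : ℤ → (Fin 6 → ℝ) → ℂ}
    (ha : NiceAt T ε δ a) (κ : ℝ) (k : ℤ) : HasPd (fastBox T (Jh ε)) 0 (Tp ε κ a k)
      (fun x => ε * (-(κ * |(k : ℝ)| : ℝ) * Tp ε κ a k x + (if k = 0 then 0 else a k x))) := by
  intro x hx
  by_cases hk : k = 0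
  · simp only [Tp, hk, if_true, mul_zero, add_zero]; exact hasDerivWithinAt_const _ _ _
  simp only [Tp, hk, if_false, Function.update_idem, Function.update_self]
  set c := κ * |(k : ℝ)| with hc
  have hcont := ha.continuous_Tp hε k hx c
  have h1 : HasDerivAt (fun t : ℝ => ∫ r in (0 : ℝ)..(ε * t), ((Real.exp (c * r) : ℝ) : ℂ)
      * a k (Function.update x 0 (ε * max r 0)))
      ((ε * 1) • (((Real.exp (c * (ε * x 0)) : ℝ) : ℂ)
        * a k (Function.update x 0 (ε * max (ε * x 0) 0)))) (x 0) :=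
    HasDerivAt.scomp (x 0) (h := fun t => ε * t) (hcont.integral_hasStrictDerivAt 0 _).hasDerivAt
      ((hasDerivAt_id (x 0)).const_mul ε)
  have hmax : ε * max (ε * x 0) 0 = x 0 := by
    rw [max_eq_left (mem_Jh_of_mem_dom hx), ← mul_assoc, side_mul_self hε, one_mul]
  rw [hmax, Function.update_eq_self] at h1
  refine (((hasDerivAt_expY (ε := ε) c (x 0)).mul h1).hasDerivWithinAt).congr_deriv ?_
  have he : ((Real.exp (-(c * (ε * x 0))) : ℝ) : ℂ) * ((Real.exp (c * (ε * x 0)) : ℝ) : ℂ) = 1 := by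
    rw [← Complex.ofReal_mul, ← Real.exp_add]; simp
  simp only [Complex.real_smul]
  push_cast at he ⊢
  linear_combination (ε : ℂ) * a k x * he

lemma Tp_zero (k : ℤ) (a : ℤ → (Fin 6 → ℝ) → ℂ) {x : Fin 6 → ℝ} (hx : x 0 = 0) :
    Tp ε κ a k x = 0 := by simp [Tp, hx]

/-- `Tp` commutes with partial derivatives other than the one in `Y₃`. -/
lemma NiceAt.hasPd_Tp_of_ne (hT : 0 < T) (hε : IsSide ε) {a a' : ℤ → (Fin 6 → ℝ) → ℂ} (hδ : 0 ≤ δ)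
    (ha : NiceAt T ε δ a) (ha' : NiceAt T ε δ a') (κ : ℝ) {i : Fin 6} (hi : i ≠ 0) {k : ℤ}
    (h : HasPd (fastBox T (Jh ε)) i (a k) (a' k)) :
    HasPd (fastBox T (Jh ε)) i (Tp ε κ a k) (Tp ε κ a' k) := by
  intro x hx
  by_cases hk : k = 0
  · simp only [Tp, hk, if_true]; exact hasDerivWithinAt_const _ _ _
  simp only [Tp, hk, if_false, Function.update_of_ne (Ne.symm hi)]
  refine HasDerivWithinAt.const_mul _ ?_
  have h0 : 0 ≤ ε * x 0 := mem_Jh_of_mem_dom hx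
  obtain ⟨C, hC0, hC⟩ := ha'.norm_le
  set c := κ * |(k : ℝ)| with hc
  simp only [intervalIntegral.integral_of_le h0]
  have hs := goodBox_fast hT hε
  have key := hasDerivWithinAt_integral (hs.convex i) (hx i)
    (μ := volume.restrict (Set.Ioc 0 (ε * x 0)))
    (F := fun t r => ((Real.exp (c * r) : ℝ) : ℂ)
      * a k (Function.update (Function.update x i t) 0 (ε * max r 0)))
    (F' := fun t r => ((Real.exp (c * r) : ℝ) : ℂ)
      * a' k (Function.update (Function.update x i t) 0 (ε * max r 0)))
    (bound := fun r => Real.exp (c * r) * C)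
    (fun t ht => (ha.continuous_Tp hε k (update_mem_dom hx ht) c).integrableOn_Ioc)
    (Continuous.integrableOn_Ioc (by fun_prop)) ?_ ?_
  · simpa using key
  · refine Filter.Eventually.of_forall fun r t ht => HasDerivWithinAt.const_mul _ ?_
    have hm := update_zero_mem (update_mem_dom hx ht) (mul_mem_Jh hε (le_max_right r 0))
    have h1 := h _ hm
    have e2 : ∀ y, Function.update (Function.update (Function.update x i t) 0 (ε * max r 0)) i y
        = Function.update (Function.update x i y) 0 (ε * max r 0) := fun y => by
      rw [Function.update_comm (Ne.symm hi), Function.update_idem]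
    simp only [e2, Function.update_of_ne hi, Function.update_self] at h1
    exact h1
  · refine Filter.Eventually.of_forall fun r t ht => ?_
    have hm := update_zero_mem (update_mem_dom hx ht) (mul_mem_Jh hε (le_max_right r 0))
    rw [norm_mul, Complex.norm_real, Real.norm_eq_abs, abs_of_pos (Real.exp_pos _)]
    refine mul_le_mul_of_nonneg_left ((hC k _ hm).trans (mul_le_of_le_one_right hC0 ?_))
      (Real.exp_pos _).le
    rw [Real.exp_le_one_iff]
    have := abs_nonneg (Function.update (Function.update x i t) 0 (ε * max r 0) 0)
    nlinarith

/-- The forward solution operator preserves rapid decay. The rate `κ|k|` of the exponential may be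
equal to the rate `δ` of the data, so that half of the rate is given up. The derivative in `Y₃`
produces the data itself, which is why the class that witnesses the claim contains the sums of
multiples of `Tp` and of nice families. -/
lemma NiceAt.Tp (hT : 0 < T) (hε : IsSide ε) (hδ : 0 < δ) (hδκ : δ ≤ κ)
    {a : ℤ → (Fin 6 → ℝ) → ℂ} (ha : NiceAt T ε δ a) : NiceAt T ε (δ / 2) (Tp ε κ a) := by
  have hκ : 0 < κ := hδ.trans_le hδκ
  have hle : δ / 2 ≤ δ := by linarith
  refine ⟨{b | ∃ c a d, PolyGrowth c ∧ NiceAt T ε δ a ∧ NiceAt T ε (δ / 2) d ∧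
      b = (fun k x => c k * FastProblem.Tp ε κ a k x) + d}, ⟨?_, ?_, ?_, ?_⟩,
      fun _ => 1, a, fun k x => 0 * a k x, .const 1, ha, (ha.symbol (.const 0)).mono hle, ?_⟩
  · rintro _ ⟨c, a, d, hc, ha, hd, rfl⟩ k x θ
    simp only [Pi.add_apply, hd.mode, add_mul]
    congr 1
    by_cases hk : k = 0
    · simp [FastProblem.Tp, hk]
    simp only [FastProblem.Tp, hk, if_false]
    have e : ∀ r : ℝ, a k (Function.update (Function.update x 5 θ) 0 (ε * max r 0))
        = a k (Function.update x 0 (ε * max r 0)) * Complex.exp (Complex.I * k * (θ - x 5)) := by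
      intro r
      rw [Function.update_comm (by decide : (5 : Fin 6) ≠ 0),
        ha.mode, Function.update_of_ne (by decide : (5 : Fin 6) ≠ 0)]
    simp only [e, ← mul_assoc]
    rw [intervalIntegral.integral_mul_const, Function.update_of_ne (by decide)]
    ring
  · rintro _ ⟨c, a, d, hc, ha, hd, rfl⟩ k i hi x hx
    have h0 : i ≠ 0 := by rintro rfl; simp [fastBox] at hi
    simp only [Pi.add_apply, niceClass_niceAt.per d hd k i hi x hx]
    congr 2
    by_cases hk : k = 0
    · simp [FastProblem.Tp, hk]
    simp only [FastProblem.Tp, hk, if_false, Function.update_of_ne (Ne.symm h0)]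
    congr 1
    refine intervalIntegral.integral_congr fun r _ => ?_
    have := niceClass_niceAt.per a ha k i hi _ (update_zero_mem hx (mul_mem_Jh hε (le_max_right r 0)))
    rw [Function.update_of_ne h0] at this
    rw [Function.update_comm h0, this]
  · rintro _ ⟨c, a, d, hc, ha, hd, rfl⟩ N
    obtain ⟨m', hm', h'⟩ := hd.bound N
    obtain ⟨C, M, hC, hcb⟩ := hc.nonneg
    obtain ⟨m, hm, h⟩ := ha.bound (M + N)
    refine ⟨(C * (2 / δ)) • m + m', (hm.smul (by positivity)).add hm', fun k x hx => ?_⟩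
    have h1 := one_le_one_add_abs k
    have hp : (0 : ℝ) < (1 + |(k : ℝ)|) ^ N := by positivity
    have hpM : (0 : ℝ) < (1 + |(k : ℝ)|) ^ (M + N) := by positivity
    simp only [Pi.add_apply]
    rw [add_mul]
    refine (mul_le_mul_of_nonneg_right (norm_add_le _ _) hp.le).trans ?_
    rw [add_mul]
    refine add_le_add ?_ (h' k x hx)
    have hm0 := hm.nonneg (Matrix.vecTail x)
    have hT0 : ‖FastProblem.Tp ε κ a k x‖ * (1 + |(k : ℝ)|) ^ (M + N)
        ≤ 2 / δ * (m (Matrix.vecTail x) * Real.exp (-(δ / 2) * |x 0|)) := by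
      by_cases hk : k = 0
      · simp only [FastProblem.Tp, hk, if_true, norm_zero, zero_mul]; positivity
      simp only [FastProblem.Tp, hk, if_false]
      have h0 : 0 ≤ ε * x 0 := mem_Jh_of_mem_dom hx
      have hY := abs_eq_mul_of_mem_Jh hε (mem_Jh_of_mem_dom hx)
      set y := ε * x 0 with hy
      set q := κ * |(k : ℝ)| with hq
      have hqκ : δ ≤ q := by
        have h1 : (1 : ℝ) ≤ |(k : ℝ)| := by exact_mod_cast Int.one_le_abs hk
        nlinarith
      have hint : ‖∫ r in (0 : ℝ)..y, ((Real.exp (q * r) : ℝ) : ℂ)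
          * a k (Function.update x 0 (ε * max r 0))‖
          ≤ m (Matrix.vecTail x) / (1 + |(k : ℝ)|) ^ (M + N) * Real.exp ((q - δ) * y) * |y - 0| := by
        refine intervalIntegral.norm_integral_le_of_norm_le_const fun r hr => ?_
        rw [Set.uIoc_of_le h0] at hr
        have hr0 := hr.1.le
        have h2 := h k _ (update_zero_mem hx (mul_mem_Jh hε (le_max_right r 0)))
        rw [vecTail_update_zero, Function.update_self, max_eq_left hr0, abs_side_mul hε hr0] at h2
        rw [norm_mul, Complex.norm_real, Real.norm_eq_abs, abs_of_pos (Real.exp_pos _),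
          max_eq_left hr0]
        calc Real.exp (q * r) * ‖a k (Function.update x 0 (ε * r))‖
            ≤ Real.exp (q * r) * (m (Matrix.vecTail x) * Real.exp (-δ * r)
                / (1 + |(k : ℝ)|) ^ (M + N)) :=
              mul_le_mul_of_nonneg_left ((le_div_iff₀ hpM).2 h2) (Real.exp_pos _).le
          _ = m (Matrix.vecTail x) / (1 + |(k : ℝ)|) ^ (M + N)
                * (Real.exp (q * r) * Real.exp (-δ * r)) := by ring
          _ = m (Matrix.vecTail x) / (1 + |(k : ℝ)|) ^ (M + N) * Real.exp ((q - δ) * r) := by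
              rw [← Real.exp_add]; congr 2; ring
          _ ≤ _ := mul_le_mul_of_nonneg_left (Real.exp_le_exp.2
              (mul_le_mul_of_nonneg_left hr.2 (by linarith))) (by positivity)
      have hlin : y * Real.exp (-δ * y) ≤ 2 / δ * Real.exp (-(δ / 2) * y) := by
        have h3 := Real.add_one_le_exp (δ / 2 * y)
        have h4 : y ≤ 2 / δ * Real.exp (δ / 2 * y) := by
          rw [div_mul_eq_mul_div, le_div_iff₀ hδ]; linarith
        calc y * Real.exp (-δ * y) ≤ 2 / δ * Real.exp (δ / 2 * y) * Real.exp (-δ * y) :=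
              mul_le_mul_of_nonneg_right h4 (Real.exp_pos _).le
          _ = _ := by rw [mul_assoc, ← Real.exp_add]; congr 2; ring
      rw [norm_mul, Complex.norm_real, Real.norm_eq_abs, abs_of_pos (Real.exp_pos _), hY]
      rw [sub_zero, abs_of_nonneg h0] at hint
      calc _ ≤ Real.exp (-(q * y)) * (m (Matrix.vecTail x) / (1 + |(k : ℝ)|) ^ (M + N)
              * Real.exp ((q - δ) * y) * y) * (1 + |(k : ℝ)|) ^ (M + N) :=
            mul_le_mul_of_nonneg_right (mul_le_mul_of_nonneg_left hint (Real.exp_pos _).le) hpM.le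
        _ = m (Matrix.vecTail x) * (y * (Real.exp (-(q * y)) * Real.exp ((q - δ) * y))) := by
            field_simp
        _ = m (Matrix.vecTail x) * (y * Real.exp (-δ * y)) := by
            rw [← Real.exp_add]; congr 3; ring
        _ ≤ m (Matrix.vecTail x) * (2 / δ * Real.exp (-(δ / 2) * y)) :=
            mul_le_mul_of_nonneg_left hlin hm0
        _ = _ := by ring
    calc ‖c k * FastProblem.Tp ε κ a k x‖ * (1 + |(k : ℝ)|) ^ N
        = ‖c k‖ * (‖FastProblem.Tp ε κ a k x‖ * (1 + |(k : ℝ)|) ^ N) := by rw [norm_mul]; ring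
      _ ≤ (C * (1 + |(k : ℝ)|) ^ M) * (‖FastProblem.Tp ε κ a k x‖ * (1 + |(k : ℝ)|) ^ N) :=
          mul_le_mul_of_nonneg_right (hcb k) (by positivity)
      _ = C * (‖FastProblem.Tp ε κ a k x‖ * (1 + |(k : ℝ)|) ^ (M + N)) := by ring
      _ ≤ C * (2 / δ * (m (Matrix.vecTail x) * Real.exp (-(δ / 2) * |x 0|))) :=
          mul_le_mul_of_nonneg_left hT0 hC
      _ = _ := by simp only [Pi.smul_apply, smul_eq_mul]; ring
  · rintro _ ⟨c, a, d, hc, ha, hd, rfl⟩ i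
    obtain ⟨d', hd', hdd⟩ := hd.pd i
    by_cases hi : i = 0
    · subst hi
      have hind : PolyGrowth fun k : ℤ => c k * ((ε : ℂ) * (if k = 0 then 0 else 1)) := by
        refine hc.mul ((PolyGrowth.const _).mul (.of_bdd (C := 1) fun k => ?_))
        split_ifs <;> simp
      have habs : PolyGrowth fun k : ℤ => c k * ((-(ε * κ) : ℂ) * ((|(k : ℝ)| : ℝ) : ℂ)) :=
        hc.mul ((PolyGrowth.const _).mul polyGrowth_abs)
      refine ⟨_, ⟨_, a, _, habs, ha, ((ha.mono hle).symbol hind).add hd', rfl⟩, fun k => ?_⟩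
      refine (((ha.hasPd_Tp hε κ k).const_mul (c k)).add (hdd k)).congr (fun _ _ => rfl)
        fun x _ => ?_
      simp only [Pi.add_apply]
      push_cast
      split_ifs <;> ring
    · obtain ⟨a', ha', h⟩ := ha.pd i
      exact ⟨_, ⟨c, a', d', hc, ha', hd', rfl⟩, fun k =>
        ((ha.hasPd_Tp_of_ne hT hε hδ.le ha' κ hi (h k)).const_mul (c k)).add (hdd k)⟩
  · ext k x; simp

end

/-! ### Adding and freezing a variable -/

section
variable {n : ℕ} {s : Fin n → Option (Set ℝ)} {J : Set ℝ}
  {E : Type*} [NormedAddCommGroup E] [NormedSpace ℝ E]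

lemma vecTail_update_succ (x : Fin (n + 1) → ℝ) (i : Fin n) (t : ℝ) :
    Matrix.vecTail (Function.update x i.succ t) = Function.update (Matrix.vecTail x) i t := by
  ext j
  by_cases h : j = i
  · subst h; simp [Matrix.vecTail]
  · simp [Matrix.vecTail, h]

lemma vecCons_update_succ (Y : ℝ) (z : Fin n → ℝ) (i : Fin n) (t : ℝ) :
    Function.update (Matrix.vecCons Y z) i.succ t = Matrix.vecCons Y (Function.update z i t) := by
  ext j
  refine Fin.cases ?_ (fun j => ?_) j
  · simp [Function.update_of_ne (Fin.succ_ne_zero i).symm]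
  · by_cases h : j = i
    · subst h; simp
    · simp [h]

lemma HasPd.comp_vecTail {i : Fin n} {f g : (Fin n → ℝ) → E} (h : HasPd s i f g) :
    HasPd (Matrix.vecCons (some J) s) i.succ (fun x => f (Matrix.vecTail x))
      (fun x => g (Matrix.vecTail x)) := fun x hx => by
  simp only [vecTail_update_succ]
  exact h _ (mem_dom_vecTail hx)

lemma hasPd_zero_comp_vecTail (f : (Fin n → ℝ) → E) :
    HasPd (Matrix.vecCons (some J) s) 0 (fun x => f (Matrix.vecTail x)) 0 := fun x _ => by
  have : ∀ t, Matrix.vecTail (Function.update x 0 t) = Matrix.vecTail x := fun t => by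
    ext j; simp [Matrix.vecTail]
  simp only [this]
  exact hasDerivWithinAt_const _ _ _

lemma HasPd.comp_vecCons {i : Fin n} {f g : (Fin (n + 1) → ℝ) → E}
    (h : HasPd (Matrix.vecCons (some J) s) i.succ f g) {Y : ℝ} (hY : Y ∈ J) :
    HasPd s i (fun z => f (Matrix.vecCons Y z)) (fun z => g (Matrix.vecCons Y z)) := fun z hz => by
  have := h _ (mem_dom_cons.2 ⟨hY, hz⟩)
  simp only [vecCons_update_succ] at this
  exact this

lemma contDiff_vecTail : ContDiff ℝ ∞ (fun x : Fin (n + 1) → ℝ => Matrix.vecTail x) :=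
  contDiff_pi.2 fun i => contDiff_apply ℝ ℝ i.succ

lemma contDiff_vecCons (Y : ℝ) : ContDiff ℝ ∞ (fun z : Fin n → ℝ => Matrix.vecCons Y z) :=
  contDiff_pi.2 fun i => by
    refine Fin.cases ?_ (fun j => ?_) i
    · simpa using contDiff_const
    · simpa using contDiff_apply ℝ ℝ j

lemma IsSmoothPer.comp_vecTail {f : (Fin n → ℝ) → ℝ} (hf : IsSmoothPer s f) :
    IsSmoothPer (Matrix.vecCons (some J) s) (fun x => f (Matrix.vecTail x)) := by
  refine ⟨hf.smooth.comp contDiff_vecTail.contDiffOn fun x hx => mem_dom_vecTail hx,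
    fun i hi x hx => ?_⟩
  revert hi
  refine Fin.cases ?_ (fun j => ?_) i
  · simp
  · intro hi
    rw [vecTail_update_succ]
    exact hf.periodic j (by simpa using hi) _ (mem_dom_vecTail hx)

lemma IsSmoothPer.comp_vecCons {f : (Fin (n + 1) → ℝ) → ℝ}
    (hf : IsSmoothPer (Matrix.vecCons (some J) s) f) {Y : ℝ} (hY : Y ∈ J) :
    IsSmoothPer s (fun z => f (Matrix.vecCons Y z)) := by
  refine ⟨hf.smooth.comp (contDiff_vecCons Y).contDiffOn fun z hz => mem_dom_cons.2 ⟨hY, hz⟩,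
    fun i hi z hz => ?_⟩
  have := hf.periodic i.succ (by simpa using hi) _ (mem_dom_cons.2 ⟨hY, hz⟩)
  rwa [vecCons_update_succ] at this

lemma mode_comp_vecTail (f : (Fin (n + 1) → ℝ) → ℝ) (k : ℤ) (x : Fin (n + 2) → ℝ) :
    mode (fun x => f (Matrix.vecTail x)) k x = mode f k (Matrix.vecTail x) := by
  simp only [mode, ← Fin.succ_last, vecTail_update_succ]

lemma mode_comp_vecCons (f : (Fin (n + 2) → ℝ) → ℝ) (k : ℤ) (Y : ℝ) (z : Fin (n + 1) → ℝ) :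
    mode (fun z => f (Matrix.vecCons Y z)) k z = mode f k (Matrix.vecCons Y z) := by
  simp only [mode, ← Fin.succ_last, vecCons_update_succ]

end

/-! ### Functions with vanishing derivative, or with given derivative, in `θ` -/

section
variable {n : ℕ} {s : Fin (n + 1) → Option (Set ℝ)}

lemma update_last_eq_of_pd (hθ : s (Fin.last n) = none) {f : (Fin (n + 1) → ℝ) → ℝ}
    (hf : IsSmoothPer s f) {x : Fin (n + 1) → ℝ} (hx : x ∈ dom s)
    (h : ∀ θ, pd s (Fin.last n) f (Function.update x (Fin.last n) θ) = 0) (θ : ℝ) :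
    f (Function.update x (Fin.last n) θ) = f x := by
  have hd := fun θ => (hasPd_pd hf.smooth (Fin.last n)).hasDerivAt_line hθ hx θ
  have := is_const_of_deriv_eq_zero (fun θ => (hd θ).differentiableAt)
    (fun θ => by rw [(hd θ).deriv, h]) θ (x (Fin.last n))
  simpa using this

lemma mean_eq_of_update {f : (Fin (n + 1) → ℝ) → ℝ} {x : Fin (n + 1) → ℝ} {c : ℝ}
    (h : ∀ θ, f (Function.update x (Fin.last n) θ) = c) : mean f x = c := by
  have := Real.pi_pos
  simp only [mean, h, intervalIntegral.integral_const, sub_zero, smul_eq_mul]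
  field_simp

lemma mean_update (f : (Fin (n + 1) → ℝ) → ℝ) (x : Fin (n + 1) → ℝ) (θ : ℝ) :
    mean f (Function.update x (Fin.last n) θ) = mean f x := by
  simp [mean]

lemma mean_pd_last (hs : GoodBox s) (hθ : s (Fin.last n) = none) {f : (Fin (n + 1) → ℝ) → ℝ}
    (hf : IsSmoothPer s f) {x : Fin (n + 1) → ℝ} (hx : x ∈ dom s) :
    mean (pd s (Fin.last n) f) x = 0 := by
  have := mode_pd_last hs hθ hf 0 hx
  rw [mode_zero_eq_mean] at this
  simpa using this

lemma mean_congr (hθ : s (Fin.last n) = none) {f g : (Fin (n + 1) → ℝ) → ℝ}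
    (h : Set.EqOn f g (dom s)) {x : Fin (n + 1) → ℝ} (hx : x ∈ dom s) :
    mean f x = mean g x := by
  have := mode_congr hθ h 0 hx
  rw [mode_zero_eq_mean, mode_zero_eq_mean] at this
  exact_mod_cast this

lemma mean_add (hθ : s (Fin.last n) = none) {f g : (Fin (n + 1) → ℝ) → ℝ}
    (hf : ContinuousOn f (dom s)) (hg : ContinuousOn g (dom s)) {x : Fin (n + 1) → ℝ}
    (hx : x ∈ dom s) : mean (f + g) x = mean f x + mean g x := by
  have := mode_add hθ hf hg 0 hx
  simp only [mode_zero_eq_mean] at this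
  exact_mod_cast this

/-- Only the mean survives if all other Fourier coefficients vanish. -/
lemma eq_mean_of_mode (hs : GoodBox s) (hθ : s (Fin.last n) = none) {f : (Fin (n + 1) → ℝ) → ℝ}
    (hf : IsSmoothPer s f) {x : Fin (n + 1) → ℝ} (hx : x ∈ dom s)
    (h : ∀ k : ℤ, k ≠ 0 → mode f k x = 0) : f x = mean f x := by
  have h1 := hasSum_mode hs hθ hf hx
  have h2 := hasSum_single (f := fun k : ℤ => mode f k x * Complex.exp (Complex.I * k * x (Fin.last n)))
    0 (fun k hk => by simp [h k hk])
  have h3 := h1.unique h2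
  simp only [Int.cast_zero, mul_zero, zero_mul, Complex.exp_zero, mul_one, mode_zero_eq_mean] at h3
  exact_mod_cast h3

/-- Translation in `θ`. -/
def shiftLast (r : ℝ) (x : Fin (n + 1) → ℝ) : Fin (n + 1) → ℝ :=
  Function.update x (Fin.last n) (x (Fin.last n) + r)

/-- The periodic antiderivative in `θ` of `f - mean f`. -/
def antiθ (f : (Fin (n + 1) → ℝ) → ℝ) (x : Fin (n + 1) → ℝ) : ℝ :=
  (2 * Real.pi)⁻¹ * ∫ r in (0 : ℝ)..(2 * Real.pi), (r - Real.pi) * f (shiftLast r x)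

lemma shiftLast_mem (hθ : s (Fin.last n) = none) {x : Fin (n + 1) → ℝ} (hx : x ∈ dom s) (r : ℝ) :
    shiftLast r x ∈ dom s := update_last_mem hθ hx _

lemma HasPd.shiftLast (hθ : s (Fin.last n) = none) {f g : (Fin (n + 1) → ℝ) → ℝ}
    {i : Fin (n + 1)} (h : HasPd s i f g) (r : ℝ) :
    HasPd s i (fun x => f (shiftLast r x)) (fun x => g (shiftLast r x)) := by
  intro x hx
  have h1 := h _ (shiftLast_mem hθ hx r)
  by_cases hi : i = Fin.last n
  · subst hi
    have hu : fac s (Fin.last n) = Set.univ := fac_none hθ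
    rw [hu, hasDerivWithinAt_univ] at h1 ⊢
    simp only [FastProblem.shiftLast, Function.update_idem, Function.update_self] at h1 ⊢
    exact h1.comp_add_const (x (Fin.last n)) r
  · simp only [FastProblem.shiftLast, Function.update_of_ne (Ne.symm hi)] at h1 ⊢
    rw [Function.update_of_ne hi] at h1
    simpa only [Function.update_comm hi] using h1

lemma continuous_shiftLast : Continuous fun q : ℝ × (Fin (n + 1) → ℝ) => shiftLast q.1 q.2 := by
  refine continuous_pi fun i => ?_
  by_cases hi : i = Fin.last n
  · subst hi; simp only [shiftLast, Function.update_self]; fun_prop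
  · simp only [shiftLast, Function.update_of_ne hi]; fun_prop

lemma continuous_shiftLast_line (hθ : s (Fin.last n) = none) {f : (Fin (n + 1) → ℝ) → ℝ}
    (hf : ContinuousOn f (dom s)) {x : Fin (n + 1) → ℝ} (hx : x ∈ dom s) :
    Continuous fun r => f (shiftLast r x) :=
  hf.comp_continuous (continuous_shiftLast.comp (by fun_prop : Continuous fun r : ℝ => (r, x)))
    fun r => shiftLast_mem hθ hx r

lemma hasPd_antiθ (hs : GoodBox s) (hθ : s (Fin.last n) = none) {f g : (Fin (n + 1) → ℝ) → ℝ}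
    {i : Fin (n + 1)} (h : HasPd s i f g) (hf : ContinuousOn f (dom s))
    (hg : ContinuousOn g (dom s)) : HasPd s i (antiθ f) (antiθ g) := by
  intro x hx
  have key := hasDerivWithinAt_intervalIntegral (hs.convex i) (hs.closed i) (hx i)
    (F := fun t r => (r - Real.pi) * f (shiftLast r (Function.update x i t)))
    (F' := fun t r => (r - Real.pi) * g (shiftLast r (Function.update x i t)))
    (a := 0) (b := 2 * Real.pi) (by positivity)
    (fun t ht => (Continuous.mul (by fun_prop)
      (continuous_shiftLast_line hθ hf (update_mem_dom hx ht))).continuousOn) ?_ ?_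
  · simpa [antiθ] using key.const_mul (2 * Real.pi)⁻¹
  · intro r _ t ht
    have := (h.shiftLast hθ r) _ (update_mem_dom hx ht)
    simp only [Function.update_idem, Function.update_self] at this
    exact this.const_mul _
  · refine ContinuousOn.mul (by fun_prop) (hg.comp ?_ ?_)
    · refine (continuous_shiftLast.comp (Continuous.prodMk continuous_snd ?_)).continuousOn
      exact continuous_const.update i continuous_fst
    · rintro ⟨t, r⟩ ⟨ht, -⟩
      exact shiftLast_mem hθ (update_mem_dom hx ht) r

lemma antiθ_pd_last (hθ : s (Fin.last n) = none) {f : (Fin (n + 1) → ℝ) → ℝ}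
    (hs : GoodBox s) (hf : IsSmoothPer s f) {x : Fin (n + 1) → ℝ} (hx : x ∈ dom s) :
    antiθ (pd s (Fin.last n) f) x = f x - mean f x := by
  have hd := fun r => (hasPd_pd hf.smooth (Fin.last n)).hasDerivAt_line hθ hx (x (Fin.last n) + r)
  have hd' : ∀ r, HasDerivAt (fun r => f (shiftLast r x))
      (pd s (Fin.last n) f (shiftLast r x)) r := fun r => by
    simpa [shiftLast] using (hd r).comp_const_add (x (Fin.last n)) r
  have hc' := continuous_shiftLast_line hθ (contDiffOn_pd hs hf.smooth (Fin.last n)).continuousOn hx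
  have hc := continuous_shiftLast_line hθ hf.smooth.continuousOn hx
  have hp := hf.periodic_last hθ hx
  have hparts := intervalIntegral.integral_mul_deriv_eq_deriv_mul (a := 0) (b := 2 * Real.pi)
    (u := fun r => r - Real.pi) (u' := fun _ => 1) (v := fun r => f (shiftLast r x))
    (fun r _ => (hasDerivAt_id r).sub_const _) (fun r _ => hd' r)
    (by simp) (hc'.intervalIntegrable _ _)
  have e1 : f (shiftLast (2 * Real.pi) x) = f x := by
    have := hp (x (Fin.last n)); simpa [shiftLast] using this
  have e2 : f (shiftLast 0 x) = f x := by simp [shiftLast]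
  have e3 : ∫ r in (0 : ℝ)..(2 * Real.pi), f (shiftLast r x)
      = ∫ θ in (0 : ℝ)..(2 * Real.pi), f (Function.update x (Fin.last n) θ) := by
    have h1 := intervalIntegral.integral_comp_add_left
      (fun θ => f (Function.update x (Fin.last n) θ)) (a := 0) (b := 2 * Real.pi) (x (Fin.last n))
    have h2 := hp.intervalIntegral_add_eq (x (Fin.last n)) 0
    simp only [shiftLast]
    rw [h1, add_zero, h2, zero_add]
  rw [antiθ, hparts, mean, e1, e2]
  simp only [one_mul]
  rw [e3]
  have := Real.pi_pos
  field_simp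
  ring

/-- A function with zero mean has an antiderivative in `θ` with zero mean. -/
lemma IsHInf.exists_antideriv (hs : GoodBox s) (hθ : s (Fin.last n) = none)
    {f : (Fin (n + 1) → ℝ) → ℝ} (hf : IsHInf s f) (h0 : ∀ x ∈ dom s, mean f x = 0) :
    ∃ g, IsHInf s g ∧ (∀ x ∈ dom s, mean g x = 0) ∧
      Set.EqOn (FastProblem.pd s (Fin.last n) g) f (dom s) := by
  have hanti : ∀ f, IsHInf s f → IsHInf s (antiθ f) := by
    intro f hf
    refine IsHInf.of_class hs (C := {g | ∃ f, IsHInf s f ∧ g = antiθ f}) ?_ ?_ ?_ ?_ ⟨f, hf, rfl⟩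
    · rintro _ ⟨f, hf, rfl⟩
      rw [continuousOn_iff_continuous_domRestrict]
      refine Continuous.mul continuous_const
        (intervalIntegral.continuous_parametric_intervalIntegral_of_continuous'
          (f := fun (x : dom s) r => (r - Real.pi) * f (shiftLast r x)) ?_ _ _)
      have h1 : Continuous fun q : dom s × ℝ => f (shiftLast q.2 q.1) :=
        hf.smoothPer.smooth.continuousOn.comp_continuous
          (continuous_shiftLast.comp (continuous_snd.prodMk (continuous_subtype_val.comp
            continuous_fst))) fun q => shiftLast_mem hθ q.1.2 _
      exact Continuous.mul (by fun_prop) h1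
    · rintro _ ⟨f, hf, rfl⟩ i
      exact ⟨_, ⟨_, hf.pd hs i, rfl⟩, hasPd_antiθ hs hθ (hasPd_pd hf.smoothPer.smooth i)
        hf.smoothPer.smooth.continuousOn (hf.pd hs i).smoothPer.smooth.continuousOn⟩
    · rintro _ ⟨f, hf, rfl⟩ i hi x hx
      simp only [antiθ]
      congr 1
      refine intervalIntegral.integral_congr fun r _ => ?_
      have := hf.smoothPer.periodic i hi _ (shiftLast_mem hθ hx r)
      congr 1
      rw [← this]
      congr 1
      by_cases hl : i = Fin.last n
      · subst hl; simp only [shiftLast, Function.update_idem, Function.update_self]; congr 1; ring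
      · simp only [shiftLast, Function.update_of_ne (Ne.symm hl), Function.update_of_ne hl]
        rw [Function.update_comm hl]
    · rintro _ ⟨f, hf, rfl⟩
      obtain ⟨m, hm, h⟩ := hf.exists_maj hs hθ []
      refine ⟨Real.pi • m, hm.smul Real.pi_pos.le, fun x hx => ?_⟩
      have hb := intervalIntegral.norm_integral_le_of_norm_le_const (a := 0) (b := 2 * Real.pi)
        (f := fun r => (r - Real.pi) * f (shiftLast r x)) (C := Real.pi * m x) fun r hr => by
          rw [Set.uIoc_of_le (by positivity)] at hr
          rw [norm_mul, Real.norm_eq_abs, Real.norm_eq_abs]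
          refine mul_le_mul (abs_le.2 ⟨by linarith [hr.1], by linarith [hr.2]⟩) ?_ (abs_nonneg _)
            Real.pi_pos.le
          have := h _ (shiftLast_mem hθ hx r)
          rwa [shiftLast, hm.indep] at this
      have hpi := Real.pi_pos
      rw [antiθ, abs_mul, abs_of_pos (by positivity)]
      rw [sub_zero, abs_of_pos (by positivity), Real.norm_eq_abs] at hb
      rw [Pi.smul_apply, smul_eq_mul, inv_mul_le_iff₀ (by positivity)]
      linarith
  have hf1 := hanti f hf
  have hf2 := hanti _ hf1
  have hpd : ∀ f, IsHInf s f → HasPd s (Fin.last n) (antiθ f) (f - mean f) := fun f hf =>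
    (hasPd_antiθ hs hθ (hasPd_pd hf.smoothPer.smooth _) hf.smoothPer.smooth.continuousOn
      (hf.pd hs _).smoothPer.smooth.continuousOn).congr (fun _ _ => rfl)
      fun x hx => (antiθ_pd_last hθ hs hf.smoothPer hx).symm
  refine ⟨FastProblem.pd s (Fin.last n) (antiθ (antiθ f)), hf2.pd hs _,
    fun x hx => mean_pd_last hs hθ hf2.smoothPer hx, ?_⟩
  refine HasPd.eqOn_pd hs (hf2.pd hs _).smoothPer.smooth ?_
  have h1 := (hpd _ hf1).eqOn_pd hs hf2.smoothPer.smooth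
  have hmean : HasPd s (Fin.last n) (mean (antiθ f)) 0 := fun x _ => by
    simp only [mean_update]; exact hasDerivWithinAt_const _ _ _
  refine ((hpd f hf).sub hmean).congr h1 fun x hx => ?_
  simp [h0 x hx]

end

/-! ### Vector space structure and zero functions -/

section
variable {n : ℕ} {s : Fin (n + 1) → Option (Set ℝ)} {T ε : ℝ}

lemma L2Maj.zero : L2Maj s 0 := ⟨fun _ => le_rfl, fun _ _ => rfl, MemLp.zero⟩

lemma IsHInf.zero (hs : GoodBox s) : IsHInf s 0 := by
  refine IsHInf.of_class hs (C := {0}) ?_ ?_ ?_ ?_ rfl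
  · rintro _ rfl; exact continuousOn_const
  · rintro _ rfl i; exact ⟨0, rfl, fun x _ => hasDerivWithinAt_const _ _ _⟩
  · rintro _ rfl; simp
  · rintro _ rfl; exact ⟨0, L2Maj.zero, by simp⟩

lemma InStar.smoothPer {J : Set ℝ} {f : (Fin 6 → ℝ) → ℝ} (hf : InStar T J f) :
    IsSmoothPer (fastBox T J) f := hf.hInf.smoothPer

lemma InStar.congr (hT : 0 < T) (hε : IsSide ε) {f g : (Fin 6 → ℝ) → ℝ} (hf : InStar T (Jh ε) f)
    (h : Set.EqOn g f (dom (fastBox T (Jh ε)))) : InStar T (Jh ε) g := by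
  refine ⟨hf.hInf.congr (goodBox_fast hT hε) h, ?_⟩
  obtain ⟨δ, hδ, hd⟩ := hf.decay
  refine ⟨δ, hδ, fun l => ?_⟩
  obtain ⟨C, h1, h2⟩ := hd l
  have hl := iterPd_congr h l
  refine ⟨C, fun x hx => by rw [hl hx]; exact h1 x hx, fun Y hY => ?_⟩
  refine le_trans (le_of_eq (eLpNorm_congr_ae ?_)) (h2 Y hY)
  refine (ae_restrict_iff' (goodBox_slow hT hε).measurableSet_cell).2
    (Filter.Eventually.of_forall fun z hz => ?_)
  exact hl (mem_dom_fast.2 ⟨hY, cell_subset_dom hz⟩)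

lemma InStar.pd (hT : 0 < T) (hε : IsSide ε) {f : (Fin 6 → ℝ) → ℝ} (hf : InStar T (Jh ε) f)
    (i : Fin 6) : InStar T (Jh ε) (pd (fastBox T (Jh ε)) i f) := by
  refine ⟨hf.hInf.pd (goodBox_fast hT hε) i, ?_⟩
  obtain ⟨δ, hδ, hd⟩ := hf.decay
  refine ⟨δ, hδ, fun l => ?_⟩
  have := hd (l ++ [i])
  simp only [iterPd_append] at this
  exact this

/-- Finitely many surface wave functions have Fourier components of a common decay rate. -/
lemma exists_common_niceAt (hT : 0 < T) (hε : IsSide ε) {ι : Type*} [Finite ι]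
    {F : ι → (Fin 6 → ℝ) → ℝ} (hF : ∀ i, InStar T (Jh ε) (F i)) {κ : ℝ} (hκ : 0 < κ) :
    ∃ δ, 0 < δ ∧ δ ≤ κ ∧ ∀ i, NiceAt T ε δ (comp (F i)) := by
  choose d hd hn using fun i => (hF i).niceAt_comp hT hε
  obtain ⟨o, ho⟩ := Finite.exists_min (fun o : Option ι => o.elim κ d)
  refine ⟨o.elim κ d, ?_, ho none, fun i => (hn i).mono (ho (some i))⟩
  cases o
  exacts [hκ, hd _]

lemma summable_comp (hT : 0 < T) (hε : IsSide ε) {f : (Fin 6 → ℝ) → ℝ}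
    (hf : IsSmoothPer (fastBox T (Jh ε)) f) {x : Fin 6 → ℝ} (hx : x ∈ dom (fastBox T (Jh ε))) :
    Summable fun k => comp f k x :=
  (hasSum_comp (goodBox_fast hT hε) (fastBox_last _) hf hx).summable

lemma NiceAt.zero {δ : ℝ} : NiceAt T ε δ (fun _ _ => 0) := by
  refine ⟨{fun _ _ => 0}, ⟨?_, ?_, ?_, ?_⟩, rfl⟩
  · rintro _ rfl; simp
  · rintro _ rfl; simp
  · rintro _ rfl N
    exact ⟨0, ⟨L2Maj.zero, 0, fun _ => le_rfl⟩, by simp⟩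
  · rintro _ rfl i; exact ⟨_, rfl, fun k x _ => hasDerivWithinAt_const _ _ _⟩

lemma NiceAt.sum {δ : ℝ} {ι : Type*} [Fintype ι] {a : ι → ℤ → (Fin 6 → ℝ) → ℂ}
    (ha : ∀ i, NiceAt T ε δ (a i)) (c : ι → ℂ) :
    NiceAt T ε δ (fun k x => ∑ i, c i * a i k x) := by
  classical
  suffices ∀ t : Finset ι, NiceAt T ε δ (fun k x => ∑ i ∈ t, c i * a i k x) from this _
  intro t
  induction t using Finset.induction_on with
  | empty => simpa using NiceAt.zero
  | insert i t hi ih =>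
    simp only [Finset.sum_insert hi]
    exact ((ha i).symbol (.const (c i))).add ih

lemma InStar.sum (hT : 0 < T) (hε : IsSide ε) {ι : Type*} [Fintype ι]
    {F : ι → (Fin 6 → ℝ) → ℝ} (hF : ∀ i, InStar T (Jh ε) (F i)) (c : ι → ℝ) :
    InStar T (Jh ε) (fun x => ∑ i, c i * F i x) := by
  obtain ⟨δ, hδ, -, hn⟩ := exists_common_niceAt hT hε hF one_pos
  refine ((NiceAt.sum hn fun i => (c i : ℂ)).inStar_syn hT hε hδ).congr hT hε fun x hx => ?_
  rw [← syn_linear (a := fun i => comp (F i)) (fun i => summable_comp hT hε (hF i).smoothPer hx) c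
    (fun k => rfl)]
  exact Finset.sum_congr rfl fun i _ => by rw [syn_comp hT hε (hF i).smoothPer hx]

lemma InStar.zero (hT : 0 < T) (hε : IsSide ε) : InStar T (Jh ε) 0 :=
  (InStar.sum hT hε (ι := Empty) (F := fun e => e.elim) (fun e => e.elim) (fun e => e.elim)).congr
    hT hε fun x _ => by simp

lemma InStar.sub (hT : 0 < T) (hε : IsSide ε) {f g : (Fin 6 → ℝ) → ℝ} (hf : InStar T (Jh ε) f)
    (hg : InStar T (Jh ε) g) : InStar T (Jh ε) (f - g) :=
  (InStar.sum hT hε (F := ![f, g]) (Fin.forall_fin_two.2 ⟨hf, hg⟩) ![1, -1]).congr hT hε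
    fun x _ => by simp [Fin.sum_univ_two, sub_eq_add_neg]

lemma InStar.abs_le {J : Set ℝ} {f : (Fin 6 → ℝ) → ℝ} (hf : InStar T J f) :
    ∃ δ > 0, ∃ C : ℝ, ∀ x ∈ dom (fastBox T J), |f x| ≤ C * Real.exp (-δ * |x 0|) := by
  obtain ⟨δ, hδ, h⟩ := hf.decay
  obtain ⟨C, hC, -⟩ := h []
  exact ⟨δ, hδ, C, hC⟩

lemma InStar.inStarPressure (hT : 0 < T) (hε : IsSide ε) {f : (Fin 6 → ℝ) → ℝ}
    (hf : InStar T (Jh ε) f) : InStarPressure T (Jh ε) f :=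
  ⟨hf.smoothPer, hf.abs_le, fun i _ => hf.pd hT hε i⟩

lemma IsHInf.inResPressure (hT : 0 < T) (hε : IsSide ε) {f : (Fin 5 → ℝ) → ℝ}
    (hf : IsHInf (slowBox T (Jh ε)) f) : InResPressure T (Jh ε) f :=
  ⟨hf.smoothPer, fun i _ => hf.pd (goodBox_slow hT hε) i⟩

lemma decay_sub {J : Set ℝ} {f g : (Fin 6 → ℝ) → ℝ}
    (hf : ∃ δ > 0, ∃ C : ℝ, ∀ x ∈ dom (fastBox T J), |f x| ≤ C * Real.exp (-δ * |x 0|))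
    (hg : ∃ δ > 0, ∃ C : ℝ, ∀ x ∈ dom (fastBox T J), |g x| ≤ C * Real.exp (-δ * |x 0|)) :
    ∃ δ > 0, ∃ C : ℝ, ∀ x ∈ dom (fastBox T J), |(f - g) x| ≤ C * Real.exp (-δ * |x 0|) := by
  obtain ⟨δ, hδ, C, hC⟩ := hf
  obtain ⟨δ', hδ', C', hC'⟩ := hg
  refine ⟨min δ δ', lt_min hδ hδ', |C| + |C'|, fun x hx => ?_⟩
  have h1 : Real.exp (-δ * |x 0|) ≤ Real.exp (-(min δ δ') * |x 0|) :=
    Real.exp_le_exp.2 (by nlinarith [min_le_left δ δ', abs_nonneg (x 0)])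
  have h2 : Real.exp (-δ' * |x 0|) ≤ Real.exp (-(min δ δ') * |x 0|) :=
    Real.exp_le_exp.2 (by nlinarith [min_le_right δ δ', abs_nonneg (x 0)])
  have h3 : |f x| ≤ |C| * Real.exp (-(min δ δ') * |x 0|) := (hC x hx).trans
    (mul_le_mul (le_abs_self C) h1 (Real.exp_pos _).le (abs_nonneg C))
  have h4 : |g x| ≤ |C'| * Real.exp (-(min δ δ') * |x 0|) := (hC' x hx).trans
    (mul_le_mul (le_abs_self C') h2 (Real.exp_pos _).le (abs_nonneg C'))
  rw [add_mul]
  exact (abs_sub _ _).trans (add_le_add h3 h4)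

lemma InStarPressure.sub (hT : 0 < T) (hε : IsSide ε) {f g : (Fin 6 → ℝ) → ℝ}
    (hf : InStarPressure T (Jh ε) f) (hg : InStarPressure T (Jh ε) g) :
    InStarPressure T (Jh ε) (f - g) := by
  have hs := goodBox_fast hT hε
  refine ⟨hf.smoothPer.sub hg.smoothPer, decay_sub hf.decay hg.decay, fun i hi => ?_⟩
  exact ((hf.grad i hi).sub hT hε (hg.grad i hi)).congr hT hε
    (((hasPd_pd hf.smoothPer.smooth i).sub (hasPd_pd hg.smoothPer.smooth i)).eqOn_pd hs
      (hf.smoothPer.sub hg.smoothPer).smooth)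

lemma InResPressure.sub (hT : 0 < T) (hε : IsSide ε) {f g : (Fin 5 → ℝ) → ℝ}
    (hf : InResPressure T (Jh ε) f) (hg : InResPressure T (Jh ε) g) :
    InResPressure T (Jh ε) (f - g) := by
  have hs := goodBox_slow hT hε
  refine ⟨hf.smoothPer.sub hg.smoothPer, fun i hi => ?_⟩
  exact ((hf.grad i hi).sub hs (hg.grad i hi)).congr hs
    (((hasPd_pd hf.smoothPer.smooth i).sub (hasPd_pd hg.smoothPer.smooth i)).eqOn_pd hs
      (hf.smoothPer.sub hg.smoothPer).smooth)

lemma InSPlus.sub (hT : 0 < T) {U U' : Fin 7 → Profile} (hU : InSPlus T U) (hU' : InSPlus T U') :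
    InSPlus T (U - U') := by
  obtain ⟨⟨a1, a2⟩, a3, a4⟩ := hU
  obtain ⟨⟨b1, b2⟩, b3, b4⟩ := hU'
  rw [InSPlus, InResPlus, InStarPlus]
  rw [Jp_eq] at *
  exact ⟨⟨fun i hi => (a1 i hi).sub (goodBox_slow hT (.inl rfl)) (b1 i hi),
    a2.sub hT (.inl rfl) b2⟩, fun i hi => (a3 i hi).sub hT (.inl rfl) (b3 i hi),
    a4.sub hT (.inl rfl) b4⟩

lemma InSMinus.sub (hT : 0 < T) {V V' : Fin 6 → Profile} (hV : InSMinus T V) (hV' : InSMinus T V') :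
    InSMinus T (V - V') := by
  intro i
  have h1 := hV i
  have h2 := hV' i
  rw [InS, Jm_eq] at *
  exact ⟨h1.1.sub (goodBox_slow hT (.inr rfl)) h2.1, h1.2.sub hT (.inr rfl) h2.2⟩

end

/-! ### Profiles -/

/-- What the components of `S^±`, the total pressure included, have in common: smoothness, and
exponential decay of the surface wave component itself. -/
structure IsProfile (T : ℝ) (J : Set ℝ) (P : Profile) : Prop where
  res : IsSmoothPer (slowBox T J) P.1
  star : IsSmoothPer (fastBox T J) P.2
  decay : ∃ δ > 0, ∃ C : ℝ, ∀ x ∈ dom (fastBox T J), |P.2 x| ≤ C * Real.exp (-δ * |x 0|)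

lemma InS.isProfile {T : ℝ} {J : Set ℝ} {P : Profile} (h : InS T J P) : IsProfile T J P :=
  ⟨h.1.smoothPer, h.2.smoothPer, h.2.abs_le⟩

lemma InSPlus.isProfile {T : ℝ} {U : Fin 7 → Profile} (h : InSPlus T U) (i : Fin 7) :
    IsProfile T Jp (U i) := by
  by_cases hi : i = 6
  · subst hi; exact ⟨h.1.2.smoothPer, h.2.2.smoothPer, h.2.2.decay⟩
  · exact InS.isProfile ⟨h.1.1 i hi, h.2.1 i hi⟩

lemma InSMinus.isProfile {T : ℝ} {V : Fin 6 → Profile} (h : InSMinus T V) (i : Fin 6) :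
    IsProfile T Jm (V i) := (h i).isProfile

namespace IsProfile
variable {T ε : ℝ} {P Q : Profile}

lemma smoothPer_val {J : Set ℝ} (h : IsProfile T J P) : IsSmoothPer (fastBox T J) (val P) :=
  h.res.comp_vecTail.add h.star

lemma hasPd_dY {J : Set ℝ} (h : IsProfile T J P) : HasPd (fastBox T J) 0 (val P) (dY T J P) :=
  hasPd_pd h.smoothPer_val.smooth 0

lemma hasPd_dθ {J : Set ℝ} (h : IsProfile T J P) : HasPd (fastBox T J) 5 (val P) (dθ T J P) :=
  hasPd_pd h.smoothPer_val.smooth 5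

lemma dY_eq (hT : 0 < T) (hε : IsSide ε) (h : IsProfile T (Jh ε) P) :
    Set.EqOn (dY T (Jh ε) P) (pd (fastBox T (Jh ε)) 0 P.2) (dom (fastBox T (Jh ε))) :=
  HasPd.eqOn_pd (goodBox_fast hT hε) h.smoothPer_val.smooth
    (((hasPd_zero_comp_vecTail P.1).add (hasPd_pd h.star.smooth 0)).congr (fun _ _ => rfl)
      fun x _ => by simp)

lemma dθ_eq (hT : 0 < T) (hε : IsSide ε) (h : IsProfile T (Jh ε) P) :
    Set.EqOn (dθ T (Jh ε) P)
      (fun x => pd (slowBox T (Jh ε)) 4 P.1 (Matrix.vecTail x) + pd (fastBox T (Jh ε)) 5 P.2 x)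
      (dom (fastBox T (Jh ε))) :=
  HasPd.eqOn_pd (goodBox_fast hT hε) h.smoothPer_val.smooth
    ((hasPd_pd h.res.smooth 4).comp_vecTail.add (hasPd_pd h.star.smooth 5))

lemma mode_val (h : IsProfile T (Jh ε) P) (k : ℤ) {x : Fin 6 → ℝ}
    (hx : x ∈ dom (fastBox T (Jh ε))) :
    mode (val P) k x = mode P.1 k (Matrix.vecTail x) + mode P.2 k x := by
  rw [← mode_comp_vecTail]
  exact mode_add (fastBox_last _) h.res.comp_vecTail.smooth.continuousOn
    h.star.smooth.continuousOn k hx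

lemma mode_dθ (hT : 0 < T) (hε : IsSide ε) (h : IsProfile T (Jh ε) P) (k : ℤ) {x : Fin 6 → ℝ}
    (hx : x ∈ dom (fastBox T (Jh ε))) :
    mode (dθ T (Jh ε) P) k x = Complex.I * k * mode (val P) k x :=
  mode_pd_last (goodBox_fast hT hε) (fastBox_last _) h.smoothPer_val k hx

/-- The point over `z` at distance `r` from the interface in the fast variable. -/
lemma mem_ray (hε : IsSide ε) {z : Fin 5 → ℝ} (hz : z ∈ dom (slowBox T (Jh ε))) {r : ℝ}
    (hr : 0 ≤ r) : Matrix.vecCons (ε * r) z ∈ dom (fastBox T (Jh ε)) :=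
  mem_dom_fast.2 ⟨mul_mem_Jh hε hr, hz⟩

lemma tendsto_exp_neg {δ : ℝ} (hδ : 0 < δ) (C : ℝ) :
    Filter.Tendsto (fun r : ℝ => C * Real.exp (-δ * r)) Filter.atTop (nhds 0) := by
  have : Filter.Tendsto (fun r : ℝ => C * Real.exp (-δ * r)) Filter.atTop (nhds (C * 0)) :=
    Filter.Tendsto.const_mul _ (Real.tendsto_exp_atBot.comp
      (Filter.tendsto_id.const_mul_atTop_of_neg (by linarith)))
  simpa using this

lemma tendsto_mode_star (hε : IsSide ε) (h : IsProfile T (Jh ε) P) (k : ℤ)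
    {z : Fin 5 → ℝ} (hz : z ∈ dom (slowBox T (Jh ε))) :
    Filter.Tendsto (fun r : ℝ => mode P.2 k (Matrix.vecCons (ε * r) z)) Filter.atTop (nhds 0) := by
  obtain ⟨δ, hδ, C, hC⟩ := h.decay
  refine squeeze_zero_norm' ?_ (tendsto_exp_neg hδ C)
  filter_upwards [Filter.eventually_ge_atTop 0] with r hr
  refine norm_mode_le (fun θ => ?_) k
  have := hC _ (update_last_mem (fastBox_last _) (mem_ray hε hz hr) θ)
  rwa [Function.update_of_ne (by decide), Matrix.cons_val_zero, abs_side_mul hε hr] at this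

lemma tendsto_mode_val (hε : IsSide ε) (h : IsProfile T (Jh ε) P) (k : ℤ)
    {z : Fin 5 → ℝ} (hz : z ∈ dom (slowBox T (Jh ε))) :
    Filter.Tendsto (fun r : ℝ => mode (val P) k (Matrix.vecCons (ε * r) z)) Filter.atTop
      (nhds (mode P.1 k z)) := by
  have := (h.tendsto_mode_star hε k hz).const_add (mode P.1 k z)
  rw [add_zero] at this
  refine this.congr' ?_
  filter_upwards [Filter.eventually_ge_atTop 0] with r hr
  rw [h.mode_val k (mem_ray hε hz hr)]
  rfl

lemma hasDeriv_mode (hT : 0 < T) (hε : IsSide ε) (h : IsProfile T (Jh ε) P) (k : ℤ)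
    {z : Fin 5 → ℝ} (hz : z ∈ dom (slowBox T (Jh ε))) {r : ℝ} (hr : 0 ≤ r) :
    HasDerivWithinAt (fun r => mode (val P) k (Matrix.vecCons (ε * r) z))
      (ε * mode (dY T (Jh ε) P) k (Matrix.vecCons (ε * r) z)) (Set.Ici 0) r := by
  have hs := goodBox_fast hT hε
  have h1 := hasPd_mode hs (fastBox_last _) (by decide) h.hasPd_dY
    h.smoothPer_val.smooth.continuousOn (contDiffOn_pd hs h.smoothPer_val.smooth 0).continuousOn k
  have h0 : Matrix.vecCons 0 z ∈ dom (fastBox T (Jh ε)) := by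
    have := mem_ray hε hz le_rfl; simpa using this
  have := h1.shift hε h0 hr
  simpa only [vecCons_update_zero, Matrix.cons_val_zero, zero_add] using this

lemma sub {J : Set ℝ} (hP : IsProfile T J P) (hQ : IsProfile T J Q) : IsProfile T J (P - Q) :=
  ⟨hP.res.sub hQ.res, hP.star.sub hQ.star, decay_sub hP.decay hQ.decay⟩

lemma dY_sub (hT : 0 < T) (hε : IsSide ε) (hP : IsProfile T (Jh ε) P)
    (hQ : IsProfile T (Jh ε) Q) : Set.EqOn (dY T (Jh ε) (P - Q))
      (dY T (Jh ε) P - dY T (Jh ε) Q) (dom (fastBox T (Jh ε))) :=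
  HasPd.eqOn_pd (goodBox_fast hT hε) (hP.sub hQ).smoothPer_val.smooth
    ((hP.hasPd_dY.sub hQ.hasPd_dY).congr (fun x _ => by simp [val]; ring) fun _ _ => rfl)

lemma dθ_sub (hT : 0 < T) (hε : IsSide ε) (hP : IsProfile T (Jh ε) P)
    (hQ : IsProfile T (Jh ε) Q) : Set.EqOn (dθ T (Jh ε) (P - Q))
      (dθ T (Jh ε) P - dθ T (Jh ε) Q) (dom (fastBox T (Jh ε))) :=
  HasPd.eqOn_pd (goodBox_fast hT hε) (hP.sub hQ).smoothPer_val.smooth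
    ((hP.hasPd_dθ.sub hQ.hasPd_dθ).congr (fun x _ => by simp [val]; ring) fun _ _ => rfl)

lemma smoothPer_trace (h : IsProfile T (Jh ε) P) :
    IsSmoothPer (bdryBox T) (fun w => val P (onΓ w)) := by
  have h0 : (0 : ℝ) ∈ Jh ε := by simp [Jh]
  exact (h.smoothPer_val.comp_vecCons h0).comp_vecCons h0

lemma onΓ_mem {w : Fin 4 → ℝ} (hw : w ∈ dom (bdryBox T)) : onΓ w ∈ dom (fastBox T (Jh ε)) := by
  have h0 : (0 : ℝ) ∈ Jh ε := by simp [Jh]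
  exact mem_dom_cons.2 ⟨h0, mem_dom_cons.2 ⟨h0, hw⟩⟩

lemma dθb_trace (hT : 0 < T) (h : IsProfile T (Jh ε) P) :
    Set.EqOn (dθb T (fun w => val P (onΓ w))) (fun w => dθ T (Jh ε) P (onΓ w))
      (dom (bdryBox T)) := by
  have h0 : (0 : ℝ) ∈ Jh ε := by simp [Jh]
  exact HasPd.eqOn_pd (goodBox_bdry hT) h.smoothPer_trace.smooth
    ((h.hasPd_dθ.comp_vecCons (i := 4) h0).comp_vecCons (i := 3) h0)

lemma mode_trace (P : Profile) (k : ℤ) (w : Fin 4 → ℝ) :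
    mode (fun w => val P (onΓ w)) k w = mode (val P) k (onΓ w) :=
  (mode_comp_vecCons (fun z => val P (Matrix.vecCons 0 z)) k 0 w).trans
    (mode_comp_vecCons (val P) k 0 _)

end IsProfile

/-! ### Extension of boundary functions -/

section
variable {T ε : ℝ}

lemma IsSmoothPer.exists_abs_le {g : (Fin 4 → ℝ) → ℝ} (hg : IsSmoothPer (bdryBox T) g) :
    ∃ C, ∀ w ∈ dom (bdryBox T), |g w| ≤ C := by
  have hpi := Real.pi_pos
  have hred : ∀ i : Fin 4, bdryBox T i = none → ∀ w ∈ dom (bdryBox T),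
      ∃ y ∈ Set.Ico 0 (2 * Real.pi), g w = g (Function.update w i y) := by
    intro i hi w hw
    have hp : Function.Periodic (fun t => g (Function.update w i t)) (2 * Real.pi) := fun t => by
      have := hg.periodic i hi (Function.update w i t)
        (update_mem_dom hw (by simp [fac, hi]))
      simpa using this
    obtain ⟨y, hy, h⟩ := hp.exists_mem_Ico₀ (by positivity) (w i)
    exact ⟨y, hy, by simpa using h⟩
  let K : Fin 4 → Set ℝ := ![Set.Icc 0 T, Set.Icc 0 (2 * Real.pi), Set.Icc 0 (2 * Real.pi),
    Set.Icc 0 (2 * Real.pi)]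
  have hK : IsCompact (Set.univ.pi K) := isCompact_univ_pi fun i => by
    fin_cases i <;> exact isCompact_Icc
  have hKd : Set.univ.pi K ⊆ dom (bdryBox T) := fun w hw i => by
    have := hw i trivial
    fin_cases i
    · simpa [bdryBox, K] using this
    all_goals simp [bdryBox]
  obtain ⟨C, hC⟩ := hK.exists_bound_of_continuousOn (hg.smooth.continuousOn.mono hKd)
  refine ⟨C, fun w hw => ?_⟩
  obtain ⟨y1, h1, e1⟩ := hred 1 rfl w hw
  have hw1 := update_mem_dom (i := 1) hw (t := y1) trivial
  obtain ⟨y2, h2, e2⟩ := hred 2 rfl _ hw1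
  have hw2 := update_mem_dom (i := 2) hw1 (t := y2) trivial
  obtain ⟨y3, h3, e3⟩ := hred 3 rfl _ hw2
  rw [e1, e2, e3]
  refine hC _ fun i _ => ?_
  have hw0 : w 0 ∈ Set.Icc 0 T := hw 0
  fin_cases i
  · simpa [K, Function.update] using hw0
  · simpa [K, Function.update] using And.intro h1.1 h1.2.le
  · simpa [K, Function.update] using And.intro h2.1 h2.2.le
  · simpa [K, Function.update] using And.intro h3.1 h3.2.le

/-- Extension of a boundary function to a residual function. -/
def resLift (ε : ℝ) (g : (Fin 4 → ℝ) → ℝ) (z : Fin 5 → ℝ) : ℝ :=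
  Real.exp (-(ε * z 0)) * g (Matrix.vecTail z)

/-- Extension of a boundary function to a surface wave function. -/
def starLift (ε : ℝ) (g : (Fin 4 → ℝ) → ℝ) (x : Fin 6 → ℝ) : ℝ :=
  Real.exp (-(ε * x 0)) * resLift ε g (Matrix.vecTail x)

lemma hasDerivAt_exp_side (y : ℝ) :
    HasDerivAt (fun t : ℝ => Real.exp (-(ε * t))) (-ε * Real.exp (-(ε * y))) y := by
  have := ((hasDerivAt_id y).const_mul ε).neg.exp
  refine this.congr_deriv ?_
  simp; ring

lemma hasPd_resLift (hT : 0 < T) {g : (Fin 4 → ℝ) → ℝ} (hg : IsSmoothPer (bdryBox T) g)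
    (i : Fin 5) : ∃ g', IsSmoothPer (bdryBox T) g' ∧
      HasPd (slowBox T (Jh ε)) i (resLift ε g) (resLift ε g') := by
  refine Fin.cases ?_ (fun j => ?_) i
  · refine ⟨(-ε) • g, hg.smul _, fun z hz => ?_⟩
    have := (hasPd_zero_comp_vecTail (s := bdryBox T) (J := Jh ε) g) z hz
    have h2 := (hasDerivAt_exp_side (ε := ε) (z 0)).hasDerivWithinAt (s := Jh ε) |>.mul this
    simp only [resLift, Function.update_self]
    refine h2.congr_deriv ?_
    simp; ring
  · refine ⟨pd (bdryBox T) j g, hg.pd (goodBox_bdry hT) j, fun z hz => ?_⟩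
    have := ((hasPd_pd hg.smooth j).comp_vecTail (J := Jh ε)) z hz
    simp only [resLift, Function.update_of_ne (Fin.succ_ne_zero j).symm]
    exact this.const_mul _

lemma hasPd_starLift (hT : 0 < T) {g : (Fin 4 → ℝ) → ℝ} (hg : IsSmoothPer (bdryBox T) g)
    (i : Fin 6) : ∃ g', IsSmoothPer (bdryBox T) g' ∧
      HasPd (fastBox T (Jh ε)) i (starLift ε g) (starLift ε g') := by
  refine Fin.cases ?_ (fun j => ?_) i
  · refine ⟨(-ε) • g, hg.smul _, fun z hz => ?_⟩
    have := (hasPd_zero_comp_vecTail (s := slowBox T (Jh ε)) (J := Jh ε) (resLift ε g)) z hz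
    have h2 := (hasDerivAt_exp_side (ε := ε) (z 0)).hasDerivWithinAt (s := Jh ε) |>.mul this
    simp only [starLift, Function.update_self]
    refine h2.congr_deriv ?_
    simp [resLift]; ring
  · obtain ⟨g', hg', h⟩ := hasPd_resLift (ε := ε) hT hg j
    refine ⟨g', hg', fun z hz => ?_⟩
    have := (h.comp_vecTail (J := Jh ε)) z hz
    simp only [starLift, Function.update_of_ne (Fin.succ_ne_zero j).symm]
    exact this.const_mul _

lemma volume_cell_bdryBox_lt_top : (volume : Measure (Fin 4 → ℝ)) (cell (bdryBox T)) < ⊤ := by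
  rw [cell_eq_pi, volume_pi_pi]
  refine ENNReal.prod_lt_top fun i _ => ?_
  fin_cases i <;> simp [per, bdryBox, ENNReal.mul_lt_top]

lemma starMaj_exp (hε : IsSide ε) {K : ℝ} (hK : 0 ≤ K) :
    StarMaj T ε (fun z => K * Real.exp (-|z 0|)) := by
  refine ⟨⟨fun z => by positivity, fun z θ => ?_, ?_⟩, K, fun z => ?_⟩
  · rw [Function.update_of_ne (by decide)]
  · refine ⟨Continuous.aestronglyMeasurable (by fun_prop), (eLpNorm_two_lt_top_iff _).2 ?_⟩
    have hm : Measurable fun z : Fin 5 → ℝ => ENNReal.ofReal ((K * Real.exp (-|z 0|)) ^ 2) := by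
      fun_prop
    rw [slowBox, lintegral_cell_cons hm]
    simp only [Matrix.cons_val_zero, lintegral_const, Measure.restrict_apply_univ]
    rw [lintegral_mul_const _ (by fun_prop)]
    refine ENNReal.mul_lt_top ?_ volume_cell_bdryBox_lt_top
    have := lintegral_exp_lt_top hε (δ := 2) (by norm_num) (K ^ 2)
    refine lt_of_eq_of_lt (lintegral_congr fun r => ?_) this
    rw [mul_pow, ← Real.exp_nat_mul]; congr 3; push_cast; ring
  · exact mul_le_of_le_one_right hK (Real.exp_le_one_iff.2 (by simp))

lemma resLift_le (hε : IsSide ε) {g : (Fin 4 → ℝ) → ℝ} (hg : IsSmoothPer (bdryBox T) g) :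
    ∃ m, StarMaj T ε m ∧ ∀ z ∈ dom (slowBox T (Jh ε)), |resLift ε g z| ≤ m z := by
  obtain ⟨C, hC⟩ := hg.exists_abs_le
  refine ⟨_, starMaj_exp hε (abs_nonneg C), fun z hz => ?_⟩
  rw [resLift, abs_mul, abs_of_pos (Real.exp_pos _), abs_eq_mul_of_mem_Jh hε (hz 0), mul_comm]
  exact mul_le_mul_of_nonneg_right ((hC _ (mem_dom_vecTail hz)).trans (le_abs_self C))
    (Real.exp_pos _).le

lemma isHInf_resLift (hT : 0 < T) (hε : IsSide ε) {g : (Fin 4 → ℝ) → ℝ}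
    (hg : IsSmoothPer (bdryBox T) g) : IsHInf (slowBox T (Jh ε)) (resLift ε g) := by
  have hper := fun {g : (Fin 4 → ℝ) → ℝ} (hg : IsSmoothPer (bdryBox T) g) =>
    hg.comp_vecTail (J := Jh ε)
  refine IsHInf.of_class (goodBox_slow hT hε)
    (C := {f | ∃ g, IsSmoothPer (bdryBox T) g ∧ f = resLift ε g}) ?_ ?_ ?_ ?_ ⟨g, hg, rfl⟩
  · rintro _ ⟨g, hg, rfl⟩
    exact ContinuousOn.mul (Continuous.continuousOn (by fun_prop)) (hper hg).smooth.continuousOn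
  · rintro _ ⟨g, hg, rfl⟩ i
    obtain ⟨g', hg', h⟩ := hasPd_resLift (ε := ε) hT hg i
    exact ⟨_, ⟨g', hg', rfl⟩, h⟩
  · rintro _ ⟨g, hg, rfl⟩ i hi z hz
    have h0 : i ≠ 0 := by rintro rfl; simp [slowBox] at hi
    rw [resLift, resLift, (hper hg).periodic i hi z hz, Function.update_of_ne h0.symm]
  · rintro _ ⟨g, hg, rfl⟩
    obtain ⟨m, hm, h⟩ := resLift_le hε hg
    exact ⟨m, hm.toL2Maj, h⟩

lemma inStar_starLift (hT : 0 < T) (hε : IsSide ε) {g : (Fin 4 → ℝ) → ℝ}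
    (hg : IsSmoothPer (bdryBox T) g) : InStar T (Jh ε) (starLift ε g) := by
  refine InStar.of_class hT hε one_pos
    (C := {f | ∃ g, IsSmoothPer (bdryBox T) g ∧ f = starLift ε g}) ?_ ?_ ?_ ⟨g, hg, rfl⟩
  · rintro _ ⟨g, hg, rfl⟩ i
    obtain ⟨g', hg', h⟩ := hasPd_starLift (ε := ε) hT hg i
    exact ⟨_, ⟨g', hg', rfl⟩, h⟩
  · rintro _ ⟨g, hg, rfl⟩ i hi z hz
    have h0 : i ≠ 0 := by rintro rfl; simp [fastBox] at hi
    have := ((isHInf_resLift hT hε hg).smoothPer.comp_vecTail (J := Jh ε)).periodic i hi z hz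
    rw [starLift, starLift, this, Function.update_of_ne h0.symm]
  · rintro _ ⟨g, hg, rfl⟩
    obtain ⟨m, hm, h⟩ := resLift_le hε hg
    refine ⟨m, hm, fun x hx => ?_⟩
    rw [starLift, abs_mul, abs_of_pos (Real.exp_pos _), abs_eq_mul_of_mem_Jh hε (hx 0), mul_comm,
      neg_one_mul]
    exact mul_le_mul_of_nonneg_right (h _ (mem_dom_vecTail hx)) (Real.exp_pos _).le

lemma starLift_onΓ (g : (Fin 4 → ℝ) → ℝ) (w : Fin 4 → ℝ) : starLift ε g (onΓ w) = g w := by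
  simp [starLift, resLift, onΓ]

lemma resLift_zero (g : (Fin 4 → ℝ) → ℝ) (w : Fin 4 → ℝ) :
    resLift ε g (Matrix.vecCons 0 w) = g w := by
  simp [resLift]

end

/-! ### The two by two system on a half line -/

section
variable {T ε δ ρ : ℝ}

lemma isgn_mul_self {k : ℤ} (hk : k ≠ 0) : Params.isgn k * Params.isgn k = -1 := by
  have h : (k.sign : ℂ) * k.sign = 1 := by
    rw [← Int.cast_mul, ← Int.sign_mul, Int.sign_eq_one_of_pos (mul_self_pos.2 hk), Int.cast_one]
  rw [Params.isgn, mul_mul_mul_comm, Complex.I_mul_I, h]; ring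

lemma I_mul_eq (k : ℤ) : Complex.I * k = Params.isgn k * ((|(k : ℝ)| : ℝ) : ℂ) := by
  have h : (k : ℂ) = (k.sign : ℂ) * ((|(k : ℝ)| : ℝ) : ℂ) := by
    rw [← Int.cast_abs, Complex.ofReal_intCast, ← Int.cast_mul, Int.sign_mul_abs]
  rw [Params.isgn, mul_assoc, ← h]

lemma I_mul_ne_zero {k : ℤ} (hk : k ≠ 0) : Complex.I * (k : ℂ) ≠ 0 :=
  mul_ne_zero Complex.I_ne_zero (Int.cast_ne_zero.2 hk)

lemma polyGrowth_isgn : PolyGrowth Params.isgn := .of_bdd (C := 1) fun k => by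
  rw [Params.isgn, norm_mul, Complex.norm_I, one_mul, Complex.norm_intCast]
  rcases lt_trichotomy k 0 with h | rfl | h
  · simp [Int.sign_eq_neg_one_of_neg h]
  · simp
  · simp [Int.sign_eq_one_of_pos h]

lemma polyGrowth_inv : PolyGrowth fun k : ℤ => (Complex.I * (k : ℂ))⁻¹ :=
  .of_bdd (C := 1) fun k => by
    by_cases hk : k = 0
    · simp [hk]
    rw [norm_inv, norm_mul, Complex.norm_I, one_mul, Complex.norm_intCast]
    exact inv_le_one_of_one_le₀ (by exact_mod_cast Int.one_le_abs hk)

lemma NiceAt.ite {a b : ℤ → (Fin 6 → ℝ) → ℂ} (ha : NiceAt T ε δ a) (hb : NiceAt T ε δ b) :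
    NiceAt T ε δ (fun k x => if k = 0 then a k x else b k x) := by
  have h1 : PolyGrowth fun k : ℤ => if k = 0 then 1 else 0 :=
    .of_bdd (C := 1) fun k => by split_ifs <;> simp
  have h2 : PolyGrowth fun k : ℤ => if k = 0 then 0 else 1 :=
    .of_bdd (C := 1) fun k => by split_ifs <;> simp
  have := (ha.symbol h1).add (hb.symbol h2)
  convert this using 1
  ext k x
  simp only [Pi.add_apply]
  split_ifs <;> simp

/-- The system `∂_{Y₃} a = ikρ² b + r`, `∂_{Y₃} b = -ik a + s` on the side `ε` has a decaying
solution with prescribed trace of `a`: the combinations `a ± iε sgn(k) ρ b` decouple, one of them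
grows in the homogeneous problem and is determined by the source, and the other one decays and is
determined by its trace. -/
lemma exists_halfspace (hT : 0 < T) (hε : IsSide ε) (hδ : 0 < δ) (hρ : δ ≤ ρ)
    {r s h : ℤ → (Fin 6 → ℝ) → ℂ} (hr : NiceAt T ε δ r) (hs : NiceAt T ε δ s)
    (hh : NiceAt T ε δ h) :
    ∃ a b, NiceAt T ε (δ / 2) a ∧ NiceAt T ε (δ / 2) b ∧
      (∀ k : ℤ, k ≠ 0 → HasPd (fastBox T (Jh ε)) 0 (a k)
        (fun x => Complex.I * k * ρ ^ 2 * b k x + r k x)) ∧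
      (∀ k : ℤ, k ≠ 0 → HasPd (fastBox T (Jh ε)) 0 (b k)
        (fun x => -(Complex.I * k) * a k x + s k x)) ∧
      ∀ k : ℤ, k ≠ 0 → ∀ x ∈ dom (fastBox T (Jh ε)), x 0 = 0 → a k x = h k x := by
  have hρ0 : 0 < ρ := hδ.trans_le hρ
  have hδ2 : δ / 2 ≤ δ := by linarith
  have hsym : ∀ c : ℂ, PolyGrowth fun k => c * Params.isgn k := fun c =>
    (PolyGrowth.const c).mul polyGrowth_isgn
  have hε2 : (ε : ℂ) * ε = 1 := by exact_mod_cast side_mul_self hε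
  have hρc : (ρ : ℂ) ≠ 0 := by exact_mod_cast hρ0.ne'
  -- `G` is the growing combination `a + iε sgn(k) ρ b`, determined by the source.
  obtain ⟨G, hGn, dG⟩ : ∃ G, NiceAt T ε δ G ∧ ∀ k : ℤ, HasPd (fastBox T (Jh ε)) 0 (G k)
      (fun x => ε * ((ρ * |(k : ℝ)| : ℝ) * G k x
        + (ε * r k x + (ρ : ℂ) * Params.isgn k * s k x))) := by
    have hgn : NiceAt T ε δ ((fun k x => (-ε : ℂ) * r k x)
        + fun k x => ((-ρ : ℂ) * Params.isgn k) * s k x) :=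
      (hr.symbol (.const _)).add (hs.symbol (hsym _))
    refine ⟨_, hgn.Tm hT hε hδ hρ0.le (κ := ρ), fun k =>
      (hgn.hasPd_Tm hT hε hδ hρ0.le k).congr (fun _ _ => rfl) fun x _ => ?_⟩
    simp only [Pi.add_apply]; ring
  -- `L` is the decaying combination; its trace is chosen such that `(G + L) / 2` has trace `h`.
  obtain ⟨L, hLn, dL, L0⟩ : ∃ L, NiceAt T ε (δ / 2) L ∧
      (∀ k : ℤ, k ≠ 0 → HasPd (fastBox T (Jh ε)) 0 (L k)
        (fun x => ε * (-(ρ * |(k : ℝ)| : ℝ) * L k x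
          + (ε * r k x - (ρ : ℂ) * Params.isgn k * s k x)))) ∧
      ∀ k : ℤ, k ≠ 0 → ∀ x : Fin 6 → ℝ, x 0 = 0 → L k x = 2 * h k x - G k x := by
    have hln : NiceAt T ε δ ((fun k x => (ε : ℂ) * r k x)
        + fun k x => ((-ρ : ℂ) * Params.isgn k) * s k x) :=
      (hr.symbol (.const _)).add (hs.symbol (hsym _))
    have hen : NiceAt T ε δ ((fun k x => (2 : ℂ) * h k x) + fun k x => (-1 : ℂ) * G k x) :=
      (hh.symbol (.const _)).add (hGn.symbol (.const _))
    refine ⟨_, (hln.Tp hT hε hδ hρ).add ((hen.Pe hε hρ0).mono (by linarith)), fun k hk =>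
      ((hln.hasPd_Tp hε ρ k).add (hasPd_Pe (T := T) ρ _ k)).congr (fun _ _ => rfl) fun x _ => ?_,
      fun k hk x hx0 => ?_⟩
    · simp only [Pi.add_apply, if_neg hk]; ring
    · have : Function.update x 0 0 = x := by rw [← hx0]; exact Function.update_eq_self _ _
      simp only [Pi.add_apply, Tp_zero k _ hx0, Pe, if_neg hk, hx0, this, mul_zero, neg_zero,
        Real.exp_zero, Complex.ofReal_one]
      ring
  set t : ℂ := ε / (2 * ρ) with ht
  have htρ : t * ρ = ε / 2 := by rw [ht]; field_simp
  clear_value t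
  refine ⟨(fun k x => (1 / 2 : ℂ) * G k x) + fun k x => (1 / 2 : ℂ) * L k x,
    (fun k x => (-t * Params.isgn k) * G k x) + fun k x => (t * Params.isgn k) * L k x,
    ((hGn.mono hδ2).symbol (.const _)).add (hLn.symbol (.const _)),
    ((hGn.mono hδ2).symbol (hsym _)).add (hLn.symbol (hsym _)), fun k hk => ?_, fun k hk => ?_,
    fun k hk x hx hx0 => ?_⟩
  · refine (((dG k).const_mul _).add ((dL k hk).const_mul _)).congr (fun _ _ => rfl) fun x _ => ?_
    have hsg := isgn_mul_self hk
    simp only [Pi.add_apply, I_mul_eq]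
    push_cast
    linear_combination -r k x * hε2
      - 1 / 2 * ε * ρ * ((|(k : ℝ)| : ℝ) : ℂ) * (G k x - L k x) * hsg
      - Params.isgn k ^ 2 * ((|(k : ℝ)| : ℝ) : ℂ) * ρ * (G k x - L k x) * htρ
  · refine (((dG k).const_mul _).add ((dL k hk).const_mul _)).congr (fun _ _ => rfl) fun x _ => ?_
    have hsg := isgn_mul_self hk
    simp only [Pi.add_apply, I_mul_eq]
    push_cast
    linear_combination (1 / 2 * Params.isgn k * ((|(k : ℝ)| : ℝ) : ℂ) * (L k x + G k x)
        + Params.isgn k ^ 2 * s k x) * hε2 + s k x * hsg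
      - (-ε * Params.isgn k * ((|(k : ℝ)| : ℝ) : ℂ) * (L k x + G k x)
        - 2 * ε * Params.isgn k ^ 2 * s k x) * htρ
  · simp only [Pi.add_apply, L0 k hk x hx0]
    ring

/-- The same system with prescribed trace of `b`. -/
lemma exists_halfspace' (hT : 0 < T) (hε : IsSide ε) (hδ : 0 < δ) (hρ : δ ≤ ρ)
    {r s h : ℤ → (Fin 6 → ℝ) → ℂ} (hr : NiceAt T ε δ r) (hs : NiceAt T ε δ s)
    (hh : NiceAt T ε δ h) :
    ∃ a b, NiceAt T ε (δ / 2) a ∧ NiceAt T ε (δ / 2) b ∧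
      (∀ k : ℤ, k ≠ 0 → HasPd (fastBox T (Jh ε)) 0 (a k)
        (fun x => Complex.I * k * ρ ^ 2 * b k x + r k x)) ∧
      (∀ k : ℤ, k ≠ 0 → HasPd (fastBox T (Jh ε)) 0 (b k)
        (fun x => -(Complex.I * k) * a k x + s k x)) ∧
      ∀ k : ℤ, k ≠ 0 → ∀ x ∈ dom (fastBox T (Jh ε)), x 0 = 0 → b k x = h k x := by
  have hρ0 : (ρ : ℂ) ≠ 0 := by exact_mod_cast (hδ.trans_le hρ).ne'
  -- the pair `(b, -a / ρ²)` solves a system of the same form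
  obtain ⟨a, b, ha, hb, h1, h2, h3⟩ := exists_halfspace hT hε hδ hρ hs
    (hr.symbol (.const (-1 / ρ ^ 2 : ℂ))) hh
  refine ⟨fun k x => (-ρ ^ 2 : ℂ) * b k x, a, hb.symbol (.const _), ha, fun k hk => ?_,
    fun k hk => ?_, h3⟩
  · refine ((h2 k hk).const_mul _).congr (fun _ _ => rfl) fun x _ => ?_
    field_simp; ring
  · refine (h1 k hk).congr (fun _ _ => rfl) fun x _ => ?_
    ring

/-- Uniqueness for `g' = c g` on the half line. -/
lemma eq_exp_mul {c : ℝ} {g : ℝ → ℂ}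
    (hd : ∀ r, 0 ≤ r → HasDerivWithinAt g (c * g r) (Set.Ici 0) r) {r : ℝ} (hr : 0 ≤ r) :
    g r = ((Real.exp (c * r) : ℝ) : ℂ) * g 0 := by
  have h1 : ∀ r ∈ Set.Ici (0 : ℝ), HasDerivWithinAt
      (fun r => ((Real.exp (-c * r) : ℝ) : ℂ) * g r) 0 (Set.Ici 0) r := fun r hr => by
    have h2 : HasDerivAt (fun r : ℝ => ((Real.exp (-c * r) : ℝ) : ℂ))
        ((Real.exp (-c * r) * (-c * 1) : ℝ) : ℂ) r :=
      (((hasDerivAt_id r).const_mul (-c)).exp).ofReal_comp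
    refine (h2.hasDerivWithinAt.mul (hd r hr)).congr_deriv ?_
    push_cast; ring
  have h3 := (convex_Ici (0 : ℝ)).norm_image_sub_le_of_norm_hasDerivWithin_le (C := 0) h1
    (fun r _ => by simp) (Set.self_mem_Ici) hr
  rw [zero_mul] at h3
  have h4 := sub_eq_zero.1 (norm_le_zero_iff.1 h3)
  simp only [mul_zero, Real.exp_zero, Complex.ofReal_one, one_mul] at h4
  rw [← h4, ← mul_assoc, ← Complex.ofReal_mul, ← Real.exp_add]
  simp

/-- A bounded solution of `g' = c g` with `c > 0` vanishes. -/
lemma eq_zero_of_bounded {c : ℝ} (hc : 0 < c) {g : ℝ → ℂ}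
    (hd : ∀ r, 0 ≤ r → HasDerivWithinAt g (c * g r) (Set.Ici 0) r)
    (hb : ∃ C, ∀ r, 0 ≤ r → ‖g r‖ ≤ C) {r : ℝ} (hr : 0 ≤ r) : g r = 0 := by
  obtain ⟨C, hC⟩ := hb
  have h0 : g 0 = 0 := by
    have h1 : Filter.Tendsto (fun r : ℝ => C * Real.exp (-c * r)) Filter.atTop (nhds 0) :=
      IsProfile.tendsto_exp_neg hc C
    have h2 : ∀ᶠ r : ℝ in Filter.atTop, ‖g 0‖ ≤ C * Real.exp (-c * r) := by
      filter_upwards [Filter.eventually_ge_atTop 0] with r hr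
      have h3 := hC r hr
      rw [eq_exp_mul hd hr, norm_mul, Complex.norm_real, Real.norm_eq_abs,
        abs_of_pos (Real.exp_pos _)] at h3
      have h4 := mul_le_mul_of_nonneg_right h3 (Real.exp_pos (-c * r)).le
      have h5 : Real.exp (c * r) * Real.exp (-c * r) = 1 := by rw [← Real.exp_add]; simp
      linear_combination h4 - ‖g 0‖ * h5
    exact norm_le_zero_iff.1 (ge_of_tendsto h1 h2)
  rw [eq_exp_mul hd hr, h0, mul_zero]

/-- Bounded solutions of the homogeneous system on a half line. -/
lemma halfspace_homogeneous (hε : IsSide ε) (hρ : 0 < ρ) {k : ℤ} (hk : k ≠ 0) {a b : ℝ → ℂ}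
    (ha : ∀ r, 0 ≤ r → HasDerivWithinAt a (ε * (Complex.I * k * ρ ^ 2 * b r)) (Set.Ici 0) r)
    (hb : ∀ r, 0 ≤ r → HasDerivWithinAt b (ε * (-(Complex.I * k) * a r)) (Set.Ici 0) r)
    (hba : ∃ C, ∀ r, 0 ≤ r → ‖a r‖ ≤ C) (hbb : ∃ C, ∀ r, 0 ≤ r → ‖b r‖ ≤ C) {r : ℝ} (hr : 0 ≤ r) :
    a r = -(ε * Params.isgn k * ρ) * b r ∧
      b r = ((Real.exp (-(ρ * |(k : ℝ)| * r)) : ℝ) : ℂ) * b 0 := by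
  have hε2 : (ε : ℂ) * ε = 1 := by exact_mod_cast side_mul_self hε
  have hsg := isgn_mul_self hk
  have hk0 : 0 < |(k : ℝ)| := abs_pos.2 (by exact_mod_cast hk)
  have hrel : ∀ r, 0 ≤ r → a r = -(ε * Params.isgn k * ρ) * b r := by
    intro r hr
    have hd : ∀ r, 0 ≤ r → HasDerivWithinAt (fun r => a r + ε * Params.isgn k * ρ * b r)
        ((ρ * |(k : ℝ)| : ℝ) * (a r + ε * Params.isgn k * ρ * b r)) (Set.Ici 0) r := by
      intro r hr
      refine ((ha r hr).add ((hb r hr).const_mul _)).congr_deriv ?_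
      rw [I_mul_eq]
      push_cast
      linear_combination (-(ρ * |(k : ℝ)| * a r : ℂ)) * hsg
        - (Params.isgn k ^ 2 * ρ * |(k : ℝ)| * a r : ℂ) * hε2
    have hbd : ∃ C, ∀ r, 0 ≤ r → ‖a r + ε * Params.isgn k * ρ * b r‖ ≤ C := by
      obtain ⟨A, hA⟩ := hba
      obtain ⟨B, hB⟩ := hbb
      refine ⟨A + ‖(ε * Params.isgn k * ρ : ℂ)‖ * B, fun r hr => (norm_add_le _ _).trans ?_⟩
      rw [norm_mul]
      exact add_le_add (hA r hr) (mul_le_mul_of_nonneg_left (hB r hr) (norm_nonneg _))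
    have := eq_zero_of_bounded (mul_pos hρ hk0) hd hbd hr
    linear_combination this
  refine ⟨hrel r hr, ?_⟩
  have := eq_exp_mul (c := -(ρ * |(k : ℝ)|)) (g := b) (fun r hr => (hb r hr).congr_deriv ?_) hr
  · rw [this]; congr 3; ring
  · rw [hrel r hr, I_mul_eq]
    push_cast
    linear_combination (ρ * |(k : ℝ)| * b r : ℂ) * hsg
      + (Params.isgn k ^ 2 * ρ * |(k : ℝ)| * b r : ℂ) * hε2

end

/-! ### Bulk systems -/

/-- The equations `A₃ ∂_{Y₃} U + 𝒜 ∂_θ U = F` on one side. -/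
def Bulk (T : ℝ) (J : Set ℝ) {m n : ℕ} (A₃ A : Matrix (Fin m) (Fin n) ℝ) (U : Fin n → Profile)
    (F : Fin m → Profile) : Prop :=
  ∀ x ∈ dom (fastBox T J), ∀ i,
    ∑ j, A₃ i j * dY T J (U j) x + ∑ j, A i j * dθ T J (U j) x = val (F i) x

section
variable {T ε δ : ℝ} {m n q : ℕ}

lemma mode_sum {N : ℕ} {s : Fin (N + 1) → Option (Set ℝ)} (hθ : s (Fin.last N) = none)
    {ι : Type*} [Fintype ι] {f : ι → (Fin (N + 1) → ℝ) → ℝ} (hf : ∀ i, ContinuousOn (f i) (dom s))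
    (c : ι → ℝ) (k : ℤ) {x : Fin (N + 1) → ℝ} (hx : x ∈ dom s) :
    mode (fun x => ∑ i, c i * f i x) k x = ∑ i, (c i : ℂ) * mode (f i) k x := by
  classical
  suffices ∀ t : Finset ι, mode (fun x => ∑ i ∈ t, c i * f i x) k x
      = ∑ i ∈ t, (c i : ℂ) * mode (f i) k x from this _
  intro t
  induction t using Finset.induction_on with
  | empty => simp [mode]
  | insert i t hi ih =>
    simp only [Finset.sum_insert hi]
    rw [← ih, ← mode_smul]
    exact mode_add hθ (continuousOn_const.mul (hf i))
      (continuousOn_finsetSum _ fun i _ => continuousOn_const.mul (hf i)) k hx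

lemma HasPd.sum {N : ℕ} {s : Fin N → Option (Set ℝ)} {ι : Type*} [Fintype ι]
    {E : Type*} [NormedRing E] [NormedAlgebra ℝ E] {i : Fin N} {f f' : ι → (Fin N → ℝ) → E}
    (h : ∀ j, HasPd s i (f j) (f' j)) (c : ι → E) :
    HasPd s i (fun x => ∑ j, c j * f j x) (fun x => ∑ j, c j * f' j x) := fun x hx =>
  HasDerivWithinAt.fun_sum fun j _ => (h j x hx).const_mul (c j)

lemma Bulk.mode (hT : 0 < T) (hε : IsSide ε) {A₃ A : Matrix (Fin m) (Fin n) ℝ}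
    {U : Fin n → Profile} {F : Fin m → Profile} (h : Bulk T (Jh ε) A₃ A U F)
    (hU : ∀ j, IsProfile T (Jh ε) (U j)) (k : ℤ) {x : Fin 6 → ℝ}
    (hx : x ∈ dom (fastBox T (Jh ε))) (i : Fin m) :
    ∑ j, (A₃ i j : ℂ) * FastProblem.mode (dY T (Jh ε) (U j)) k x
      + Complex.I * k * ∑ j, (A i j : ℂ) * FastProblem.mode (val (U j)) k x
      = FastProblem.mode (val (F i)) k x := by
  have hs := goodBox_fast hT hε
  have hl : fastBox T (Jh ε) (Fin.last 5) = none := fastBox_last _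
  have hcY : ∀ j, ContinuousOn (dY T (Jh ε) (U j)) (dom (fastBox T (Jh ε))) := fun j =>
    (contDiffOn_pd hs (hU j).smoothPer_val.smooth 0).continuousOn
  have hcθ : ∀ j, ContinuousOn (dθ T (Jh ε) (U j)) (dom (fastBox T (Jh ε))) := fun j =>
    (contDiffOn_pd hs (hU j).smoothPer_val.smooth 5).continuousOn
  rw [← mode_congr hl (fun x hx => h x hx i) k hx]
  have hadd : FastProblem.mode (fun x => ∑ j, A₃ i j * dY T (Jh ε) (U j) x
      + ∑ j, A i j * dθ T (Jh ε) (U j) x) k x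
      = FastProblem.mode (fun x => ∑ j, A₃ i j * dY T (Jh ε) (U j) x) k x
        + FastProblem.mode (fun x => ∑ j, A i j * dθ T (Jh ε) (U j) x) k x :=
    mode_add hl (continuousOn_finsetSum _ fun j _ => continuousOn_const.mul (hcY j))
      (continuousOn_finsetSum _ fun j _ => continuousOn_const.mul (hcθ j)) k hx
  rw [hadd, mode_sum hl hcY _ k hx, mode_sum hl hcθ _ k hx, Finset.mul_sum]
  congr 1
  refine Finset.sum_congr rfl fun j _ => ?_
  rw [(hU j).mode_dθ hT hε k hx]; ring

lemma Bulk.sub (hT : 0 < T) (hε : IsSide ε) {A₃ A : Matrix (Fin m) (Fin n) ℝ}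
    {U U' : Fin n → Profile} {F F' : Fin m → Profile} (h : Bulk T (Jh ε) A₃ A U F)
    (h' : Bulk T (Jh ε) A₃ A U' F') (hU : ∀ j, IsProfile T (Jh ε) (U j))
    (hU' : ∀ j, IsProfile T (Jh ε) (U' j)) : Bulk T (Jh ε) A₃ A (U - U') (F - F') := by
  intro x hx i
  have e1 := h x hx i
  have e2 := h' x hx i
  have e3 : ∀ j, dY T (Jh ε) ((U - U') j) x = dY T (Jh ε) (U j) x - dY T (Jh ε) (U' j) x :=
    fun j => (hU j).dY_sub hT hε (hU' j) hx
  have e4 : ∀ j, dθ T (Jh ε) ((U - U') j) x = dθ T (Jh ε) (U j) x - dθ T (Jh ε) (U' j) x :=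
    fun j => (hU j).dθ_sub hT hε (hU' j) hx
  simp only [e3, e4, mul_sub, Finset.sum_sub_distrib]
  simp only [val, Pi.sub_apply, Prod.fst_sub, Prod.snd_sub] at *
  linarith

lemma Bulk.of_parts (hT : 0 < T) (hε : IsSide ε) {A₃ A : Matrix (Fin m) (Fin n) ℝ}
    {U : Fin n → Profile} {F : Fin m → Profile} (hU : ∀ j, IsProfile T (Jh ε) (U j))
    (hres : ∀ z ∈ dom (slowBox T (Jh ε)), ∀ i,
      ∑ j, A i j * pd (slowBox T (Jh ε)) 4 (U j).1 z = (F i).1 z)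
    (hstar : ∀ x ∈ dom (fastBox T (Jh ε)), ∀ i, ∑ j, A₃ i j * pd (fastBox T (Jh ε)) 0 (U j).2 x
      + ∑ j, A i j * pd (fastBox T (Jh ε)) 5 (U j).2 x = (F i).2 x) :
    Bulk T (Jh ε) A₃ A U F := by
  intro x hx i
  simp only [fun j => (hU j).dY_eq hT hε hx, fun j => (hU j).dθ_eq hT hε hx, mul_add,
    Finset.sum_add_distrib, val]
  rw [← hres _ (mem_dom_vecTail hx) i, ← hstar x hx i]
  ring

/-- A bounded function on a half line whose derivative has a limit: the limit is zero. -/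
lemma limit_deriv_eq_zero {g g' : ℝ → ℂ} {L : ℂ}
    (hd : ∀ r, 0 ≤ r → HasDerivWithinAt g (g' r) (Set.Ici 0) r)
    {M : ℂ} (hg : Filter.Tendsto g Filter.atTop (nhds M))
    (hL : Filter.Tendsto g' Filter.atTop (nhds L)) : L = 0 := by
  refine norm_le_zero_iff.1 (le_of_forall_pos_le_add fun η hη => ?_)
  rw [zero_add]
  have h1 : Filter.Tendsto (fun r => ‖g (r + 1) - g r - L‖) Filter.atTop (nhds ‖M - M - L‖) :=
    (((hg.comp (Filter.tendsto_atTop_add_const_right _ 1 Filter.tendsto_id)).sub hg).sub_const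
      L).norm
  rw [sub_self, zero_sub, norm_neg] at h1
  refine le_of_tendsto h1 ?_
  obtain ⟨R, hR⟩ := Filter.eventually_atTop.1 (Metric.tendsto_nhds.1 hL η hη)
  filter_upwards [Filter.eventually_ge_atTop (max R 0)] with r hr
  have hd' : ∀ t ∈ Set.Icc r (r + 1), HasDerivWithinAt (fun t => g t - t • L) (g' t - L)
      (Set.Icc r (r + 1)) t := fun t ht => by
    have h0 : 0 ≤ r := (le_max_right _ _).trans hr
    refine ((hd t (h0.trans ht.1)).mono fun u hu => h0.trans hu.1).sub ?_
    simpa using ((hasDerivAt_id t).smul_const L).hasDerivWithinAt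
  have := (convex_Icc r (r + 1)).norm_image_sub_le_of_norm_hasDerivWithin_le (C := η) hd'
    (fun t ht => by
      have := hR t (((le_max_left _ _).trans hr).trans ht.1)
      rw [dist_eq_norm] at this
      exact this.le) (Set.left_mem_Icc.2 (by linarith)) (Set.right_mem_Icc.2 (by linarith))
  simp only [add_sub_cancel_left, norm_one, mul_one, add_smul, one_smul] at this
  refine le_of_eq_of_le (congrArg _ ?_) this
  abel

end

/-! ### Solution formulas -/

section
variable {T ε δ : ℝ} {m n q : ℕ}

/-- The value `κ⁻¹ N F + α Z`; `κ` stands for `∂_θ`, `F` for the source and `Z` for the components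
that are determined by ordinary differential equations. -/
def lin (N : Matrix (Fin n) (Fin m) ℝ) (α : Matrix (Fin n) (Fin q) ℝ) (κ : ℂ) (F : Fin m → ℂ)
    (Z : Fin q → ℂ) (j : Fin n) : ℂ :=
  κ⁻¹ * ∑ i, (N j i : ℂ) * F i + ∑ l, (α j l : ℂ) * Z l

/-- The Fourier components of the surface wave part of a solution: `lin` for `k ≠ 0`, and `Z₀` for
`k = 0`. -/
def starFam (N : Matrix (Fin n) (Fin m) ℝ) (α : Matrix (Fin n) (Fin q) ℝ)
    (F : Fin m → (Fin 6 → ℝ) → ℝ) (Z : Fin q → ℤ → (Fin 6 → ℝ) → ℂ)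
    (Z₀ : Fin n → ℤ → (Fin 6 → ℝ) → ℂ) (j : Fin n) : ℤ → (Fin 6 → ℝ) → ℂ := fun k x =>
  if k = 0 then Z₀ j k x else
    lin N α (Complex.I * k) (fun i => comp (F i) k x) (fun l => Z l k x) j

lemma niceAt_starFam (N : Matrix (Fin n) (Fin m) ℝ) (α : Matrix (Fin n) (Fin q) ℝ)
    {F : Fin m → (Fin 6 → ℝ) → ℝ} {Z : Fin q → ℤ → (Fin 6 → ℝ) → ℂ}
    {Z₀ : Fin n → ℤ → (Fin 6 → ℝ) → ℂ} (hF : ∀ i, NiceAt T ε δ (comp (F i)))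
    (hZ : ∀ l, NiceAt T ε δ (Z l)) (hZ₀ : ∀ j, NiceAt T ε δ (Z₀ j)) (j : Fin n) :
    NiceAt T ε δ (starFam N α F Z Z₀ j) :=
  (hZ₀ j).ite (((NiceAt.sum hF fun i => (N j i : ℂ)).symbol polyGrowth_inv).add
    (NiceAt.sum hZ fun l => (α j l : ℂ)))

lemma NiceAt.pd_syn (hT : 0 < T) (hε : IsSide ε) (hδ : 0 < δ) {a a' : ℤ → (Fin 6 → ℝ) → ℂ}
    (ha : NiceAt T ε δ a) {i : Fin 6} (h : ∀ k, HasPd (fastBox T (Jh ε)) i (a k) (a' k))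
    {x : Fin 6 → ℝ} (hx : x ∈ dom (fastBox T (Jh ε))) :
    FastProblem.pd (fastBox T (Jh ε)) i (syn a) x = syn a' x ∧ Summable fun k => a' k x := by
  have hs := goodBox_fast hT hε
  obtain ⟨b, hb, hab⟩ := ha.pd i
  have e : ∀ k, b k x = a' k x := fun k => (hab k).unique hs (h k) hx
  have h1 := (ha.hasPd_syn hT hε hδ.le hb hab).eqOn_pd hs
    (ha.inStar_syn hT hε hδ).smoothPer.smooth hx
  refine ⟨h1.trans ?_, ?_⟩
  · simp only [syn, e]
  · simpa only [e] using hb.summable hx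

lemma star_rows (hT : 0 < T) (hε : IsSide ε) (hδ : 0 < δ) {A₃ A : Matrix (Fin m) (Fin n) ℝ}
    {F : Fin m → (Fin 6 → ℝ) → ℝ} (hF : ∀ i, IsSmoothPer (fastBox T (Jh ε)) (F i))
    {W DW : Fin n → ℤ → (Fin 6 → ℝ) → ℂ} (hW : ∀ j, NiceAt T ε δ (W j))
    (hD : ∀ j k, HasPd (fastBox T (Jh ε)) 0 (W j k) (DW j k))
    (heq : ∀ k : ℤ, ∀ x ∈ dom (fastBox T (Jh ε)), ∀ i, ∑ j, (A₃ i j : ℂ) * DW j k x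
      + Complex.I * k * ∑ j, (A i j : ℂ) * W j k x = comp (F i) k x)
    {x : Fin 6 → ℝ} (hx : x ∈ dom (fastBox T (Jh ε))) (i : Fin m) :
    ∑ j, A₃ i j * pd (fastBox T (Jh ε)) 0 (syn (W j)) x
      + ∑ j, A i j * pd (fastBox T (Jh ε)) 5 (syn (W j)) x = F i x := by
  have h0 := fun j => (hW j).pd_syn hT hε hδ (hD j) hx
  have h5 := fun j => (hW j).pd_syn hT hε hδ (fun k => (hW j).hasPd_theta k) hx
  have := syn_linear (ι := Fin n ⊕ Fin n)
    (a := Sum.elim DW fun j k x => Complex.I * k * W j k x) (x := x)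
    (fun j => by rcases j with j | j; exacts [(h0 j).2, (h5 j).2])
    (Sum.elim (A₃ i) (A i)) (b := comp (F i)) (fun k => by
      rw [← heq k x hx i, Fintype.sum_sum_type, Finset.mul_sum]
      congr 1
      exact Finset.sum_congr rfl fun j _ => by simp only [Sum.elim_inr]; ring)
  rw [syn_comp hT hε (hF i) hx, Fintype.sum_sum_type] at this
  rw [← this]
  congr 1
  · exact Finset.sum_congr rfl fun j _ => by rw [(h0 j).1]; rfl
  · exact Finset.sum_congr rfl fun j _ => by rw [(h5 j).1]; rfl

/-- A family without zero mode has a sum with zero mean, because it is a derivative in `θ`. -/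
lemma NiceAt.mean_syn (hT : 0 < T) (hε : IsSide ε) (hδ : 0 < δ) {a : ℤ → (Fin 6 → ℝ) → ℂ}
    (ha : NiceAt T ε δ a) (h0 : ∀ x, a 0 x = 0) {x : Fin 6 → ℝ}
    (hx : x ∈ dom (fastBox T (Jh ε))) : mean (syn a) x = 0 := by
  have hb := ha.symbol polyGrowth_inv
  have h1 : Set.EqOn (FastProblem.pd (fastBox T (Jh ε)) 5
      (syn fun k x => (Complex.I * (k : ℂ))⁻¹ * a k x)) (syn a) (dom (fastBox T (Jh ε))) :=
    fun x hx => by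
      rw [(hb.pd_syn hT hε hδ (fun k => hb.hasPd_theta k) hx).1, syn, syn]
      congr 2
      ext k
      by_cases hk : k = 0
      · simp [hk, h0]
      · rw [mul_inv_cancel_left₀ (I_mul_ne_zero hk)]
  rw [← mean_congr (fastBox_last _) h1 hx]
  exact mean_pd_last (goodBox_fast hT hε) (fastBox_last _) (hb.inStar_syn hT hε hδ).smoothPer hx

lemma sum_pd_theta_syn (hT : 0 < T) (hε : IsSide ε) (hδ : 0 < δ)
    {W : Fin n → ℤ → (Fin 6 → ℝ) → ℂ} (hW : ∀ j, NiceAt T ε δ (W j)) (c : Fin n → ℝ)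
    {h : (Fin 6 → ℝ) → ℝ} (hh : IsSmoothPer (fastBox T (Jh ε)) h)
    {x : Fin 6 → ℝ} (hx : x ∈ dom (fastBox T (Jh ε)))
    (heq : ∀ k : ℤ, k ≠ 0 → ∑ j, (c j : ℂ) * W j k x = comp h k x) :
    ∑ j, c j * pd (fastBox T (Jh ε)) 5 (syn (W j)) x = pd (fastBox T (Jh ε)) 5 h x := by
  have hs := goodBox_fast hT hε
  have h5 := fun j => (hW j).pd_syn hT hε hδ (fun k => (hW j).hasPd_theta k) hx
  have hc : ∀ k, comp (pd (fastBox T (Jh ε)) 5 h) k x = Complex.I * k * comp h k x := fun k => by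
    have : pd (fastBox T (Jh ε)) 5 h = pd (fastBox T (Jh ε)) (Fin.last 5) h := rfl
    rw [comp, this, mode_pd_last hs (fastBox_last _) hh k hx, comp, mul_assoc]
  have hlin := syn_linear (a := fun j k x => Complex.I * k * W j k x) (fun j => (h5 j).2) c
    (b := comp (pd (fastBox T (Jh ε)) 5 h)) (fun k => by
      rw [hc]
      by_cases hk : k = 0
      · simp [hk]
      · rw [← heq k hk, Finset.mul_sum]
        exact Finset.sum_congr rfl fun j _ => by ring)
  rw [syn_comp hT hε (hh.pd hs 5) hx] at hlin
  rw [← hlin]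
  exact Finset.sum_congr rfl fun j _ => by rw [(h5 j).1]

/-- Solution of the surface wave part of the bulk equations, from pointwise identities for the
Fourier components. -/
lemma starFam_rows (hT : 0 < T) (hε : IsSide ε) (hδ : 0 < δ) {A₃ A : Matrix (Fin m) (Fin n) ℝ}
    {N : Matrix (Fin n) (Fin m) ℝ} {α : Matrix (Fin n) (Fin q) ℝ}
    {F : Fin m → (Fin 6 → ℝ) → ℝ} (hF : ∀ i, IsSmoothPer (fastBox T (Jh ε)) (F i))
    {Z DZ : Fin q → ℤ → (Fin 6 → ℝ) → ℂ} {Z₀ DZ₀ : Fin n → ℤ → (Fin 6 → ℝ) → ℂ}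
    (hW : ∀ j, NiceAt T ε δ (starFam N α F Z Z₀ j))
    (hZ : ∀ l, ∀ k : ℤ, k ≠ 0 → HasPd (fastBox T (Jh ε)) 0 (Z l k) (DZ l k))
    (hZ₀ : ∀ j, HasPd (fastBox T (Jh ε)) 0 (Z₀ j 0) (DZ₀ j 0))
    (heq : ∀ k : ℤ, k ≠ 0 → ∀ x ∈ dom (fastBox T (Jh ε)), ∀ i,
      ∑ j, (A₃ i j : ℂ) * lin N α (Complex.I * k)
          (fun i => comp (pd (fastBox T (Jh ε)) 0 (F i)) k x) (fun l => DZ l k x) j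
        + Complex.I * k * ∑ j, (A i j : ℂ) * lin N α (Complex.I * k)
          (fun i => comp (F i) k x) (fun l => Z l k x) j = comp (F i) k x)
    (heq₀ : ∀ x ∈ dom (fastBox T (Jh ε)), ∀ i,
      ∑ j, (A₃ i j : ℂ) * DZ₀ j 0 x = comp (F i) 0 x)
    {x : Fin 6 → ℝ} (hx : x ∈ dom (fastBox T (Jh ε))) (i : Fin m) :
    ∑ j, A₃ i j * pd (fastBox T (Jh ε)) 0 (syn (starFam N α F Z Z₀ j)) x
      + ∑ j, A i j * pd (fastBox T (Jh ε)) 5 (syn (starFam N α F Z Z₀ j)) x = F i x := by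
  have hs := goodBox_fast hT hε
  refine star_rows hT hε hδ hF hW
    (DW := starFam N α (fun i => pd (fastBox T (Jh ε)) 0 (F i)) DZ DZ₀) (fun j k => ?_)
    (fun k x hx i => ?_) hx i
  · by_cases hk : k = 0
    · subst hk
      exact (hZ₀ j).congr (fun x _ => by simp [starFam]) fun x _ => by simp [starFam]
    · refine HasPd.congr (((HasPd.sum (fun i => hasPd_comp hs (fastBox_last _) (hF i) 0 k)
        fun i => (N j i : ℂ)).const_mul (Complex.I * k)⁻¹).add
        (HasPd.sum (fun l => hZ l k hk) fun l => (α j l : ℂ))) (fun x _ => ?_) (fun x _ => ?_)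
      · simp [starFam, lin, hk]
      · simp [starFam, lin, hk]
  · by_cases hk : k = 0
    · subst hk
      simpa [starFam] using heq₀ x hx i
    · simpa only [starFam, if_neg hk] using heq k hk x hx i

/-- Residual solution: the formula of `lin` with `κ⁻¹` replaced by the antiderivative in `θ`. -/
lemma exists_residual (hT : 0 < T) (hε : IsSide ε) (N : Matrix (Fin n) (Fin m) ℝ)
    (α : Matrix (Fin n) (Fin q) ℝ) (Q : Matrix (Fin q) (Fin m) ℝ) {F : Fin m → (Fin 5 → ℝ) → ℝ}
    (hF : ∀ i, IsHInf (slowBox T (Jh ε)) (F i))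
    (h0 : ∀ i, ∀ z ∈ dom (slowBox T (Jh ε)), mean (F i) z = 0) :
    ∃ U : Fin n → (Fin 5 → ℝ) → ℝ, (∀ j, IsHInf (slowBox T (Jh ε)) (U j)) ∧
      (∀ j, ∀ z ∈ dom (slowBox T (Jh ε)), mean (U j) z = 0) ∧
      ∀ z ∈ dom (slowBox T (Jh ε)), ∀ j, ((pd (slowBox T (Jh ε)) 4 (U j) z : ℝ) : ℂ)
        = lin N α 1 (fun i => (F i z : ℂ)) (fun l => ∑ i, (Q l i : ℂ) * F i z) j := by
  have hs := goodBox_slow hT hε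
  choose g hg hg0 hgd using fun i => (hF i).exists_antideriv hs (slowBox_last _) (h0 i)
  have hsum : ∀ c : Fin m → ℝ, IsHInf (slowBox T (Jh ε)) (fun z => ∑ i, c i * g i z) := by
    intro c
    classical
    suffices ∀ t : Finset (Fin m), IsHInf (slowBox T (Jh ε)) (fun z => ∑ i ∈ t, c i * g i z) from
      this _
    intro t
    induction t using Finset.induction_on with
    | empty => simp only [Finset.sum_empty]; exact IsHInf.zero hs
    | insert i t hi ih =>
      simp only [Finset.sum_insert hi]
      exact ((hg i).smul hs (c i)).add hs ih
  refine ⟨fun j z => ∑ i, (N + α * Q) j i * g i z, fun j => hsum _, fun j z hz => ?_,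
    fun z hz j => ?_⟩
  · have h1 := mode_sum (slowBox_last _) (fun i => (hg i).smoothPer.smooth.continuousOn)
      (fun i => (N + α * Q) j i) 0 hz
    simp only [mode_zero_eq_mean, hg0 _ z hz] at h1
    simpa using h1
  · have h1 := ((HasPd.sum (fun i => hasPd_pd (hg i).smoothPer.smooth 4)
      fun i => (N + α * Q) j i)).eqOn_pd hs (hsum _).smoothPer.smooth hz
    have h2 : ∀ i, pd (slowBox T (Jh ε)) 4 (g i) z = F i z := fun i => hgd i hz
    rw [h1]
    simp only [h2, lin, inv_one, one_mul, Matrix.add_apply, Matrix.mul_apply]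
    push_cast
    simp only [add_mul, Finset.sum_add_distrib, Finset.sum_mul, Finset.mul_sum]
    congr 1
    rw [Finset.sum_comm]
    exact Finset.sum_congr rfl fun i _ => Finset.sum_congr rfl fun l _ => by ring

end

/-! ### The two bulk systems -/

namespace Params
variable (p : Params)

/-- `A₃⁺` together with the row of the divergence constraint. -/
def A3P : Matrix (Fin 8) (Fin 7) ℝ :=
  !![0, 0, p.u₁, 0, 0, -p.B₁, 0;
     0, 0, p.u₂, 0, 0, -p.B₂, 0;
     0, 0, 0, 0, 0, 0, 1;
     0, 0, p.B₁, 0, 0, -p.u₁, 0;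
     0, 0, p.B₂, 0, 0, -p.u₂, 0;
     0, 0, 0, 0, 0, 0, 0;
     0, 0, 1, 0, 0, 0, 0;
     0, 0, 0, 0, 0, 1, 0]

/-- `𝒜⁺` together with the row of the divergence constraint. -/
def AP : Matrix (Fin 8) (Fin 7) ℝ :=
  !![p.cp + p.ξ₁ * p.u₁, p.ξ₂ * p.u₁, 0, -(p.bp + p.ξ₁ * p.B₁), -(p.ξ₂ * p.B₁), 0, p.ξ₁;
     p.ξ₁ * p.u₂, p.cp + p.ξ₂ * p.u₂, 0, -(p.ξ₁ * p.B₂), -(p.bp + p.ξ₂ * p.B₂), 0, p.ξ₂;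
     0, 0, p.cp, 0, 0, -p.bp, 0;
     -(p.ξ₂ * p.B₂), p.ξ₂ * p.B₁, 0, p.cp - p.ξ₁ * p.u₁, -(p.ξ₂ * p.u₁), 0, 0;
     p.ξ₁ * p.B₂, -(p.ξ₁ * p.B₁), 0, -(p.ξ₁ * p.u₂), p.cp - p.ξ₂ * p.u₂, 0, 0;
     0, 0, -p.bp, 0, 0, p.cp, 0;
     p.ξ₁, p.ξ₂, 0, 0, 0, 0, 0;
     0, 0, 0, p.ξ₁, p.ξ₂, 0, 0]

/-- `A₃⁻` together with the rows of the divergence constraints. -/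
def A3M : Matrix (Fin 8) (Fin 6) ℝ :=
  !![0, 0, 0, 0, -1, 0;
     0, 0, 0, 1, 0, 0;
     0, 0, 0, 0, 0, 0;
     0, 1, 0, 0, 0, 0;
     -1, 0, 0, 0, 0, 0;
     0, 0, 0, 0, 0, 0;
     0, 0, 1, 0, 0, 0;
     0, 0, 0, 0, 0, 1]

/-- `𝒜⁻` together with the rows of the divergence constraints. -/
def AM : Matrix (Fin 8) (Fin 6) ℝ :=
  !![p.ν * p.τ, 0, 0, 0, 0, p.ξ₂;
     0, p.ν * p.τ, 0, 0, 0, -p.ξ₁;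
     0, 0, p.ν * p.τ, -p.ξ₂, p.ξ₁, 0;
     0, 0, -p.ξ₂, p.ν * p.τ, 0, 0;
     0, 0, p.ξ₁, 0, p.ν * p.τ, 0;
     p.ξ₂, -p.ξ₁, 0, 0, 0, p.ν * p.τ;
     p.ξ₁, p.ξ₂, 0, 0, 0, 0;
     0, 0, 0, p.ξ₁, p.ξ₂, 0]

/-- `(c⁺)² - (b⁺)²`. -/
def disc : ℝ := p.cp ^ 2 - p.bp ^ 2

/-- Dependence of the plasma solution on the source. -/
def NP : Matrix (Fin 7) (Fin 8) ℝ :=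
  !![p.cp / p.disc, 0, 0, p.bp / p.disc, 0, 0, -(p.cp * p.u₁ + p.bp * p.B₁) / p.disc,
       (p.cp * p.B₁ + p.bp * p.u₁) / p.disc;
     0, p.cp / p.disc, 0, 0, p.bp / p.disc, 0, -(p.cp * p.u₂ + p.bp * p.B₂) / p.disc,
       (p.cp * p.B₂ + p.bp * p.u₂) / p.disc;
     0, 0, 0, 0, 0, p.bp / p.disc, 0, 0;
     p.bp / p.disc, 0, 0, p.cp / p.disc, 0, 0, -(p.cp * p.B₁ + p.bp * p.u₁) / p.disc,
       (p.cp * p.u₁ + p.bp * p.B₁) / p.disc;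
     0, p.bp / p.disc, 0, 0, p.cp / p.disc, 0, -(p.cp * p.B₂ + p.bp * p.u₂) / p.disc,
       (p.cp * p.u₂ + p.bp * p.B₂) / p.disc;
     0, 0, 0, 0, 0, p.cp / p.disc, 0, 0;
     0, 0, 0, 0, 0, 0, 0, 0]

/-- Dependence of the plasma solution on `c⁺u₃ - b⁺B₃` and `q`. -/
def αP : Matrix (Fin 7) (Fin 2) ℝ :=
  !![0, -p.ξ₁ * p.cp / p.disc; 0, -p.ξ₂ * p.cp / p.disc; p.cp / p.disc, 0;
     0, -p.ξ₁ * p.bp / p.disc; 0, -p.ξ₂ * p.bp / p.disc; p.bp / p.disc, 0; 0, 1]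

/-- The residual values of `∂_θ (c⁺u₃ - b⁺B₃)` and `∂_θ q` in terms of the source. -/
def QP : Matrix (Fin 2) (Fin 8) ℝ :=
  !![0, 0, 1, 0, 0, 0, 0, 0; p.ξ₁, p.ξ₂, 0, 0, 0, 0, -(p.ap + p.cp), 2 * p.bp]

/-- Dependence of the vacuum solution on the source. -/
def NM : Matrix (Fin 6) (Fin 8) ℝ :=
  !![0, 0, 0, 0, 0, p.ξ₂, 0, 0; 0, 0, 0, 0, 0, -p.ξ₁, 0, 0; 0, 0, 0, 0, 0, 0, 0, 0;
     0, 0, -p.ξ₂, 0, 0, 0, 0, 0; 0, 0, p.ξ₁, 0, 0, 0, 0, 0; 0, 0, 0, 0, 0, 0, 0, 0]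

/-- Dependence of the vacuum solution on `ξ·H`, `H₃`, `ξ·E`, `E₃`. -/
def αM : Matrix (Fin 6) (Fin 4) ℝ :=
  !![p.ξ₁, 0, 0, -(p.ξ₂ * (p.ν * p.τ)); p.ξ₂, 0, 0, p.ξ₁ * (p.ν * p.τ); 0, 1, 0, 0;
     0, p.ξ₂ * (p.ν * p.τ), p.ξ₁, 0; 0, -(p.ξ₁ * (p.ν * p.τ)), p.ξ₂, 0; 0, 0, 0, 1]

/-- The residual values of `∂_θ (ξ·H)`, `∂_θ H₃`, `∂_θ (ξ·E)`, `∂_θ E₃` in terms of the source. -/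
def QM : Matrix (Fin 4) (Fin 8) ℝ :=
  !![0, 0, 0, 0, 0, 0, 1, 0;
     0, 0, -(p.ν * p.τ) / p.rt ^ 2, -p.ξ₂ / p.rt ^ 2, p.ξ₁ / p.rt ^ 2, 0, 0, 0;
     0, 0, 0, 0, 0, 0, 0, 1;
     p.ξ₂ / p.rt ^ 2, -p.ξ₁ / p.rt ^ 2, 0, 0, 0, -(p.ν * p.τ) / p.rt ^ 2, 0, 0]

variable {p}

/-- The solution formula for the plasma. Given its Fourier coefficients, the eight equations hold as
soon as `Z = (c⁺u₃ - b⁺B₃, q)` solves a two by two system and the sources satisfy the divergence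
identity. The same statement serves the surface wave part, with `κ = ik`, and the residual part, with
`κ = 1` and without `Y₃` derivatives. -/
lemma plasma_rows (hξ : p.ξ₁ ^ 2 + p.ξ₂ ^ 2 = 1) (hΔ : p.disc ≠ 0) {κ : ℂ} (hκ : κ ≠ 0)
    {F DF : Fin 8 → ℂ} {Z DZ : Fin 2 → ℂ}
    (h1 : DZ 0 = κ * Z 1 + ((p.ap + p.cp) * F 6 - 2 * p.bp * F 7 - p.ξ₁ * F 0 - p.ξ₂ * F 1))
    (h2 : DZ 1 = -κ * Z 0 + F 2)
    (h3 : DF 5 + κ * (p.ξ₁ * F 3 + p.ξ₂ * F 4 - p.τ * F 7) = 0) (i : Fin 8) :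
    ∑ j, (p.A3P i j : ℂ) * lin p.NP p.αP κ DF DZ j
      + κ * ∑ j, (p.AP i j : ℂ) * lin p.NP p.αP κ F Z j = F i := by
  have hΔc : (p.disc : ℂ) ≠ 0 := by exact_mod_cast hΔ
  have hd : (p.disc : ℂ) = p.cp ^ 2 - p.bp ^ 2 := by rw [disc]; push_cast; ring
  have hξc : (p.ξ₁ : ℂ) ^ 2 + p.ξ₂ ^ 2 = 1 := by exact_mod_cast hξ
  have hc : (p.cp : ℂ) = p.τ + (p.ξ₁ * p.u₁ + p.ξ₂ * p.u₂) := by rw [cp, ap]; push_cast; ring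
  have ha : (p.ap : ℂ) = p.ξ₁ * p.u₁ + p.ξ₂ * p.u₂ := by rw [ap]; push_cast; ring
  have hb : (p.bp : ℂ) = p.ξ₁ * p.B₁ + p.ξ₂ * p.B₂ := by rw [bp]; push_cast; ring
  obtain ⟨D2, eD2⟩ : ∃ D, lin p.NP p.αP κ DF DZ 2 = D := ⟨_, rfl⟩
  obtain ⟨D5, eD5⟩ : ∃ D, lin p.NP p.αP κ DF DZ 5 = D := ⟨_, rfl⟩
  obtain ⟨D6, eD6⟩ : ∃ D, lin p.NP p.αP κ DF DZ 6 = D := ⟨_, rfl⟩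
  obtain ⟨U, eU⟩ : ∃ U, lin p.NP p.αP κ F Z = U := ⟨_, rfl⟩
  have w1 : κ * (p.cp * U 0 - p.bp * U 3) = F 0 - p.u₁ * F 6 + p.B₁ * F 7 - κ * p.ξ₁ * Z 1 := by
    rw [← eU]; simp [lin, NP, αP, Fin.sum_univ_succ]; field_simp; rw [hd]; ring
  have w2 : κ * (p.cp * U 1 - p.bp * U 4) = F 1 - p.u₂ * F 6 + p.B₂ * F 7 - κ * p.ξ₂ * Z 1 := by
    rw [← eU]; simp [lin, NP, αP, Fin.sum_univ_succ]; field_simp; rw [hd]; ring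
  have w3 : p.cp * U 2 - p.bp * U 5 = Z 0 := by
    rw [← eU]; simp [lin, NP, αP, Fin.sum_univ_succ]; field_simp; rw [hd]; ring
  have z1 : κ * (p.cp * U 3 - p.bp * U 0) = F 3 - p.B₁ * F 6 + p.u₁ * F 7 := by
    rw [← eU]; simp [lin, NP, αP, Fin.sum_univ_succ]; field_simp; rw [hd]; ring
  have z2 : κ * (p.cp * U 4 - p.bp * U 1) = F 4 - p.B₂ * F 6 + p.u₂ * F 7 := by
    rw [← eU]; simp [lin, NP, αP, Fin.sum_univ_succ]; field_simp; rw [hd]; ring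
  have z3 : κ * (p.cp * U 5 - p.bp * U 2) = F 5 := by
    rw [← eU]; simp [lin, NP, αP, Fin.sum_univ_succ]; field_simp; rw [hd]; ring
  have d6 : D6 = DZ 1 := by rw [← eD6]; simp [lin, NP, αP, Fin.sum_univ_succ]
  have dw : p.cp * D2 - p.bp * D5 = DZ 0 := by
    rw [← eD2, ← eD5]; simp [lin, NP, αP, Fin.sum_univ_succ]; field_simp; rw [hd]; ring
  have dz : κ * (p.cp * D5 - p.bp * D2) = DF 5 := by
    rw [← eD2, ← eD5]; simp [lin, NP, αP, Fin.sum_univ_succ]; field_simp; rw [hd]; ring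
  -- `c` and `b` times the two divergences
  have e1 : p.cp * (D2 + κ * (p.ξ₁ * U 0 + p.ξ₂ * U 1))
      - p.bp * (D5 + κ * (p.ξ₁ * U 3 + p.ξ₂ * U 4)) = p.cp * F 6 - p.bp * F 7 := by
    linear_combination dw + h1 + p.ξ₁ * w1 + p.ξ₂ * w2 - κ * Z 1 * hξc + F 6 * ha - F 7 * hb
  have e2 : p.cp * (D5 + κ * (p.ξ₁ * U 3 + p.ξ₂ * U 4))
      - p.bp * (D2 + κ * (p.ξ₁ * U 0 + p.ξ₂ * U 1)) = p.cp * F 7 - p.bp * F 6 := by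
    refine mul_left_cancel₀ hκ ?_
    linear_combination dz + h3 + κ * p.ξ₁ * z1 + κ * p.ξ₂ * z2 + κ * F 6 * hb - κ * F 7 * hc
  have s1 : D2 + κ * (p.ξ₁ * U 0 + p.ξ₂ * U 1) = F 6 := by
    refine mul_left_cancel₀ hΔc ?_
    rw [hd]; linear_combination p.cp * e1 + p.bp * e2
  have s2 : D5 + κ * (p.ξ₁ * U 3 + p.ξ₂ * U 4) = F 7 := by
    refine mul_left_cancel₀ hΔc ?_
    rw [hd]; linear_combination p.bp * e1 + p.cp * e2
  rw [eU]
  have hU6 : U 6 = Z 1 := by rw [← eU]; simp [lin, NP, αP, Fin.sum_univ_succ]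
  fin_cases i
  · simp [A3P, AP, Fin.sum_univ_seven, eD2, eD5, eD6]
    linear_combination p.u₁ * s1 - p.B₁ * s2 + w1 + κ * p.ξ₁ * hU6
  · simp [A3P, AP, Fin.sum_univ_seven, eD2, eD5, eD6]
    linear_combination p.u₂ * s1 - p.B₂ * s2 + w2 + κ * p.ξ₂ * hU6
  · simp [A3P, AP, Fin.sum_univ_seven, eD2, eD5, eD6]
    linear_combination d6 + h2 + κ * w3
  · simp [A3P, AP, Fin.sum_univ_seven, eD2, eD5, eD6]
    linear_combination p.B₁ * s1 - p.u₁ * s2 + z1 + κ * U 0 * hb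
  · simp [A3P, AP, Fin.sum_univ_seven, eD2, eD5, eD6]
    linear_combination p.B₂ * s1 - p.u₂ * s2 + z2 + κ * U 1 * hb
  · simp [A3P, AP, Fin.sum_univ_seven, eD2, eD5, eD6]
    linear_combination z3
  · simp [A3P, AP, Fin.sum_univ_seven, eD2, eD5, eD6]
    linear_combination s1
  · simp [A3P, AP, Fin.sum_univ_seven, eD2, eD5, eD6]
    linear_combination s2

/-- The solution formula for the vacuum. Here `Z = (ξ·H, H₃, ξ·E, E₃)`, and the equations decouple
into two systems of two equations. -/
lemma vacuum_rows (hξ : p.ξ₁ ^ 2 + p.ξ₂ ^ 2 = 1) {κ : ℂ} (hκ : κ ≠ 0)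
    (hρ : p.rt ^ 2 = 1 - p.ν ^ 2 * p.τ ^ 2)
    {F DF : Fin 8 → ℂ} {Z DZ : Fin 4 → ℂ}
    (h0 : DZ 0 = κ * p.rt ^ 2 * Z 1 + (p.ν * p.τ * F 2 - (p.ξ₁ * F 4 - p.ξ₂ * F 3)))
    (h1 : DZ 1 = -κ * Z 0 + F 6)
    (h2 : DZ 2 = κ * p.rt ^ 2 * Z 3 + (p.ν * p.τ * F 5 + (p.ξ₁ * F 1 - p.ξ₂ * F 0)))
    (h3 : DZ 3 = -κ * Z 2 + F 7)
    (h4 : DF 2 + κ * (p.ξ₁ * F 0 + p.ξ₂ * F 1 - p.ν * p.τ * F 6) = 0)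
    (h5 : DF 5 + κ * (p.ξ₁ * F 3 + p.ξ₂ * F 4 - p.ν * p.τ * F 7) = 0) (i : Fin 8) :
    ∑ j, (A3M i j : ℂ) * lin p.NM p.αM κ DF DZ j
      + κ * ∑ j, (p.AM i j : ℂ) * lin p.NM p.αM κ F Z j = F i := by
  have hξc : (p.ξ₁ : ℂ) ^ 2 + p.ξ₂ ^ 2 = 1 := by exact_mod_cast hξ
  have hρc : (p.rt : ℂ) ^ 2 = 1 - p.ν ^ 2 * p.τ ^ 2 := by exact_mod_cast hρ
  rw [hρc] at h0 h2
  fin_cases i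
  all_goals
    simp [A3M, AM, lin, NM, αM, Fin.sum_univ_succ, h0, h1, h2, h3, eq_neg_of_add_eq_zero_left h4,
      eq_neg_of_add_eq_zero_left h5]
    field_simp
  · linear_combination F 0 * hξc
  · linear_combination F 1 * hξc
  · linear_combination (F 2 - κ * p.ν * p.τ * Z 1) * hξc
  · linear_combination F 3 * hξc
  · linear_combination F 4 * hξc
  · linear_combination (F 5 - κ * p.ν * p.τ * Z 3) * hξc
  · linear_combination κ * Z 0 * hξc
  · linear_combination κ * Z 2 * hξc

end Params

/-! ### Surface wave solutions of the bulk systems -/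

section
variable {T ε δ : ℝ}

/-- A primitive in `Y₃` of the zero mode. -/
lemma NiceAt.exists_primitive (hT : 0 < T) (hε : IsSide ε) (hδ : 0 < δ)
    {a : ℤ → (Fin 6 → ℝ) → ℂ} (ha : NiceAt T ε δ a) :
    ∃ b, NiceAt T ε δ b ∧ HasPd (fastBox T (Jh ε)) 0 (b 0) (a 0) := by
  refine ⟨_, (ha.Tm hT hε hδ zero_le_one).symbol (.const (-ε)),
    ((ha.hasPd_Tm hT hε hδ zero_le_one 0).const_mul _).congr (fun _ _ => rfl) fun x _ => ?_⟩
  have hε2 : (ε : ℂ) * ε = 1 := by exact_mod_cast side_mul_self hε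
  simp only [Int.cast_zero, abs_zero, mul_zero, Complex.ofReal_zero, zero_mul, zero_sub]
  linear_combination -a 0 x * hε2

/-- Fourier components of a divergence identity. -/
lemma comp_divergence (hT : 0 < T) (hε : IsSide ε) {f g₁ g₂ g₃ : (Fin 6 → ℝ) → ℝ}
    (hf : IsSmoothPer (fastBox T (Jh ε)) f) (h₁ : IsSmoothPer (fastBox T (Jh ε)) g₁)
    (h₂ : IsSmoothPer (fastBox T (Jh ε)) g₂) (h₃ : IsSmoothPer (fastBox T (Jh ε)) g₃)
    {c₁ c₂ c₃ : ℝ} (h : ∀ x ∈ dom (fastBox T (Jh ε)), pd (fastBox T (Jh ε)) 0 f x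
      + (c₁ * pd (fastBox T (Jh ε)) 5 g₁ x + c₂ * pd (fastBox T (Jh ε)) 5 g₂ x)
      - c₃ * pd (fastBox T (Jh ε)) 5 g₃ x = 0) (k : ℤ) {x : Fin 6 → ℝ}
    (hx : x ∈ dom (fastBox T (Jh ε))) :
    comp (pd (fastBox T (Jh ε)) 0 f) k x
      + Complex.I * k * (c₁ * comp g₁ k x + c₂ * comp g₂ k x - c₃ * comp g₃ k x) = 0 := by
  have hs := goodBox_fast hT hε
  have hl : fastBox T (Jh ε) (Fin.last 5) = none := fastBox_last _
  have h0 : mode (fun x => ∑ i, ![1, c₁, c₂, -c₃] i * (![pd (fastBox T (Jh ε)) 0 f,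
      pd (fastBox T (Jh ε)) 5 g₁, pd (fastBox T (Jh ε)) 5 g₂, pd (fastBox T (Jh ε)) 5 g₃] i) x) k x
      = mode (fun _ => 0) k x := by
    refine mode_congr hl (fun x hx => ?_) k hx
    simp only [Fin.sum_univ_four]
    simp
    linear_combination h x hx
  rw [mode_sum hl] at h0
  · have e : ∀ g, IsSmoothPer (fastBox T (Jh ε)) g →
        mode (pd (fastBox T (Jh ε)) 5 g) k x = Complex.I * k * mode g k x :=
      fun g hg => mode_pd_last hs hl hg k hx
    simp [Fin.sum_univ_four, e _ h₁, e _ h₂, e _ h₃] at h0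
    have h1 : mode (fun _ => 0 : (Fin 6 → ℝ) → ℝ) k x = 0 := by simp [mode]
    rw [h1] at h0
    simp only [comp]
    linear_combination Complex.exp (Complex.I * k * x (Fin.last 5)) * h0
  · intro i
    fin_cases i
    exacts [(hf.pd hs 0).smooth.continuousOn, (h₁.pd hs 5).smooth.continuousOn,
      (h₂.pd hs 5).smooth.continuousOn, (h₃.pd hs 5).smooth.continuousOn]
  · exact hx

lemma comp_zero_eq_mean {n : ℕ} (f : (Fin (n + 1) → ℝ) → ℝ) (x : Fin (n + 1) → ℝ) :
    comp f 0 x = (mean f x : ℂ) := by simp [comp, mode_zero_eq_mean]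

lemma InStar.isProfile {J : Set ℝ} {f : (Fin 6 → ℝ) → ℝ} (hf : InStar T J f) :
    IsProfile T J (0, f) :=
  ⟨⟨contDiffOn_const, fun _ _ _ _ => rfl⟩, hf.smoothPer, hf.abs_le⟩

lemma val_zero_left (f : (Fin 6 → ℝ) → ℝ) : val (0, f) = f := by ext; simp [val]

lemma vecCons_side (hε : IsSide ε) (x : Fin 6 → ℝ) :
    Matrix.vecCons (ε * (ε * x 0)) (Matrix.vecTail x) = x := by
  rw [← mul_assoc, side_mul_self hε, one_mul]
  exact Matrix.cons_head_tail x

/-- A decaying function whose `Y₃` derivative has zero mean has zero mean. -/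
lemma InStar.mean_eq_zero (hT : 0 < T) (hε : IsSide ε) {f : (Fin 6 → ℝ) → ℝ}
    (hf : InStar T (Jh ε) f)
    (h : ∀ x ∈ dom (fastBox T (Jh ε)), comp (FastProblem.pd (fastBox T (Jh ε)) 0 f) 0 x = 0)
    {x : Fin 6 → ℝ} (hx : x ∈ dom (fastBox T (Jh ε))) : comp f 0 x = 0 := by
  have hz := mem_dom_vecTail (s := slowBox T (Jh ε)) hx
  have hP := hf.isProfile
  have hd : ∀ r, 0 ≤ r → HasDerivWithinAt
      (fun r => FastProblem.mode f 0 (Matrix.vecCons (ε * r) (Matrix.vecTail x)))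
      (((0 : ℝ) : ℂ) * FastProblem.mode f 0 (Matrix.vecCons (ε * r) (Matrix.vecTail x)))
      (Set.Ici 0) r := fun r hr => by
    have h1 := hP.hasDeriv_mode hT hε 0 hz hr
    have h2 := h _ (IsProfile.mem_ray hε hz hr)
    simp only [comp, Int.cast_zero, mul_zero, zero_mul, Complex.exp_zero, mul_one] at h2
    rw [dY, val_zero_left, h2, mul_zero] at h1
    simpa using h1
  have ht := hP.tendsto_mode_star hε 0 hz
  have h0 : FastProblem.mode f 0 (Matrix.vecCons (ε * 0) (Matrix.vecTail x)) = 0 := by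
    refine tendsto_nhds_unique (tendsto_const_nhds.congr' ?_) ht
    filter_upwards [Filter.eventually_ge_atTop 0] with r hr
    have := eq_exp_mul hd hr
    simp only [zero_mul, Real.exp_zero, Complex.ofReal_one, one_mul] at this
    exact this.symm
  have h3 := eq_exp_mul hd (r := ε * x 0) (mem_Jh_of_mem_dom hx)
  rw [h0, mul_zero, vecCons_side hε] at h3
  simp [comp, h3]

end

namespace Params
variable {p : Params} {T : ℝ}

lemma plasma_trace (hΔ : p.disc ≠ 0) {κ : ℂ} {F : Fin 8 → ℂ} {Z : Fin 2 → ℂ} :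
    p.cp * lin p.NP p.αP κ F Z 2 - p.bp * lin p.NP p.αP κ F Z 5 = Z 0 := by
  have hΔc : (p.disc : ℂ) ≠ 0 := by exact_mod_cast hΔ
  have hd : (p.disc : ℂ) = p.cp ^ 2 - p.bp ^ 2 := by rw [disc]; push_cast; ring
  simp [lin, NP, αP, Fin.sum_univ_succ]
  field_simp
  rw [hd]; ring

/-- The surface wave part of the plasma equations, with the nonzero modes of `c⁺u₃ - b⁺B₃` prescribed
at `Y₃ = 0`. -/
lemma exists_star_plasma (hT : 0 < T) (hξ : p.ξ₁ ^ 2 + p.ξ₂ ^ 2 = 1) (hΔ : p.disc ≠ 0)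
    {F : Fin 8 → (Fin 6 → ℝ) → ℝ} (hF : ∀ i, InStar T (Jh 1) (F i)) {h : (Fin 6 → ℝ) → ℝ}
    (hh : InStar T (Jh 1) h)
    (hc : ∀ x ∈ dom (fastBox T (Jh 1)),
      p.u₁ * mean (F 6) x - p.B₁ * mean (F 7) x = mean (F 0) x ∧
      p.u₂ * mean (F 6) x - p.B₂ * mean (F 7) x = mean (F 1) x ∧
      p.B₁ * mean (F 6) x - p.u₁ * mean (F 7) x = mean (F 3) x ∧
      p.B₂ * mean (F 6) x - p.u₂ * mean (F 7) x = mean (F 4) x)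
    (hd : ∀ x ∈ dom (fastBox T (Jh 1)), pd (fastBox T (Jh 1)) 0 (F 5) x
      + (p.ξ₁ * pd (fastBox T (Jh 1)) 5 (F 3) x + p.ξ₂ * pd (fastBox T (Jh 1)) 5 (F 4) x)
      - p.τ * pd (fastBox T (Jh 1)) 5 (F 7) x = 0) :
    ∃ U : Fin 7 → (Fin 6 → ℝ) → ℝ, (∀ j, InStar T (Jh 1) (U j)) ∧
      (∀ x ∈ dom (fastBox T (Jh 1)), ∀ i, ∑ j, p.A3P i j * pd (fastBox T (Jh 1)) 0 (U j) x
        + ∑ j, p.AP i j * pd (fastBox T (Jh 1)) 5 (U j) x = F i x) ∧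
      (∀ j ∈ ({0, 1, 3, 4} : Set (Fin 7)), ∀ x ∈ dom (fastBox T (Jh 1)), mean (U j) x = 0) ∧
      ∀ x ∈ dom (fastBox T (Jh 1)), x 0 = 0 →
        p.cp * pd (fastBox T (Jh 1)) 5 (U 2) x - p.bp * pd (fastBox T (Jh 1)) 5 (U 5) x
          = pd (fastBox T (Jh 1)) 5 h x := by
  have hε : IsSide 1 := .inl rfl
  obtain ⟨δ, hδ, hδ1, hn⟩ := exists_common_niceAt hT hε
    (F := fun o : Option (Fin 8) => o.elim h F) (fun o => by cases o; exacts [hh, hF _]) one_pos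
  have hnF : ∀ i, NiceAt T 1 δ (comp (F i)) := fun i => hn (some i)
  have hnr := NiceAt.sum hnF
    ![-(p.ξ₁ : ℂ), -(p.ξ₂ : ℂ), 0, 0, 0, 0, ((p.ap + p.cp : ℝ) : ℂ), -(2 * p.bp : ℂ)]
  obtain ⟨a, b, ha, hb, da, db, ha0⟩ := exists_halfspace hT hε hδ hδ1 hnr (hnF 2) (hn none)
  choose B hB hBd using fun i => (hnF i).exists_primitive hT hε hδ
  have hδ2 : δ / 2 ≤ δ := by linarith
  let Z : Fin 2 → ℤ → (Fin 6 → ℝ) → ℂ := ![a, b]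
  -- The zero mode: `u₃`, `B₃`, `q` are primitives in `Y₃` of the rows 6, 7, 2 of the source.
  let Z₀ : Fin 7 → ℤ → (Fin 6 → ℝ) → ℂ :=
    ![fun _ _ => 0, fun _ _ => 0, B 6, fun _ _ => 0, fun _ _ => 0, B 7, B 2]
  have hW : ∀ j, NiceAt T 1 (δ / 2) (starFam p.NP p.αP F Z Z₀ j) := by
    refine niceAt_starFam _ _ (fun i => (hnF i).mono hδ2) (Fin.forall_fin_two.2 ⟨ha, hb⟩)
      (fun j => ?_)
    fin_cases j
    exacts [.zero, .zero, (hB _).mono hδ2, .zero, .zero, (hB _).mono hδ2, (hB _).mono hδ2]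
  have hδ' : 0 < δ / 2 := by linarith
  have hdiv := fun k (x : Fin 6 → ℝ) (hx : x ∈ dom _) => comp_divergence hT hε (hF 5).smoothPer
    (hF 3).smoothPer (hF 4).smoothPer (hF 7).smoothPer hd k hx
  have hF5 : ∀ x ∈ dom (fastBox T (Jh 1)), comp (F 5) 0 x = 0 := fun x hx =>
    (hF 5).mean_eq_zero hT hε (fun x hx => by simpa using hdiv 0 x hx) hx
  refine ⟨fun j => syn (starFam p.NP p.αP F Z Z₀ j), fun j => (hW j).inStar_syn hT hε hδ',
    fun x hx i => starFam_rows hT hε hδ' (fun i => (hF i).smoothPer) hW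
      (DZ := ![fun k x => _, fun k x => _])
      (DZ₀ := ![fun _ _ => 0, fun _ _ => 0, comp (F 6), fun _ _ => 0, fun _ _ => 0, comp (F 7),
        comp (F 2)]) (Fin.forall_fin_two.2 ⟨da, db⟩) (fun j => ?_) (fun k hk x hx i => ?_)
      (fun x hx i => ?_) hx i, fun j hj x hx => (hW j).mean_syn hT hε hδ' (fun x => ?_) hx,
    fun x hx hx0 => ?_⟩
  · have hz : HasPd (fastBox T (Jh 1)) 0 (fun _ => (0 : ℂ)) (fun _ => 0) :=
      fun x _ => hasDerivWithinAt_const _ _ _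
    fin_cases j
    exacts [hz, hz, hBd _, hz, hz, hBd _, hBd _]
  · refine plasma_rows hξ hΔ (I_mul_ne_zero hk) ?_ rfl ?_ i
    · simp [Z, Fin.sum_univ_eight]; ring
    · exact hdiv k x hx
  · obtain ⟨c1, c2, c3, c4⟩ := hc x hx
    have h5 := hF5 x hx
    simp only [comp_zero_eq_mean] at h5 ⊢
    have h5' : mean (F 5) x = 0 := by exact_mod_cast h5
    fin_cases i <;> simp [A3P, Fin.sum_univ_seven, comp_zero_eq_mean, ← c1, ← c2, ← c3, ← c4, h5'] <;>
      ring
  · rcases hj with rfl | rfl | rfl | rfl <;> simp [starFam, Z₀]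
  · have := sum_pd_theta_syn hT hε hδ' hW ![0, 0, p.cp, 0, 0, -p.bp, 0] hh.smoothPer hx
      (fun k hk => by
        rw [← show a k x = comp h k x from ha0 k hk x hx hx0]
        have := plasma_trace hΔ (κ := Complex.I * k) (F := fun i => comp (F i) k x)
          (Z := fun l => Z l k x)
        rw [show Z 0 k x = a k x from rfl] at this
        simp only [Fin.sum_univ_seven, starFam, if_neg hk]
        simp
        linear_combination this)
    simp only [Fin.sum_univ_seven] at this
    simp at this
    linear_combination this

lemma vacuum_traceE (hξ : p.ξ₁ ^ 2 + p.ξ₂ ^ 2 = 1) {κ : ℂ} {F : Fin 8 → ℂ} {Z : Fin 4 → ℂ} :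
    p.ξ₁ * lin p.NM p.αM κ F Z 3 + p.ξ₂ * lin p.NM p.αM κ F Z 4 = Z 2 := by
  have hξc : (p.ξ₁ : ℂ) ^ 2 + p.ξ₂ ^ 2 = 1 := by exact_mod_cast hξ
  simp [lin, NM, αM, Fin.sum_univ_succ]
  linear_combination Z 2 * hξc

/-- The surface wave part of the vacuum equations, with the nonzero modes of `H₃` and of `ξ·E`
prescribed at `Y₃ = 0`. -/
lemma exists_star_vacuum (hT : 0 < T) (hξ : p.ξ₁ ^ 2 + p.ξ₂ ^ 2 = 1) (hρ0 : 0 < p.rt)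
    (hρ : p.rt ^ 2 = 1 - p.ν ^ 2 * p.τ ^ 2)
    {F : Fin 8 → (Fin 6 → ℝ) → ℝ} (hF : ∀ i, InStar T (Jh (-1)) (F i)) {h h' : (Fin 6 → ℝ) → ℝ}
    (hh : InStar T (Jh (-1)) h) (hh' : InStar T (Jh (-1)) h')
    (hd : ∀ x ∈ dom (fastBox T (Jh (-1))), pd (fastBox T (Jh (-1))) 0 (F 2) x
      + (p.ξ₁ * pd (fastBox T (Jh (-1))) 5 (F 0) x + p.ξ₂ * pd (fastBox T (Jh (-1))) 5 (F 1) x)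
      - p.ν * p.τ * pd (fastBox T (Jh (-1))) 5 (F 6) x = 0)
    (hd' : ∀ x ∈ dom (fastBox T (Jh (-1))), pd (fastBox T (Jh (-1))) 0 (F 5) x
      + (p.ξ₁ * pd (fastBox T (Jh (-1))) 5 (F 3) x + p.ξ₂ * pd (fastBox T (Jh (-1))) 5 (F 4) x)
      - p.ν * p.τ * pd (fastBox T (Jh (-1))) 5 (F 7) x = 0) :
    ∃ V : Fin 6 → (Fin 6 → ℝ) → ℝ, (∀ j, InStar T (Jh (-1)) (V j)) ∧
      (∀ x ∈ dom (fastBox T (Jh (-1))), ∀ i, ∑ j, A3M i j * pd (fastBox T (Jh (-1))) 0 (V j) x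
        + ∑ j, p.AM i j * pd (fastBox T (Jh (-1))) 5 (V j) x = F i x) ∧
      ∀ x ∈ dom (fastBox T (Jh (-1))), x 0 = 0 →
        pd (fastBox T (Jh (-1))) 5 (V 2) x = pd (fastBox T (Jh (-1))) 5 h x ∧
        p.ξ₁ * pd (fastBox T (Jh (-1))) 5 (V 3) x + p.ξ₂ * pd (fastBox T (Jh (-1))) 5 (V 4) x
          = pd (fastBox T (Jh (-1))) 5 h' x := by
  have hε : IsSide (-1) := .inr rfl
  obtain ⟨δ, hδ, hδ1, hn⟩ := exists_common_niceAt hT hε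
    (F := fun o : Option (Option (Fin 8)) => o.elim h fun o => o.elim h' F)
    (fun o => by rcases o with _ | _ | i; exacts [hh, hh', hF _]) hρ0
  have hnF : ∀ i, NiceAt T (-1) δ (comp (F i)) := fun i => hn (some (some i))
  have hnr := NiceAt.sum hnF
    ![0, 0, ((p.ν * p.τ : ℝ) : ℂ), (p.ξ₂ : ℂ), -(p.ξ₁ : ℂ), 0, 0, 0]
  have hnr' := NiceAt.sum hnF
    ![-(p.ξ₂ : ℂ), (p.ξ₁ : ℂ), 0, 0, 0, ((p.ν * p.τ : ℝ) : ℂ), 0, 0]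
  obtain ⟨a, b, ha, hb, da, db, hb0⟩ := exists_halfspace' hT hε hδ hδ1 hnr (hnF 6) (hn none)
  obtain ⟨a', b', ha', hb', da', db', ha0⟩ :=
    exists_halfspace hT hε hδ hδ1 hnr' (hnF 7) (hn (some none))
  choose B hB hBd using fun i => (hnF i).exists_primitive hT hε hδ
  have hδ2 : δ / 2 ≤ δ := by linarith
  let Z : Fin 4 → ℤ → (Fin 6 → ℝ) → ℂ := ![a, b, a', b']
  -- Each component of the zero mode is a primitive in `Y₃` of one row of the source.
  let Z₀ : Fin 6 → ℤ → (Fin 6 → ℝ) → ℂ :=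
    ![fun k x => (-1 : ℂ) * B 4 k x, B 3, B 6, B 1, fun k x => (-1 : ℂ) * B 0 k x, B 7]
  have hW : ∀ j, NiceAt T (-1) (δ / 2) (starFam p.NM p.αM F Z Z₀ j) := by
    refine niceAt_starFam _ _ (fun i => (hnF i).mono hδ2) (fun j => ?_) (fun j => ?_)
    · fin_cases j
      exacts [ha, hb, ha', hb']
    · fin_cases j
      exacts [((hB _).mono hδ2).symbol (.const _), (hB _).mono hδ2, (hB _).mono hδ2,
        (hB _).mono hδ2, ((hB _).mono hδ2).symbol (.const _), (hB _).mono hδ2]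
  have hδ' : 0 < δ / 2 := by linarith
  have hdiv := fun k (x : Fin 6 → ℝ) (hx : x ∈ dom _) => comp_divergence hT hε (hF 2).smoothPer
    (hF 0).smoothPer (hF 1).smoothPer (hF 6).smoothPer hd k hx
  have hdiv' := fun k (x : Fin 6 → ℝ) (hx : x ∈ dom _) => comp_divergence hT hε (hF 5).smoothPer
    (hF 3).smoothPer (hF 4).smoothPer (hF 7).smoothPer hd' k hx
  have hF2 : ∀ x ∈ dom (fastBox T (Jh (-1))), comp (F 2) 0 x = 0 := fun x hx =>
    (hF 2).mean_eq_zero hT hε (fun x hx => by simpa using hdiv 0 x hx) hx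
  have hF5 : ∀ x ∈ dom (fastBox T (Jh (-1))), comp (F 5) 0 x = 0 := fun x hx =>
    (hF 5).mean_eq_zero hT hε (fun x hx => by simpa using hdiv' 0 x hx) hx
  refine ⟨fun j => syn (starFam p.NM p.αM F Z Z₀ j), fun j => (hW j).inStar_syn hT hε hδ',
    fun x hx i => starFam_rows hT hε hδ' (fun i => (hF i).smoothPer) hW
      (DZ := ![fun k x => Complex.I * k * p.rt ^ 2 * b k x
          + ∑ i, ![0, 0, ((p.ν * p.τ : ℝ) : ℂ), (p.ξ₂ : ℂ), -(p.ξ₁ : ℂ), 0, 0, 0] i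
            * comp (F i) k x,
        fun k x => -(Complex.I * k) * a k x + comp (F 6) k x,
        fun k x => Complex.I * k * p.rt ^ 2 * b' k x
          + ∑ i, ![-(p.ξ₂ : ℂ), (p.ξ₁ : ℂ), 0, 0, 0, ((p.ν * p.τ : ℝ) : ℂ), 0, 0] i
            * comp (F i) k x,
        fun k x => -(Complex.I * k) * a' k x + comp (F 7) k x])
      (DZ₀ := ![fun k x => (-1 : ℂ) * comp (F 4) k x, comp (F 3), comp (F 6), comp (F 1),
        fun k x => (-1 : ℂ) * comp (F 0) k x, comp (F 7)]) (fun j => ?_) (fun j => ?_)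
      (fun k hk x hx i => ?_) (fun x hx i => ?_) hx i, fun x hx hx0 => ⟨?_, ?_⟩⟩
  · fin_cases j
    exacts [da, db, da', db']
  · fin_cases j
    exacts [(hBd _).const_mul _, hBd _, hBd _, hBd _, (hBd _).const_mul _, hBd _]
  · refine vacuum_rows hξ (I_mul_ne_zero hk) hρ ?_ rfl ?_ rfl ?_ ?_ i
    · simp [Z, Fin.sum_univ_eight]; ring
    · simp [Z, Fin.sum_univ_eight]; ring
    · simpa using hdiv k x hx
    · simpa using hdiv' k x hx
  · have h2 := hF2 x hx
    have h5 := hF5 x hx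
    fin_cases i <;> simp [A3M, Fin.sum_univ_six, h2, h5]
  · have := sum_pd_theta_syn hT hε hδ' hW ![0, 0, 1, 0, 0, 0] hh.smoothPer hx
      (fun k hk => by
        rw [← show b k x = comp h k x from hb0 k hk x hx hx0]
        simp only [Fin.sum_univ_six, starFam, if_neg hk]
        simp [lin, NM, αM, Fin.sum_univ_succ, Z])
    simp only [Fin.sum_univ_six] at this
    simpa using this
  · have := sum_pd_theta_syn hT hε hδ' hW ![0, 0, 0, p.ξ₁, p.ξ₂, 0] hh'.smoothPer hx
      (fun k hk => by
        rw [← show a' k x = comp h' k x from ha0 k hk x hx hx0]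
        have := vacuum_traceE hξ (κ := Complex.I * k) (F := fun i => comp (F i) k x)
          (Z := fun l => Z l k x)
        rw [show Z 2 k x = a' k x from rfl] at this
        simp only [Fin.sum_univ_six, starFam, if_neg hk]
        simp
        linear_combination this)
    simp only [Fin.sum_univ_six] at this
    simpa using this

end Params

/-! ### The solvability identity -/

lemma integral_exp_mul {κ : ℝ} (hκ : 0 < κ) {g f : ℝ → ℂ} {M L : ℂ}
    (hd : ∀ r, 0 ≤ r → HasDerivWithinAt g (κ * g r + f r) (Set.Ici 0) r)
    (hg : Filter.Tendsto g Filter.atTop (nhds M)) (hc : ContinuousOn f (Set.Ici 0))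
    (hf : Filter.Tendsto f Filter.atTop (nhds L)) :
    ∫ r in Set.Ioi (0 : ℝ), ((Real.exp (-κ * r) : ℝ) : ℂ) * f r = -g 0 := by
  have he : ∀ r : ℝ, HasDerivAt (fun r : ℝ => ((Real.exp (-κ * r) : ℝ) : ℂ))
      ((Real.exp (-κ * r) * -κ : ℝ) : ℂ) r := fun r => by
    have := (((hasDerivAt_id r).const_mul (-κ)).exp).ofReal_comp
    simpa using this
  have hlim : Filter.Tendsto (fun r : ℝ => ((Real.exp (-κ * r) : ℝ) : ℂ)) Filter.atTop (nhds 0) := by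
    have := (IsProfile.tendsto_exp_neg hκ 1).ofReal
    simpa using this
  have hcont : Continuous fun r : ℝ => ((Real.exp (-κ * r) : ℝ) : ℂ) := by fun_prop
  have hD : ∀ r, 0 ≤ r → HasDerivWithinAt (fun r => ((Real.exp (-κ * r) : ℝ) : ℂ) * g r)
      (((Real.exp (-κ * r) : ℝ) : ℂ) * f r) (Set.Ici 0) r := fun r hr => by
    refine (((he r).hasDerivWithinAt).mul (hd r hr)).congr_deriv ?_
    push_cast
    ring
  have := integral_Ioi_of_hasDerivAt_of_tendsto (hD 0 le_rfl).continuousWithinAt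
    (fun r hr => (hD r (le_of_lt hr)).hasDerivAt (Ici_mem_nhds hr)) ?_ (hlim.mul hg)
  · simpa using this
  · refine ((integrableOn_Ici_iff_integrableOn_Ioi (by finiteness)).mp <|
      ((hcont.continuousOn.mul hc).locallyIntegrableOn measurableSet_Ici).integrableOn_of_isBigO_atTop
        (g := fun r => Real.exp (-κ * r)) ?_ ⟨Set.Ioi 0, Filter.Ioi_mem_atTop 0,
          exp_neg_integrableOn_Ioi 0 hκ⟩)
    have h1 := (Asymptotics.isBigO_refl (fun r : ℝ => ((Real.exp (-κ * r) : ℝ) : ℂ))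
      Filter.atTop).mul (hf.isBigO_one ℂ)
    refine h1.trans (Asymptotics.IsBigO.of_bound 1 (.of_forall fun r => ?_))
    rw [norm_mul, Complex.norm_real]
    simp

variable {T ε : ℝ}

lemma IsProfile.continuousOn_mode (hT : 0 < T) (hε : IsSide ε) {P : Profile}
    (h : IsProfile T (Jh ε) P) (k : ℤ) {z : Fin 5 → ℝ} (hz : z ∈ dom (slowBox T (Jh ε))) :
    ContinuousOn (fun r : ℝ => mode (val P) k (Matrix.vecCons (ε * r) z)) (Set.Ici 0) :=
  fun _ hr => (h.hasDeriv_mode hT hε k hz hr).continuousWithinAt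

/-- Pairing the equations with a row vector `L` that annihilates the symbol
`ε κ A₃ + i k A` on the left, the Laplace transform of the source at `κ` is a boundary term. -/
lemma Bulk.integral (hT : 0 < T) (hε : IsSide ε) {m n : ℕ} {A₃ A : Matrix (Fin m) (Fin n) ℝ}
    {U : Fin n → Profile} {F : Fin m → Profile} (h : Bulk T (Jh ε) A₃ A U F)
    (hU : ∀ j, IsProfile T (Jh ε) (U j)) (hF : ∀ i, IsProfile T (Jh ε) (F i)) {k : ℤ} {κ : ℝ}
    (hκ : 0 < κ) {L : Fin m → ℂ}
    (hL : ∀ j, κ * ∑ i, L i * A₃ i j + ε * (Complex.I * k) * ∑ i, L i * A i j = 0)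
    {z : Fin 5 → ℝ} (hz : z ∈ dom (slowBox T (Jh ε))) :
    ∫ r in Set.Ioi (0 : ℝ), ((Real.exp (-κ * r) : ℝ) : ℂ) *
        ∑ i, L i * FastProblem.mode (val (F i)) k (Matrix.vecCons (ε * r) z)
      = -(ε * ∑ j, (∑ i, L i * A₃ i j) * FastProblem.mode (val (U j)) k (Matrix.vecCons 0 z)) := by
  have hε2 : (ε : ℂ) * ε = 1 := by exact_mod_cast side_mul_self hε
  have key := integral_exp_mul hκ (g := fun r => ε * ∑ j, (∑ i, L i * A₃ i j)
      * FastProblem.mode (val (U j)) k (Matrix.vecCons (ε * r) z))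
    (f := fun r => ∑ i, L i * FastProblem.mode (val (F i)) k (Matrix.vecCons (ε * r) z))
    (fun r hr => ?_) ((tendsto_finsetSum _ fun j _ =>
      ((hU j).tendsto_mode_val hε k hz).const_mul _).const_mul _)
    (continuousOn_finsetSum _ fun i _ => ((hF i).continuousOn_mode hT hε k hz).const_mul _)
    (tendsto_finsetSum _ fun i _ => ((hF i).tendsto_mode_val hε k hz).const_mul _)
  · simpa using key
  · have hx := IsProfile.mem_ray hε hz hr
    refine ((HasDerivWithinAt.fun_sum fun j _ =>
      ((hU j).hasDeriv_mode hT hε k hz hr).const_mul (∑ i, L i * (A₃ i j : ℂ))).const_mul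
      (ε : ℂ)).congr_deriv ?_
    simp only [← h.mode hT hε hU k hx]
    set u := fun j => FastProblem.mode (val (U j)) k (Matrix.vecCons (ε * r) z)
    set d := fun j => FastProblem.mode (dY T (Jh ε) (U j)) k (Matrix.vecCons (ε * r) z)
    have e1 : ∀ (B : Matrix (Fin m) (Fin n) ℝ) (v : Fin n → ℂ),
        ∑ i, L i * ∑ j, (B i j : ℂ) * v j = ∑ j, (∑ i, L i * B i j) * v j := fun B v => by
      simp only [Finset.mul_sum, Finset.sum_mul]
      rw [Finset.sum_comm]
      simp only [mul_assoc]
    have e2 : ∑ j, (κ * ∑ i, L i * A₃ i j + ε * (Complex.I * k) * ∑ i, L i * A i j) * u j = 0 :=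
      Finset.sum_eq_zero fun j _ => by rw [hL j, zero_mul]
    simp only [add_mul, Finset.sum_add_distrib, mul_assoc, ← Finset.mul_sum] at e2
    have e3 : ∑ i, L i * (∑ j, (A₃ i j : ℂ) * d j + Complex.I * k * ∑ j, (A i j : ℂ) * u j)
        = ∑ j, (∑ i, L i * A₃ i j) * d j + Complex.I * k * ∑ j, (∑ i, L i * A i j) * u j := by
      rw [← e1, ← e1, Finset.mul_sum, ← Finset.sum_add_distrib]
      exact Finset.sum_congr rfl fun i _ => by ring
    have e4 : ∑ j, (∑ i, L i * (A₃ i j : ℂ)) * ((ε : ℂ) * d j)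
        = ε * ∑ j, (∑ i, L i * A₃ i j) * d j := by
      rw [Finset.mul_sum]
      exact Finset.sum_congr rfl fun j _ => by ring
    change (ε : ℂ) * ∑ j, (∑ i, L i * (A₃ i j : ℂ)) * ((ε : ℂ) * d j) = κ * (ε * _) + ∑ i, _
    rw [e3, e4]
    linear_combination (∑ j, (∑ i, L i * (A₃ i j : ℂ)) * d j) * hε2 - ε * e2
      + (Complex.I * k * ∑ j, (∑ i, L i * (A i j : ℂ)) * u j) * hε2

namespace Params
variable {p : Params}

/-- The eight plasma sources `(F₁⁺, …, F₈⁺)`. -/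
def _root_.FastProblem.Sources.plasma (S : Sources) : Fin 8 → Profile :=
  ![S.Fp 0, S.Fp 1, S.Fp 2, S.Fp 3, S.Fp 4, S.Fp 5, S.Fp 6, S.F8p]

/-- The eight vacuum sources `(F₁⁻, …, F₈⁻)`. -/
def _root_.FastProblem.Sources.vacuum (S : Sources) : Fin 8 → Profile :=
  ![S.Fm 0, S.Fm 1, S.Fm 2, S.Fm 3, S.Fm 4, S.Fm 5, S.F7m, S.F8m]

lemma xi_dot_am (p : Params) :
    p.ξ₁ * p.am₁ + p.ξ₂ * p.am₂ = p.ν * p.τ * p.bm := by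
  rw [am₁, am₂, bm]; ring

/-- The vector `conj 𝓛⁺(k)`, extended by zero to the divergence equation. -/
def dualP (p : Params) (k : ℤ) : Fin 8 → ℂ :=
  ![p.ξ₁ * p.τ, p.ξ₂ * p.τ, -isgn k * p.τ, 2 * p.ξ₁ * p.bp, 2 * p.ξ₂ * p.bp,
    -(2 * isgn k * p.bp), -p.τ * (p.ap + p.cp), 0]

/-- The vector `-ν ρ conj 𝓛⁻(k)`, extended by zero to the divergence equations. -/
def dualM (p : Params) (k : ℤ) : Fin 8 → ℂ :=
  ![p.ν * p.τ * p.am₁ - p.ξ₁ * p.bm, p.ν * p.τ * p.am₂ - p.ξ₂ * p.bm, -isgn k * p.rt * p.bm,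
    -isgn k * p.rt * p.am₂, isgn k * p.rt * p.am₁, p.ξ₁ * p.am₂ - p.ξ₂ * p.am₁, 0, 0]

lemma conj_isgn (k : ℤ) : (starRingEnd ℂ) (isgn k) = -isgn k := by
  simp [isgn]

lemma sum_dualP (k : ℤ) (f : Fin 8 → ℂ) :
    ∑ i, p.dualP k i * f i = ∑ i : Fin 7, (starRingEnd ℂ) (p.Lp k i) * f (Fin.castSucc i) := by
  rw [Fin.sum_univ_castSucc]
  have h7 : p.dualP k (Fin.last 7) = 0 := rfl
  rw [h7, zero_mul, add_zero]
  refine Finset.sum_congr rfl fun i _ => ?_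
  congr 1
  fin_cases i <;> simp [dualP, Lp, conj_isgn, map_ofNat (starRingEnd ℂ) 2]

lemma sum_dualM (hν : p.ν ≠ 0) (hρ : p.rt ≠ 0) (k : ℤ) (f : Fin 8 → ℂ) :
    ∑ i : Fin 6, (starRingEnd ℂ) (p.Lm k i) * f (Fin.castAdd 2 i)
      = -(1 / (p.ν * p.rt)) * ∑ i, p.dualM k i * f i := by
  have hν' : (p.ν : ℂ) ≠ 0 := by exact_mod_cast hν
  have hρ' : (p.rt : ℂ) ≠ 0 := by exact_mod_cast hρ
  have h8 : ∑ i, p.dualM k i * f i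
      = ∑ i : Fin 6, p.dualM k (Fin.castAdd 2 i) * f (Fin.castAdd 2 i) := by
    rw [Fin.sum_univ_castSucc, Fin.sum_univ_castSucc]
    have h6 : p.dualM k (Fin.castSucc (Fin.last 6)) = 0 := rfl
    have h7 : p.dualM k (Fin.last 7) = 0 := rfl
    rw [h6, h7, zero_mul, zero_mul, add_zero, add_zero]
    rfl
  rw [h8, Finset.mul_sum]
  refine Finset.sum_congr rfl fun i _ => ?_
  rw [← mul_assoc]
  congr 1
  fin_cases i <;> simp [dualM, Lm, conj_isgn] <;> field_simp

lemma dualP_annihilates (hξ : p.ξ₁ ^ 2 + p.ξ₂ ^ 2 = 1) {k : ℤ} (hk : k ≠ 0) (j : Fin 7) :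
    ((|(k : ℝ)| : ℝ) : ℂ) * ∑ i, p.dualP k i * p.A3P i j
      + ((1 : ℝ) : ℂ) * (Complex.I * k) * ∑ i, p.dualP k i * p.AP i j = 0 := by
  have hξc : (p.ξ₁ : ℂ) ^ 2 + p.ξ₂ ^ 2 = 1 := by exact_mod_cast hξ
  have hσ := isgn_mul_self hk
  have ha : (p.ap : ℂ) = p.ξ₁ * p.u₁ + p.ξ₂ * p.u₂ := by rw [ap]; push_cast; ring
  have hb : (p.bp : ℂ) = p.ξ₁ * p.B₁ + p.ξ₂ * p.B₂ := by rw [bp]; push_cast; ring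
  have hc : (p.cp : ℂ) = p.τ + p.ap := by rw [cp]; push_cast; ring
  rw [I_mul_eq]
  simp only [dualP, A3P, AP, Fin.sum_univ_eight]
  generalize isgn k = σ at *
  push_cast
  generalize ((|(k : ℝ)| : ℝ) : ℂ) = K
  fin_cases j <;> simp [-mul_eq_zero]
  · linear_combination -K * σ * p.ξ₁ * p.τ * ha
  · linear_combination -K * σ * p.ξ₂ * p.τ * ha
  · linear_combination -K * p.τ * ha - 2 * p.bp * K * hb + K * (2 * p.bp ^ 2 - p.τ * p.cp) * hσ
  · linear_combination K * σ * p.ξ₁ * (p.τ * hb + 2 * p.bp * ha + 2 * p.bp * hc)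
  · linear_combination K * σ * p.ξ₂ * (p.τ * hb + 2 * p.bp * ha + 2 * p.bp * hc)
  · linear_combination K * (p.τ * hb + 2 * p.bp * ha + 2 * p.bp * hc
      + (p.τ * p.bp - 2 * p.bp * p.cp) * hσ)
  · linear_combination K * σ * p.τ * hξc

lemma dualM_annihilates (hξ : p.ξ₁ ^ 2 + p.ξ₂ ^ 2 = 1) (hρ : p.rt ^ 2 = 1 - p.ν ^ 2 * p.τ ^ 2)
    {k : ℤ} (hk : k ≠ 0) (j : Fin 6) :
    ((|(k : ℝ)| * p.rt : ℝ) : ℂ) * ∑ i, p.dualM k i * A3M i j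
      + ((-1 : ℝ) : ℂ) * (Complex.I * k) * ∑ i, p.dualM k i * p.AM i j = 0 := by
  have hξc : (p.ξ₁ : ℂ) ^ 2 + p.ξ₂ ^ 2 = 1 := by exact_mod_cast hξ
  have hρc : (p.rt : ℂ) ^ 2 = 1 - p.ν ^ 2 * p.τ ^ 2 := by exact_mod_cast hρ
  have ha : (p.ξ₁ : ℂ) * p.am₁ + p.ξ₂ * p.am₂ = p.ν * p.τ * p.bm := by
    exact_mod_cast p.xi_dot_am
  have hσ := isgn_mul_self hk
  rw [I_mul_eq]
  simp only [dualM, A3M, AM, Fin.sum_univ_eight]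
  generalize isgn k = σ at *
  push_cast
  generalize ((|(k : ℝ)| : ℝ) : ℂ) = K
  fin_cases j <;> simp [-mul_eq_zero]
  · linear_combination K * (-σ) * (p.am₁ * hρc - p.am₁ * hξc + p.ξ₁ * ha)
  · linear_combination K * (-σ) * (p.am₂ * hρc - p.am₂ * hξc + p.ξ₂ * ha)
  · linear_combination K * (σ * σ) * p.rt * ha
  · linear_combination K * (-p.rt * (p.ξ₂ * p.bm - p.ν * p.τ * p.am₂)) * hσ
  · linear_combination K * (-p.rt * (p.ν * p.τ * p.am₁ - p.ξ₁ * p.bm)) * hσ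
  · ring

lemma dualP_A3P (k : ℤ) (j : Fin 7) :
    ∑ i, p.dualP k i * p.A3P i j
      = ![0, 0, (p.lp₁ : ℂ), 0, 0, (p.lp₂ : ℂ), -isgn k * p.τ] j := by
  simp only [dualP, A3P, Fin.sum_univ_eight, lp₁, lp₂, cp, ap, bp]
  push_cast
  fin_cases j <;> simp [-mul_eq_zero] <;> ring

lemma dualM_A3M (k : ℤ) (j : Fin 6) :
    ∑ i, p.dualM k i * A3M i j
      = ![-(isgn k * p.rt * p.am₁), -(isgn k * p.rt * p.am₂), 0,
        p.ν * p.τ * p.am₂ - p.ξ₂ * p.bm, -(p.ν * p.τ * p.am₁ - p.ξ₁ * p.bm), 0] j := by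
  simp only [dualM, A3M, Fin.sum_univ_eight]
  fin_cases j <;> simp [-mul_eq_zero]

section
variable {T : ℝ} {S : Sources} {U : Fin 7 → Profile} {V : Fin 6 → Profile}

lemma mem_dom_cons_zero {ε : ℝ} {w : Fin 4 → ℝ} (hw : w ∈ dom (bdryBox T)) :
    (Matrix.vecCons 0 w : Fin 5 → ℝ) ∈ dom (slowBox T (Jh ε)) :=
  mem_dom_vecTail (s := slowBox T (Jh ε)) (IsProfile.onΓ_mem (ε := ε) hw)

lemma integral_plasma (hT : 0 < T) (hξ : p.ξ₁ ^ 2 + p.ξ₂ ^ 2 = 1)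
    (hU : ∀ j, IsProfile T (Jh 1) (U j)) (hF : ∀ i, IsProfile T (Jh 1) (S.plasma i))
    (hb : Bulk T (Jh 1) p.A3P p.AP U S.plasma) {w : Fin 4 → ℝ} (hw : w ∈ dom (bdryBox T))
    {k : ℤ} (hk : k ≠ 0) :
    ∫ Y in Set.Ioi (0 : ℝ), (Real.exp (-|(k : ℝ)| * Y) : ℂ) *
        ∑ i, (starRingEnd ℂ) (p.Lp k i) *
          mode (val (S.Fp i)) k (Matrix.vecCons Y (Matrix.vecCons 0 w))
      = -(p.lp₁ * mode (val (U 2)) k (onΓ w) + p.lp₂ * mode (val (U 5)) k (onΓ w)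
        - isgn k * p.τ * mode (val (U 6)) k (onΓ w)) := by
  have hk' : 0 < |(k : ℝ)| := by positivity
  have h := hb.integral hT (.inl rfl) hU hF hk' (p.dualP_annihilates hξ hk) (mem_dom_cons_zero hw)
  simp only [dualP_A3P, sum_dualP, one_mul] at h
  refine Eq.trans ?_ (h.trans ?_)
  · refine integral_congr_ae (.of_forall fun r => ?_)
    refine congrArg _ (Finset.sum_congr rfl fun i _ => ?_)
    fin_cases i <;> rfl
  · rw [Fin.sum_univ_seven]
    simp [onΓ]
    ring

lemma integral_vacuum (hT : 0 < T) (hξ : p.ξ₁ ^ 2 + p.ξ₂ ^ 2 = 1) (hν : p.ν ≠ 0)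
    (hρ0 : 0 < p.rt) (hρ : p.rt ^ 2 = 1 - p.ν ^ 2 * p.τ ^ 2)
    (hV : ∀ j, IsProfile T (Jh (-1)) (V j)) (hF : ∀ i, IsProfile T (Jh (-1)) (S.vacuum i))
    (hb : Bulk T (Jh (-1)) A3M p.AM V S.vacuum) {w : Fin 4 → ℝ} (hw : w ∈ dom (bdryBox T))
    {k : ℤ} (hk : k ≠ 0) :
    ∫ Y in Set.Iio (0 : ℝ), (Real.exp (|(k : ℝ)| * p.rt * Y) : ℂ) *
        ∑ i, (starRingEnd ℂ) (p.Lm k i) *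
          mode (val (S.Fm i)) k (Matrix.vecCons Y (Matrix.vecCons 0 w))
      = 1 / (p.ν * p.rt) *
        (isgn k * p.rt * (p.am₁ * mode (val (V 0)) k (onΓ w) + p.am₂ * mode (val (V 1)) k (onΓ w))
        - (p.ν * p.τ * p.am₂ - p.ξ₂ * p.bm) * mode (val (V 3)) k (onΓ w)
        + (p.ν * p.τ * p.am₁ - p.ξ₁ * p.bm) * mode (val (V 4)) k (onΓ w)) := by
  have hk' : 0 < |(k : ℝ)| * p.rt := by positivity
  have h := hb.integral hT (.inr rfl) hV hF hk' (p.dualM_annihilates hξ hρ hk)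
    (mem_dom_cons_zero hw)
  simp only [dualM_A3M] at h
  rw [← integral_Iic_eq_integral_Iio, ← neg_zero, ← integral_comp_neg_Ioi]
  have h' := congrArg (fun c : ℂ => -(1 / ((p.ν : ℂ) * p.rt)) * c) h
  simp only [← integral_const_mul] at h'
  refine Eq.trans ?_ (h'.trans ?_)
  · refine integral_congr_ae (.of_forall fun r => ?_)
    simp only
    rw [mul_left_comm, ← sum_dualM hν hρ0.ne', neg_mul, neg_one_mul, mul_neg]
    refine congrArg _ (Finset.sum_congr rfl fun i _ => ?_)
    fin_cases i <;> rw [neg_zero] <;> rfl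
  · rw [Fin.sum_univ_six]
    simp [onΓ]
    ring

/-- For a solution of the bulk equations that satisfies the first five boundary conditions, the
left side of the last compatibility condition is a multiple of the defect in the sixth boundary
condition. The front, through `Φ`, drops out because of the Lopatinskii condition. -/
lemma solvability_identity (hT : 0 < T) (hξ : p.ξ₁ ^ 2 + p.ξ₂ ^ 2 = 1) (hν : p.ν ≠ 0)
    (hρ0 : 0 < p.rt) (hρ : p.rt ^ 2 = 1 - p.ν ^ 2 * p.τ ^ 2) (hL : p.Lopatinskii)
    (hU : ∀ j, IsProfile T (Jh 1) (U j)) (hFP : ∀ i, IsProfile T (Jh 1) (S.plasma i))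
    (hbP : Bulk T (Jh 1) p.A3P p.AP U S.plasma)
    (hV : ∀ j, IsProfile T (Jh (-1)) (V j)) (hFM : ∀ i, IsProfile T (Jh (-1)) (S.vacuum i))
    (hbM : Bulk T (Jh (-1)) A3M p.AM V S.vacuum) {w : Fin 4 → ℝ} (hw : w ∈ dom (bdryBox T))
    {k : ℤ} (hk : k ≠ 0) {Φ : ℂ} {g : Fin 6 → ℂ}
    (h0 : mode (val (U 2)) k (onΓ w) - p.cp * Φ = g 0)
    (h1 : mode (val (U 5)) k (onΓ w) - p.bp * Φ = g 1)
    (h3 : mode (val (V 4)) k (onΓ w) + p.am₁ * Φ = g 3)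
    (h4 : -mode (val (V 3)) k (onΓ w) + p.am₂ * Φ = g 4) :
    (∫ Y in Set.Ioi (0 : ℝ), (Real.exp (-|(k : ℝ)| * Y) : ℂ) *
        ∑ i, (starRingEnd ℂ) (p.Lp k i) *
          mode (val (S.Fp i)) k (Matrix.vecCons Y (Matrix.vecCons 0 w)))
      + (p.lp₁ * g 0 + p.lp₂ * g 1)
      - (∫ Y in Set.Iio (0 : ℝ), (Real.exp (|(k : ℝ)| * p.rt * Y) : ℂ) *
        ∑ i, (starRingEnd ℂ) (p.Lm k i) *
          mode (val (S.Fm i)) k (Matrix.vecCons Y (Matrix.vecCons 0 w)))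
      - (((-(p.ν * p.τ * p.am₁) + p.ξ₁ * p.bm) / (p.ν * p.rt) : ℝ) * g 3
        + ((-(p.ν * p.τ * p.am₂) + p.ξ₂ * p.bm) / (p.ν * p.rt) : ℝ) * g 4)
      - Params.isgn k * p.τ * g 5
      + ((p.E₃ / (|(k : ℝ)| * p.ν) : ℝ) : ℂ) * mode (val (S.Fm 5)) k (onΓ w)
    = isgn k * p.τ * (mode (val (U 6)) k (onΓ w)
      - (p.H₁ * mode (val (V 0)) k (onΓ w) + p.H₂ * mode (val (V 1)) k (onΓ w))
      + p.E₃ * mode (val (V 5)) k (onΓ w) - g 5) := by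
  have hx : onΓ w ∈ dom (fastBox T (Jh (-1))) := IsProfile.onΓ_mem hw
  have h6 := hbM.mode hT (.inr rfl) hV k hx 5
  have hk' : ((|(k : ℝ)| : ℝ) : ℂ) ≠ 0 := by
    have : (k : ℝ) ≠ 0 := by exact_mod_cast hk
    exact_mod_cast (abs_pos.2 this).ne'
  have hν' : (p.ν : ℂ) ≠ 0 := by exact_mod_cast hν
  have hρ' : (p.rt : ℂ) ≠ 0 := by exact_mod_cast hρ0.ne'
  have ha : (p.ξ₁ : ℂ) * p.am₁ + p.ξ₂ * p.am₂ = p.ν * p.τ * p.bm := by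
    exact_mod_cast p.xi_dot_am
  have hLc : (p.rt : ℂ) * (p.cp ^ 2 - p.bp ^ 2) + (p.am₁ ^ 2 + p.am₂ ^ 2 - p.bm ^ 2) = 0 := by
    exact_mod_cast hL
  have e1 : (p.am₁ : ℂ) = p.ν * p.τ * p.H₁ + p.ξ₂ * p.E₃ := by rw [am₁]; push_cast; ring
  have e2 : (p.am₂ : ℂ) = p.ν * p.τ * p.H₂ - p.ξ₁ * p.E₃ := by rw [am₂]; push_cast; ring
  have hc : (p.cp : ℂ) = p.τ + p.ap := by rw [cp]; push_cast; ring
  rw [integral_plasma hT hξ hU hFP hbP hw hk,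
    integral_vacuum hT hξ hν hρ0 hρ hV hFM hbM hw hk]
  rw [I_mul_eq] at h6
  simp only [Fin.sum_univ_six, A3M, AM] at h6
  have e5 : (mode (val (S.vacuum 5)) k (onΓ w)) = mode (val (S.Fm 5)) k (onΓ w) := rfl
  rw [e5] at h6
  simp at h6
  rw [← h6, ← h0, ← h1, ← h3, ← h4, lp₁, lp₂]
  push_cast
  -- The terms with `Φ` add up to a multiple of the Lopatinskii determinant.
  linear_combination (norm := (field_simp; ring)) Φ * p.τ / p.rt * hLc
    - Φ * p.bm / (p.ν * p.rt) * ha - Φ * p.bp ^ 2 * hc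
    - isgn k / p.ν * (mode (val (V 0)) k (onΓ w) * e1 + mode (val (V 1)) k (onΓ w) * e2)

end

end Params

/-! ### Solutions that match the θ-derivatives of the boundary data -/

section
variable {n : ℕ} {s : Fin n → Option (Set ℝ)}

lemma IsSmoothPer.sum {ι : Type*} [Fintype ι] {f : ι → (Fin n → ℝ) → ℝ}
    (hf : ∀ i, IsSmoothPer s (f i)) (c : ι → ℝ) : IsSmoothPer s (fun x => ∑ i, c i * f i x) :=
  ⟨ContDiffOn.sum fun i _ => contDiffOn_const.mul (hf i).smooth,
    fun i hi x hx => by simp only [(hf _).periodic i hi x hx]⟩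

lemma pd_sum (hs : GoodBox s) {ι : Type*} [Fintype ι] {f : ι → (Fin n → ℝ) → ℝ}
    (hf : ∀ i, IsSmoothPer s (f i)) (c : ι → ℝ) (i : Fin n) :
    Set.EqOn (pd s i (fun x => ∑ j, c j * f j x)) (fun x => ∑ j, c j * pd s i (f j) x) (dom s) :=
  (HasPd.sum (fun j => hasPd_pd (hf j).smooth i) c).eqOn_pd hs (IsSmoothPer.sum hf c).smooth

end

variable {T ε : ℝ}

lemma IsProfile.mean_val {P : Profile} (h : IsProfile T (Jh ε) P) {x : Fin 6 → ℝ}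
    (hx : x ∈ dom (fastBox T (Jh ε))) :
    mean (val P) x = mean P.1 (Matrix.vecTail x) + mean P.2 x := by
  have := h.mode_val 0 hx
  simp only [mode_zero_eq_mean] at this
  exact_mod_cast this

lemma pd_starLift_onΓ (hT : 0 < T) (hε : IsSide ε) {g : (Fin 4 → ℝ) → ℝ}
    (hg : IsSmoothPer (bdryBox T) g) {w : Fin 4 → ℝ} (hw : w ∈ dom (bdryBox T)) :
    pd (fastBox T (Jh ε)) 5 (starLift ε g) (onΓ w) = dθb T g w := by
  have h := (inStar_starLift hT hε hg).isProfile.dθb_trace hT hw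
  simp only [dθ, val_zero_left, starLift_onΓ] at h
  exact h.symm

lemma dθb_trace_res (hT : 0 < T) (hε : IsSide ε) {f : (Fin 5 → ℝ) → ℝ}
    (hf : IsHInf (slowBox T (Jh ε)) f) {w : Fin 4 → ℝ} (hw : w ∈ dom (bdryBox T)) :
    dθb T (fun w => val (f, 0) (onΓ w)) w
      = pd (slowBox T (Jh ε)) 4 f (Matrix.vecTail (onΓ w)) := by
  have hP : IsProfile T (Jh ε) (f, 0) := InS.isProfile ⟨hf, InStar.zero hT hε⟩
  rw [hP.dθb_trace hT hw]
  refine (hP.dθ_eq hT hε (IsProfile.onΓ_mem hw)).trans ?_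
  simp [pd]

/-- The residual part and the decaying part of an identity vanish separately. -/
lemma split_of_add (hε : IsSide ε) {f : (Fin 5 → ℝ) → ℝ} {g : (Fin 6 → ℝ) → ℝ}
    (hg : ∃ δ > 0, ∃ C : ℝ, ∀ x ∈ dom (fastBox T (Jh ε)), |g x| ≤ C * Real.exp (-δ * |x 0|))
    (h : ∀ x ∈ dom (fastBox T (Jh ε)), f (Matrix.vecTail x) + g x = 0) :
    (∀ z ∈ dom (slowBox T (Jh ε)), f z = 0) ∧ ∀ x ∈ dom (fastBox T (Jh ε)), g x = 0 := by
  have h1 : ∀ z ∈ dom (slowBox T (Jh ε)), f z = 0 := fun z hz => by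
    obtain ⟨δ, hδ, C, hC⟩ := hg
    refine abs_nonpos_iff.1 (ge_of_tendsto (IsProfile.tendsto_exp_neg hδ C) ?_)
    filter_upwards [Filter.eventually_ge_atTop 0] with r hr
    have hm := IsProfile.mem_ray hε hz hr
    have h2 := h _ hm
    have h3 := hC _ hm
    have h4 : |(Matrix.vecCons (ε * r) z : Fin 6 → ℝ) 0| = r := by
      rw [Matrix.cons_val_zero, abs_mul, abs_of_nonneg hr]
      rcases hε with rfl | rfl <;> simp
    rw [h4] at h3
    rwa [show f z = -g (Matrix.vecCons (ε * r) z) from eq_neg_of_add_eq_zero_left h2, abs_neg]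
  refine ⟨h1, fun x hx => ?_⟩
  have := h x hx
  rwa [h1 _ (mem_dom_vecTail hx), zero_add] at this

/-- A divergence identity for profiles whose residual parts have zero mean. In the residual part only
`∂_θ` remains, and it may be dropped because the means vanish. -/
lemma divergence_split (hT : 0 < T) (hε : IsSide ε) {P : Fin 4 → Profile}
    (hP : ∀ i, InS T (Jh ε) (P i)) {c₁ c₂ c₃ : ℝ}
    (h0 : ∀ i, ∀ z ∈ dom (slowBox T (Jh ε)), mean (P i).1 z = 0)
    (h : ∀ x ∈ dom (fastBox T (Jh ε)), dY T (Jh ε) (P 0) x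
      + (c₁ * dθ T (Jh ε) (P 1) x + c₂ * dθ T (Jh ε) (P 2) x) - c₃ * dθ T (Jh ε) (P 3) x = 0) :
    (∀ z ∈ dom (slowBox T (Jh ε)), c₁ * (P 1).1 z + c₂ * (P 2).1 z - c₃ * (P 3).1 z = 0) ∧
    ∀ x ∈ dom (fastBox T (Jh ε)), pd (fastBox T (Jh ε)) 0 (P 0).2 x
      + (c₁ * pd (fastBox T (Jh ε)) 5 (P 1).2 x + c₂ * pd (fastBox T (Jh ε)) 5 (P 2).2 x)
      - c₃ * pd (fastBox T (Jh ε)) 5 (P 3).2 x = 0 := by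
  have hs := goodBox_slow hT hε
  have hl : slowBox T (Jh ε) (Fin.last 4) = none := slowBox_last _
  let c : Fin 4 → ℝ := ![0, c₁, c₂, -c₃]
  have hf : ∀ i, IsSmoothPer (slowBox T (Jh ε)) (P i).1 := fun i => (hP i).1.smoothPer
  have hfs := IsSmoothPer.sum hf c
  obtain ⟨h1, h2⟩ := split_of_add hε
    (f := fun z => ∑ i, c i * pd (slowBox T (Jh ε)) 4 (P i).1 z)
    (g := fun x => ∑ i, ![1, c₁, c₂, -c₃] i * pd (fastBox T (Jh ε)) (![0, 5, 5, 5] i) (P i).2 x)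
    (InStar.sum hT hε (fun i => (hP i).2.pd hT hε _) _).abs_le (fun x hx => by
      rw [← h x hx, (hP 0).isProfile.dY_eq hT hε hx, (hP 1).isProfile.dθ_eq hT hε hx,
        (hP 2).isProfile.dθ_eq hT hε hx, (hP 3).isProfile.dθ_eq hT hε hx]
      simp [Fin.sum_univ_four, c]
      ring)
  refine ⟨fun z hz => ?_, fun x hx => ?_⟩
  · have e1 : ∀ θ, pd (slowBox T (Jh ε)) (Fin.last 4) (fun z => ∑ i, c i * (P i).1 z)
        (Function.update z (Fin.last 4) θ) = 0 := fun θ => by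
      have hz' := update_last_mem hl hz θ
      exact (pd_sum hs hf c _ hz').trans (h1 _ hz')
    have e2 := mean_eq_of_update (f := fun z => ∑ i, c i * (P i).1 z)
      (update_last_eq_of_pd hl hfs hz e1)
    have e3 := mode_sum hl (fun i => (hf i).smooth.continuousOn) c 0 hz
    simp only [mode_zero_eq_mean, h0 _ z hz] at e3
    rw [e2] at e3
    simp only [Complex.ofReal_zero, mul_zero, Finset.sum_const_zero] at e3
    have e4 : ∑ i, c i * (P i).1 z = 0 := by exact_mod_cast e3
    simp [Fin.sum_univ_four, c] at e4
    linear_combination e4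
  · have := h2 x hx
    simp [Fin.sum_univ_four] at this
    linear_combination this

lemma Sources.Regular.plasma {S : Sources} (hS : S.Regular T) (i : Fin 8) :
    InS T (Jh 1) (S.plasma i) := by
  rw [← Jp_eq]
  fin_cases i
  exacts [hS.Fp 0, hS.Fp 1, hS.Fp 2, hS.Fp 3, hS.Fp 4, hS.Fp 5, hS.Fp 6, hS.F8p]

lemma Sources.Regular.vacuum {S : Sources} (hS : S.Regular T) (i : Fin 8) :
    InS T (Jh (-1)) (S.vacuum i) := by
  rw [← Jm_eq]
  fin_cases i
  exacts [hS.Fm 0, hS.Fm 1, hS.Fm 2, hS.Fm 3, hS.Fm 4, hS.Fm 5, hS.F7m, hS.F8m]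

namespace Params
variable {p : Params} {S : Sources}

/-- A solution of the plasma equations with zero tangential means, for which the `θ`-derivatives of
the boundary conditions for `u₃` and `B₃` hold with `φ = 0`. The trace of `c⁺∂_θu₃ - b⁺∂_θB₃` is
prescribed; the one of `c⁺∂_θB₃ - b⁺∂_θu₃` is given by the sixth equation and the boundary
compatibility condition, and the two determine `∂_θu₃` and `∂_θB₃` because
`(c⁺)² ≠ (b⁺)²`. -/
lemma exists_plasma (hT : 0 < T) (hξ : p.ξ₁ ^ 2 + p.ξ₂ ^ 2 = 1) (hΔ : p.disc ≠ 0)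
    (hS : S.Regular T) (hC : Compatible p T S) :
    ∃ U : Fin 7 → Profile, (∀ j, InS T (Jh 1) (U j)) ∧
      Bulk T (Jh 1) p.A3P p.AP U S.plasma ∧
      (∀ j ∈ ({0, 1, 3, 4} : Set (Fin 7)), ∀ x ∈ dom (fastBox T (Jh 1)),
        mean (val (U j)) x = 0) ∧
      ∀ w ∈ dom (bdryBox T), dθ T (Jh 1) (U 2) (onΓ w) = dθb T (S.G 0) w ∧
        dθ T (Jh 1) (U 5) (onΓ w) = dθb T (S.G 1) w := by
  have hε : IsSide 1 := .inl rfl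
  have hF := hS.plasma
  have hb : ∀ i, ∀ z ∈ dom (slowBox T (Jh 1)), mean (S.plasma i).1 z = 0 := fun i z hz => by
    have := hC.b_plus z (by rwa [Jp_eq])
    fin_cases i
    exacts [this.1 0, this.1 1, this.1 2, this.1 3, this.1 4, this.1 5, this.1 6, this.2]
  have hdp := hC.d_plus
  have hcp := hC.c
  rw [Jp_eq] at hdp hcp
  obtain ⟨hd1, hd2⟩ := divergence_split hT hε
    (P := ![S.plasma 5, S.plasma 3, S.plasma 4, S.plasma 7])
    (fun i => by fin_cases i; exacts [hF 5, hF 3, hF 4, hF 7])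
    (fun i => by fin_cases i; exacts [hb 5, hb 3, hb 4, hb 7]) hdp
  obtain ⟨Ur, hUr, hUr0, hUrθ⟩ := exists_residual hT hε p.NP p.αP p.QP (fun i => (hF i).1) hb
  have hP : ∀ j, IsProfile T (Jh 1) (Ur j, 0) := fun j => InS.isProfile ⟨hUr j, InStar.zero hT hε⟩
  have hf : ∀ i, IsSmoothPer (bdryBox T) (![S.G 0, S.G 1, fun w => val (Ur 2, 0) (onΓ w),
      fun w => val (Ur 5, 0) (onΓ w)] i) := fun i => by
    fin_cases i
    exacts [(hS.G 0).smoothPer, (hS.G 1).smoothPer, (hP 2).smoothPer_trace,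
      (hP 5).smoothPer_trace]
  have hg := IsSmoothPer.sum hf ![p.cp, -p.bp, -p.cp, p.bp]
  obtain ⟨Us, hUs, hrow, hmean, htr⟩ := p.exists_star_plasma hT hξ hΔ
    (F := fun i => (S.plasma i).2) (fun i => (hF i).2) (inStar_starLift hT hε hg) hcp hd2
  have hU : ∀ j, IsProfile T (Jh 1) (Ur j, Us j) := fun j => InS.isProfile ⟨hUr j, hUs j⟩
  have hB : Bulk T (Jh 1) p.A3P p.AP (fun j => (Ur j, Us j)) S.plasma := by
    refine Bulk.of_parts hT hε hU (fun z hz i => ?_) hrow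
    have := plasma_rows hξ hΔ (κ := 1) one_ne_zero (F := fun i => ((S.plasma i).1 z : ℂ))
      (DF := 0) (Z := fun l => ∑ i, (p.QP l i : ℂ) * (S.plasma i).1 z) (DZ := 0)
      (by simp [QP, Fin.sum_univ_eight]; ring) (by simp [QP, Fin.sum_univ_eight])
      (by have := hd1 z hz; simp at this ⊢; exact_mod_cast this) i
    have h0 : ∀ j, lin p.NP p.αP 1 (0 : Fin 8 → ℂ) 0 j = 0 := fun j => by simp [lin]
    simp only [h0, ← hUrθ z hz] at this
    simp at this
    exact_mod_cast this
  refine ⟨fun j => (Ur j, Us j), fun j => ⟨hUr j, hUs j⟩, hB, fun j hj x hx => ?_,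
    fun w hw => ?_⟩
  · rw [(hU j).mean_val hx, hmean j hj x hx, hUr0 j _ (mem_dom_vecTail hx), add_zero]
  · have hx : onΓ w ∈ dom (fastBox T (Jh 1)) := IsProfile.onΓ_mem hw
    have h1 := htr _ hx rfl
    rw [pd_starLift_onΓ hT hε hg hw, dθb, pd_sum (goodBox_bdry hT) hf _ _ hw] at h1
    have e2 := dθb_trace_res hT hε (hUr 2) hw
    have e5 := dθb_trace_res hT hε (hUr 5) hw
    simp only [dθb] at e2 e5
    simp [Fin.sum_univ_four] at h1
    rw [e2, e5] at h1
    have h2 := hB _ hx 5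
    simp [Fin.sum_univ_seven, A3P, AP] at h2
    rw [show val (S.plasma 5) (onΓ w) = _ from hC.a₁ w hw] at h2
    have d2 := (hU 2).dθ_eq hT hε hx
    have d5 := (hU 5).dθ_eq hT hε hx
    simp only at d2 d5
    have h3 : p.cp * dθ T (Jh 1) (Ur 2, Us 2) (onΓ w) - p.bp * dθ T (Jh 1) (Ur 5, Us 5) (onΓ w)
        = p.cp * dθb T (S.G 0) w - p.bp * dθb T (S.G 1) w := by
      rw [d2, d5, dθb, dθb]
      linear_combination h1
    constructor <;> apply mul_left_cancel₀ hΔ <;> rw [disc]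
    · linear_combination p.cp * h3 + p.bp * h2
    · linear_combination p.bp * h3 + p.cp * h2

/-- A solution of the vacuum equations for which the `θ`-derivatives of the boundary conditions for
`H₃`, `E₁` and `E₂` hold with `φ = 0`. The traces of `H₃` and `ξ·E` are prescribed; the one of
`ξ₁E₂ - ξ₂E₁` is given by the third equation and the boundary compatibility condition. -/
lemma exists_vacuum (hT : 0 < T) (hξ : p.ξ₁ ^ 2 + p.ξ₂ ^ 2 = 1) (hρ0 : 0 < p.rt)
    (hρ : p.rt ^ 2 = 1 - p.ν ^ 2 * p.τ ^ 2) (hS : S.Regular T) (hC : Compatible p T S) :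
    ∃ V : Fin 6 → Profile, (∀ j, InS T (Jh (-1)) (V j)) ∧
      Bulk T (Jh (-1)) A3M p.AM V S.vacuum ∧
      ∀ w ∈ dom (bdryBox T), dθ T (Jh (-1)) (V 2) (onΓ w) = dθb T (S.G 2) w ∧
        dθ T (Jh (-1)) (V 4) (onΓ w) = dθb T (S.G 3) w ∧
        dθ T (Jh (-1)) (V 3) (onΓ w) = -dθb T (S.G 4) w := by
  have hε : IsSide (-1) := .inr rfl
  have hF := hS.vacuum
  have hb : ∀ i, ∀ z ∈ dom (slowBox T (Jh (-1))), mean (S.vacuum i).1 z = 0 := fun i z hz => by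
    have := hC.b_minus z (by rwa [Jm_eq])
    fin_cases i
    exacts [this.1 0, this.1 1, this.1 2, this.1 3, this.1 4, this.1 5, this.2.1, this.2.2]
  have hdm := hC.d_minus
  rw [Jm_eq] at hdm
  obtain ⟨hd1, hd2⟩ := divergence_split hT hε
    (P := ![S.vacuum 2, S.vacuum 0, S.vacuum 1, S.vacuum 6])
    (fun i => by fin_cases i; exacts [hF 2, hF 0, hF 1, hF 6])
    (fun i => by fin_cases i; exacts [hb 2, hb 0, hb 1, hb 6])
    (fun x hx => (hdm x hx).1)
  obtain ⟨hd1', hd2'⟩ := divergence_split hT hε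
    (P := ![S.vacuum 5, S.vacuum 3, S.vacuum 4, S.vacuum 7])
    (fun i => by fin_cases i; exacts [hF 5, hF 3, hF 4, hF 7])
    (fun i => by fin_cases i; exacts [hb 5, hb 3, hb 4, hb 7])
    (fun x hx => (hdm x hx).2)
  obtain ⟨Vr, hVr, -, hVrθ⟩ := exists_residual hT hε p.NM p.αM p.QM (fun i => (hF i).1) hb
  have hP : ∀ j, IsProfile T (Jh (-1)) (Vr j, 0) :=
    fun j => InS.isProfile ⟨hVr j, InStar.zero hT hε⟩
  have hf : ∀ i, IsSmoothPer (bdryBox T) (![S.G 2, S.G 3, S.G 4, fun w => val (Vr 2, 0) (onΓ w),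
      fun w => val (Vr 3, 0) (onΓ w), fun w => val (Vr 4, 0) (onΓ w)] i) := fun i => by
    fin_cases i
    exacts [(hS.G 2).smoothPer, (hS.G 3).smoothPer, (hS.G 4).smoothPer, (hP 2).smoothPer_trace,
      (hP 3).smoothPer_trace, (hP 4).smoothPer_trace]
  have hg := IsSmoothPer.sum hf ![1, 0, 0, -1, 0, 0]
  have hg' := IsSmoothPer.sum hf ![0, p.ξ₂, -p.ξ₁, 0, -p.ξ₁, -p.ξ₂]
  obtain ⟨Vs, hVs, hrow, htr⟩ := p.exists_star_vacuum hT hξ hρ0 hρ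
    (F := fun i => (S.vacuum i).2) (fun i => (hF i).2) (inStar_starLift hT hε hg)
    (inStar_starLift hT hε hg') hd2 hd2'
  have hV : ∀ j, IsProfile T (Jh (-1)) (Vr j, Vs j) := fun j => InS.isProfile ⟨hVr j, hVs j⟩
  have hB : Bulk T (Jh (-1)) A3M p.AM (fun j => (Vr j, Vs j)) S.vacuum := by
    refine Bulk.of_parts hT hε hV (fun z hz i => ?_) hrow
    have hρ2 : (p.rt : ℂ) ≠ 0 := by exact_mod_cast hρ0.ne'
    have := vacuum_rows hξ (κ := 1) one_ne_zero hρ (F := fun i => ((S.vacuum i).1 z : ℂ))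
      (DF := 0) (Z := fun l => ∑ i, (p.QM l i : ℂ) * (S.vacuum i).1 z) (DZ := 0)
      (by simp [QM, Fin.sum_univ_eight]; field_simp; ring) (by simp [QM, Fin.sum_univ_eight])
      (by simp [QM, Fin.sum_univ_eight]; field_simp; ring) (by simp [QM, Fin.sum_univ_eight])
      (by have := hd1 z hz; simp at this ⊢; exact_mod_cast this)
      (by have := hd1' z hz; simp at this ⊢; exact_mod_cast this) i
    have h0 : ∀ j, lin p.NM p.αM 1 (0 : Fin 8 → ℂ) 0 j = 0 := fun j => by simp [lin]
    simp only [h0, ← hVrθ z hz] at this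
    simp at this
    exact_mod_cast this
  refine ⟨fun j => (Vr j, Vs j), fun j => ⟨hVr j, hVs j⟩, hB, fun w hw => ?_⟩
  have hx : onΓ w ∈ dom (fastBox T (Jh (-1))) := IsProfile.onΓ_mem hw
  obtain ⟨h1, h1'⟩ := htr _ hx rfl
  rw [pd_starLift_onΓ hT hε hg hw, dθb, pd_sum (goodBox_bdry hT) hf _ _ hw] at h1
  rw [pd_starLift_onΓ hT hε hg' hw, dθb, pd_sum (goodBox_bdry hT) hf _ _ hw] at h1'
  have e2 := dθb_trace_res hT hε (hVr 2) hw
  have e3 := dθb_trace_res hT hε (hVr 3) hw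
  have e4 := dθb_trace_res hT hε (hVr 4) hw
  simp only [dθb] at e2 e3 e4
  simp [Fin.sum_univ_six] at h1 h1'
  rw [e2] at h1
  rw [e3, e4] at h1'
  have h2 := hB _ hx 2
  simp [Fin.sum_univ_six, A3M, AM] at h2
  rw [show val (S.vacuum 2) (onΓ w) = _ from hC.a₂ w hw] at h2
  have d2 := (hV 2).dθ_eq hT hε hx
  have d3 := (hV 3).dθ_eq hT hε hx
  have d4 := (hV 4).dθ_eq hT hε hx
  simp only at d2 d3 d4
  have h3 : dθ T (Jh (-1)) (Vr 2, Vs 2) (onΓ w) = dθb T (S.G 2) w := by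
    rw [d2, dθb]
    linear_combination h1
  have h4 : p.ξ₁ * dθ T (Jh (-1)) (Vr 3, Vs 3) (onΓ w)
      + p.ξ₂ * dθ T (Jh (-1)) (Vr 4, Vs 4) (onΓ w)
      = p.ξ₂ * dθb T (S.G 3) w - p.ξ₁ * dθb T (S.G 4) w := by
    rw [d3, d4, dθb, dθb]
    linear_combination h1'
  rw [h3] at h2
  refine ⟨h3, ?_, ?_⟩
  · linear_combination p.ξ₂ * h4 + p.ξ₁ * h2
      + (dθb T (S.G 3) w - dθ T (Jh (-1)) (Vr 4, Vs 4) (onΓ w)) * hξ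
  · linear_combination p.ξ₁ * h4 - p.ξ₂ * h2
      - (dθb T (S.G 4) w + dθ T (Jh (-1)) (Vr 3, Vs 3) (onΓ w)) * hξ

end Params

/-! ### Existence of a particular solution -/

section
variable {n : ℕ} {s : Fin (n + 1) → Option (Set ℝ)}

lemma eq_mean_of_pd (hθ : s (Fin.last n) = none) {f : (Fin (n + 1) → ℝ) → ℝ}
    (hf : IsSmoothPer s f) (h : ∀ x ∈ dom s, pd s (Fin.last n) f x = 0) {x : Fin (n + 1) → ℝ}
    (hx : x ∈ dom s) : f x = mean f x :=
  (mean_eq_of_update (update_last_eq_of_pd hθ hf hx fun θ => h _ (update_last_mem hθ hx θ))).symm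

lemma mode_eq_of_pd_eq (hs : GoodBox s) (hθ : s (Fin.last n) = none)
    {f g : (Fin (n + 1) → ℝ) → ℝ} (hf : IsSmoothPer s f) (hg : IsSmoothPer s g)
    (h : Set.EqOn (pd s (Fin.last n) f) (pd s (Fin.last n) g) (dom s)) {k : ℤ} (hk : k ≠ 0)
    {x : Fin (n + 1) → ℝ} (hx : x ∈ dom s) : mode f k x = mode g k x := by
  have := mode_congr hθ h k hx
  rw [mode_pd_last hs hθ hf k hx, mode_pd_last hs hθ hg k hx] at this
  exact mul_left_cancel₀ (I_mul_ne_zero hk) this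

end

section
variable {T ε : ℝ}

lemma InSPlus.of_inS (hT : 0 < T) {U : Fin 7 → Profile} (h : ∀ j, InS T (Jh 1) (U j)) :
    InSPlus T U := by
  rw [InSPlus, InResPlus, InStarPlus, Jp_eq]
  exact ⟨⟨fun i _ => (h i).1, (h 6).1.inResPressure hT (.inl rfl)⟩,
    fun i _ => (h i).2, (h 6).2.inStarPressure hT (.inl rfl)⟩

lemma pd_resLift (hT : 0 < T) (hε : IsSide ε) {D : (Fin 4 → ℝ) → ℝ}
    (hD : IsSmoothPer (bdryBox T) D) (h : ∀ w ∈ dom (bdryBox T), D w = mean D w) :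
    Set.EqOn (pd (slowBox T (Jh ε)) 4 (resLift ε D)) 0 (dom (slowBox T (Jh ε))) := by
  have hp : HasPd (slowBox T (Jh ε)) 4 (resLift ε (mean D)) 0 := fun z _ => by
    have : ∀ t : ℝ, resLift ε (mean D) (Function.update z 4 t) = resLift ε (mean D) z := fun t => by
      have h1 := vecTail_update_succ z (Fin.last 3) t
      have h2 := mean_update D (Matrix.vecTail z) t
      rw [← h1] at h2
      exact congrArg₂ (· * ·) (by simp) h2
    simp only [this]
    exact hasDerivWithinAt_const _ _ _
  refine HasPd.eqOn_pd (goodBox_slow hT hε) (isHInf_resLift hT hε hD).smoothPer.smooth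
    (hp.congr (fun z hz => ?_) fun _ _ => rfl)
  rw [resLift, resLift, h _ (mem_dom_vecTail hz)]

/-- Lifts of boundary functions that do not depend on `θ` can be added to the residual components
without affecting the equations. -/
lemma Bulk.add_resLift (hT : 0 < T) (hε : IsSide ε) {m n : ℕ} {A₃ A : Matrix (Fin m) (Fin n) ℝ}
    {U : Fin n → Profile} {F : Fin m → Profile} (hB : Bulk T (Jh ε) A₃ A U F)
    (hU : ∀ j, InS T (Jh ε) (U j)) {D : Fin n → (Fin 4 → ℝ) → ℝ}
    (hD : ∀ j, IsSmoothPer (bdryBox T) (D j))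
    (hm : ∀ j, ∀ w ∈ dom (bdryBox T), D j w = mean (D j) w) :
    ∃ U' : Fin n → Profile, (∀ j, InS T (Jh ε) (U' j)) ∧ Bulk T (Jh ε) A₃ A U' F ∧
      (∀ j w, val (U' j) (onΓ w) = val (U j) (onΓ w) + D j w) ∧
      ∀ j, D j = 0 → val (U' j) = val (U j) := by
  have hU' : ∀ j, InS T (Jh ε) ((U j).1 + resLift ε (D j), (U j).2) := fun j =>
    ⟨(hU j).1.add (goodBox_slow hT hε) (isHInf_resLift hT hε (hD j)), (hU j).2⟩
  refine ⟨_, hU', fun x hx i => ?_, fun j w => ?_, fun j hj => ?_⟩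
  · rw [← hB x hx i]
    congr 1 <;> refine Finset.sum_congr rfl fun j _ => ?_
    · rw [(hU j).isProfile.dY_eq hT hε hx, (hU' j).isProfile.dY_eq hT hε hx]
    · have hz := mem_dom_vecTail (s := slowBox T (Jh ε)) hx
      rw [(hU j).isProfile.dθ_eq hT hε hx, (hU' j).isProfile.dθ_eq hT hε hx]
      simp only
      rw [pd_add (goodBox_slow hT hε) (hU j).1.smoothPer.smooth
        (isHInf_resLift hT hε (hD j)).smoothPer.smooth 4 hz, Pi.add_apply,
        pd_resLift hT hε (hD j) (hm j) hz]
      simp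
  · have := resLift_zero (ε := ε) (D j) w
    simp only [val, onΓ, Matrix.tail_cons, Pi.add_apply, this]
    ring
  · ext x
    simp [val, hj, resLift]

end

namespace Params
variable {p : Params} {T : ℝ} {J : Set ℝ} {S : Sources}

lemma bulk_plasma_iff {U : Fin 7 → Profile} :
    Bulk T J p.A3P p.AP U S.plasma ↔
      (∀ x ∈ dom (fastBox T J),
        p.A3p.mulVec (fun i => dY T J (U i) x) + p.Ap.mulVec (fun i => dθ T J (U i) x)
          = fun i => val (S.Fp i) x) ∧
      ∀ x ∈ dom (fastBox T J), dY T J (U 5) x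
        + (p.ξ₁ * dθ T J (U 3) x + p.ξ₂ * dθ T J (U 4) x) = val S.F8p x := by
  refine ⟨fun h => ⟨fun x hx => ?_, fun x hx => ?_⟩, fun ⟨h1, h2⟩ x hx i => ?_⟩
  · funext i
    have := h x hx (Fin.castSucc i)
    fin_cases i <;> exact this
  · have := h x hx 7
    refine Eq.trans ?_ this
    simp [A3P, AP, Fin.sum_univ_seven]
  · have h3 := fun i => congrFun (h1 x hx) i
    fin_cases i
    exacts [h3 0, h3 1, h3 2, h3 3, h3 4, h3 5, h3 6, by
      have := h2 x hx
      refine Eq.trans ?_ this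
      simp [A3P, AP, Fin.sum_univ_seven]]

lemma bulk_vacuum_iff {V : Fin 6 → Profile} :
    Bulk T J A3M p.AM V S.vacuum ↔
      (∀ x ∈ dom (fastBox T J),
        A3m.mulVec (fun i => dY T J (V i) x) + p.Am.mulVec (fun i => dθ T J (V i) x)
          = fun i => val (S.Fm i) x) ∧
      (∀ x ∈ dom (fastBox T J), dY T J (V 2) x
        + (p.ξ₁ * dθ T J (V 0) x + p.ξ₂ * dθ T J (V 1) x) = val S.F7m x) ∧
      ∀ x ∈ dom (fastBox T J), dY T J (V 5) x
        + (p.ξ₁ * dθ T J (V 3) x + p.ξ₂ * dθ T J (V 4) x) = val S.F8m x := by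
  refine ⟨fun h => ⟨fun x hx => ?_, fun x hx => ?_, fun x hx => ?_⟩, fun ⟨h1, h2, h2'⟩ x hx i => ?_⟩
  · funext i
    have := h x hx (Fin.castAdd 2 i)
    fin_cases i <;> exact this
  · have := h x hx 6
    refine Eq.trans ?_ this
    simp [A3M, AM, Fin.sum_univ_six]
  · have := h x hx 7
    refine Eq.trans ?_ this
    simp [A3M, AM, Fin.sum_univ_six]
  · have h3 := fun i => congrFun (h1 x hx) i
    fin_cases i
    exacts [h3 0, h3 1, h3 2, h3 3, h3 4, h3 5, by
      have := h2 x hx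
      refine Eq.trans ?_ this
      simp [A3M, AM, Fin.sum_univ_six], by
      have := h2' x hx
      refine Eq.trans ?_ this
      simp [A3M, AM, Fin.sum_univ_six]]

/-- The six boundary conditions, written out. -/
lemma jump_iff {U : Fin 7 → Profile} {V : Fin 6 → Profile} {φ : (Fin 4 → ℝ) → ℝ}
    {w : Fin 4 → ℝ} :
    Params.BBp.mulVec (fun i => val (U i) (onΓ w)) + p.BBm.mulVec (fun i => val (V i) (onΓ w))
      + dθb T φ w • p.bvec = (fun i => S.G i w) ↔
    val (U 2) (onΓ w) - p.cp * dθb T φ w = S.G 0 w ∧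
    val (U 5) (onΓ w) - p.bp * dθb T φ w = S.G 1 w ∧
    val (V 2) (onΓ w) - p.bm * dθb T φ w = S.G 2 w ∧
    val (V 4) (onΓ w) + p.am₁ * dθb T φ w = S.G 3 w ∧
    -val (V 3) (onΓ w) + p.am₂ * dθb T φ w = S.G 4 w ∧
    val (U 6) (onΓ w) - (p.H₁ * val (V 0) (onΓ w) + p.H₂ * val (V 1) (onΓ w))
      + p.E₃ * val (V 5) (onΓ w) = S.G 5 w := by
  rw [funext_iff]
  simp only [Fin.forall_fin_succ, IsEmpty.forall_iff, and_true]
  simp only [BBp, BBm, bvec, Pi.add_apply, Matrix.cons_mulVec, Matrix.cons_dotProduct]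
  simp
  refine and_congr (Eq.congr_left ?_) <| and_congr (Eq.congr_left ?_) <|
    and_congr (Eq.congr_left ?_) <| and_congr (Eq.congr_left ?_) <|
    and_congr (Eq.congr_left ?_) (Eq.congr_left ?_)
  · change val (U 2) (onΓ w) + _ = _
    ring
  · change val (U 5) (onΓ w) + _ = _
    ring
  · change val (V 2) (onΓ w) + _ = _
    ring
  · change val (V 4) (onΓ w) + _ = _
    ring
  · change -val (V 3) (onΓ w) + _ = _
    ring
  · change val (U 6) (onΓ w) + (-(p.H₁ * val (V 0) (onΓ w))
      + (-(p.H₂ * val (V 1) (onΓ w)) + p.E₃ * val (V 5) (onΓ w))) = _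
    ring

/-- Sufficiency of the compatibility conditions. After solving the equations on the two sides, the
defects in the boundary conditions do not depend on `θ`: for five of them this is part of the
construction, for the pressure condition it is the solvability identity. They are removed by
residual lifts. -/
lemma exists_particular (hT : 0 < T) (hξ : p.ξ₁ ^ 2 + p.ξ₂ ^ 2 = 1) (hΔ : p.disc ≠ 0)
    (hν : p.ν ≠ 0) (hτ : p.τ ≠ 0) (hρ0 : 0 < p.rt) (hρ : p.rt ^ 2 = 1 - p.ν ^ 2 * p.τ ^ 2)
    (hL : p.Lopatinskii) (hS : S.Regular T) (hC : Compatible p T S) :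
    ∃ U V, IsParticular p T S U V := by
  obtain ⟨U, hU, hBU, hU0, hUt⟩ := exists_plasma hT hξ hΔ hS hC
  obtain ⟨V, hV, hBV, hVt⟩ := exists_vacuum hT hξ hρ0 hρ hS hC
  have hs := goodBox_bdry hT
  have hl : bdryBox T (Fin.last 3) = none := rfl
  let u : Fin 7 → (Fin 4 → ℝ) → ℝ := fun j w => val (U j) (onΓ w)
  let v : Fin 6 → (Fin 4 → ℝ) → ℝ := fun j w => val (V j) (onΓ w)
  have hu : ∀ j, IsSmoothPer (bdryBox T) (u j) := fun j => (hU j).isProfile.smoothPer_trace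
  have hv : ∀ j, IsSmoothPer (bdryBox T) (v j) := fun j => (hV j).isProfile.smoothPer_trace
  have hG : ∀ i, IsSmoothPer (bdryBox T) (S.G i) := fun i => (hS.G i).smoothPer
  have hG4 := (hG 4).smul (-1)
  -- the data and the traces have the same `θ`-derivative
  have d0 : Set.EqOn (pd (bdryBox T) 3 (S.G 0)) (pd (bdryBox T) 3 (u 2)) (dom (bdryBox T)) :=
    fun w hw => ((hUt w hw).1.symm).trans ((hU 2).isProfile.dθb_trace hT hw).symm
  have d1 : Set.EqOn (pd (bdryBox T) 3 (S.G 1)) (pd (bdryBox T) 3 (u 5)) (dom (bdryBox T)) :=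
    fun w hw => ((hUt w hw).2.symm).trans ((hU 5).isProfile.dθb_trace hT hw).symm
  have d2 : Set.EqOn (pd (bdryBox T) 3 (S.G 2)) (pd (bdryBox T) 3 (v 2)) (dom (bdryBox T)) :=
    fun w hw => ((hVt w hw).1.symm).trans ((hV 2).isProfile.dθb_trace hT hw).symm
  have d3 : Set.EqOn (pd (bdryBox T) 3 (S.G 3)) (pd (bdryBox T) 3 (v 4)) (dom (bdryBox T)) :=
    fun w hw => ((hVt w hw).2.1.symm).trans ((hV 4).isProfile.dθb_trace hT hw).symm
  have d4 : Set.EqOn (pd (bdryBox T) 3 ((-1 : ℝ) • S.G 4)) (pd (bdryBox T) 3 (v 3))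
      (dom (bdryBox T)) := fun w hw => by
    refine (pd_smul hs (hG 4).smooth (-1) 3 hw).trans (Eq.trans ?_
      ((hVt w hw).2.2.symm.trans ((hV 3).isProfile.dθb_trace hT hw).symm))
    simp [dθb]
  -- So their differences do not depend on `θ`.
  have hdiff : ∀ {f g : (Fin 4 → ℝ) → ℝ}, IsSmoothPer (bdryBox T) f → IsSmoothPer (bdryBox T) g →
      Set.EqOn (pd (bdryBox T) 3 f) (pd (bdryBox T) 3 g) (dom (bdryBox T)) →
      ∀ w ∈ dom (bdryBox T), (f - g) w = mean (f - g) w := fun hf hg h w hw => by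
    refine eq_mean_of_pd hl (hf.sub hg) (fun w hw => ?_) hw
    refine (HasPd.eqOn_pd hs (hf.sub hg).smooth
      ((hasPd_pd hf.smooth _).sub (hasPd_pd hg.smooth _)) hw).trans ?_
    rw [Pi.sub_apply]
    exact sub_eq_zero.2 (h hw)
  let f6 : Fin 5 → (Fin 4 → ℝ) → ℝ := ![S.G 5, u 6, v 0, v 1, v 5]
  have hf6 : ∀ i, IsSmoothPer (bdryBox T) (f6 i) := fun i => by
    fin_cases i
    exacts [hG 5, hu 6, hv 0, hv 1, hv 5]
  let c6 : Fin 5 → ℝ := ![1, -1, p.H₁, p.H₂, -p.E₃]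
  -- Neither does the defect in the pressure condition, by the solvability identity with `Φ = 0`.
  have hm6 : ∀ w ∈ dom (bdryBox T), ∑ i, c6 i * f6 i w
      = mean (fun w => ∑ i, c6 i * f6 i w) w := fun w hw => by
    refine eq_mean_of_mode hs hl (IsSmoothPer.sum hf6 c6) hw fun k hk => ?_
    rw [mode_sum hl (fun i => (hf6 i).smooth.continuousOn) c6 k hw]
    have key := solvability_identity hT hξ hν hρ0 hρ hL (fun j => (hU j).isProfile)
      (fun i => (hS.plasma i).isProfile) hBU (fun j => (hV j).isProfile)
      (fun i => (hS.vacuum i).isProfile) hBV hw hk (Φ := 0) (g := fun i => mode (S.G i) k w)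
      (by rw [mul_zero, sub_zero]
          exact (IsProfile.mode_trace _ _ _).symm.trans
            (mode_eq_of_pd_eq hs hl (hG 0) (hu 2) d0 hk hw).symm)
      (by rw [mul_zero, sub_zero]
          exact (IsProfile.mode_trace _ _ _).symm.trans
            (mode_eq_of_pd_eq hs hl (hG 1) (hu 5) d1 hk hw).symm)
      (by rw [mul_zero, add_zero]
          exact (IsProfile.mode_trace _ _ _).symm.trans
            (mode_eq_of_pd_eq hs hl (hG 3) (hv 4) d3 hk hw).symm)
      (by
        have := mode_eq_of_pd_eq hs hl hG4 (hv 3) d4 hk hw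
        rw [mode_smul] at this
        rw [mul_zero, add_zero, ← IsProfile.mode_trace,
          ← show _ = mode (fun w => val (V 3) (onΓ w)) k w from this]
        push_cast
        ring)
    rw [hC.e w hw k hk, eq_comm] at key
    have hne : isgn k * (p.τ : ℂ) ≠ 0 := mul_ne_zero
      (fun h => by simpa [h] using isgn_mul_self hk) (by exact_mod_cast hτ)
    have key' := (mul_eq_zero.1 key).resolve_left hne
    simp only [Fin.sum_univ_five]
    simp only [← IsProfile.mode_trace] at key'
    simp [c6, f6, u, v]
    linear_combination -key'
  let DU : Fin 7 → (Fin 4 → ℝ) → ℝ :=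
    ![0, 0, S.G 0 - u 2, 0, 0, S.G 1 - u 5, fun w => ∑ i, c6 i * f6 i w]
  let DV : Fin 6 → (Fin 4 → ℝ) → ℝ :=
    ![0, 0, S.G 2 - v 2, (-1 : ℝ) • S.G 4 - v 3, S.G 3 - v 4, 0]
  have h0 : IsSmoothPer (bdryBox T) (0 : (Fin 4 → ℝ) → ℝ) := (IsHInf.zero hs).smoothPer
  have hm0 : ∀ w ∈ dom (bdryBox T), (0 : (Fin 4 → ℝ) → ℝ) w = mean 0 w := fun w _ => by
    simp [mean]
  obtain ⟨U', hU', hBU', hUt', hUe⟩ := hBU.add_resLift hT (.inl rfl) hU (D := DU)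
    (fun j => by
      fin_cases j
      exacts [h0, h0, (hG 0).sub (hu 2), h0, h0, (hG 1).sub (hu 5), IsSmoothPer.sum hf6 c6])
    (fun j => by
      fin_cases j
      exacts [hm0, hm0, hdiff (hG 0) (hu 2) d0, hm0, hm0, hdiff (hG 1) (hu 5) d1, hm6])
  obtain ⟨V', hV', hBV', hVt', -⟩ := hBV.add_resLift hT (.inr rfl) hV (D := DV)
    (fun j => by
      fin_cases j
      exacts [h0, h0, (hG 2).sub (hv 2), hG4.sub (hv 3), (hG 3).sub (hv 4), h0])
    (fun j => by
      fin_cases j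
      exacts [hm0, hm0, hdiff (hG 2) (hv 2) d2, hdiff hG4 (hv 3) d4, hdiff (hG 3) (hv 4) d3, hm0])
  rw [← Jp_eq] at hBU'
  rw [← Jm_eq] at hBV' hV'
  have hBU'' := bulk_plasma_iff.1 hBU'
  have hBV'' := bulk_vacuum_iff.1 hBV'
  refine ⟨U', V', ⟨InSPlus.of_inS hT hU', hV', IsHInf.zero hs, hBU''.1, hBU''.2, hBV''.1,
    hBV''.2.1, hBV''.2.2, fun w hw => jump_iff.2 ?_⟩, fun j hj x hx => ?_⟩
  · have hz : dθb T 0 w = 0 := by simp [dθb, pd]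
    simp only [hUt', hVt', hz]
    simp [DU, DV, u, v, c6, f6, Fin.sum_univ_five]
    ring
  · rw [Jp_eq] at hx
    have hj' : DU j = 0 := by rcases hj with rfl | rfl | rfl | rfl <;> rfl
    rw [hUe j hj', hU0 j hj x hx]

end Params

/-! ### Necessity of the compatibility conditions -/

section
variable {T ε : ℝ}

lemma dθb_jump (hT : 0 < T) {P : Profile} (hP : IsProfile T (Jh ε) P) {φ g : (Fin 4 → ℝ) → ℝ}
    (hφ : IsSmoothPer (bdryBox T) φ) {c d : ℝ}
    (h : ∀ w ∈ dom (bdryBox T), c * val P (onΓ w) + d * dθb T φ w = g w) {w : Fin 4 → ℝ}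
    (hw : w ∈ dom (bdryBox T)) :
    dθb T g w = c * dθ T (Jh ε) P (onΓ w) + d * dθb T (dθb T φ) w := by
  have hs := goodBox_bdry hT
  have hf : ∀ i, IsSmoothPer (bdryBox T) (![fun w => val P (onΓ w), dθb T φ] i) := fun i => by
    fin_cases i
    exacts [hP.smoothPer_trace, hφ.pd hs 3]
  have h1 := pd_sum hs hf ![c, d] 3 hw
  have h2 := pd_congr (s := bdryBox T) (f := g)
    (g := fun w => ∑ j, ![c, d] j * ![fun w => val P (onΓ w), dθb T φ] j w)
    (fun w hw => by simp [Fin.sum_univ_two, ← h w hw]) 3 hw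
  have h3 : dθb T (fun w => val P (onΓ w)) w = dθ T (Jh ε) P (onΓ w) := hP.dθb_trace hT hw
  rw [dθb, h2, h1, ← h3]
  simp [Fin.sum_univ_two, dθb]

/-- Fourier coefficients of a boundary condition. -/
lemma mode_jump (hT : 0 < T) {P : Profile} (hP : IsProfile T (Jh ε) P) {φ g : (Fin 4 → ℝ) → ℝ}
    (hφ : IsSmoothPer (bdryBox T) φ) {c d : ℝ}
    (h : ∀ w ∈ dom (bdryBox T), c * val P (onΓ w) + d * dθb T φ w = g w) (k : ℤ)
    {w : Fin 4 → ℝ} (hw : w ∈ dom (bdryBox T)) :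
    mode g k w = c * mode (val P) k (onΓ w) + d * mode (dθb T φ) k w := by
  have hs := goodBox_bdry hT
  have hl : bdryBox T (Fin.last 3) = none := rfl
  have hf : ∀ i, IsSmoothPer (bdryBox T) (![fun w => val P (onΓ w), dθb T φ] i) := fun i => by
    fin_cases i
    exacts [hP.smoothPer_trace, hφ.pd hs 3]
  have h1 := mode_sum hl (fun i => (hf i).smooth.continuousOn) ![c, d] k hw
  have h2 := mode_congr hl (f := g)
    (g := fun w => ∑ j, ![c, d] j * ![fun w => val P (onΓ w), dθb T φ] j w)
    (fun w hw => by simp [Fin.sum_univ_two, ← h w hw]) k hw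
  rw [h2, h1, ← IsProfile.mode_trace]
  simp [Fin.sum_univ_two]

variable {m n : ℕ} {A₃ A : Matrix (Fin m) (Fin n) ℝ} {U : Fin n → Profile} {F : Fin m → Profile}

/-- The residual sources have zero mean: otherwise a component of the solution would grow linearly
in `Y₃`. -/
lemma Bulk.mean_res (hT : 0 < T) (hε : IsSide ε) (h : Bulk T (Jh ε) A₃ A U F)
    (hU : ∀ j, IsProfile T (Jh ε) (U j)) (hF : ∀ i, IsProfile T (Jh ε) (F i)) (i : Fin m)
    {z : Fin 5 → ℝ} (hz : z ∈ dom (slowBox T (Jh ε))) : mean (F i).1 z = 0 := by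
  have hε0 : (ε : ℂ) ≠ 0 := by rcases hε with rfl | rfl <;> simp
  have key := limit_deriv_eq_zero
    (g := fun r => ∑ j, (A₃ i j : ℂ) * FastProblem.mode (val (U j)) 0 (Matrix.vecCons (ε * r) z))
    (g' := fun r => ε * FastProblem.mode (val (F i)) 0 (Matrix.vecCons (ε * r) z))
    (fun r hr => by
      refine (HasDerivWithinAt.fun_sum fun j _ =>
        ((hU j).hasDeriv_mode hT hε 0 hz hr).const_mul (A₃ i j : ℂ)).congr_deriv ?_
      rw [← h.mode hT hε hU 0 (IsProfile.mem_ray hε hz hr) i, Int.cast_zero, mul_zero, zero_mul,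
        add_zero, Finset.mul_sum]
      exact Finset.sum_congr rfl fun j _ => by ring)
    (tendsto_finsetSum _ fun j _ => ((hU j).tendsto_mode_val hε 0 hz).const_mul _)
    (((hF i).tendsto_mode_val hε 0 hz).const_mul _)
  have := (mul_eq_zero.1 key).resolve_left hε0
  rw [mode_zero_eq_mean] at this
  exact_mod_cast this

lemma Bulk.mean_star (hT : 0 < T) (hε : IsSide ε) (h : Bulk T (Jh ε) A₃ A U F)
    (hU : ∀ j, IsProfile T (Jh ε) (U j)) (hF : ∀ i, IsProfile T (Jh ε) (F i)) (i : Fin m)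
    {x : Fin 6 → ℝ} (hx : x ∈ dom (fastBox T (Jh ε))) :
    ∑ j, A₃ i j * mean (dY T (Jh ε) (U j)) x = mean (F i).2 x := by
  have h1 := h.mode hT hε hU 0 hx i
  rw [(hF i).mode_val 0 hx] at h1
  simp only [mode_zero_eq_mean, h.mean_res hT hε hU hF i (mem_dom_vecTail hx), Int.cast_zero,
    mul_zero, zero_mul, add_zero, Complex.ofReal_zero, zero_add] at h1
  exact_mod_cast h1

lemma subset_closure_interior {s : Set ℝ} (hs : Convex ℝ s) {a b : ℝ} (ha : a ∈ s) (hb : b ∈ s)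
    (hab : a < b) : s ⊆ closure (interior s) := by
  have h : Set.Ioo a b ⊆ interior s := interior_maximal
    (Set.Ioo_subset_Icc_self.trans (hs.ordConnected.out ha hb)) isOpen_Ioo
  rw [hs.closure_interior_eq_closure_of_nonempty_interior ((Set.nonempty_Ioo.2 hab).mono h)]
  exact subset_closure

lemma dom_subset_closure_interior (hT : 0 < T) (hε : IsSide ε) :
    dom (fastBox T (Jh ε)) ⊆ closure (interior (dom (fastBox T (Jh ε)))) := by
  rw [dom_eq_pi, interior_pi_set Set.finite_univ, closure_pi_set]
  refine Set.pi_mono fun i _ => ?_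
  have hJ : Jh ε ⊆ closure (interior (Jh ε)) := by
    rcases hε with rfl | rfl
    · exact subset_closure_interior (Jh_props (.inl rfl)).2.1 (a := 0) (b := 1) (by simp [Jh])
        (by simp [Jh]) one_pos
    · exact subset_closure_interior (Jh_props (.inr rfl)).2.1 (a := -1) (b := 0) (by simp [Jh])
        (by simp [Jh]) (by norm_num)
  have hu : (Set.univ : Set ℝ) ⊆ closure (interior Set.univ) := by simp
  fin_cases i
  exacts [hJ, hJ, subset_closure_interior (convex_Icc 0 T) (Set.left_mem_Icc.2 hT.le)
    (Set.right_mem_Icc.2 hT.le) hT, hu, hu, hu]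

lemma Bulk.pd (hT : 0 < T) (hε : IsSide ε) (h : Bulk T (Jh ε) A₃ A U F)
    (hU : ∀ j, IsProfile T (Jh ε) (U j)) (i : Fin m) (l : Fin 6) {x : Fin 6 → ℝ}
    (hx : x ∈ dom (fastBox T (Jh ε))) :
    FastProblem.pd (fastBox T (Jh ε)) l (val (F i)) x
      = ∑ j, A₃ i j * FastProblem.pd (fastBox T (Jh ε)) 0
          (FastProblem.pd (fastBox T (Jh ε)) l (val (U j))) x
        + ∑ j, A i j * FastProblem.pd (fastBox T (Jh ε)) 5
          (FastProblem.pd (fastBox T (Jh ε)) l (val (U j))) x := by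
  have hs := goodBox_fast hT hε
  have hi := dom_subset_closure_interior hT hε
  have h0 : ∀ j, IsSmoothPer (fastBox T (Jh ε)) (dY T (Jh ε) (U j)) :=
    fun j => (hU j).smoothPer_val.pd hs 0
  have h5 : ∀ j, IsSmoothPer (fastBox T (Jh ε)) (dθ T (Jh ε) (U j)) :=
    fun j => (hU j).smoothPer_val.pd hs 5
  have e := pd_congr (s := fastBox T (Jh ε)) (f := val (F i))
    (g := (fun x => ∑ j, A₃ i j * dY T (Jh ε) (U j) x) + fun x => ∑ j, A i j * dθ T (Jh ε) (U j) x)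
    (fun x hx => (h x hx i).symm) l hx
  rw [e, pd_add hs (IsSmoothPer.sum h0 _).smooth (IsSmoothPer.sum h5 _).smooth l hx, Pi.add_apply,
    pd_sum hs h0 _ l hx, pd_sum hs h5 _ l hx]
  congr 1 <;> refine Finset.sum_congr rfl fun j _ => ?_
  · rw [dY, pd_comm hs hi (hU j).smoothPer_val.smooth l 0 hx]
  · rw [dθ, pd_comm hs hi (hU j).smoothPer_val.smooth l 5 hx]

end

namespace Params
variable {p : Params} {T : ℝ} {S : Sources} {U : Fin 7 → Profile} {V : Fin 6 → Profile}
  {φ : (Fin 4 → ℝ) → ℝ}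

lemma divergence_plasma (hT : 0 < T) (hU : ∀ j, IsProfile T (Jh 1) (U j))
    (hB : Bulk T (Jh 1) p.A3P p.AP U S.plasma) {x : Fin 6 → ℝ}
    (hx : x ∈ dom (fastBox T (Jh 1))) :
    dY T (Jh 1) (S.Fp 5) x + (p.ξ₁ * dθ T (Jh 1) (S.Fp 3) x + p.ξ₂ * dθ T (Jh 1) (S.Fp 4) x)
      - p.τ * dθ T (Jh 1) S.F8p x = 0 := by
  have hε : IsSide 1 := .inl rfl
  have hcm := fun j => pd_comm (goodBox_fast hT hε) (dom_subset_closure_interior hT hε)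
    (hU j).smoothPer_val.smooth 0 5 hx
  have e5 := hB.pd hT hε hU 5 0 hx
  have e3 := hB.pd hT hε hU 3 5 hx
  have e4 := hB.pd hT hε hU 4 5 hx
  have e7 := hB.pd hT hε hU 7 5 hx
  have f5 : val (S.plasma 5) = val (S.Fp 5) := rfl
  have f3 : val (S.plasma 3) = val (S.Fp 3) := rfl
  have f4 : val (S.plasma 4) = val (S.Fp 4) := rfl
  have f7 : val (S.plasma 7) = val S.F8p := rfl
  rw [f5] at e5
  rw [f3] at e3
  rw [f4] at e4
  rw [f7] at e7
  rw [dY, dθ, dθ, dθ, e5, e3, e4, e7]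
  simp only [A3P, AP, Fin.sum_univ_seven, hcm, cp, ap, bp]
  simp
  ring

lemma divergence_vacuum (hT : 0 < T) (hV : ∀ j, IsProfile T (Jh (-1)) (V j))
    (hB : Bulk T (Jh (-1)) A3M p.AM V S.vacuum) {x : Fin 6 → ℝ}
    (hx : x ∈ dom (fastBox T (Jh (-1)))) :
    dY T (Jh (-1)) (S.Fm 2) x
        + (p.ξ₁ * dθ T (Jh (-1)) (S.Fm 0) x + p.ξ₂ * dθ T (Jh (-1)) (S.Fm 1) x)
        - p.ν * p.τ * dθ T (Jh (-1)) S.F7m x = 0 ∧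
      dY T (Jh (-1)) (S.Fm 5) x
        + (p.ξ₁ * dθ T (Jh (-1)) (S.Fm 3) x + p.ξ₂ * dθ T (Jh (-1)) (S.Fm 4) x)
        - p.ν * p.τ * dθ T (Jh (-1)) S.F8m x = 0 := by
  have hε : IsSide (-1) := .inr rfl
  have hcm := fun j => pd_comm (goodBox_fast hT hε) (dom_subset_closure_interior hT hε)
    (hV j).smoothPer_val.smooth 0 5 hx
  have e := fun i l => hB.pd hT hε hV i l hx
  have f0 : S.vacuum 0 = S.Fm 0 := rfl
  have f1 : S.vacuum 1 = S.Fm 1 := rfl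
  have f2 : S.vacuum 2 = S.Fm 2 := rfl
  have f3 : S.vacuum 3 = S.Fm 3 := rfl
  have f4 : S.vacuum 4 = S.Fm 4 := rfl
  have f5 : S.vacuum 5 = S.Fm 5 := rfl
  have f6 : S.vacuum 6 = S.F7m := rfl
  have f7 : S.vacuum 7 = S.F8m := rfl
  constructor
  · simp only [dY, dθ, ← f0, ← f1, ← f2, ← f6, e, A3M, AM, Fin.sum_univ_six, hcm]
    simp
    ring
  · simp only [dY, dθ, ← f3, ← f4, ← f5, ← f7, e, A3M, AM, Fin.sum_univ_six, hcm]
    simp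
    ring

/-- Necessity of the compatibility conditions. -/
lemma _root_.FastProblem.IsSolution.compatible (hT : 0 < T) (hξ : p.ξ₁ ^ 2 + p.ξ₂ ^ 2 = 1)
    (hν : p.ν ≠ 0) (hρ0 : 0 < p.rt) (hρ : p.rt ^ 2 = 1 - p.ν ^ 2 * p.τ ^ 2)
    (hL : p.Lopatinskii) (hS : S.Regular T) (h : IsSolution p T S U V φ) : Compatible p T S := by
  have hU : ∀ j, IsProfile T (Jh 1) (U j) := fun j => by
    rw [← Jp_eq]; exact h.memU.isProfile j
  have hV : ∀ j, IsProfile T (Jh (-1)) (V j) := fun j => by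
    rw [← Jm_eq]; exact h.memV.isProfile j
  have hBU : Bulk T (Jh 1) p.A3P p.AP U S.plasma := by
    rw [← Jp_eq]; exact bulk_plasma_iff.2 ⟨h.plasma, h.divB⟩
  have hBV : Bulk T (Jh (-1)) A3M p.AM V S.vacuum := by
    rw [← Jm_eq]; exact bulk_vacuum_iff.2 ⟨h.vacuum, h.divH, h.divE⟩
  have hFP := fun i => (hS.plasma i).isProfile
  have hFM := fun i => (hS.vacuum i).isProfile
  have hφ := h.memφ.smoothPer
  have hj := fun w hw => jump_iff.1 (h.jump w hw)
  have j0 : ∀ w ∈ dom (bdryBox T), 1 * val (U 2) (onΓ w) + -p.cp * dθb T φ w = S.G 0 w :=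
    fun w hw => by linear_combination (hj w hw).1
  have j1 : ∀ w ∈ dom (bdryBox T), 1 * val (U 5) (onΓ w) + -p.bp * dθb T φ w = S.G 1 w :=
    fun w hw => by linear_combination (hj w hw).2.1
  have j2 : ∀ w ∈ dom (bdryBox T), 1 * val (V 2) (onΓ w) + -p.bm * dθb T φ w = S.G 2 w :=
    fun w hw => by linear_combination (hj w hw).2.2.1
  have j3 : ∀ w ∈ dom (bdryBox T), 1 * val (V 4) (onΓ w) + p.am₁ * dθb T φ w = S.G 3 w :=
    fun w hw => by linear_combination (hj w hw).2.2.2.1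
  have j4 : ∀ w ∈ dom (bdryBox T), -1 * val (V 3) (onΓ w) + p.am₂ * dθb T φ w = S.G 4 w :=
    fun w hw => by linear_combination (hj w hw).2.2.2.2.1
  constructor
  · intro w hw
    have h5 := hBU _ (IsProfile.onΓ_mem hw) 5
    rw [dθb_jump hT (hU 2) hφ j0 hw, dθb_jump hT (hU 5) hφ j1 hw]
    refine (Eq.symm h5).trans ?_
    simp [A3P, AP, Fin.sum_univ_seven]
    ring
  · intro w hw
    have h5 := hBV _ (IsProfile.onΓ_mem hw) 2
    rw [dθb_jump hT (hV 2) hφ j2 hw, dθb_jump hT (hV 4) hφ j3 hw, dθb_jump hT (hV 3) hφ j4 hw]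
    refine (Eq.symm h5).trans ?_
    simp [A3M, AM, Fin.sum_univ_six]
    linear_combination -dθb T (dθb T φ) w * p.xi_dot_am
  · rw [Jp_eq]
    intro z hz
    have := fun i => hBU.mean_res hT (.inl rfl) hU hFP i hz
    refine ⟨fun i => ?_, this 7⟩
    fin_cases i
    exacts [this 0, this 1, this 2, this 3, this 4, this 5, this 6]
  · rw [Jm_eq]
    intro z hz
    have := fun i => hBV.mean_res hT (.inr rfl) hV hFM i hz
    refine ⟨fun i => ?_, this 6, this 7⟩
    fin_cases i
    exacts [this 0, this 1, this 2, this 3, this 4, this 5]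
  · rw [Jp_eq]
    intro x hx
    have e := fun i => hBU.mean_star hT (.inl rfl) hU hFP i hx
    have e6 := (e 6).symm
    have e7 := (e 7).symm
    simp [A3P, Fin.sum_univ_seven] at e6 e7
    have f6 : mean (S.Fp 6).2 x = mean (dY T (Jh 1) (U 2)) x := e6
    have f7 : mean S.F8p.2 x = mean (dY T (Jh 1) (U 5)) x := e7
    rw [f6, f7]
    refine ⟨(Eq.trans ?_ (e 0)), (Eq.trans ?_ (e 1)), (Eq.trans ?_ (e 3)), (Eq.trans ?_ (e 4))⟩ <;>
      simp [A3P, Fin.sum_univ_seven] <;> ring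
  · rw [Jp_eq]
    exact fun x hx => divergence_plasma hT hU hBU hx
  · rw [Jm_eq]
    exact fun x hx => divergence_vacuum hT hV hBV hx
  · intro w hw k hk
    have hl : bdryBox T (Fin.last 3) = none := rfl
    have key := solvability_identity hT hξ hν hρ0 hρ hL hU hFP hBU hV hFM hBV hw hk
      (Φ := mode (dθb T φ) k w) (g := fun i => mode (S.G i) k w)
      (by rw [mode_jump hT (hU 2) hφ j0 k hw]; push_cast; ring)
      (by rw [mode_jump hT (hU 5) hφ j1 k hw]; push_cast; ring)
      (by rw [mode_jump hT (hV 4) hφ j3 k hw]; push_cast; ring)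
      (by rw [mode_jump hT (hV 3) hφ j4 k hw]; push_cast; ring)
    refine key.trans ?_
    have hf : ∀ i, IsSmoothPer (bdryBox T) (![fun w => val (U 6) (onΓ w),
        fun w => val (V 0) (onΓ w), fun w => val (V 1) (onΓ w), fun w => val (V 5) (onΓ w)] i) :=
      fun i => by
        fin_cases i
        exacts [(hU 6).smoothPer_trace, (hV 0).smoothPer_trace, (hV 1).smoothPer_trace,
          (hV 5).smoothPer_trace]
    have e := mode_sum hl (fun i => (hf i).smooth.continuousOn) ![1, -p.H₁, -p.H₂, p.E₃] k hw
    rw [mode_congr hl (g := S.G 5) (fun w hw => by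
      rw [← (hj w hw).2.2.2.2.2]
      simp [Fin.sum_univ_four]
      ring) k hw] at e
    simp only [e, ← IsProfile.mode_trace]
    simp [Fin.sum_univ_four]
    right
    ring

end Params

/-! ### Homogeneous solutions -/

section
variable {T ε : ℝ} {P : Profile}

lemma bounded_of_tendsto {g : ℝ → ℂ} {L : ℂ} (hc : ContinuousOn g (Set.Ici 0))
    (ht : Filter.Tendsto g Filter.atTop (nhds L)) : ∃ C, ∀ r, 0 ≤ r → ‖g r‖ ≤ C := by
  have h1 := (ht.norm).eventually (Iic_mem_nhds (lt_add_one ‖L‖))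
  obtain ⟨R, hR⟩ := Filter.eventually_atTop.1 h1
  obtain ⟨C, hC⟩ := isCompact_Icc.exists_bound_of_continuousOn
    (hc.mono (Set.Icc_subset_Ici_self : Set.Icc 0 R ⊆ _))
  refine ⟨max C (‖L‖ + 1), fun r hr => ?_⟩
  rcases le_total r R with h | h
  · exact (hC r ⟨hr, h⟩).trans (le_max_left _ _)
  · exact le_trans (hR r h) (le_max_right _ _)

/-- If the zero mode of `∂_{Y₃} P` vanishes, then so does the mean of the decaying part. -/
lemma IsProfile.mean_star_eq_zero (hT : 0 < T) (hε : IsSide ε) (hP : IsProfile T (Jh ε) P)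
    (h : ∀ x ∈ dom (fastBox T (Jh ε)), mean (dY T (Jh ε) P) x = 0) {x : Fin 6 → ℝ}
    (hx : x ∈ dom (fastBox T (Jh ε))) : mean P.2 x = 0 := by
  have hz := mem_dom_vecTail (s := slowBox T (Jh ε)) hx
  have hd : ∀ r, 0 ≤ r → HasDerivWithinAt
      (fun r => mode (val P) 0 (Matrix.vecCons (ε * r) (Matrix.vecTail x)))
      (((0 : ℝ) : ℂ) * mode (val P) 0 (Matrix.vecCons (ε * r) (Matrix.vecTail x)))
      (Set.Ici 0) r := fun r hr => by
    have h1 := hP.hasDeriv_mode hT hε 0 hz hr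
    rw [mode_zero_eq_mean, h _ (mem_ray hε hz hr)] at h1
    simpa using h1
  have h0 : ∀ r, 0 ≤ r → mode (val P) 0 (Matrix.vecCons (ε * r) (Matrix.vecTail x))
      = mode (val P) 0 (Matrix.vecCons (ε * 0) (Matrix.vecTail x)) := fun r hr => by
    have := eq_exp_mul hd hr
    simp only [zero_mul, Real.exp_zero, Complex.ofReal_one, one_mul] at this
    exact this
  have h1 : mode (val P) 0 (Matrix.vecCons (ε * 0) (Matrix.vecTail x))
      = mode P.1 0 (Matrix.vecTail x) := by
    refine tendsto_nhds_unique (tendsto_const_nhds.congr' ?_) (hP.tendsto_mode_val hε 0 hz)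
    filter_upwards [Filter.eventually_ge_atTop 0] with r hr
    exact (h0 r hr).symm
  have h2 := (h0 (ε * x 0) (mem_Jh_of_mem_dom hx)).trans h1
  rw [vecCons_side hε, hP.mode_val 0 hx, add_eq_left, mode_zero_eq_mean] at h2
  exact_mod_cast h2

/-- The residual part has no mode that decays exponentially along the rays. -/
lemma IsProfile.mode_res_eq_zero (hε : IsSide ε) (hP : IsProfile T (Jh ε) P) {k : ℤ}
    {z : Fin 5 → ℝ} (hz : z ∈ dom (slowBox T (Jh ε))) {c : ℝ} (hc : 0 < c) {C : ℂ}
    (h : ∀ r, 0 ≤ r → mode (val P) k (Matrix.vecCons (ε * r) z)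
      = ((Real.exp (-c * r) : ℝ) : ℂ) * C) : mode P.1 k z = 0 := by
  refine tendsto_nhds_unique (hP.tendsto_mode_val hε k hz) (Filter.Tendsto.congr' ?_
    (f₁ := fun r : ℝ => ((Real.exp (-c * r) : ℝ) : ℂ) * C) ?_)
  · filter_upwards [Filter.eventually_ge_atTop 0] with r hr
    exact (h r hr).symm
  · have := ((tendsto_exp_neg hc 1).ofReal).mul_const C
    simpa using this

end

namespace Params
variable {p : Params} {T : ℝ} {U : Fin 7 → Profile} {V : Fin 6 → Profile}

/-- The nonzero modes of a solution of the homogeneous plasma equations are multiples of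
`e^{-|k|Y₃} 𝓡⁺(k)`: the pair `(c⁺u₃ - b⁺B₃, q)` is a bounded solution of a two by two system, and
the other components are functions of `q`. -/
lemma plasma_modes (hT : 0 < T) (hξ : p.ξ₁ ^ 2 + p.ξ₂ ^ 2 = 1) (hΔ : p.disc ≠ 0)
    (hU : ∀ j, IsProfile T (Jh 1) (U j)) (hB : Bulk T (Jh 1) p.A3P p.AP U 0)
    {k : ℤ} (hk : k ≠ 0) {z : Fin 5 → ℝ} (hz : z ∈ dom (slowBox T (Jh 1))) {r : ℝ} (hr : 0 ≤ r)
    (j : Fin 7) :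
    mode (val (U j)) k (Matrix.vecCons (1 * r) z)
      = ((Real.exp (-|(k : ℝ)| * r) : ℝ) : ℂ)
        * (mode (val (U 6)) k (Matrix.vecCons 0 z) / (p.bp ^ 2 - p.cp ^ 2) * p.Rp k j) := by
  have hε : IsSide 1 := .inl rfl
  have hκ := I_mul_ne_zero hk
  have hξc : (p.ξ₁ : ℂ) ^ 2 + p.ξ₂ ^ 2 = 1 := by exact_mod_cast hξ
  have hΔc : (p.bp : ℂ) ^ 2 - p.cp ^ 2 ≠ 0 := by
    intro h
    apply hΔ
    rw [disc]
    have : p.bp ^ 2 - p.cp ^ 2 = 0 := by exact_mod_cast h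
    linarith
  have hb : (p.bp : ℂ) = p.ξ₁ * p.B₁ + p.ξ₂ * p.B₂ := by rw [bp]; push_cast; ring
  let u : Fin 7 → ℝ → ℂ := fun j r => mode (val (U j)) k (Matrix.vecCons (1 * r) z)
  let d : Fin 7 → ℝ → ℂ := fun j r => mode (dY T (Jh 1) (U j)) k (Matrix.vecCons (1 * r) z)
  have hud : ∀ j r, 0 ≤ r → HasDerivWithinAt (u j) (d j r) (Set.Ici 0) r := fun j r hr => by
    have := (hU j).hasDeriv_mode hT hε k hz hr
    rwa [Complex.ofReal_one, one_mul] at this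
  have hbd : ∀ j, ∃ C, ∀ r, 0 ≤ r → ‖u j r‖ ≤ C := fun j =>
    bounded_of_tendsto ((hU j).continuousOn_mode hT hε k hz) ((hU j).tendsto_mode_val hε k hz)
  have hrow : ∀ r, 0 ≤ r → ∀ i, ∑ j, (p.A3P i j : ℂ) * d j r
      + Complex.I * k * ∑ j, (p.AP i j : ℂ) * u j r = 0 := fun r hr i => by
    rw [hB.mode hT hε hU k (IsProfile.mem_ray hε hz hr) i]
    simp [mode, val]
  set κ := Complex.I * (k : ℂ) with hκd
  have rows : ∀ r, 0 ≤ r →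
      p.cp * d 2 r - p.bp * d 5 r = κ * u 6 r ∧ d 6 r = -κ * (p.cp * u 2 r - p.bp * u 5 r) ∧
      p.cp * u 0 r - p.bp * u 3 r = -p.ξ₁ * u 6 r ∧ p.cp * u 1 r - p.bp * u 4 r = -p.ξ₂ * u 6 r ∧
      p.cp * u 3 r - p.bp * u 0 r = 0 ∧ p.cp * u 4 r - p.bp * u 1 r = 0 ∧
      p.cp * u 5 r - p.bp * u 2 r = 0 := fun r hr => by
    have h0 := hrow r hr 0
    have h1 := hrow r hr 1
    have h2 := hrow r hr 2
    have h3 := hrow r hr 3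
    have h4 := hrow r hr 4
    have h5 := hrow r hr 5
    have h6 := hrow r hr 6
    have h7 := hrow r hr 7
    simp only [A3P, AP, Fin.sum_univ_seven] at h0 h1 h2 h3 h4 h5 h6 h7
    simp [-mul_eq_zero] at h0 h1 h2 h3 h4 h5 h6 h7
    have w0 : p.cp * u 0 r - p.bp * u 3 r = -p.ξ₁ * u 6 r := by
      apply mul_left_cancel₀ hκ
      linear_combination h0 - p.u₁ * h6 + p.B₁ * h7
    have w1 : p.cp * u 1 r - p.bp * u 4 r = -p.ξ₂ * u 6 r := by
      apply mul_left_cancel₀ hκ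
      linear_combination h1 - p.u₂ * h6 + p.B₂ * h7
    have w5 : p.cp * u 5 r - p.bp * u 2 r = 0 := by
      apply mul_left_cancel₀ hκ
      linear_combination h5
    refine ⟨?_, ?_, w0, w1, ?_, ?_, w5⟩
    · linear_combination -κ * p.ξ₁ * w0 - κ * p.ξ₂ * w1 + p.cp * h6 - p.bp * h7 + κ * u 6 r * hξc
    · linear_combination h2
    · apply mul_left_cancel₀ hκ
      linear_combination h3 - p.B₁ * h6 + p.u₁ * h7 - κ * u 0 r * hb
    · apply mul_left_cancel₀ hκ
      linear_combination h4 - p.B₂ * h6 + p.u₂ * h7 - κ * u 1 r * hb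
  obtain ⟨C2, hC2⟩ := hbd 2
  obtain ⟨C5, hC5⟩ := hbd 5
  have key := fun r hr => halfspace_homogeneous hε one_pos hk
    (a := fun r => p.cp * u 2 r - p.bp * u 5 r) (b := u 6)
    (fun r hr => by
      refine (((hud 2 r hr).const_mul _).sub ((hud 5 r hr).const_mul _)).congr_deriv ?_
      rw [(rows r hr).1]
      push_cast
      ring)
    (fun r hr => by
      refine (hud 6 r hr).congr_deriv ?_
      rw [(rows r hr).2.1]
      push_cast
      ring)
    ⟨‖(p.cp : ℂ)‖ * C2 + ‖(p.bp : ℂ)‖ * C5, fun r hr => by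
      refine (norm_sub_le _ _).trans ?_
      rw [norm_mul, norm_mul]
      gcongr
      exacts [hC2 r hr, hC5 r hr]⟩ (hbd 6) (r := r) hr
  obtain ⟨k1, k2⟩ := key r hr
  obtain ⟨-, -, r0, r1, r3, r4, r5⟩ := rows r hr
  have k3 : u 6 r = ((Real.exp (-|(k : ℝ)| * r) : ℝ) : ℂ)
      * mode (val (U 6)) k (Matrix.vecCons 0 z) := by
    rw [k2, one_mul, neg_mul]
    simp only [u, mul_zero]
  push_cast at k1
  change u j r = _
  rw [div_mul_eq_mul_div, mul_div_assoc', ← mul_assoc, ← k3, eq_div_iff hΔc]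
  fin_cases j <;> simp [Rp, -mul_eq_mul_right_iff, -mul_eq_mul_left_iff]
  · linear_combination -p.cp * r0 - p.bp * r3
  · linear_combination -p.cp * r1 - p.bp * r4
  · linear_combination -p.cp * k1 - p.bp * r5
  · linear_combination -p.bp * r0 - p.cp * r3
  · linear_combination -p.bp * r1 - p.cp * r4
  · linear_combination -p.bp * k1 - p.cp * r5

/-- The nonzero modes of a solution of the homogeneous vacuum equations are combinations of
`e^{|k|ρY₃} 𝓡₁⁻(k)` and `e^{|k|ρY₃} 𝓡₂⁻(k)`: the pairs `(ξ·H, H₃)` and `(ξ·E, E₃)` are bounded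
solutions of the same two by two system. -/
lemma vacuum_modes (hT : 0 < T) (hξ : p.ξ₁ ^ 2 + p.ξ₂ ^ 2 = 1) (hρ0 : 0 < p.rt)
    (hρ : p.rt ^ 2 = 1 - p.ν ^ 2 * p.τ ^ 2) (hν : p.ν ≠ 0) (hτ : p.τ ≠ 0)
    (hV : ∀ j, IsProfile T (Jh (-1)) (V j)) (hB : Bulk T (Jh (-1)) A3M p.AM V 0)
    {k : ℤ} (hk : k ≠ 0) {z : Fin 5 → ℝ} (hz : z ∈ dom (slowBox T (Jh (-1)))) {r : ℝ}
    (hr : 0 ≤ r) (j : Fin 6) :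
    mode (val (V j)) k (Matrix.vecCons (-1 * r) z)
      = ((Real.exp (-(|(k : ℝ)| * p.rt) * r) : ℝ) : ℂ)
        * (mode (val (V 0)) k (Matrix.vecCons 0 z) / (p.rt * (p.ν * p.τ)) * p.Rm₁ k j
          + mode (val (V 1)) k (Matrix.vecCons 0 z) / (p.rt * (p.ν * p.τ)) * p.Rm₂ k j) := by
  have hε : IsSide (-1) := .inr rfl
  have hκ := I_mul_ne_zero hk
  have hξc : (p.ξ₁ : ℂ) ^ 2 + p.ξ₂ ^ 2 = 1 := by exact_mod_cast hξ
  have hρc : (p.rt : ℂ) ^ 2 = 1 - p.ν ^ 2 * p.τ ^ 2 := by exact_mod_cast hρ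
  have hρ' : (p.rt : ℂ) ≠ 0 := by exact_mod_cast hρ0.ne'
  have hlam : (p.ν : ℂ) * p.τ ≠ 0 := by exact_mod_cast mul_ne_zero hν hτ
  let u : Fin 6 → ℝ → ℂ := fun j r => mode (val (V j)) k (Matrix.vecCons (-1 * r) z)
  let d : Fin 6 → ℝ → ℂ := fun j r => mode (dY T (Jh (-1)) (V j)) k (Matrix.vecCons (-1 * r) z)
  have hud : ∀ j r, 0 ≤ r → HasDerivWithinAt (u j) (((-1 : ℝ) : ℂ) * d j r) (Set.Ici 0) r :=
    fun j r hr => (hV j).hasDeriv_mode hT hε k hz hr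
  have hbd : ∀ j, ∃ C, ∀ r, 0 ≤ r → ‖u j r‖ ≤ C := fun j =>
    bounded_of_tendsto ((hV j).continuousOn_mode hT hε k hz) ((hV j).tendsto_mode_val hε k hz)
  have hbd2 : ∀ (c c' : ℂ) (i j : Fin 6), ∃ C, ∀ r, 0 ≤ r → ‖c * u i r + c' * u j r‖ ≤ C :=
    fun c c' i j => by
      obtain ⟨C, hC⟩ := hbd i
      obtain ⟨C', hC'⟩ := hbd j
      refine ⟨‖c‖ * C + ‖c'‖ * C', fun r hr => (norm_add_le _ _).trans ?_⟩
      rw [norm_mul, norm_mul]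
      gcongr
      exacts [hC r hr, hC' r hr]
  have hrow : ∀ r, 0 ≤ r → ∀ i, ∑ j, (A3M i j : ℂ) * d j r
      + Complex.I * k * ∑ j, (p.AM i j : ℂ) * u j r = 0 := fun r hr i => by
    rw [hB.mode hT hε hV k (IsProfile.mem_ray hε hz hr) i]
    simp [mode, val]
  set κ := Complex.I * (k : ℂ) with hκd
  have rows : ∀ r, 0 ≤ r →
      p.ξ₁ * d 0 r + p.ξ₂ * d 1 r = κ * p.rt ^ 2 * u 2 r ∧
      d 2 r = -κ * (p.ξ₁ * u 0 r + p.ξ₂ * u 1 r) ∧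
      p.ξ₁ * d 3 r + p.ξ₂ * d 4 r = κ * p.rt ^ 2 * u 5 r ∧
      d 5 r = -κ * (p.ξ₁ * u 3 r + p.ξ₂ * u 4 r) ∧
      p.ν * p.τ * u 2 r - p.ξ₂ * u 3 r + p.ξ₁ * u 4 r = 0 ∧
      p.ξ₂ * u 0 r - p.ξ₁ * u 1 r + p.ν * p.τ * u 5 r = 0 := fun r hr => by
    have h0 := hrow r hr 0
    have h1 := hrow r hr 1
    have h2 := hrow r hr 2
    have h3 := hrow r hr 3
    have h4 := hrow r hr 4
    have h5 := hrow r hr 5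
    have h6 := hrow r hr 6
    have h7 := hrow r hr 7
    simp only [A3M, AM, Fin.sum_univ_six] at h0 h1 h2 h3 h4 h5 h6 h7
    simp [-mul_eq_zero] at h0 h1 h2 h3 h4 h5 h6 h7
    have w2 : p.ν * p.τ * u 2 r - p.ξ₂ * u 3 r + p.ξ₁ * u 4 r = 0 := by
      apply mul_left_cancel₀ hκ
      linear_combination h2
    have w5 : p.ξ₂ * u 0 r - p.ξ₁ * u 1 r + p.ν * p.τ * u 5 r = 0 := by
      apply mul_left_cancel₀ hκ
      linear_combination h5
    refine ⟨?_, ?_, ?_, ?_, w2, w5⟩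
    · linear_combination p.ξ₂ * h3 - p.ξ₁ * h4 + κ * u 2 r * hξc + κ * (p.ν * p.τ) * w2
        - κ * u 2 r * hρc
    · linear_combination h6
    · linear_combination p.ξ₁ * h1 - p.ξ₂ * h0 + κ * u 5 r * hξc + κ * (p.ν * p.τ) * w5
        - κ * u 5 r * hρc
    · linear_combination h7
  have key := fun r hr => halfspace_homogeneous hε hρ0 hk
    (a := fun r => p.ξ₁ * u 0 r + p.ξ₂ * u 1 r) (b := u 2)
    (fun r hr => by
      refine (((hud 0 r hr).const_mul _).add ((hud 1 r hr).const_mul _)).congr_deriv ?_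
      rw [← (rows r hr).1]
      ring)
    (fun r hr => by
      refine (hud 2 r hr).congr_deriv ?_
      rw [(rows r hr).2.1])
    (hbd2 _ _ _ _) (hbd 2) (r := r) hr
  have key' := fun r hr => halfspace_homogeneous hε hρ0 hk
    (a := fun r => p.ξ₁ * u 3 r + p.ξ₂ * u 4 r) (b := u 5)
    (fun r hr => by
      refine (((hud 3 r hr).const_mul _).add ((hud 4 r hr).const_mul _)).congr_deriv ?_
      rw [← (rows r hr).2.2.1]
      ring)
    (fun r hr => by
      refine (hud 5 r hr).congr_deriv ?_
      rw [(rows r hr).2.2.2.1])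
    (hbd2 _ _ _ _) (hbd 5) (r := r) hr
  have h0 : ∀ j, u j 0 = mode (val (V j)) k (Matrix.vecCons 0 z) := fun j => by
    simp only [u, mul_zero]
  obtain ⟨k1, k2⟩ := key r hr
  obtain ⟨k1', k2'⟩ := key' r hr
  obtain ⟨l1, -⟩ := key 0 le_rfl
  obtain ⟨l1', -⟩ := key' 0 le_rfl
  obtain ⟨-, -, -, -, r2, r5⟩ := rows r hr
  obtain ⟨-, -, -, -, s2, s5⟩ := rows 0 le_rfl
  rw [← h0, ← h0]
  change u j r = _
  have he : -(p.rt * |(k : ℝ)| * r) = -(|(k : ℝ)| * p.rt) * r := by ring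
  rw [he] at k2 k2'
  push_cast at k1 k1' l1 l1'
  have hσ := isgn_mul_self hk
  generalize ((Real.exp (-(|(k : ℝ)| * p.rt) * r) : ℝ) : ℂ) = e at *
  have e0 : u 0 r = e * u 0 0 := by
    linear_combination p.ξ₁ * k1 + p.ξ₂ * r5 - e * (p.ξ₁ * l1 + p.ξ₂ * s5)
      + p.ξ₁ * isgn k * p.rt * k2 - p.ξ₂ * (p.ν * p.τ) * k2' - (u 0 r - e * u 0 0) * hξc
  have e1 : u 1 r = e * u 1 0 := by
    linear_combination p.ξ₂ * k1 - p.ξ₁ * r5 - e * (p.ξ₂ * l1 - p.ξ₁ * s5)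
      + p.ξ₂ * isgn k * p.rt * k2 + p.ξ₁ * (p.ν * p.τ) * k2' - (u 1 r - e * u 1 0) * hξc
  rw [div_mul_eq_mul_div, div_mul_eq_mul_div, ← add_div, mul_div_assoc',
    eq_div_iff (mul_ne_zero hρ' hlam), mul_add, ← mul_assoc e, ← mul_assoc e, ← e0, ← e1]
  fin_cases j <;> simp [Rm₁, Rm₂, -mul_eq_mul_right_iff, -mul_eq_mul_left_iff]
  · ring
  · ring
  · linear_combination isgn k * (p.ν * p.τ) * k1 + (p.ν * p.τ) * p.rt * u 2 r * hσ
  · linear_combination p.rt * (p.ν * p.τ) * (p.ξ₁ * k1' - p.ξ₂ * r2 - u 3 r * hξc)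
      + p.ξ₁ * isgn k * p.rt ^ 2 * r5 + p.ξ₂ * (p.ν * p.τ) ^ 2 * (isgn k * k1 + p.rt * u 2 r * hσ)
      - p.ξ₁ * isgn k * (p.ξ₂ * u 0 r - p.ξ₁ * u 1 r) * hρc - isgn k * (p.ν * p.τ) ^ 2 * u 1 r * hξc
  · linear_combination p.rt * (p.ν * p.τ) * (p.ξ₂ * k1' + p.ξ₁ * r2 - u 4 r * hξc)
      + p.ξ₂ * isgn k * p.rt ^ 2 * r5 - p.ξ₁ * (p.ν * p.τ) ^ 2 * (isgn k * k1 + p.rt * u 2 r * hσ)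
      - p.ξ₂ * isgn k * (p.ξ₂ * u 0 r - p.ξ₁ * u 1 r) * hρc + isgn k * (p.ν * p.τ) ^ 2 * u 0 r * hξc
  · linear_combination p.rt * r5

end Params

/-! ### The general solution -/

section
variable {n : ℕ} {s : Fin (n + 1) → Option (Set ℝ)}

/-- A function without nonzero modes does not depend on `θ`. -/
lemma update_eq_of_mode (hs : GoodBox s) (hθ : s (Fin.last n) = none)
    {f : (Fin (n + 1) → ℝ) → ℝ} (hf : IsSmoothPer s f)
    (h : ∀ x ∈ dom s, ∀ k : ℤ, k ≠ 0 → mode f k x = 0) {x : Fin (n + 1) → ℝ} (hx : x ∈ dom s)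
    (θ : ℝ) : f (Function.update x (Fin.last n) θ) = f x := by
  have hx' := update_last_mem hθ hx θ
  rw [eq_mean_of_mode hs hθ hf hx' (h _ hx'), mean_update, ← eq_mean_of_mode hs hθ hf hx (h _ hx)]

end

lemma val_sub (P Q : Profile) (x : Fin 6 → ℝ) : val (P - Q) x = val P x - val Q x := by
  simp [val]
  ring

lemma Sources.zero_plasma : Sources.zero.plasma = 0 := by
  funext i
  fin_cases i <;> rfl

lemma Sources.zero_vacuum : Sources.zero.vacuum = 0 := by
  funext i
  fin_cases i <;> rfl

section
variable {T ε : ℝ}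

lemma isProfile_zero (hT : 0 < T) (hε : IsSide ε) : IsProfile T (Jh ε) 0 :=
  InS.isProfile ⟨IsHInf.zero (goodBox_slow hT hε), InStar.zero hT hε⟩

lemma InStar.mean (hT : 0 < T) (hε : IsSide ε) {f : (Fin 6 → ℝ) → ℝ} (hf : InStar T (Jh ε) f) :
    InStar T (Jh ε) (mean f) := by
  obtain ⟨δ, hδ, -, h⟩ := exists_common_niceAt hT hε (F := fun _ : Unit => f) (fun _ => hf) one_pos
  refine (NiceAt.ite (h ()) .zero).inStar_syn hT hε hδ |>.congr hT hε fun x _ => ?_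
  rw [syn, tsum_eq_single 0 fun k hk => by simp [hk]]
  simp [comp_zero_eq_mean]

/-- If a profile has zero mean, so does its surface wave part. -/
lemma mean_star_of_mean_val (hε : IsSide ε) {P : Profile} (hP : IsProfile T (Jh ε) P)
    (h : ∀ x ∈ dom (fastBox T (Jh ε)), FastProblem.mean (val P) x = 0) {x : Fin 6 → ℝ}
    (hx : x ∈ dom (fastBox T (Jh ε))) : FastProblem.mean P.2 x = 0 := by
  have hz := mem_dom_vecTail (s := slowBox T (Jh ε)) hx
  have h1 : mode P.1 0 (Matrix.vecTail x) = 0 := by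
    refine tendsto_nhds_unique (hP.tendsto_mode_val hε 0 hz) (tendsto_const_nhds.congr' ?_)
    filter_upwards [Filter.eventually_ge_atTop 0] with r hr
    rw [mode_zero_eq_mean, h _ (IsProfile.mem_ray hε hz hr), Complex.ofReal_zero]
  have h2 := hP.mean_val hx
  rw [mode_zero_eq_mean] at h1
  rw [h x hx, show FastProblem.mean P.1 (Matrix.vecTail x) = 0 by exact_mod_cast h1] at h2
  linarith

lemma hasSum_nonzero_modes (hT : 0 < T) (hε : IsSide ε) {f : (Fin 6 → ℝ) → ℝ}
    (hf : IsSmoothPer (fastBox T (Jh ε)) f) {x : Fin 6 → ℝ} (hx : x ∈ dom (fastBox T (Jh ε))) :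
    HasSum (fun k : {k : ℤ // k ≠ 0} => mode f k x * Complex.exp (Complex.I * (k : ℤ) * x 5))
      ((f x - FastProblem.mean f x : ℝ) : ℂ) := by
  have h := (hasSum_comp (goodBox_fast hT hε) (fastBox_last _) hf hx).sub
    (hasSum_ite_eq (0 : ℤ) (FastProblem.mean f x : ℂ))
  have h' := (hasSum_subtype_iff_of_support_subset (s := {k : ℤ | k ≠ 0}) (fun k hk h0 => hk (by
    subst h0
    simp [comp_zero_eq_mean]))).2 h
  rw [Complex.ofReal_sub]
  have e : (fun k : {k : ℤ // k ≠ 0} => mode f k x * Complex.exp (Complex.I * (k : ℤ) * x 5))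
      = (fun k : ℤ => comp f k x - if k = 0 then (FastProblem.mean f x : ℂ) else 0) ∘
        Subtype.val := by
    funext k
    have hk : (k : ℤ) ≠ 0 := k.2
    simp [comp, hk]
  rw [e]
  exact h'

lemma cons_eq_update_last (x : Fin 6 → ℝ) :
    (![0, x 1, x 2, x 3, x 4, 0] : Fin 6 → ℝ)
      = Function.update (Matrix.vecCons 0 (Matrix.vecTail x)) (Fin.last 5) 0 := by
  funext i
  fin_cases i <;> rfl

end

namespace Params
variable {p : Params} {T : ℝ} {S : Sources} {U U₀ : Fin 7 → Profile} {V V₀ : Fin 6 → Profile}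
  {φ : (Fin 4 → ℝ) → ℝ}

lemma _root_.FastProblem.IsSolution.sub (hT : 0 < T) (h : IsSolution p T S U V φ)
    (h₀ : IsSolution p T S U₀ V₀ 0) : IsSolution p T Sources.zero (U - U₀) (V - V₀) φ := by
  have hBU : Bulk T Jp p.A3P p.AP (U - U₀) Sources.zero.plasma := by
    rw [Sources.zero_plasma, ← sub_self S.plasma, Jp_eq]
    exact Bulk.sub hT (.inl rfl) (Jp_eq ▸ bulk_plasma_iff.2 ⟨h.plasma, h.divB⟩)
      (Jp_eq ▸ bulk_plasma_iff.2 ⟨h₀.plasma, h₀.divB⟩) (fun j => Jp_eq ▸ h.memU.isProfile j)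
      (fun j => Jp_eq ▸ h₀.memU.isProfile j)
  have hBV : Bulk T Jm A3M p.AM (V - V₀) Sources.zero.vacuum := by
    rw [Sources.zero_vacuum, ← sub_self S.vacuum, Jm_eq]
    exact Bulk.sub hT (.inr rfl) (Jm_eq ▸ bulk_vacuum_iff.2 ⟨h.vacuum, h.divH, h.divE⟩)
      (Jm_eq ▸ bulk_vacuum_iff.2 ⟨h₀.vacuum, h₀.divH, h₀.divE⟩)
      (fun j => Jm_eq ▸ h.memV.isProfile j) (fun j => Jm_eq ▸ h₀.memV.isProfile j)
  have h1 := bulk_plasma_iff.1 hBU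
  have h2 := bulk_vacuum_iff.1 hBV
  refine ⟨h.memU.sub hT h₀.memU, h.memV.sub hT h₀.memV, h.memφ, h1.1, h1.2, h2.1, h2.2.1, h2.2.2,
    fun w hw => jump_iff.2 ?_⟩
  have hz : dθb T 0 w = 0 := by simp [dθb, pd]
  have e := jump_iff.1 (h.jump w hw)
  have e₀ := jump_iff.1 (h₀.jump w hw)
  obtain ⟨a0, a1, a2, a3, a4, a5⟩ := e
  obtain ⟨b0, b1, b2, b3, b4, b5⟩ := e₀
  rw [hz, mul_zero] at b0 b1 b2 b3 b4
  simp only [Pi.sub_apply, val_sub, Sources.zero, Pi.zero_apply]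
  refine ⟨?_, ?_, ?_, ?_, ?_, ?_⟩
  · linear_combination a0 - b0
  · linear_combination a1 - b1
  · linear_combination a2 - b2
  · linear_combination a3 - b3
  · linear_combination a4 - b4
  · linear_combination a5 - b5

lemma _root_.FastProblem.IsSolution.bulk_plasma_zero (h : IsSolution p T Sources.zero U V φ) :
    Bulk T (Jh 1) p.A3P p.AP U 0 := by
  rw [← Jp_eq, ← Sources.zero_plasma]; exact bulk_plasma_iff.2 ⟨h.plasma, h.divB⟩

lemma _root_.FastProblem.IsSolution.bulk_vacuum_zero (h : IsSolution p T Sources.zero U V φ) :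
    Bulk T (Jh (-1)) A3M p.AM V 0 := by
  rw [← Jm_eq, ← Sources.zero_vacuum]; exact bulk_vacuum_iff.2 ⟨h.vacuum, h.divH, h.divE⟩

/-- The amplitudes of a homogeneous solution at the boundary are determined by the front. -/
lemma boundary_amplitudes (hT : 0 < T) (hξ : p.ξ₁ ^ 2 + p.ξ₂ ^ 2 = 1) (hΔ : p.disc ≠ 0)
    (hρ0 : 0 < p.rt) (hρ : p.rt ^ 2 = 1 - p.ν ^ 2 * p.τ ^ 2) (hν : p.ν ≠ 0) (hτ : p.τ ≠ 0)
    (h : IsSolution p T Sources.zero U V φ) {w : Fin 4 → ℝ} (hw : w ∈ dom (bdryBox T)) {k : ℤ}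
    (hk : k ≠ 0) :
    mode (val (U 6)) k (onΓ w) / (p.bp ^ 2 - p.cp ^ 2) = |(k : ℝ)| * mode φ k w ∧
    mode (val (V 0)) k (onΓ w) / (p.rt * (p.ν * p.τ))
      = ((p.am₁ - p.ξ₁ * p.bm / (p.ν * p.τ)) / p.rt ^ 2 : ℝ) * |(k : ℝ)| * mode φ k w ∧
    mode (val (V 1)) k (onΓ w) / (p.rt * (p.ν * p.τ))
      = ((p.am₂ - p.ξ₂ * p.bm / (p.ν * p.τ)) / p.rt ^ 2 : ℝ) * |(k : ℝ)| * mode φ k w := by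
  have hU : ∀ j, IsProfile T (Jh 1) (U j) := fun j => Jp_eq ▸ h.memU.isProfile j
  have hV : ∀ j, IsProfile T (Jh (-1)) (V j) := fun j => Jm_eq ▸ h.memV.isProfile j
  have hφ := h.memφ.smoothPer
  have hj := fun w hw => jump_iff.1 (h.jump w hw)
  have hG : ∀ i w, Sources.zero.G i w = 0 := fun _ _ => rfl
  simp only [hG] at hj
  have m0 : mode (fun _ => 0 : (Fin 4 → ℝ) → ℝ) k w = 0 := by simp [mode]
  have hΦ : mode (dθb T φ) k w = isgn k * ((|(k : ℝ)| : ℝ) : ℂ) * mode φ k w := by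
    rw [← I_mul_eq]
    exact mode_pd_last (goodBox_bdry hT) rfl hφ k hw
  have j0 := mode_jump hT (hU 2) hφ (c := 1) (d := -p.cp) (g := fun _ => 0)
    (fun w hw => by linear_combination (hj w hw).1) k hw
  have j1 := mode_jump hT (hU 5) hφ (c := 1) (d := -p.bp) (g := fun _ => 0)
    (fun w hw => by linear_combination (hj w hw).2.1) k hw
  have j2 := mode_jump hT (hV 2) hφ (c := 1) (d := -p.bm) (g := fun _ => 0)
    (fun w hw => by linear_combination (hj w hw).2.2.1) k hw
  have j3 := mode_jump hT (hV 4) hφ (c := 1) (d := p.am₁) (g := fun _ => 0)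
    (fun w hw => by linear_combination (hj w hw).2.2.2.1) k hw
  have j4 := mode_jump hT (hV 3) hφ (c := -1) (d := p.am₂) (g := fun _ => 0)
    (fun w hw => by linear_combination (hj w hw).2.2.2.2.1) k hw
  have eU := fun j => plasma_modes hT hξ hΔ hU h.bulk_plasma_zero hk
    (mem_dom_cons_zero hw) le_rfl j
  have eV := fun j => vacuum_modes hT hξ hρ0 hρ hν hτ hV h.bulk_vacuum_zero hk
    (mem_dom_cons_zero hw) le_rfl j
  have eΓ : (Matrix.vecCons 0 (Matrix.vecCons 0 w) : Fin 6 → ℝ) = onΓ w := rfl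
  simp only [mul_zero, Real.exp_zero, Complex.ofReal_one, one_mul, eΓ] at eU eV
  rw [m0, hΦ, eU 2] at j0
  rw [m0, hΦ, eU 5] at j1
  rw [m0, hΦ, eV 2] at j2
  rw [m0, hΦ, eV 4] at j3
  rw [m0, hΦ, eV 3] at j4
  generalize mode (val (U 6)) k (onΓ w) / ((p.bp : ℂ) ^ 2 - p.cp ^ 2) = γ at *
  generalize mode (val (V 0)) k (onΓ w) / ((p.rt : ℂ) * (p.ν * p.τ)) = γ₁ at *
  generalize mode (val (V 1)) k (onΓ w) / ((p.rt : ℂ) * (p.ν * p.τ)) = γ₂ at *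
  simp [Rp, Rm₁, Rm₂] at j0 j1 j2 j3 j4
  have hσ := isgn_mul_self hk
  have hσ0 : isgn k ≠ 0 := fun h => by simp [h] at hσ
  have hξc : (p.ξ₁ : ℂ) ^ 2 + p.ξ₂ ^ 2 = 1 := by exact_mod_cast hξ
  have hρc : (p.rt : ℂ) ^ 2 = 1 - p.ν ^ 2 * p.τ ^ 2 := by exact_mod_cast hρ
  have hρ' : (p.rt : ℂ) ≠ 0 := by exact_mod_cast hρ0.ne'
  have hν' : (p.ν : ℂ) ≠ 0 := by exact_mod_cast hν
  have hτ' : (p.τ : ℂ) ≠ 0 := by exact_mod_cast hτ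
  have hΔc : (p.disc : ℂ) ≠ 0 := by exact_mod_cast hΔ
  have hdc : (p.disc : ℂ) = p.cp ^ 2 - p.bp ^ 2 := by rw [disc]; push_cast; ring
  have hne : isgn k * ((p.ν : ℂ) * p.τ) * (p.rt : ℂ) ^ 2 ≠ 0 :=
    mul_ne_zero (mul_ne_zero hσ0 (mul_ne_zero hν' hτ')) (pow_ne_zero 2 hρ')
  refine ⟨mul_left_cancel₀ (mul_ne_zero hσ0 hΔc) ?_, ?_, ?_⟩
  · rw [hdc]
    linear_combination -p.cp * j0 + p.bp * j1
  · apply mul_left_cancel₀ hne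
    calc _ = isgn k * (p.ν * p.τ * p.am₁ - p.ξ₁ * p.bm) * ((|(k : ℝ)| : ℝ) * mode φ k w) := by
          linear_combination (p.ν * p.τ : ℂ) * j3 + p.ξ₁ * j2
            + isgn k * (p.ν * p.τ) * γ₁ * (hρc - hξc)
      _ = _ := by
          push_cast
          field_simp
  · apply mul_left_cancel₀ hne
    calc _ = isgn k * (p.ν * p.τ * p.am₂ - p.ξ₂ * p.bm) * ((|(k : ℝ)| : ℝ) * mode φ k w) := by
          linear_combination (p.ν * p.τ : ℂ) * j4 + p.ξ₂ * j2
            + isgn k * (p.ν * p.τ) * γ₂ * (hρc - hξc)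
      _ = _ := by
          push_cast
          field_simp

end Params

namespace Params
variable {p : Params} {T : ℝ} {S : Sources} {U U₀ : Fin 7 → Profile} {V V₀ : Fin 6 → Profile}
  {φ : (Fin 4 → ℝ) → ℝ}

/-- In a homogeneous solution only the tangential velocity and magnetic field have fast means. -/
lemma plasma_mean_star (hT : 0 < T) (h : IsSolution p T Sources.zero U V φ) {x : Fin 6 → ℝ}
    (hx : x ∈ dom (fastBox T (Jh 1))) {j : Fin 7} (hj : j = 2 ∨ j = 5 ∨ j = 6) :
    mean (U j).2 x = 0 := by
  have hU : ∀ j, IsProfile T (Jh 1) (U j) := fun j => Jp_eq ▸ h.memU.isProfile j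
  refine (hU j).mean_star_eq_zero hT (.inl rfl) (fun y hy => ?_) hx
  have e := fun i => h.bulk_plasma_zero.mean_star hT (.inl rfl) hU
    (fun _ => isProfile_zero hT (.inl rfl)) i hy
  have m0 : mean (0 : (Fin 6 → ℝ) → ℝ) y = 0 := by simp [mean]
  have e2 := e 2
  have e6 := e 6
  have e7 := e 7
  simp [A3P, Fin.sum_univ_succ, m0] at e2 e6 e7
  rcases hj with rfl | rfl | rfl <;> simp [*]

lemma vacuum_mean_star (hT : 0 < T) (h : IsSolution p T Sources.zero U V φ) {x : Fin 6 → ℝ}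
    (hx : x ∈ dom (fastBox T (Jh (-1)))) (j : Fin 6) : mean (V j).2 x = 0 := by
  have hV : ∀ j, IsProfile T (Jh (-1)) (V j) := fun j => Jm_eq ▸ h.memV.isProfile j
  refine (hV j).mean_star_eq_zero hT (.inr rfl) (fun y hy => ?_) hx
  have e := fun i => h.bulk_vacuum_zero.mean_star hT (.inr rfl) hV
    (fun _ => isProfile_zero hT (.inr rfl)) i hy
  have m0 : mean (0 : (Fin 6 → ℝ) → ℝ) y = 0 := by simp [mean]
  have e0 := e 0
  have e1 := e 1
  have e3 := e 3
  have e4 := e 4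
  have e6 := e 6
  have e7 := e 7
  simp [A3M, Fin.sum_univ_succ, m0] at e0 e1 e3 e4 e6 e7
  fin_cases j <;> simp [*]

/-- The residual part of a homogeneous solution does not depend on `θ`. -/
lemma plasma_res_mode (hT : 0 < T) (hξ : p.ξ₁ ^ 2 + p.ξ₂ ^ 2 = 1) (hΔ : p.disc ≠ 0)
    (h : IsSolution p T Sources.zero U V φ) {k : ℤ} (hk : k ≠ 0) {z : Fin 5 → ℝ}
    (hz : z ∈ dom (slowBox T (Jh 1))) (j : Fin 7) : mode (U j).1 k z = 0 := by
  have hU : ∀ j, IsProfile T (Jh 1) (U j) := fun j => Jp_eq ▸ h.memU.isProfile j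
  exact (hU j).mode_res_eq_zero (.inl rfl) hz (abs_pos.2 (Int.cast_ne_zero.2 hk))
    fun r hr => plasma_modes hT hξ hΔ hU h.bulk_plasma_zero hk hz hr j

lemma vacuum_res_mode (hT : 0 < T) (hξ : p.ξ₁ ^ 2 + p.ξ₂ ^ 2 = 1) (hρ0 : 0 < p.rt)
    (hρ : p.rt ^ 2 = 1 - p.ν ^ 2 * p.τ ^ 2) (hν : p.ν ≠ 0) (hτ : p.τ ≠ 0)
    (h : IsSolution p T Sources.zero U V φ) {k : ℤ} (hk : k ≠ 0) {z : Fin 5 → ℝ}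
    (hz : z ∈ dom (slowBox T (Jh (-1)))) (j : Fin 6) : mode (V j).1 k z = 0 := by
  have hV : ∀ j, IsProfile T (Jh (-1)) (V j) := fun j => Jm_eq ▸ h.memV.isProfile j
  exact (hV j).mode_res_eq_zero (.inr rfl) hz
    (mul_pos (abs_pos.2 (Int.cast_ne_zero.2 hk)) hρ0)
    fun r hr => vacuum_modes hT hξ hρ0 hρ hν hτ hV h.bulk_vacuum_zero hk hz hr j

/-- The mean in `θ` of the jump conditions of a homogeneous solution: the front drops out. -/
lemma jump_mean (hT : 0 < T) (h : IsSolution p T Sources.zero U V φ) {w : Fin 4 → ℝ}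
    (hw : w ∈ dom (bdryBox T)) :
    mean (val (U 2)) (onΓ w) = 0 ∧ mean (val (U 5)) (onΓ w) = 0 ∧
    mean (val (V 2)) (onΓ w) = 0 ∧ mean (val (V 3)) (onΓ w) = 0 ∧
    mean (val (V 4)) (onΓ w) = 0 ∧
    mean (val (U 6)) (onΓ w) - (p.H₁ * mean (val (V 0)) (onΓ w) + p.H₂ * mean (val (V 1)) (onΓ w))
      + p.E₃ * mean (val (V 5)) (onΓ w) = 0 := by
  have hU : ∀ j, IsProfile T (Jh 1) (U j) := fun j => Jp_eq ▸ h.memU.isProfile j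
  have hV : ∀ j, IsProfile T (Jh (-1)) (V j) := fun j => Jm_eq ▸ h.memV.isProfile j
  have hφ := h.memφ.smoothPer
  have hl : bdryBox T (Fin.last 3) = none := rfl
  have hj := fun w hw => jump_iff.1 (h.jump w hw)
  have hG : ∀ i w, Sources.zero.G i w = 0 := fun _ _ => rfl
  simp only [hG] at hj
  have m0 : mode (fun _ => 0 : (Fin 4 → ℝ) → ℝ) 0 w = 0 := by simp [mode]
  have hΦ : mode (dθb T φ) 0 w = 0 :=
    (mode_pd_last (goodBox_bdry hT) hl hφ 0 hw).trans (by simp)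
  have j0 := mode_jump hT (hU 2) hφ (c := 1) (d := -p.cp) (g := fun _ => 0)
    (fun w hw => by linear_combination (hj w hw).1) 0 hw
  have j1 := mode_jump hT (hU 5) hφ (c := 1) (d := -p.bp) (g := fun _ => 0)
    (fun w hw => by linear_combination (hj w hw).2.1) 0 hw
  have j2 := mode_jump hT (hV 2) hφ (c := 1) (d := -p.bm) (g := fun _ => 0)
    (fun w hw => by linear_combination (hj w hw).2.2.1) 0 hw
  have j3 := mode_jump hT (hV 4) hφ (c := 1) (d := p.am₁) (g := fun _ => 0)
    (fun w hw => by linear_combination (hj w hw).2.2.2.1) 0 hw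
  have j4 := mode_jump hT (hV 3) hφ (c := -1) (d := p.am₂) (g := fun _ => 0)
    (fun w hw => by linear_combination (hj w hw).2.2.2.2.1) 0 hw
  have hf : ∀ i, IsSmoothPer (bdryBox T) (![fun w => val (U 6) (onΓ w), fun w => val (V 0) (onΓ w),
      fun w => val (V 1) (onΓ w), fun w => val (V 5) (onΓ w)] i) := fun i => by
    fin_cases i
    exacts [(hU 6).smoothPer_trace, (hV 0).smoothPer_trace, (hV 1).smoothPer_trace,
      (hV 5).smoothPer_trace]
  have e := mode_sum hl (fun i => (hf i).smooth.continuousOn) ![1, -p.H₁, -p.H₂, p.E₃] 0 hw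
  rw [mode_congr hl (g := fun _ => 0) (fun w hw => by
    have := (hj w hw).2.2.2.2.2
    simp [Fin.sum_univ_four]
    linear_combination this) 0 hw, m0] at e
  rw [m0, hΦ] at j0 j1 j2 j3 j4
  simp [Fin.sum_univ_four] at e j0 j1 j2 j3 j4
  simp only [IsProfile.mode_trace] at e
  simp only [mode_zero_eq_mean] at e j0 j1 j2 j3 j4
  refine ⟨by exact_mod_cast j0.symm, by exact_mod_cast j1.symm, by exact_mod_cast j2.symm,
    by exact_mod_cast j4, by exact_mod_cast j3.symm, ?_⟩
  have e' : (0 : ℝ) = mean (val (U 6)) (onΓ w) + -(p.H₁ * mean (val (V 0)) (onΓ w))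
      + -(p.H₂ * mean (val (V 1)) (onΓ w)) + p.E₃ * mean (val (V 5)) (onΓ w) := by
    exact_mod_cast e
  linear_combination -e'

/-- The fast means of `U - U₀` are those of `U`, and vanish in the components `u₃`, `B₃`, `q`. -/
lemma mean_star_sub (hT : 0 < T) (h : IsSolution p T S U V φ) (h₀ : IsParticular p T S U₀ V₀)
    {x : Fin 6 → ℝ} (hx : x ∈ dom (fastBox T (Jh 1))) (j : Fin 7) :
    mean ((U - U₀) j).2 x = fastMean U j x := by
  have hW := h.sub hT h₀.1
  have key : ∀ i ∈ ({0, 1, 3, 4} : Set (Fin 7)), mean ((U - U₀) i).2 x = mean (U i).2 x := by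
    intro i hi
    have h1 : IsProfile T (Jh 1) ((U - U₀) i) := Jp_eq ▸ hW.memU.isProfile i
    have h2 : IsProfile T (Jh 1) (U₀ i) := Jp_eq ▸ h₀.1.memU.isProfile i
    have h3 := mean_star_of_mean_val (.inl rfl) h2 (fun y hy => h₀.2 i hi y (Jp_eq ▸ hy)) hx
    have h4 := mean_add (fastBox_last _) h1.star.smooth.continuousOn
      h2.star.smooth.continuousOn hx
    rw [show ((U - U₀) i).2 + (U₀ i).2 = (U i).2 by simp] at h4
    rw [h4, h3, add_zero]
  fin_cases j
  · exact key 0 (by simp)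
  · exact key 1 (by simp)
  · exact plasma_mean_star hT hW hx (by simp)
  · exact key 3 (by simp)
  · exact key 4 (by simp)
  · exact plasma_mean_star hT hW hx (by simp)
  · exact plasma_mean_star hT hW hx (by simp)

lemma inStarPlus_fastMean (hT : 0 < T) (hU : InSPlus T U) : InStarPlus T (fastMean U) := by
  rw [InStarPlus, Jp_eq]
  have h0 := InStar.zero hT (ε := 1) (.inl rfl)
  have h : ∀ i ≠ 6, InStar T (Jh 1) (mean (U i).2) := fun i hi =>
    InStar.mean hT (.inl rfl) (Jp_eq ▸ hU.2.1 i hi)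
  refine ⟨fun i hi => ?_, h0.inStarPressure hT (.inl rfl)⟩
  fin_cases i
  exacts [h 0 (by decide), h 1 (by decide), h0, h 3 (by decide), h 4 (by decide), h0, h0]

/-- The trace at `Y₃ = 0` of the `k`-th mode of `P`, divided by `d`, as a function of the slow
variables. The last entry `0` is a value of `θ`, on which the mode does not depend. -/
def amplitude (P : Profile) (d : ℝ) (k : ℤ) (y₃ t y₁ y₂ : ℝ) : ℂ :=
  mode (val P) k ![0, y₃, t, y₁, y₂, 0] / d

lemma amplitude_eq (P : Profile) (d : ℝ) (k : ℤ) (x : Fin 6 → ℝ) :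
    amplitude P d k (x 1) (x 2) (x 3) (x 4)
      = mode (val P) k (Matrix.vecCons 0 (Matrix.vecTail x)) / d := by
  rw [amplitude, cons_eq_update_last, mode_update]

/-- The general form of a solution. The residual part `U_h` is the residual component of `U - U₀`, and
the amplitudes are those of the modes of `q`, `H₁` and `H₂`, in which `𝓡⁺`, `𝓡₁⁻` and `𝓡₂⁻` have the
entries `(b⁺)² - (c⁺)²` and `ρντ`. -/
lemma decomposition (hT : 0 < T) (hξ : p.ξ₁ ^ 2 + p.ξ₂ ^ 2 = 1) (hΔ : p.disc ≠ 0)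
    (hν : p.ν ≠ 0) (hτ : p.τ ≠ 0) (hρ0 : 0 < p.rt) (hρ : p.rt ^ 2 = 1 - p.ν ^ 2 * p.τ ^ 2)
    (h₀ : IsParticular p T S U₀ V₀) (h : IsSolution p T S U V φ) :
    Decomposition p T ((p.am₁ - p.ξ₁ * p.bm / (p.ν * p.τ)) / p.rt ^ 2)
      ((p.am₂ - p.ξ₂ * p.bm / (p.ν * p.τ)) / p.rt ^ 2) U₀ V₀ U V φ
      (fun i => ((U - U₀) i).1) (fun i => ((V - V₀) i).1)
      (amplitude ((U - U₀) 6) (p.bp ^ 2 - p.cp ^ 2))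
      (amplitude ((V - V₀) 0) (p.rt * (p.ν * p.τ)))
      (amplitude ((V - V₀) 1) (p.rt * (p.ν * p.τ))) := by
  have hW := h.sub hT h₀.1
  have hwU : ∀ j, IsProfile T (Jh 1) ((U - U₀) j) := fun j => Jp_eq ▸ hW.memU.isProfile j
  have hwV : ∀ j, IsProfile T (Jh (-1)) ((V - V₀) j) := fun j => Jm_eq ▸ hW.memV.isProfile j
  have rU := fun z hz k hk => plasma_res_mode hT hξ hΔ hW (k := k) hk (z := z) hz
  have rV := fun z hz k hk => vacuum_res_mode hT hξ hρ0 hρ hν hτ hW (k := k) hk (z := z) hz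
  have gp := goodBox_slow hT (ε := 1) (.inl rfl)
  have gm := goodBox_slow hT (ε := -1) (.inr rfl)
  -- The residual part does not depend on `θ`, so that it is its own mean.
  have mU : ∀ x ∈ dom (fastBox T (Jh 1)), ∀ j, mean (val ((U - U₀) j)) x
      = ((U - U₀) j).1 (Matrix.vecTail x) + fastMean U j x := fun x hx j => by
    have hz := mem_dom_vecTail (s := slowBox T (Jh 1)) hx
    rw [(hwU j).mean_val hx, mean_star_sub hT h h₀ hx,
      ← eq_mean_of_mode gp (slowBox_last _) (hwU j).res hz fun k hk => rU _ hz k hk j]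
  have mV : ∀ x ∈ dom (fastBox T (Jh (-1))), ∀ j, mean (val ((V - V₀) j)) x
      = ((V - V₀) j).1 (Matrix.vecTail x) := fun x hx j => by
    have hz := mem_dom_vecTail (s := slowBox T (Jh (-1))) hx
    rw [(hwV j).mean_val hx, vacuum_mean_star hT hW hx, add_zero,
      ← eq_mean_of_mode gm (slowBox_last _) (hwV j).res hz fun k hk => rV _ hz k hk j]
  refine ⟨hW.memU.1, fun i => (hW.memV i).1, fun i z hz θ => ?_, fun i z hz θ => ?_, fun w hw => ?_,
    inStarPlus_fastMean hT h.memU, fun w hw k hk => ?_, fun i x hx => ?_, fun i x hx => ?_⟩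
  · rw [Jp_eq] at hz
    exact update_eq_of_mode gp (slowBox_last _) (hwU i).res (fun y hy k hk => rU y hy k hk i) hz θ
  · rw [Jm_eq] at hz
    exact update_eq_of_mode gm (slowBox_last _) (hwV i).res (fun y hy k hk => rV y hy k hk i) hz θ
  · have e := jump_mean hT hW hw
    simp only [mU _ (IsProfile.onΓ_mem hw), mV _ (IsProfile.onΓ_mem hw)] at e
    simpa [fastMean, onΓ] using e
  · have e := boundary_amplitudes hT hξ hΔ hρ0 hρ hν hτ hW hw hk
    have a := fun P d => amplitude_eq P d k (onΓ w)
    refine ⟨?_, ?_, ?_⟩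
    · refine (a _ _).trans (Eq.trans ?_ e.1)
      push_cast
      rfl
    · refine (a _ _).trans (Eq.trans ?_ e.2.1)
      push_cast
      rfl
    · refine (a _ _).trans (Eq.trans ?_ e.2.2)
      push_cast
      rfl
  · rw [Jp_eq] at hx
    have hz := mem_dom_vecTail (s := slowBox T (Jh 1)) hx
    have e := hasSum_nonzero_modes hT (.inl rfl) (hwU i).smoothPer_val hx
    rw [mU x hx i, Pi.sub_apply, val_sub, ← sub_sub, ← Pi.sub_apply] at e
    refine (Eq.mp ?_ e)
    congr 1
    funext k
    have hm := plasma_modes hT hξ hΔ hwU hW.bulk_plasma_zero k.2 hz (r := 1 * x 0)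
      (mem_Jh_of_mem_dom hx) i
    rw [vecCons_side (.inl rfl), one_mul] at hm
    rw [hm, amplitude_eq, Complex.exp_add]
    push_cast
    ring
  · rw [Jm_eq] at hx
    have hz := mem_dom_vecTail (s := slowBox T (Jh (-1))) hx
    have e := hasSum_nonzero_modes hT (.inr rfl) (hwV i).smoothPer_val hx
    rw [mV x hx i, Pi.sub_apply, val_sub, ← Pi.sub_apply] at e
    refine (Eq.mp ?_ e)
    congr 1
    funext k
    have hm := vacuum_modes hT hξ hρ0 hρ hν hτ hwV hW.bulk_vacuum_zero k.2 hz (r := -1 * x 0)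
      (mem_Jh_of_mem_dom hx) i
    rw [vecCons_side (.inr rfl)] at hm
    rw [hm, amplitude_eq, amplitude_eq, Complex.exp_add]
    push_cast
    ring_nf

end Params

/-! ### Nondegenerate frequencies -/

lemma RefState.RationalDirection.sq_add_sq {s : RefState} (h : s.RationalDirection) :
    s.ξ₁ ^ 2 + s.ξ₂ ^ 2 = 1 := by
  obtain ⟨m, n, hmn, h1, h2⟩ := h
  have hpos : 0 < (m : ℝ) ^ 2 + (n : ℝ) ^ 2 := by
    by_contra hneg
    have hm : (m : ℝ) = 0 := by nlinarith [sq_nonneg (m : ℝ), sq_nonneg (n : ℝ)]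
    have hn : (n : ℝ) = 0 := by nlinarith [sq_nonneg (m : ℝ), sq_nonneg (n : ℝ)]
    exact hmn (by rw [Int.cast_eq_zero.1 hm, Int.cast_eq_zero.1 hn])
  rw [h1, h2, div_pow, div_pow, Real.sq_sqrt hpos.le, ← add_div, div_self hpos.ne']

/-- For `H⁰ = 0` the right side of the stability condition is zero. -/
lemma RefState.Stability.ne_zero {s : RefState} (h : s.Stability) : s.H₁ ^ 2 + s.H₂ ^ 2 ≠ 0 := by
  intro h0
  have hH₁ : s.H₁ = 0 := by nlinarith [sq_nonneg s.H₁, sq_nonneg s.H₂]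
  have hH₂ : s.H₂ = 0 := by nlinarith [sq_nonneg s.H₁, sq_nonneg s.H₂]
  have hB : 0 ≤ s.B₁ ^ 2 + s.B₂ ^ 2 := by positivity
  rw [RefState.Stability, hH₁, hH₂] at h
  simp [Real.sqrt_sq hB] at h
  exact absurd h (not_lt.2 (sq_nonneg _))

/-- A real root `x` of `a x² + b x = d`, where `(a, b, d) ≠ 0`, is either zero or bounded away from
zero. -/
lemma exists_root_bound (a b d : ℝ) (h : ¬(a = 0 ∧ b = 0 ∧ d = 0)) :
    ∃ r > 0, ∀ x : ℝ, x ≠ 0 → |x| < r → a * x ^ 2 + b * x ≠ d := by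
  by_cases hd : d = 0
  · subst hd
    have hx : ∀ x : ℝ, x ≠ 0 → a * x ^ 2 + b * x = 0 → a * x + b = 0 := fun x hx e =>
      mul_left_cancel₀ hx (by linear_combination e)
    by_cases hb : b = 0
    · subst hb
      refine ⟨1, one_pos, fun x hx0 _ e => ?_⟩
      have := hx x hx0 e
      rw [add_zero] at this
      exact h ⟨(mul_eq_zero.1 this).resolve_right hx0, rfl, rfl⟩
    · refine ⟨|b| / (|a| + 1), by positivity, fun x hx0 hr e => ?_⟩
      rw [lt_div_iff₀ (by positivity)] at hr
      have h1 : |b| = |a| * |x| := by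
        rw [← abs_mul, ← abs_neg b]; congr 1; linear_combination -hx x hx0 e
      nlinarith [abs_nonneg x, abs_pos.2 hx0]
  · have hd' := abs_pos.2 hd
    refine ⟨min 1 (|d| / (|a| + |b| + 1)), lt_min one_pos (by positivity), fun x _ hr e => ?_⟩
    have h1 := hr.trans_le (min_le_left _ _)
    have h2 := hr.trans_le (min_le_right _ _)
    rw [lt_div_iff₀ (by positivity)] at h2
    have h3 : |d| ≤ |a| * |x| ^ 2 + |b| * |x| := by
      rw [← e, ← abs_pow, ← abs_mul, ← abs_mul]; exact abs_add_le _ _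
    nlinarith [abs_nonneg x, abs_nonneg a, abs_nonneg b,
      mul_nonneg (abs_nonneg a) (mul_nonneg (abs_nonneg x) (sub_nonneg.2 h1.le))]

namespace Params
variable {p : Params}

/-- If `ν` is small, the roots of the Lopatinskii determinant stay away from the frequencies
`τ = -a⁺ ± b⁺`: there `τ` is bounded, and the determinant reduces to a quadratic polynomial in `ντ`,
which has no small nonzero root. -/
lemma exists_disc_ne_zero (s : RefState) (hs : s.Stability) (hξ : s.ξ₁ ^ 2 + s.ξ₂ ^ 2 = 1) :
    ∃ νs > 0, ∀ p : Params, p.toRefState = s → 0 < p.ν → p.ν < νs → p.Lopatinskii →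
      p.Nondegenerate → p.disc ≠ 0 := by
  obtain ⟨r, hr, hroot⟩ := exists_root_bound (s.H₁ ^ 2 + s.H₂ ^ 2)
    (2 * s.E₃ * (s.ξ₂ * s.H₁ - s.ξ₁ * s.H₂)) ((s.ξ₁ * s.H₁ + s.ξ₂ * s.H₂) ^ 2 - s.E₃ ^ 2)
    (fun h => hs.ne_zero h.1)
  set M := |s.ξ₁ * s.u₁ + s.ξ₂ * s.u₂| + |s.ξ₁ * s.B₁ + s.ξ₂ * s.B₂| with hM
  have hM0 : 0 ≤ M := by positivity
  refine ⟨r / (M + 1), by positivity, fun p hp hν hνs hL hN hd => ?_⟩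
  subst hp
  have hcb : p.cp ^ 2 = p.bp ^ 2 := sub_eq_zero.1 hd
  have hτ : |p.τ| ≤ M := by
    have h1 : |p.cp| = |p.bp| := sq_eq_sq_iff_abs_eq_abs _ _ |>.1 hcb
    calc |p.τ| = |p.cp - p.ap| := by rw [cp]; ring_nf
      _ ≤ |p.cp| + |p.ap| := abs_sub _ _
      _ = M := by rw [h1, add_comm]; rfl
  rw [lt_div_iff₀ (by positivity)] at hνs
  refine hroot (p.ν * p.τ) (mul_ne_zero hν.ne' hN.2) ?_ ?_
  · rw [abs_mul, abs_of_pos hν]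
    nlinarith
  · rw [Lopatinskii, hcb, sub_self, mul_zero, zero_add, am₁, am₂, bm] at hL
    linear_combination hL - p.E₃ ^ 2 * hξ

/-- The normalization of the coefficients `γ̃₁`, `γ̃₂`. -/
lemma front_coefficients (hν : p.ν ≠ 0) (hτ : p.τ ≠ 0)
    (hρ : p.rt ^ 2 = 1 - p.ν ^ 2 * p.τ ^ 2) :
    p.am₁ * ((p.am₁ - p.ξ₁ * p.bm / (p.ν * p.τ)) / p.rt ^ 2)
        + p.am₂ * ((p.am₂ - p.ξ₂ * p.bm / (p.ν * p.τ)) / p.rt ^ 2)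
      = (p.am₁ ^ 2 + p.am₂ ^ 2 - p.bm ^ 2) / (1 - p.ν ^ 2 * p.τ ^ 2) := by
  rw [← hρ, ← mul_div_assoc, ← mul_div_assoc, ← add_div]
  congr 1
  have h := p.xi_dot_am
  field_simp
  linear_combination -p.bm * h

end Params

end

end FastProblem

open FastProblem
theorem theorem3p1 (s : RefState) (hH1 : s.Stability) (hH2 : s.RationalDirection) :
    ∃ νs > 0, ∀ p : Params, p.toRefState = s → 0 < p.ν → p.ν < νs →
      p.ν ^ 2 * p.τ ^ 2 < 1 → p.Lopatinskii → p.Nondegenerate →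
      ∃ c₁ c₂ : ℝ,
        p.am₁ * c₁ + p.am₂ * c₂
          = (p.am₁ ^ 2 + p.am₂ ^ 2 - p.bm ^ 2) / (1 - p.ν ^ 2 * p.τ ^ 2) ∧
        ∀ T : ℝ, 0 < T → ∀ S : Sources, S.Regular T →
          ((∃ U V φ, IsSolution p T S U V φ) ↔ Compatible p T S) ∧
          (Compatible p T S → ∃ U V, IsParticular p T S U V) ∧
          (∀ U₀ V₀, IsParticular p T S U₀ V₀ → ∀ U V φ, IsSolution p T S U V φ →
            (∃ Uh Vh γp γm₁ γm₂,
              Decomposition p T c₁ c₂ U₀ V₀ U V φ Uh Vh γp γm₁ γm₂) ∧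
            IsSolution p T Sources.zero (U - U₀) (V - V₀) φ) := by
  have hξs := hH2.sq_add_sq
  obtain ⟨νs, hνs, hdisc⟩ := Params.exists_disc_ne_zero s hH1 hξs
  refine ⟨νs, hνs, fun p hp hν hν' hντ hL hN => ?_⟩
  have hΔ := hdisc p hp hν hν' hL hN
  subst hp
  have hpos : 0 < 1 - p.ν ^ 2 * p.τ ^ 2 := sub_pos.2 hντ
  have hρ0 : 0 < p.rt := Real.sqrt_pos.2 hpos
  have hρ : p.rt ^ 2 = 1 - p.ν ^ 2 * p.τ ^ 2 := Real.sq_sqrt hpos.le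
  refine ⟨_, _, Params.front_coefficients hν.ne' hN.2 hρ, fun T hT S hS => ?_⟩
  have hex : Compatible p T S → ∃ U V, IsParticular p T S U V :=
    Params.exists_particular hT hξs hΔ hν.ne' hN.2 hρ0 hρ hL hS
  refine ⟨⟨fun ⟨U, V, φ, h⟩ => h.compatible hT hξs hν.ne' hρ0 hρ hL hS, fun hC => ?_⟩, hex,
    fun U₀ V₀ h₀ U V φ h =>
      ⟨⟨_, _, _, _, _, Params.decomposition hT hξs hΔ hν.ne' hN.2 hρ0 hρ h₀ h⟩, h.sub hT h₀.1⟩⟩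
  obtain ⟨U, V, h⟩ := hex hC
  exact ⟨U, V, 0, h.1⟩
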